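/- Let $T>0$, $x>0$, and let $W$ be a standard $d$-dimensional Brownian motion on a probability space $(\Omega,\mathcal F,\mathbf P)$ with augmented natural filtration $(\mathcal F_t)$. Let $r_t\in\mathbb R$, $\mu_t\in\mathbb R^d$, $\sigma_t\in\mathbb R^{d\times d}$ be deterministic càdlàg functions on $[0,T]$, with $r_t\ge 0$ for all $t\in[0,T]$ and $\sigma_t$ non-singular for almost every $t$. Put $\theta_t=\sigma_t^{-1}(\mu_t-r_t\mathbf 1)$, $R_t=\int_0^t r_u\,du$, $\|y\|_t=(\int_0^t|y_u|^2du)^{1/2}$, $\|f\|_{q,t}=(\int_0^t|f_u|^q\,du)^{1/q}$, and assume $\|\theta\|_T<\infty$. Wealth and controls. For a control $(y,c)$ with values in $\mathbb R^d\times[0,\infty)$, the wealth process $X$ is the a.s. positive, continuous, $(\mathcal F_t)$-adapted solution on $[0,T]$ of $$dX_t=X_t(r_t+y_t'\theta_t)\,dt-c_t\,dt+X_t\,y_t'\,dW_t,\qquad X_0=x .$$ The class $\mathcal V$ consists of the progressively measurable controls $(y,c)$ for which this equation has such a solution and it is unique. The class $\mathcal U$ consists of the controls $\varsigma=(y,vX)$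 with $y$ deterministic, $\|y\|_T<\infty$, and $v\ge0$ deterministic, $\int_0^Tv_t\,dt<\infty$. For $\gamma\in(0,1)$ put $$J(x,\varsigma)=\mathbf E\Big(\int_0^Tc_t^{\gamma}\,dt+X_T^{\gamma}\Big).$$ Risk bound. Let $0<\alpha\le1/2$ and $0<\zeta<1$. Let $\lambda_t=\inf\{\lambda\ge0:\mathbf P(X_t\le\lambda)\ge\alpha\}$ and $\mathrm{ES}_t(x,\varsigma,\alpha)=xe^{R_t}-\mathbf E(X_t\mid X_t\le\lambda_t)$. The ES-constrained problem is $$\max_{\varsigma\in\mathcal U}J(x,\varsigma)\quad\text{subject to}\quad\sup_{0\le t\le T}\frac{\mathrm{ES}_t(x,\varsigma,\alpha)}{\zeta\,x\,e^{R_t}}\le1,$$ and the unconstrained problem is $\max_{\varsigma\in\mathcal V}J(x,\varsigma)$. Let $z_\alpha$ be the $\alpha$-quantile of the standard normal distribution, $q=1/(1-\gamma)$, and $$F_\alpha(z)=\frac{\int_z^\infty e^{-t^2/2}dt}{\int_{|z_\alpha|}^\infty e^{-t^2/2}dt},\qquad \widetilde g_\gamma(t)=\exp\Big(\gamma R_t+\frac{q-1}{2}\|\theta\|_t^2\Big),\qquad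 \widetilde\kappa(\gamma)=\frac{\|\widetilde g_\gamma\|_{q,T}^q}{\|\widetilde g_\gamma\|_{q,T}^q+\widetilde g_\gamma^q(T)} .$$ Theorem. Assume $|z_\alpha|\ge2\|\theta\|_T$ and $$1-(1-\widetilde\kappa(\gamma))\,e^{q\|\theta\|_T^2}\,F_\alpha(|z_\alpha|+q\|\theta\|_T)\le\zeta<1 .$$ Let $$y_t^*=\frac{\theta_t}{1-\gamma},\qquad v_t^*=\frac{\widetilde g_\gamma^q(t)}{\widetilde g_\gamma^q(T)+\int_t^T\widetilde g_\gamma^q(s)\,ds},$$ so that the corresponding portfolio process, given by $\sigma_t'\pi^*_t=y^*_t$, is $\pi_t^*=(\sigma_t\sigma_t')^{-1}(\mu_t-r_t\mathbf 1)/(1-\gamma)$ for almost every $t$. Then the equation $$dX_t^*=X_t^*\Big(r_t-v_t^*+\frac{|\theta_t|^2}{1-\gamma}\Big)dt+X_t^*\frac{\theta_t'}{1-\gamma}\,dW_t,\qquad X_0^*=x,$$ has an a.s. positive, continuous, adapted solution $X^*$ on $[0,T]$, unique up to indistinguishability among such solutions, and the control $\varsigma^*=(y^*,v^*X^*)$ solves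 the ES-constrained problem: it belongs to $\mathcal U$, satisfies the risk bound, and $J(x,\varsigma)\le J(x,\varsigma^*)$ for every $\varsigma\in\mathcal U$ that satisfies the risk bound. It is equal to the solution of the unconstrained problem: $\varsigma^*\in\mathcal V$ and $J(x,\varsigma)\le J(x,\varsigma^*)$ for every $\varsigma\in\mathcal V$. The optimal value of both problems is $$J(x,\varsigma^*)=x^\gamma\big(\|\widetilde g_\gamma\|_{q,T}^q+\widetilde g_\gamma^q(T)\big)^{1/q}<\infty .$$ -/

import Mathlib

open MeasureTheory ProbabilityTheory Filter Set
open scoped NNReal ENNReal Topology RealInnerProductSpace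

namespace PortfolioES

noncomputable section

/-! ### The market -/

/-- `f` is right continuous with left limits on `[0, T]`. -/
def IsCadlagOn {E : Type*} [TopologicalSpace E] (T : ℝ) (f : ℝ → E) : Prop :=
  (∀ t, 0 ≤ t → t < T → ContinuousWithinAt f (Ici t) t) ∧
    ∀ t, 0 < t → t ≤ T → ∃ l, Tendsto f (𝓝[<] t) (𝓝 l)

/-- The deterministic coefficients of a Black-Scholes market with one bond and `d` stocks:
riskless interest rate, stock-appreciation rates, stock-volatilities. -/
structure Market (d : ℕ) where
  r : ℝ → ℝ
  mu : ℝ → Fin d → ℝ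
  sigma : ℝ → Matrix (Fin d) (Fin d) ℝ

variable {d : ℕ}

/-- `θ_t = σ_t⁻¹ (μ_t - r_t 𝟏)`. -/
def Market.theta (mk : Market d) (t : ℝ) : EuclideanSpace ℝ (Fin d) :=
  WithLp.toLp 2 (Matrix.mulVec (mk.sigma t)⁻¹ (fun i => mk.mu t i - mk.r t))

/-- Standing assumptions on the market on `[0, T]`: càdlàg coefficients, volatility matrix
non-singular almost everywhere, and `‖θ‖_T < ∞`. -/
structure Market.IsRegular (mk : Market d) (T : ℝ) : Prop where
  cadlag_r : IsCadlagOn T mk.r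
  cadlag_mu : IsCadlagOn T mk.mu
  cadlag_sigma : IsCadlagOn T mk.sigma
  nonsingular : ∀ᵐ t ∂(volume.restrict (Icc 0 T)), IsUnit (mk.sigma t).det
  theta_sq : IntegrableOn (fun t => ‖mk.theta t‖ ^ 2) (Icc 0 T)

/-- `R_t = ∫₀ᵗ r_u du`. -/
def Market.R (mk : Market d) (t : ℝ) : ℝ := ∫ u in (0 : ℝ)..t, mk.r u

/-- `‖y‖_t = (∫₀ᵗ |y_u|² du)^{1/2}`. -/
def l2Norm (y : ℝ → EuclideanSpace ℝ (Fin d)) (t : ℝ) : ℝ :=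
  Real.sqrt (∫ u in (0 : ℝ)..t, ‖y u‖ ^ 2)

/-- `‖f‖_{q,t} = (∫₀ᵗ |f_u|^q du)^{1/q}`. -/
def qNorm (q : ℝ) (f : ℝ → ℝ) (t : ℝ) : ℝ :=
  (∫ u in (0 : ℝ)..t, |f u| ^ q) ^ (1 / q)

/-! ### Brownian motion, its filtration, and the Itô integral -/

variable {Ω : Type*} [mΩ : MeasurableSpace Ω]

/-- A standard `d`-dimensional Brownian motion: independent components, each of which is a
real Brownian motion. -/
structure IsStandardBrownian (W : ℝ≥0 → Ω → EuclideanSpace ℝ (Fin d)) (P : Measure Ω) :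
    Prop where
  measurable : ∀ t, Measurable (W t)
  component : ∀ j, IsBrownianReal (fun t ω => W t ω j) P
  indep : iIndepFun (fun j ω (t : ℝ≥0) => W t ω j) P

/-- `ℱ_t = σ(W_s : s ≤ t)`, augmented by the null sets. -/
def brownianFiltration (W : ℝ≥0 → Ω → EuclideanSpace ℝ (Fin d)) (hW : ∀ t, Measurable (W t))
    (P : Measure Ω) : Filtration ℝ≥0 mΩ where
  seq t := (⨆ s : Iic t, MeasurableSpace.comap (W s) inferInstance) ⊔
    MeasurableSpace.generateFrom {N | MeasurableSet N ∧ P N = 0}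
  mono' s t hst := by
    refine sup_le_sup (iSup_le fun u => ?_) le_rfl
    exact le_iSup (fun v : Iic t => MeasurableSpace.comap (W v) inferInstance)
      ⟨u.1, le_trans (mem_Iic.1 u.2) hst⟩
  le' t := sup_le (iSup_le fun s => (hW s).comap_le)
    (MeasurableSpace.generateFrom_le fun _ hN => hN.1)

/-- A bounded simple integrand `∑_{i < n} ξ_i 1_{(t_i, t_{i+1}]}`, `ξ_i` being
`ℱ_{t_i}`-measurable. -/
structure SimpleIntegrand (𝓕 : Filtration ℝ≥0 mΩ) (d : ℕ) where
  n : ℕ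
  time : ℕ → ℝ≥0
  mono : Monotone time
  coef : ℕ → Ω → EuclideanSpace ℝ (Fin d)
  measurable : ∀ i, Measurable[𝓕 (time i)] (coef i)
  bounded : ∃ C : ℝ, ∀ i ω, ‖coef i ω‖ ≤ C

/-- The simple integrand as a process. -/
def SimpleIntegrand.val {𝓕 : Filtration ℝ≥0 mΩ} (S : SimpleIntegrand 𝓕 d) (s : ℝ) (ω : Ω) :
    EuclideanSpace ℝ (Fin d) :=
  ∑ i ∈ Finset.range S.n,
    (Ioc (S.time i : ℝ) (S.time (i + 1))).indicator (fun _ => S.coef i ω) s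

/-- The elementary integral `∑_{i < n} ξ_i' (W_{t_{i+1} ∧ t} - W_{t_i ∧ t})`. -/
def SimpleIntegrand.integral {𝓕 : Filtration ℝ≥0 mΩ} (S : SimpleIntegrand 𝓕 d)
    (W : ℝ≥0 → Ω → EuclideanSpace ℝ (Fin d)) (t : ℝ≥0) (ω : Ω) : ℝ :=
  ∑ i ∈ Finset.range S.n,
    ⟪S.coef i ω, W (min (S.time (i + 1)) t) ω - W (min (S.time i) t) ω⟫

/-- `M` is (a version with almost surely continuous paths of) the Itô integral
`M_t = ∫₀ᵗ H_s' dW_s`, `0 ≤ t ≤ T`, of an integrand with `∫₀ᵀ |H_s|² ds < ∞` a.s.: there are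
simple integrands `Hⁿ` with `∫₀ᵀ |Hⁿ_s - H_s|² ds → 0` in probability whose elementary integrals
converge to `M_t` in probability for every `t ∈ [0, T]`. -/
structure IsItoIntegral (𝓕 : Filtration ℝ≥0 mΩ) (P : Measure Ω)
    (W : ℝ≥0 → Ω → EuclideanSpace ℝ (Fin d)) (T : ℝ)
    (H : ℝ → Ω → EuclideanSpace ℝ (Fin d)) (M : ℝ → Ω → ℝ) : Prop where
  sq_integrable : ∀ᵐ ω ∂P, MemLp (fun s => H s ω) 2 (volume.restrict (Icc 0 T))
  continuous : ∀ᵐ ω ∂P, ContinuousOn (fun t => M t ω) (Icc 0 T)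
  approx : ∃ S : ℕ → SimpleIntegrand 𝓕 d,
    TendstoInMeasure P (fun n ω => ∫ s in (0 : ℝ)..T, ‖(S n).val s ω - H s ω‖ ^ 2) atTop
      (fun _ => (0 : ℝ)) ∧
    ∀ t : ℝ≥0, (t : ℝ) ≤ T →
      TendstoInMeasure P (fun n => (S n).integral W t) atTop (M t)

/-- `X` is a continuous adapted process with `dX_t = a_t dt + b_t' dW_t` on `[0, T]`, `X_0 = x`. -/
structure IsItoProcess (𝓕 : Filtration ℝ≥0 mΩ) (P : Measure Ω)
    (W : ℝ≥0 → Ω → EuclideanSpace ℝ (Fin d)) (T x : ℝ)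
    (a : ℝ → Ω → ℝ) (b : ℝ → Ω → EuclideanSpace ℝ (Fin d)) (X : ℝ → Ω → ℝ) : Prop where
  adapted : ∀ t : ℝ≥0, (t : ℝ) ≤ T → Measurable[𝓕 t] (X t)
  continuous : ∀ᵐ ω ∂P, ContinuousOn (fun t => X t ω) (Icc 0 T)
  drift_integrable : ∀ᵐ ω ∂P, IntegrableOn (fun s => a s ω) (Icc 0 T)
  eq : ∃ M : ℝ → Ω → ℝ, IsItoIntegral 𝓕 P W T b M ∧
    ∀ᵐ ω ∂P, ∀ t ∈ Icc 0 T, X t ω = x + (∫ s in (0 : ℝ)..t, a s ω) + M t ω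

/-- The process `u` is progressively measurable on the time interval `[0, T]`. -/
def IsProgressiveOn {E : Type*} [TopologicalSpace E] (𝓕 : Filtration ℝ≥0 mΩ) (T : ℝ)
    (u : ℝ → Ω → E) : Prop :=
  IsStronglyProgressive 𝓕 (fun t : ℝ≥0 => u (min (t : ℝ) T))

/-- The processes `X` and `Y` are indistinguishable on `[0, T]`. -/
def Indistinguishable (P : Measure Ω) (T : ℝ) (X Y : ℝ → Ω → ℝ) : Prop :=
  ∀ᵐ ω ∂P, ∀ t ∈ Icc 0 T, X t ω = Y t ω

/-! ### Wealth processes and controls -/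

/-- `X` is a strong, a.s. positive and continuous solution on `[0, T]` of the wealth equation
`dX_t = X_t (r_t + y_t' θ_t) dt - c_t dt + X_t y_t' dW_t`, `X_0 = x`. -/
structure IsWealth (mk : Market d) (𝓕 : Filtration ℝ≥0 mΩ) (P : Measure Ω)
    (W : ℝ≥0 → Ω → EuclideanSpace ℝ (Fin d)) (T x : ℝ)
    (y : ℝ → Ω → EuclideanSpace ℝ (Fin d)) (c : ℝ → Ω → ℝ) (X : ℝ → Ω → ℝ) : Prop where
  ito : IsItoProcess 𝓕 P W T x
    (fun t ω => X t ω * (mk.r t + ⟪y t ω, mk.theta t⟫) - c t ω)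
    (fun t ω => X t ω • y t ω) X
  pos : ∀ᵐ ω ∂P, ∀ t ∈ Icc 0 T, 0 < X t ω

/-- The class `𝒱` of admissible controls `(y, c)`. -/
structure IsAdmissible (mk : Market d) (𝓕 : Filtration ℝ≥0 mΩ) (P : Measure Ω)
    (W : ℝ≥0 → Ω → EuclideanSpace ℝ (Fin d)) (T x : ℝ)
    (y : ℝ → Ω → EuclideanSpace ℝ (Fin d)) (c : ℝ → Ω → ℝ) : Prop where
  progressive_y : IsProgressiveOn 𝓕 T y
  progressive_c : IsProgressiveOn 𝓕 T c
  nonneg_c : ∀ t ∈ Icc 0 T, ∀ ω, 0 ≤ c t ω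
  exists_unique_wealth : ∃ X, IsWealth mk 𝓕 P W T x y c X ∧
    ∀ X', IsWealth mk 𝓕 P W T x y c X' → Indistinguishable P T X' X

/-- The deterministic data `(y, v)` of a control in `𝒰`: `y` is square integrable and the
consumption rate `v ≥ 0` is integrable on `[0, T]`. -/
structure IsDetControl (T : ℝ) (y : ℝ → EuclideanSpace ℝ (Fin d)) (v : ℝ → ℝ) : Prop where
  sq_integrable : MemLp y 2 (volume.restrict (Icc 0 T))
  nonneg : ∀ t ∈ Icc 0 T, 0 ≤ v t
  integrable : IntegrableOn v (Icc 0 T)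

/-- `X` is the wealth process `X^ς` of the control `ς = (y, v X) ∈ 𝒰`. -/
def IsDetWealth (mk : Market d) (𝓕 : Filtration ℝ≥0 mΩ) (P : Measure Ω)
    (W : ℝ≥0 → Ω → EuclideanSpace ℝ (Fin d)) (T x : ℝ)
    (y : ℝ → EuclideanSpace ℝ (Fin d)) (v : ℝ → ℝ) (X : ℝ → Ω → ℝ) : Prop :=
  IsWealth mk 𝓕 P W T x (fun t _ => y t) (fun t ω => v t * X t ω) X

/-! ### The cost function and the Expected Shortfall -/

/-- `J = E (∫₀ᵀ c_t^{γ₁} dt + X_T^{γ₂})`, an expectation of a nonnegative quantity, with values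
in `[0, ∞]`. -/
def cost (P : Measure Ω) (T γ₁ γ₂ : ℝ) (c X : ℝ → Ω → ℝ) : ℝ≥0∞ :=
  ∫⁻ ω, ((∫⁻ t in Icc 0 T, ENNReal.ofReal (c t ω ^ γ₁)) + ENNReal.ofReal (X T ω ^ γ₂)) ∂P

/-- The `α`-quantile `λ_t` of `X_t`. -/
def quantile (P : Measure Ω) (α : ℝ) (X : ℝ → Ω → ℝ) (t : ℝ) : ℝ :=
  sInf {l : ℝ | 0 ≤ l ∧ α ≤ P.real {ω | X t ω ≤ l}}

/-- `m_t = E (X_t | X_t ≤ λ_t)`. -/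
def tailMean (P : Measure Ω) (α : ℝ) (X : ℝ → Ω → ℝ) (t : ℝ) : ℝ :=
  ∫ ω, X t ω ∂(cond P {ω | X t ω ≤ quantile P α X t})

/-- The Expected Shortfall `ES_t = x e^{R_t} - m_t`. -/
def expectedShortfall (mk : Market d) (P : Measure Ω) (x α : ℝ) (X : ℝ → Ω → ℝ) (t : ℝ) : ℝ :=
  x * Real.exp (mk.R t) - tailMean P α X t

/-- The level risk function `ζ_t(x) = ζ x e^{R_t}`. -/
def levelRisk (mk : Market d) (x ζ t : ℝ) : ℝ := ζ * x * Real.exp (mk.R t)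

/-- The risk bound `sup_{0 ≤ t ≤ T} ES_t / ζ_t(x) ≤ 1`. -/
def ESBound (mk : Market d) (P : Measure Ω) (T x α ζ : ℝ) (X : ℝ → Ω → ℝ) : Prop :=
  ∀ t ∈ Icc 0 T, expectedShortfall mk P x α X t / levelRisk mk x ζ t ≤ 1

/-! ### The two optimization problems -/

/-- The control `ς = (y, v X) ∈ 𝒰` with wealth process `X` solves the problem of maximizing
`J(x, ς)` over `𝒰` subject to the Expected Shortfall bound. -/
structure SolvesESProblem (mk : Market d) (𝓕 : Filtration ℝ≥0 mΩ) (P : Measure Ω)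
    (W : ℝ≥0 → Ω → EuclideanSpace ℝ (Fin d)) (T x γ₁ γ₂ α ζ : ℝ)
    (y : ℝ → EuclideanSpace ℝ (Fin d)) (v : ℝ → ℝ) (X : ℝ → Ω → ℝ) : Prop where
  control : IsDetControl T y v
  wealth : IsDetWealth mk 𝓕 P W T x y v X
  bound : ESBound mk P T x α ζ X
  optimal : ∀ y' v' X', IsDetControl T y' v' → IsDetWealth mk 𝓕 P W T x y' v' X' →
    ESBound mk P T x α ζ X' →
    cost P T γ₁ γ₂ (fun t ω => v' t * X' t ω) X' ≤ cost P T γ₁ γ₂ (fun t ω => v t * X t ω) X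

/-- The control `ς = (y, c) ∈ 𝒱` with wealth process `X` solves the unconstrained problem of
maximizing `J(x, ς)` over `𝒱`. -/
structure SolvesUnconstrainedProblem (mk : Market d) (𝓕 : Filtration ℝ≥0 mΩ) (P : Measure Ω)
    (W : ℝ≥0 → Ω → EuclideanSpace ℝ (Fin d)) (T x γ₁ γ₂ : ℝ)
    (y : ℝ → Ω → EuclideanSpace ℝ (Fin d)) (c X : ℝ → Ω → ℝ) : Prop where
  admissible : IsAdmissible mk 𝓕 P W T x y c
  wealth : IsWealth mk 𝓕 P W T x y c X
  optimal : ∀ y' c' X', IsAdmissible mk 𝓕 P W T x y' c' → IsWealth mk 𝓕 P W T x y' c' X' →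
    cost P T γ₁ γ₂ c' X' ≤ cost P T γ₁ γ₂ c X

/-! ### The explicit quantities -/

/-- `q = 1 / (1 - γ)`. -/
def qExp (γ : ℝ) : ℝ := 1 / (1 - γ)

/-- `g̃_γ(t) = exp (γ R_t + (q - 1)/2 ‖θ‖_t²)`. -/
def gTilde (mk : Market d) (γ t : ℝ) : ℝ :=
  Real.exp (γ * mk.R t + (qExp γ - 1) / 2 * l2Norm mk.theta t ^ 2)

/-- `y*_t = θ_t / (1 - γ)`. -/
def yStar (mk : Market d) (γ t : ℝ) : EuclideanSpace ℝ (Fin d) := (1 / (1 - γ)) • mk.theta t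

/-- `π*_t = (σ_t σ_t')⁻¹ (μ_t - r_t 𝟏) / (1 - γ)`. -/
def piStar (mk : Market d) (γ t : ℝ) : Fin d → ℝ :=
  (1 / (1 - γ)) • Matrix.mulVec (mk.sigma t * (mk.sigma t).transpose)⁻¹
    (fun i => mk.mu t i - mk.r t)

/-- `v*_t = g̃^q(t) / (g̃^q(T) + ∫ₜᵀ g̃^q(s) ds)`. -/
def vStar (mk : Market d) (T γ t : ℝ) : ℝ :=
  gTilde mk γ t ^ qExp γ /
    (gTilde mk γ T ^ qExp γ + ∫ s in t..T, gTilde mk γ s ^ qExp γ)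

/-- `κ̃(γ) = ‖g̃‖_{q,T}^q / (‖g̃‖_{q,T}^q + g̃^q(T))`. -/
def kappaTilde (mk : Market d) (T γ : ℝ) : ℝ :=
  qNorm (qExp γ) (gTilde mk γ) T ^ qExp γ /
    (qNorm (qExp γ) (gTilde mk γ) T ^ qExp γ + gTilde mk γ T ^ qExp γ)

/-- `z_α`, the `α`-quantile of the standard normal distribution. -/
def zQuantile (α : ℝ) : ℝ := sInf {z : ℝ | α ≤ cdf (gaussianReal 0 1) z}

/-- `F_α(z) = ∫_z^∞ e^{-t²/2} dt / ∫_{|z_α|}^∞ e^{-t²/2} dt`. -/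
def Falpha (α z : ℝ) : ℝ :=
  (∫ t in Ioi z, Real.exp (-t ^ 2 / 2)) / ∫ t in Ioi |zQuantile α|, Real.exp (-t ^ 2 / 2)

end

end PortfolioES

open PortfolioES

/-! The proof is the duality method of portfolio theory. Let Z_t = exp(-∫₀ᵗ θ'dW - ½∫₀ᵗ |θ|²) and
let H_t = e^{-R_t} Z_t be the state price density. Under the measure with density Z_T the process W
+ ∫θ is a Brownian motion. There, discounted wealth plus accumulated discounted consumption equals x
plus a stochastic integral, and since it is nonnegative its expectation is at most x. Hence the
budget inequality E(H_T X_T + ∫₀ᵀ H_t c_t dt) ≤ x (`lintegral_discounted_le`,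
`lintegral_deflated_le`).

Young's inequality a^γ ≤ γ a h + (1-γ) h^{-γ/(1-γ)} with h = l H_t bounds the utility by the budget
and by the moments E H_t^{-γ/(1-γ)}, which are g̃^q(t) (`deflatorMoment`, `Market.gTilde_rpow`). Put
Γ = ∫₀ᵀ g̃^q(t) dt + g̃^q(T). The multiplier l = (Γ/x)^{1-γ} gives J ≤ x^γ Γ^{1-γ} for every
control, deterministic or not (`cost_le`). The explicit exponential `optWealth` solves the optimal
wealth equation and attains this value (`isIto_optWealth`, `cost_optWealth`), so it solves the
unconstrained problem.

It solves the constrained problem because it satisfies the constraint. Its value at time t is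
lognormal with tail mean x e^{R_t} (K_t/Γ) e^{q‖θ‖_t²} F_α(|z_α| + q‖θ‖_t), where K_t = g̃^q(T) +
∫ₜᵀ g̃^q (`tailMean_optWealth`). The ratio K_t/Γ decreases to 1 - κ̃(γ). By Mills' inequality, s ↦
e^{qs²} F_α(|z_α| + qs) decreases as long as 2s ≤ |z_α| (`antitoneOn_exp_mul_gaussTail`). The lower
bound for the tail mean relative to x e^{R_t} is therefore smallest at t = T, where it is the
hypothesis on ζ (`esBound_optWealth`).

The stochastic calculus is built from the definition of the Itô integral as a limit in probability
of elementary integrals. Lenglart's inequality on grids makes this convergence uniform in time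
(`IsGridCoef.measure_max_le_add`, `IsItoIntegral.isGridApprox_sub`). Integrals of deterministic
functions are Gaussian limits of step integrals (`exists_isWienerIntegral`). In place of Itô's
formula, the equation for the exponential is checked by a first order expansion on each cell
(`isIto_stochExp`). Uniqueness for linear equations follows from a localized Itô isometry and
Gronwall's inequality (`ae_eq_zero_of_linear`). Girsanov's theorem for a deterministic θ is a
computation with Gaussian exponentials (`isFilteredBM_shiftedBM`), and the supermartingale bound is
obtained by truncating elementary integrals (`lintegral_le_of_gridSum_approx`). -/

namespace PortfolioES

variable {d : ℕ} {Ω : Type*} [mΩ : MeasurableSpace Ω]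

/-! ### Orthogonal increments along a discrete filtration -/

/-- A square-integrable sequence of differences orthogonal to the past. -/
structure IsMartDiff (𝓖 : Filtration ℕ mΩ) (Q : Measure Ω) (ρ : ℕ → Ω → ℝ) : Prop where
  measurable : ∀ i, Measurable[𝓖 (i + 1)] (ρ i)
  memLp : ∀ i, MemLp (ρ i) 2 Q
  orth : ∀ i (ζ : Ω → ℝ), Measurable[𝓖 i] ζ → MemLp ζ 2 Q → ∫ ω, ζ ω * ρ i ω ∂Q = 0

namespace IsMartDiff

variable {𝓖 : Filtration ℕ mΩ} {Q : Measure Ω} {ρ : ℕ → Ω → ℝ}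

lemma measurable_sum (h : IsMartDiff 𝓖 Q ρ) (n : ℕ) :
    Measurable[𝓖 n] (fun ω => ∑ i ∈ Finset.range n, ρ i ω) := by
  refine Finset.measurable_fun_sum _ fun i hi => ?_
  exact (h.measurable i).mono (𝓖.mono (Finset.mem_range.1 hi)) le_rfl

lemma memLp_sum (h : IsMartDiff 𝓖 Q ρ) (n : ℕ) :
    MemLp (fun ω => ∑ i ∈ Finset.range n, ρ i ω) 2 Q :=
  memLp_finsetSum _ fun i _ => h.memLp i

lemma integral_sum_sq (h : IsMartDiff 𝓖 Q ρ) (n : ℕ) :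
    ∫ ω, (∑ i ∈ Finset.range n, ρ i ω) ^ 2 ∂Q = ∑ i ∈ Finset.range n, ∫ ω, ρ i ω ^ 2 ∂Q := by
  induction n with
  | zero => simp
  | succ n ih =>
    simp_rw [Finset.sum_range_succ, add_sq]
    have h1 := (h.memLp_sum n).integrable_sq
    have h2 := (h.memLp n).integrable_sq
    have h3 := (h.memLp_sum n).integrable_mul (h.memLp n)
    have h3' : Integrable (fun ω => 2 * (∑ i ∈ Finset.range n, ρ i ω) * ρ n ω) Q := by
      simpa [mul_assoc] using h3.const_mul 2
    rw [integral_add (by exact h1.add h3') h2, integral_add h1 h3', ih]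
    have := h.orth n _ (h.measurable_sum n) (h.memLp_sum n)
    simp_rw [mul_assoc, integral_const_mul, this]
    simp

lemma integral_sum_eq_zero [IsProbabilityMeasure Q] (h : IsMartDiff 𝓖 Q ρ) (n : ℕ) :
    ∫ ω, (∑ i ∈ Finset.range n, ρ i ω) ∂Q = 0 := by
  rw [integral_finsetSum _ fun i _ => (h.memLp i).integrable (by norm_num)]
  refine Finset.sum_eq_zero fun i _ => ?_
  simpa using h.orth i (fun _ => 1) measurable_const (memLp_const 1)

/-- On an event s known at step n, the cross term vanishes because the partial sum restricted to s
is itself a legitimate test variable for `orth`; what remains is the nonnegative square of the new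
difference. -/
lemma submartingale_sq [IsProbabilityMeasure Q] (h : IsMartDiff 𝓖 Q ρ) :
    Submartingale (fun n ω => (∑ i ∈ Finset.range n, ρ i ω) ^ 2) 𝓖 Q := by
  refine submartingale_of_setIntegral_le_succ
    (fun n => ((h.measurable_sum n).pow_const 2).stronglyMeasurable)
    (fun n => (h.memLp_sum n).integrable_sq) fun n s hs => ?_
  have hs' := 𝓖.le n s hs
  have h3 := (h.memLp_sum n).integrable_mul (h.memLp n)
  have h3' : Integrable (fun ω => 2 * (∑ i ∈ Finset.range n, ρ i ω) * ρ n ω) Q := by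
    simpa [mul_assoc] using h3.const_mul 2
  have h0 : ∫ ω in s, 2 * (∑ i ∈ Finset.range n, ρ i ω) * ρ n ω ∂Q = 0 := by
    have := h.orth n (s.indicator fun ω => ∑ i ∈ Finset.range n, ρ i ω)
      ((h.measurable_sum n).indicator hs) ((h.memLp_sum n).indicator hs')
    simp_rw [mul_assoc, integral_const_mul]
    rw [← integral_indicator hs']
    have e : (s.indicator fun ω => (∑ i ∈ Finset.range n, ρ i ω) * ρ n ω)
        = fun ω => s.indicator (fun ω => ∑ i ∈ Finset.range n, ρ i ω) ω * ρ n ω := by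
      ext ω; by_cases hω : ω ∈ s <;> simp [hω]
    rw [e, this, mul_zero]
  simp_rw [Finset.sum_range_succ, add_sq]
  have h1 := (h.memLp_sum n).integrable_sq
  have h2 := (h.memLp n).integrable_sq
  rw [integral_add (by exact (h1.add h3').integrableOn) h2.integrableOn,
    integral_add h1.integrableOn h3'.integrableOn, h0, add_zero]
  exact le_add_of_nonneg_right (integral_nonneg fun ω => sq_nonneg _)

/-- Kolmogorov's inequality: Doob's maximal inequality for the submartingale of squares at level ε²,
combined with orthogonality of the differences. -/
lemma maximal [IsProbabilityMeasure Q] (h : IsMartDiff 𝓖 Q ρ) (n : ℕ) {ε : ℝ} (hε : 0 < ε) :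
    Q {ω | ∃ k ≤ n, ε ≤ |∑ i ∈ Finset.range k, ρ i ω|} ≤
      ENNReal.ofReal ((∑ i ∈ Finset.range n, ∫ ω, ρ i ω ^ 2 ∂Q) / ε ^ 2) := by
  have hm := maximal_ineq h.submartingale_sq (fun n ω => sq_nonneg _)
    (ε := (ε ^ 2).toNNReal) n
  have hε2 : 0 < ε ^ 2 := by positivity
  have hset : {ω | ∃ k ≤ n, ε ≤ |∑ i ∈ Finset.range k, ρ i ω|} ⊆
      {ω | (((ε ^ 2).toNNReal : ℝ≥0) : ℝ) ≤ (Finset.range (n + 1)).sup' Finset.nonempty_range_add_one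
        fun k => (∑ i ∈ Finset.range k, ρ i ω) ^ 2} := by
    rintro ω ⟨k, hk, hω⟩
    simp only [Set.mem_ofPred_eq, Finset.le_sup'_iff, Real.coe_toNNReal _ hε2.le]
    refine ⟨k, Finset.mem_range.2 (by omega), ?_⟩
    rw [← sq_abs (∑ i ∈ Finset.range k, ρ i ω)]
    exact pow_le_pow_left₀ hε.le hω 2
  rw [ENNReal.ofReal_div_of_pos hε2, ENNReal.le_div_iff_mul_le (by simp [hε.ne']) (by simp)]
  calc _ ≤ ENNReal.ofReal (ε ^ 2) * Q _ := by rw [mul_comm]; gcongr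
    _ ≤ _ := hm
    _ ≤ _ := by
      apply ENNReal.ofReal_le_ofReal
      rw [← h.integral_sum_sq]
      exact setIntegral_le_integral (h.memLp_sum n).integrable_sq (ae_of_all _ fun ω => sq_nonneg _)

end IsMartDiff

/-! ### Gaussian variables independent of a σ-algebra -/

/-- `V` is independent of `m` under `Q` with law `N(0, v)`. -/
structure IndepGaussian {Ω : Type*} (m : MeasurableSpace Ω) [mΩ : MeasurableSpace Ω] (Q : Measure Ω) (V : Ω → ℝ) (v : ℝ≥0) : Prop where
  measurable : Measurable V
  map_restrict : ∀ A, MeasurableSet[m] A → (Q.restrict A).map V = Q A • gaussianReal 0 v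

namespace IndepGaussian

variable {Ω : Type*} {m : MeasurableSpace Ω} [mΩ : MeasurableSpace Ω] {Q : Measure Ω} [IsProbabilityMeasure Q] {V : Ω → ℝ} {v : ℝ≥0}

lemma map_eq (h : IndepGaussian m Q V v) : Q.map V = gaussianReal 0 v := by
  simpa using h.map_restrict univ MeasurableSet.univ

lemma indep (h : IndepGaussian m Q V v) :
    Indep m (MeasurableSpace.comap V inferInstance) Q := by
  rw [Indep_iff]
  rintro A _ hA ⟨C, hC, rfl⟩
  have h1 := congrArg (fun μ => μ C) (h.map_restrict A hA)
  have h2 := congrArg (fun μ => μ C) h.map_eq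
  simp only [Measure.smul_apply, smul_eq_mul] at h1 h2
  rw [Measure.map_apply h.measurable hC, Measure.restrict_apply (h.measurable hC)] at h1
  rw [Measure.map_apply h.measurable hC] at h2
  rw [inter_comm, h1, h2]

lemma indepFun (h : IndepGaussian m Q V v) {β : Type*} [MeasurableSpace β]
    {η : Ω → β} (hη : Measurable[m] η) : IndepFun η V Q := by
  rw [IndepFun_iff_Indep]
  exact indep_of_indep_of_le_left h.indep hη.comap_le

lemma integral_comp (h : IndepGaussian m Q V v) {φ : ℝ → ℝ} (hφ : Measurable φ) :
    ∫ ω, φ (V ω) ∂Q = ∫ z, φ z ∂(gaussianReal 0 v) := by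
  rw [← h.map_eq, integral_map h.measurable.aemeasurable hφ.aestronglyMeasurable]

lemma integral_mul_comp (h : IndepGaussian m Q V v) (hm : m ≤ mΩ) {η : Ω → ℝ}
    (hη : Measurable[m] η) {φ : ℝ → ℝ} (hφ : Measurable φ) :
    ∫ ω, η ω * φ (V ω) ∂Q = (∫ ω, η ω ∂Q) * ∫ z, φ z ∂(gaussianReal 0 v) := by
  rw [← h.integral_comp hφ]
  exact ((h.indepFun hη).comp measurable_id hφ).integral_fun_mul_eq_mul_integral
    (hη.mono hm le_rfl).aestronglyMeasurable (hφ.comp h.measurable).aestronglyMeasurable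

lemma memLp_comp (h : IndepGaussian m Q V v) {φ : ℝ → ℝ} {p : ℝ≥0∞}
    (hφ : MemLp φ p (gaussianReal 0 v)) : MemLp (fun ω => φ (V ω)) p Q := by
  rw [← h.map_eq] at hφ
  exact hφ.comp_of_map h.measurable.aemeasurable

lemma integrable_mul_comp (h : IndepGaussian m Q V v) {η : Ω → ℝ}
    (hη : Measurable[m] η) (hi : Integrable η Q) {φ : ℝ → ℝ} (hφ : Measurable φ)
    (hφi : Integrable φ (gaussianReal 0 v)) : Integrable (fun ω => η ω * φ (V ω)) Q :=
  ((h.indepFun hη).comp measurable_id hφ).integrable_mul hi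
    (memLp_one_iff_integrable.1 (h.memLp_comp (memLp_one_iff_integrable.2 hφi)))

lemma memLp_mul_comp (h : IndepGaussian m Q V v) (hm : m ≤ mΩ) {η : Ω → ℝ}
    (hη : Measurable[m] η) (hi : MemLp η 2 Q) {φ : ℝ → ℝ} (hφ : Measurable φ)
    (hφi : MemLp φ 2 (gaussianReal 0 v)) : MemLp (fun ω => η ω * φ (V ω)) 2 Q := by
  rw [memLp_two_iff_integrable_sq]
  · simp_rw [mul_pow]
    exact h.integrable_mul_comp (hη.pow_const 2) hi.integrable_sq (hφ.pow_const 2)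
      hφi.integrable_sq
  · exact ((hη.mono hm le_rfl).mul (hφ.comp h.measurable)).aestronglyMeasurable

/-- Characterization by characteristic functions. -/
lemma iff_charFun (hV : Measurable V) :
    IndepGaussian m Q V v ↔ ∀ A, MeasurableSet[m] A → ∀ s : ℝ,
      ∫ ω in A, Complex.exp (s * V ω * Complex.I) ∂Q =
        (Q.real A : ℂ) * Complex.exp (-(v * s ^ 2 / 2)) := by
  have key : ∀ A, MeasurableSet[m] A → ((Q.restrict A).map V = Q A • gaussianReal 0 v ↔
      ∀ s : ℝ, ∫ ω in A, Complex.exp (s * V ω * Complex.I) ∂Q =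
        (Q.real A : ℂ) * Complex.exp (-(v * s ^ 2 / 2))) := by
    intro A hA
    have h1 : ∀ s : ℝ, charFun ((Q.restrict A).map V) s =
        ∫ ω in A, Complex.exp (s * V ω * Complex.I) ∂Q := by
      intro s
      rw [charFun_apply_real, integral_map hV.aemeasurable (by fun_prop)]
    have h2 : ∀ s : ℝ, charFun (Q A • gaussianReal 0 v) s =
        (Q.real A : ℂ) * Complex.exp (-(v * s ^ 2 / 2)) := by
      intro s
      have := charFun_gaussianReal (μ := 0) (v := v) s
      rw [charFun_apply_real] at this ⊢
      rw [integral_smul_measure, this]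
      simp [Measure.real, Complex.real_smul]
    constructor
    · intro h s
      rw [← h1, ← h2, h]
    · intro h
      have : IsFiniteMeasure (Q A • gaussianReal 0 v) :=
        Measure.smul_finite _ (measure_ne_top _ _)
      refine Measure.ext_of_charFun (funext fun s => ?_)
      rw [h1, h2, h]
  constructor
  · intro h A hA
    exact (key A hA).1 (h.map_restrict A hA)
  · intro h
    exact ⟨hV, fun A hA => (key A hA).2 (h A hA)⟩

/-- Characterization by moment generating functions. -/
lemma of_mgf (hV : Measurable V)
    (h : ∀ A, MeasurableSet[m] A → ∀ s : ℝ,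
      Integrable (fun ω => Real.exp (s * V ω)) Q ∧
      ∫ ω in A, Real.exp (s * V ω) ∂Q = Q.real A * Real.exp (v * s ^ 2 / 2)) :
    IndepGaussian m Q V v := by
  refine ⟨hV, fun A hA => ?_⟩
  have hfin : IsFiniteMeasure (Q A • gaussianReal 0 v) :=
    Measure.smul_finite _ (measure_ne_top _ _)
  have hmgf : mgf V (Q.restrict A) = mgf id (Q A • gaussianReal 0 v) := by
    funext s
    have := congrFun (mgf_id_gaussianReal (μ := 0) (v := v)) s
    simp only [mgf] at this ⊢
    rw [integral_smul_measure, this, (h A hA s).2]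
    simp [Measure.real]
  -- The passage from real to complex moment generating functions asks that the two measures vanish
  -- together; here both vanish exactly when Q A = 0.
  have h0 : Q.restrict A = 0 ↔ Q A • gaussianReal 0 v = 0 := by
    rw [Measure.restrict_eq_zero]
    constructor
    · intro h; simp [h]
    · intro h
      have := congrArg (fun μ => μ univ) h
      simpa using this
  have hset : integrableExpSet V (Q.restrict A) = univ := by
    ext s; simpa [integrableExpSet] using (h A hA s).1.restrict
  have := eqOn_complexMGF_of_mgf' hmgf h0
  rw [hset] at this
  have h3 : complexMGF V (Q.restrict A) = complexMGF id (Q A • gaussianReal 0 v) :=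
    funext fun z => this (by simp)
  simpa using Measure.ext_of_complexMGF_eq hV.aemeasurable aemeasurable_id h3

end IndepGaussian

end PortfolioES

namespace PortfolioES

variable {d : ℕ} {Ω : Type*} [mΩ : MeasurableSpace Ω]

/-! ### Brownian motion relative to a filtration -/

/-- `B` is a `d`-dimensional Brownian motion on `[0, T]` relative to the filtration `𝓕`. -/
structure IsFilteredBM (𝓕 : Filtration ℝ≥0 mΩ) (Q : Measure Ω) (T : ℝ≥0)
    (B : ℝ≥0 → Ω → EuclideanSpace ℝ (Fin d)) : Prop where
  adapted : ∀ t, Measurable[𝓕 t] (B t)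
  increment : ∀ s t, s ≤ t → t ≤ T → ∀ u : EuclideanSpace ℝ (Fin d),
    IndepGaussian (𝓕 s) Q (fun ω => ⟪u, B t ω - B s ω⟫) (‖u‖₊ ^ 2 * (t - s))

lemma integral_sq_gaussianReal (v : ℝ≥0) : ∫ z, z ^ 2 ∂(gaussianReal 0 v) = v := by
  have := variance_id_gaussianReal (μ := 0) (v := v)
  rw [variance_eq_integral aemeasurable_id] at this
  simpa using this

lemma integrable_id_gaussianReal (v : ℝ≥0) : Integrable (fun z : ℝ => z) (gaussianReal 0 v) :=
  memLp_one_iff_integrable.1 (memLp_id_gaussianReal' 1 (by simp))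

lemma integrable_sq_gaussianReal (v : ℝ≥0) : Integrable (fun z : ℝ => z ^ 2) (gaussianReal 0 v) :=
  (memLp_id_gaussianReal' 2 (by simp)).integrable_sq

namespace IsFilteredBM

variable {𝓕 : Filtration ℝ≥0 mΩ} {Q : Measure Ω} [IsProbabilityMeasure Q] {T : ℝ≥0}
  {B : ℝ≥0 → Ω → EuclideanSpace ℝ (Fin d)}

omit [IsProbabilityMeasure Q] in
lemma measurable (hB : IsFilteredBM 𝓕 Q T B) (t : ℝ≥0) : Measurable (B t) :=
  (hB.adapted t).mono (𝓕.le t) le_rfl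

lemma integral_mul_inner_sq (hB : IsFilteredBM 𝓕 Q T B) {s t : ℝ≥0} (hst : s ≤ t) (ht : t ≤ T)
    (u : EuclideanSpace ℝ (Fin d)) {η : Ω → ℝ} (hη : Measurable[𝓕 s] η) :
    ∫ ω, η ω * ⟪u, B t ω - B s ω⟫ ^ 2 ∂Q = (∫ ω, η ω ∂Q) * (‖u‖ ^ 2 * (t - s)) := by
  rw [(hB.increment s t hst ht u).integral_mul_comp (𝓕.le s) hη (φ := fun z => z ^ 2)
    (by fun_prop), integral_sq_gaussianReal]
  simp [NNReal.coe_sub hst]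

lemma integrable_mul_inner_sq (hB : IsFilteredBM 𝓕 Q T B) {s t : ℝ≥0} (hst : s ≤ t) (ht : t ≤ T)
    (u : EuclideanSpace ℝ (Fin d)) {η : Ω → ℝ} (hη : Measurable[𝓕 s] η) (hi : Integrable η Q) :
    Integrable (fun ω => η ω * ⟪u, B t ω - B s ω⟫ ^ 2) Q :=
  (hB.increment s t hst ht u).integrable_mul_comp hη hi (φ := fun z => z ^ 2)
    (by fun_prop) (integrable_sq_gaussianReal _)

/-- Polarization. `IsFilteredBM` only gives the law of one linear functional of an increment at a
time, so covariances are read off from the variances in the directions u + w and u - w. -/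
lemma inner_mul_inner_eq (u w b : EuclideanSpace ℝ (Fin d)) :
    ⟪u, b⟫ * ⟪w, b⟫ = (1 / 4) * ⟪u + w, b⟫ ^ 2 - (1 / 4) * ⟪u - w, b⟫ ^ 2 := by
  rw [inner_add_left, inner_sub_left]; ring

lemma integrable_mul_inner_mul_inner (hB : IsFilteredBM 𝓕 Q T B) {s t : ℝ≥0} (hst : s ≤ t)
    (ht : t ≤ T) (u w : EuclideanSpace ℝ (Fin d)) {η : Ω → ℝ} (hη : Measurable[𝓕 s] η)
    (hi : Integrable η Q) :
    Integrable (fun ω => η ω * (⟪u, B t ω - B s ω⟫ * ⟪w, B t ω - B s ω⟫)) Q := by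
  have h1 := (hB.integrable_mul_inner_sq hst ht (u + w) hη hi).const_mul (1 / 4)
  have h2 := (hB.integrable_mul_inner_sq hst ht (u - w) hη hi).const_mul (1 / 4)
  refine (h1.sub h2).congr (ae_of_all _ fun ω => ?_)
  simp only [Pi.sub_apply, inner_mul_inner_eq u w]
  ring

lemma integral_mul_inner_mul_inner (hB : IsFilteredBM 𝓕 Q T B) {s t : ℝ≥0} (hst : s ≤ t)
    (ht : t ≤ T) (u w : EuclideanSpace ℝ (Fin d)) {η : Ω → ℝ} (hη : Measurable[𝓕 s] η)
    (hi : Integrable η Q) :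
    ∫ ω, η ω * (⟪u, B t ω - B s ω⟫ * ⟪w, B t ω - B s ω⟫) ∂Q =
      (∫ ω, η ω ∂Q) * (⟪u, w⟫ * (t - s)) := by
  have h1 := (hB.integrable_mul_inner_sq hst ht (u + w) hη hi).const_mul (1 / 4)
  have h2 := (hB.integrable_mul_inner_sq hst ht (u - w) hη hi).const_mul (1 / 4)
  have e : ∀ ω, η ω * (⟪u, B t ω - B s ω⟫ * ⟪w, B t ω - B s ω⟫) =
      1 / 4 * (η ω * ⟪u + w, B t ω - B s ω⟫ ^ 2) - 1 / 4 * (η ω * ⟪u - w, B t ω - B s ω⟫ ^ 2) := by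
    intro ω; rw [inner_mul_inner_eq u w]; ring
  simp_rw [e]
  rw [integral_sub h1 h2, integral_const_mul, integral_const_mul,
    hB.integral_mul_inner_sq hst ht _ hη, hB.integral_mul_inner_sq hst ht _ hη,
    norm_add_sq_real, norm_sub_sq_real]
  ring

/-- Expanding a random coefficient in coordinates turns each term into an adapted scalar times a
real Gaussian independent of the past, to which `IndepGaussian` applies. -/
lemma inner_eq_sum (x b : EuclideanSpace ℝ (Fin d)) :
    ⟪x, b⟫ = ∑ j, x j * ⟪EuclideanSpace.single j (1 : ℝ), b⟫ := by
  simp [PiLp.inner_apply, mul_comm]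

variable {s t : ℝ≥0} {ξ : Ω → EuclideanSpace ℝ (Fin d)}

lemma memLp_inner (hB : IsFilteredBM 𝓕 Q T B) (hst : s ≤ t) (ht : t ≤ T)
    (hξ : Measurable[𝓕 s] ξ) {C : ℝ} (hC : ∀ ω, ‖ξ ω‖ ≤ C) :
    MemLp (fun ω => ⟪ξ ω, B t ω - B s ω⟫) 2 Q := by
  simp_rw [inner_eq_sum (ξ _)]
  refine memLp_finsetSum _ fun j _ => ?_
  have hm : Measurable[𝓕 s] fun ω => ξ ω j := by fun_prop
  refine (hB.increment s t hst ht _).memLp_mul_comp (𝓕.le s) hm ?_ (φ := fun z => z)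
    measurable_id (memLp_id_gaussianReal' 2 (by simp))
  exact MemLp.of_bound (hm.mono (𝓕.le s) le_rfl).aestronglyMeasurable C
    (ae_of_all _ fun ω => (PiLp.norm_apply_le (ξ ω) j).trans (hC ω))

lemma integral_mul_inner (hB : IsFilteredBM 𝓕 Q T B) (hst : s ≤ t) (ht : t ≤ T)
    (hξ : Measurable[𝓕 s] ξ) {C : ℝ} (hC : ∀ ω, ‖ξ ω‖ ≤ C) {ζ : Ω → ℝ}
    (hζ : Measurable[𝓕 s] ζ) (hζ2 : MemLp ζ 2 Q) :
    ∫ ω, ζ ω * ⟪ξ ω, B t ω - B s ω⟫ ∂Q = 0 := by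
  simp_rw [inner_eq_sum (ξ _), Finset.mul_sum, ← mul_assoc]
  have hm : ∀ j, Measurable[𝓕 s] fun ω => ζ ω * ξ ω j := fun j => by fun_prop
  have hi : ∀ j, Integrable (fun ω => ζ ω * ξ ω j) Q := fun j =>
    (hζ2.integrable (by norm_num)).mul_bdd (c := C)
      ((show Measurable[𝓕 s] fun ω => ξ ω j by fun_prop).mono (𝓕.le s) le_rfl).aestronglyMeasurable
      (ae_of_all _ fun ω => (PiLp.norm_apply_le (ξ ω) j).trans (hC ω))
  rw [integral_finsetSum]
  · refine Finset.sum_eq_zero fun j _ => ?_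
    rw [(hB.increment s t hst ht _).integral_mul_comp (𝓕.le s) (hm j) (φ := fun z => z)
      measurable_id, integral_id_gaussianReal, mul_zero]
  · intro j _
    exact (hB.increment s t hst ht _).integrable_mul_comp (hm j) (hi j) (φ := fun z => z)
      measurable_id (integrable_id_gaussianReal _)

/-- The Itô isometry on one cell: after expansion in coordinates only the diagonal survives, since
distinct coordinate increments are uncorrelated. -/
lemma integral_inner_sq (hB : IsFilteredBM 𝓕 Q T B) (hst : s ≤ t) (ht : t ≤ T)
    (hξ : Measurable[𝓕 s] ξ) {C : ℝ} (hC : ∀ ω, ‖ξ ω‖ ≤ C) :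
    ∫ ω, ⟪ξ ω, B t ω - B s ω⟫ ^ 2 ∂Q = ∫ ω, ‖ξ ω‖ ^ 2 * ((t : ℝ) - s) ∂Q := by
  have hm : ∀ j k, Measurable[𝓕 s] fun ω => ξ ω j * ξ ω k := fun j k => by fun_prop
  have hi : ∀ j k, Integrable (fun ω => ξ ω j * ξ ω k) Q := fun j k => by
    refine Integrable.of_bound ((hm j k).mono (𝓕.le s) le_rfl).aestronglyMeasurable (C * C)
      (ae_of_all _ fun ω => ?_)
    rw [norm_mul]
    have h1 := (PiLp.norm_apply_le (ξ ω) j).trans (hC ω)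
    have h2 := (PiLp.norm_apply_le (ξ ω) k).trans (hC ω)
    exact mul_le_mul h1 h2 (norm_nonneg _) ((norm_nonneg _).trans h1)
  have e1 : ∀ ω, ⟪ξ ω, B t ω - B s ω⟫ ^ 2 = ∑ j, ∑ k, (ξ ω j * ξ ω k) *
      (⟪EuclideanSpace.single j (1 : ℝ), B t ω - B s ω⟫ *
        ⟪EuclideanSpace.single k (1 : ℝ), B t ω - B s ω⟫) := by
    intro ω
    rw [sq, inner_eq_sum (ξ ω), Finset.sum_mul_sum]
    refine Finset.sum_congr rfl fun j _ => Finset.sum_congr rfl fun k _ => by ring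
  simp_rw [e1]
  rw [integral_finsetSum _ fun j _ => integrable_finsetSum _ fun k _ =>
    hB.integrable_mul_inner_mul_inner hst ht _ _ (hm j k) (hi j k)]
  simp_rw [integral_finsetSum _ fun k _ =>
    hB.integrable_mul_inner_mul_inner hst ht _ _ (hm _ k) (hi _ k),
    hB.integral_mul_inner_mul_inner hst ht _ _ (hm _ _) (hi _ _)]
  rw [integral_mul_const]
  have e2 : ∀ ω, ‖ξ ω‖ ^ 2 = ∑ j, ξ ω j * ξ ω j := by
    intro ω; rw [EuclideanSpace.real_norm_sq_eq]; simp [sq]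
  simp_rw [e2]
  rw [integral_finsetSum _ fun j _ => hi j j, Finset.sum_mul]
  refine Finset.sum_congr rfl fun j _ => ?_
  rw [Finset.sum_eq_single j]
  · simp
  · intro k _ hk
    simp [EuclideanSpace.inner_single_left, hk.symm]
  · simp

end IsFilteredBM

/-! ### Elementary integrals on a grid -/

/-- `∑_{i < k} ξ_i' (B_{g_{i+1}} - B_{g_i})`. -/
noncomputable def gridSum (B : ℝ≥0 → Ω → EuclideanSpace ℝ (Fin d)) (g : ℕ → ℝ≥0)
    (ξ : ℕ → Ω → EuclideanSpace ℝ (Fin d)) (k : ℕ) (ω : Ω) : ℝ :=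
  ∑ i ∈ Finset.range k, ⟪ξ i ω, B (g (i + 1)) ω - B (g i) ω⟫

/-- `∑_{i < k} |ξ_i|² (g_{i+1} - g_i)`. -/
noncomputable def gridEnergy (g : ℕ → ℝ≥0) (ξ : ℕ → Ω → EuclideanSpace ℝ (Fin d)) (k : ℕ) (ω : Ω) : ℝ :=
  ∑ i ∈ Finset.range k, ‖ξ i ω‖ ^ 2 * ((g (i + 1) : ℝ) - g i)

/-- The coefficients, set to zero as soon as the energy exceeds `K`. -/
noncomputable def gridTrunc (g : ℕ → ℝ≥0) (K : ℝ) (ξ : ℕ → Ω → EuclideanSpace ℝ (Fin d)) (i : ℕ)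
    (ω : Ω) : EuclideanSpace ℝ (Fin d) :=
  if gridEnergy g ξ (i + 1) ω ≤ K then ξ i ω else 0

/-- `g` is a grid in `[0, T]` and `ξ` a bounded sequence of coefficients adapted to it. -/
structure IsGridCoef (𝓕 : Filtration ℝ≥0 mΩ) (T : ℝ≥0) (g : ℕ → ℝ≥0)
    (ξ : ℕ → Ω → EuclideanSpace ℝ (Fin d)) : Prop where
  mono : Monotone g
  le : ∀ i, g i ≤ T
  measurable : ∀ i, Measurable[𝓕 (g i)] (ξ i)
  bounded : ∀ i, ∃ C, ∀ ω, ‖ξ i ω‖ ≤ C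

/-- The filtration sampled at the grid points. -/
def gridFiltration (𝓕 : Filtration ℝ≥0 mΩ) {g : ℕ → ℝ≥0} (hg : Monotone g) : Filtration ℕ mΩ where
  seq i := 𝓕 (g i)
  mono' _ _ hij := 𝓕.mono (hg hij)
  le' i := 𝓕.le (g i)

section Energy

variable {g : ℕ → ℝ≥0} {ξ : ℕ → Ω → EuclideanSpace ℝ (Fin d)}

omit mΩ in
lemma gridEnergy_mono (hg : Monotone g) (ω : Ω) : Monotone (fun k => gridEnergy g ξ k ω) := by
  refine monotone_nat_of_le_succ fun k => ?_
  rw [gridEnergy, gridEnergy, Finset.sum_range_succ]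
  have : (g k : ℝ) ≤ g (k + 1) := by exact_mod_cast hg (Nat.le_succ k)
  exact le_add_of_nonneg_right (mul_nonneg (sq_nonneg _) (sub_nonneg.2 this))

omit mΩ in
lemma gridEnergy_nonneg (hg : Monotone g) (k : ℕ) (ω : Ω) : 0 ≤ gridEnergy g ξ k ω := by
  simpa [gridEnergy] using gridEnergy_mono (ξ := ξ) hg ω (Nat.zero_le k)

omit mΩ in
lemma gridTrunc_eq (hg : Monotone g) {K : ℝ} {n : ℕ} {ω : Ω} (h : gridEnergy g ξ n ω ≤ K)
    {i : ℕ} (hi : i < n) : gridTrunc g K ξ i ω = ξ i ω :=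
  if_pos ((gridEnergy_mono hg ω (show i + 1 ≤ n from hi)).trans h)

omit mΩ in
-- The energy is monotone, so once it exceeds K all later truncated coefficients are zero and the
-- truncated energy stops growing.
lemma gridEnergy_gridTrunc_le (hg : Monotone g) {K : ℝ} (hK : 0 ≤ K) (n : ℕ) (ω : Ω) :
    gridEnergy g (gridTrunc g K ξ) n ω ≤ K := by
  induction n with
  | zero => simpa [gridEnergy] using hK
  | succ n ih =>
    by_cases h : gridEnergy g ξ (n + 1) ω ≤ K
    · refine le_of_eq_of_le (Finset.sum_congr rfl fun i hi => ?_) h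
      rw [gridTrunc_eq hg h (Finset.mem_range.1 hi)]
    · rw [gridEnergy, Finset.sum_range_succ, gridTrunc, if_neg h]
      simpa [gridEnergy] using ih

omit mΩ in
lemma gridSum_gridTrunc_eq (B : ℝ≥0 → Ω → EuclideanSpace ℝ (Fin d)) (hg : Monotone g) {K : ℝ}
    {n : ℕ} {ω : Ω} (h : gridEnergy g ξ n ω ≤ K) {k : ℕ} (hk : k ≤ n) :
    gridSum B g (gridTrunc g K ξ) k ω = gridSum B g ξ k ω :=
  Finset.sum_congr rfl fun i hi => by
    rw [gridTrunc_eq hg h ((Finset.mem_range.1 hi).trans_le hk)]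

omit mΩ in
-- Truncation amounts to stopping: the truncated sum is the original one stopped at an index that
-- depends on ω. This transfers lower bounds valid at all grid times to the truncated sum.
lemma exists_gridSum_gridTrunc_eq (B : ℝ≥0 → Ω → EuclideanSpace ℝ (Fin d)) (hg : Monotone g)
    (K : ℝ) (n : ℕ) (ω : Ω) :
    ∃ k ≤ n, gridSum B g (gridTrunc g K ξ) n ω = gridSum B g ξ k ω := by
  induction n with
  | zero => exact ⟨0, le_rfl, by simp [gridSum]⟩
  | succ n ih =>
    by_cases h : gridEnergy g ξ (n + 1) ω ≤ K
    · exact ⟨n + 1, le_rfl, gridSum_gridTrunc_eq B hg h le_rfl⟩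
    · obtain ⟨k, hk, e⟩ := ih
      refine ⟨k, hk.trans (Nat.le_succ n), ?_⟩
      rw [gridSum, Finset.sum_range_succ, gridTrunc, if_neg h, inner_zero_left, add_zero, ← e]
      rfl

end Energy

namespace IsGridCoef

variable {𝓕 : Filtration ℝ≥0 mΩ} {T : ℝ≥0} {g : ℕ → ℝ≥0} {ξ : ℕ → Ω → EuclideanSpace ℝ (Fin d)}

/-- The energy of the cells 0, …, i involves only coefficients up to ξ_i, all known at time g i.
Testing the energy at index i + 1 therefore keeps the i-th truncated coefficient adapted, and yet
the bound K is never overshot. -/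
lemma measurable_energy (h : IsGridCoef 𝓕 T g ξ) (i : ℕ) :
    Measurable[𝓕 (g i)] (gridEnergy g ξ (i + 1)) := by
  refine Finset.measurable_fun_sum _ fun j hj => ?_
  have := (h.measurable j).mono (𝓕.mono (h.mono (Nat.lt_succ_iff.1 (Finset.mem_range.1 hj)))) le_rfl
  fun_prop

lemma measurable_energy' (h : IsGridCoef 𝓕 T g ξ) (i : ℕ) : Measurable (gridEnergy g ξ i) := by
  refine Finset.measurable_fun_sum _ fun j _ => ?_
  have := (h.measurable j).mono (𝓕.le _) le_rfl
  fun_prop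

lemma trunc (h : IsGridCoef 𝓕 T g ξ) (K : ℝ) : IsGridCoef 𝓕 T g (gridTrunc g K ξ) where
  mono := h.mono
  le := h.le
  measurable i := Measurable.ite (measurableSet_le (h.measurable_energy i) measurable_const)
    (h.measurable i) measurable_const
  bounded i := by
    obtain ⟨C, hC⟩ := h.bounded i
    refine ⟨C, fun ω => ?_⟩
    rw [gridTrunc]
    split_ifs
    · exact hC ω
    · simpa using (norm_nonneg _).trans (hC ω)

variable {Q : Measure Ω} [IsProbabilityMeasure Q] {B : ℝ≥0 → Ω → EuclideanSpace ℝ (Fin d)}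

lemma isMartDiff (h : IsGridCoef 𝓕 T g ξ) (hB : IsFilteredBM 𝓕 Q T B) :
    IsMartDiff (gridFiltration 𝓕 h.mono) Q
      (fun i ω => ⟪ξ i ω, B (g (i + 1)) ω - B (g i) ω⟫) where
  measurable i := by
    have h1 : Measurable[𝓕 (g (i + 1))] (ξ i) :=
      (h.measurable i).mono (𝓕.mono (h.mono (Nat.le_succ i))) le_rfl
    have h2 : Measurable[𝓕 (g (i + 1))] (B (g i)) :=
      (hB.adapted _).mono (𝓕.mono (h.mono (Nat.le_succ i))) le_rfl
    exact Measurable.inner h1 ((hB.adapted _).sub h2)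
  memLp i := by
    obtain ⟨C, hC⟩ := h.bounded i
    exact hB.memLp_inner (h.mono (Nat.le_succ i)) (h.le _) (h.measurable i) hC
  orth i ζ hζ hζ2 := by
    obtain ⟨C, hC⟩ := h.bounded i
    exact hB.integral_mul_inner (h.mono (Nat.le_succ i)) (h.le _) (h.measurable i) hC hζ hζ2

lemma integrable_term (h : IsGridCoef 𝓕 T g ξ) (i : ℕ) :
    Integrable (fun ω => ‖ξ i ω‖ ^ 2 * ((g (i + 1) : ℝ) - g i)) Q := by
  obtain ⟨C, hC⟩ := h.bounded i
  have hm := (h.measurable i).mono (𝓕.le _) le_rfl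
  refine Integrable.mul_const (Integrable.of_bound (C := C ^ 2) (by fun_prop)
    (ae_of_all _ fun ω => ?_)) _
  rw [norm_pow, norm_norm]
  exact pow_le_pow_left₀ (norm_nonneg _) (hC ω) 2

lemma sum_integral_sq (h : IsGridCoef 𝓕 T g ξ) (hB : IsFilteredBM 𝓕 Q T B) (n : ℕ) :
    ∑ i ∈ Finset.range n, ∫ ω, ⟪ξ i ω, B (g (i + 1)) ω - B (g i) ω⟫ ^ 2 ∂Q =
      ∫ ω, gridEnergy g ξ n ω ∂Q := by
  simp_rw [gridEnergy]
  rw [integral_finsetSum _ fun i _ => h.integrable_term i]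
  refine Finset.sum_congr rfl fun i _ => ?_
  obtain ⟨C, hC⟩ := h.bounded i
  exact hB.integral_inner_sq (h.mono (Nat.le_succ i)) (h.le _) (h.measurable i) hC

lemma integral_gridSum_sq (h : IsGridCoef 𝓕 T g ξ) (hB : IsFilteredBM 𝓕 Q T B) (n : ℕ) :
    ∫ ω, gridSum B g ξ n ω ^ 2 ∂Q = ∫ ω, gridEnergy g ξ n ω ∂Q := by
  rw [← h.sum_integral_sq hB n]
  exact (h.isMartDiff hB).integral_sum_sq n

lemma integral_gridSum (h : IsGridCoef 𝓕 T g ξ) (hB : IsFilteredBM 𝓕 Q T B) (n : ℕ) :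
    ∫ ω, gridSum B g ξ n ω ∂Q = 0 :=
  (h.isMartDiff hB).integral_sum_eq_zero n

lemma memLp_gridSum (h : IsGridCoef 𝓕 T g ξ) (hB : IsFilteredBM 𝓕 Q T B) (n : ℕ) :
    MemLp (gridSum B g ξ n) 2 Q :=
  (h.isMartDiff hB).memLp_sum n

lemma measure_max_le (h : IsGridCoef 𝓕 T g ξ) (hB : IsFilteredBM 𝓕 Q T B) (n : ℕ) {ε : ℝ}
    (hε : 0 < ε) :
    Q {ω | ∃ k ≤ n, ε ≤ |gridSum B g ξ k ω|} ≤
      ENNReal.ofReal ((∫ ω, gridEnergy g ξ n ω ∂Q) / ε ^ 2) := by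
  rw [← h.sum_integral_sq hB n]
  exact (h.isMartDiff hB).maximal n hε

lemma integral_energy_trunc_le (h : IsGridCoef 𝓕 T g ξ) {K : ℝ} (hK : 0 ≤ K) (n : ℕ) :
    ∫ ω, gridEnergy g (gridTrunc g K ξ) n ω ∂Q ≤ K := by
  calc _ ≤ ∫ _, K ∂Q := integral_mono_of_nonneg
        (ae_of_all _ fun ω => gridEnergy_nonneg h.mono n ω) (integrable_const K)
        (ae_of_all _ fun ω => gridEnergy_gridTrunc_le h.mono hK n ω)
    _ = K := by simp

/-- **Lenglart's inequality** for elementary integrals. -/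
lemma measure_max_le_add (h : IsGridCoef 𝓕 T g ξ) (hB : IsFilteredBM 𝓕 Q T B) (n : ℕ) {ε K : ℝ}
    (hε : 0 < ε) (hK : 0 ≤ K) :
    Q {ω | ∃ k ≤ n, ε ≤ |gridSum B g ξ k ω|} ≤
      Q {ω | K < gridEnergy g ξ n ω} + ENNReal.ofReal (K / ε ^ 2) := by
  have hsub : {ω | ∃ k ≤ n, ε ≤ |gridSum B g ξ k ω|} ⊆ {ω | K < gridEnergy g ξ n ω} ∪
      {ω | ∃ k ≤ n, ε ≤ |gridSum B g (gridTrunc g K ξ) k ω|} := by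
    rintro ω ⟨k, hk, hω⟩
    by_cases hE : K < gridEnergy g ξ n ω
    · exact Or.inl hE
    · exact Or.inr ⟨k, hk, by rwa [gridSum_gridTrunc_eq B h.mono (not_lt.1 hE) hk]⟩
  refine (measure_mono hsub).trans ((measure_union_le _ _).trans ?_)
  gcongr
  refine ((h.trunc K).measure_max_le hB n hε).trans (ENNReal.ofReal_le_ofReal ?_)
  gcongr
  exact h.integral_energy_trunc_le hK n

end IsGridCoef

end PortfolioES

namespace PortfolioES

variable {d : ℕ} {Ω : Type*} [mΩ : MeasurableSpace Ω]

/-! ### Simple integrands on a grid -/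

/-- The points of F in [0, T], together with 0 and T, are enumerated increasingly; from index n on
the grid stays at T, so that it is monotone on all of ℕ. -/
lemma exists_grid (F : Finset ℝ≥0) (T : ℝ≥0) :
    ∃ (g : ℕ → ℝ≥0) (n : ℕ), Monotone g ∧ g 0 = 0 ∧ (∀ i, g i ≤ T) ∧ g n = T ∧
      (∀ t ∈ F, t ≤ T → ∃ k ≤ n, g k = t) ∧ ∀ i, ∀ t ∈ F, ¬ (g i < t ∧ t < g (i + 1)) := by
  classical
  set F' : Finset ℝ≥0 := insert 0 (insert T (F.filter (· ≤ T))) with hF'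
  have hle : ∀ t ∈ F', t ≤ T := by
    intro t ht
    simp only [hF', Finset.mem_insert, Finset.mem_filter] at ht
    rcases ht with rfl | rfl | ht
    · exact zero_le
    · exact le_rfl
    · exact ht.2
  have hne : F'.Nonempty := ⟨0, Finset.mem_insert_self _ _⟩
  obtain ⟨n, hn⟩ : ∃ n, F'.card = n + 1 := ⟨F'.card - 1, by have := hne.card_pos; omega⟩
  set e := F'.orderEmbOfFin hn with he
  have hmem : ∀ t, t ∈ F' → ∃ j, e j = t := by
    intro t ht
    have : t ∈ Set.range e := by rw [he, Finset.range_orderEmbOfFin]; exact ht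
    exact this
  set g : ℕ → ℝ≥0 := fun k => e ⟨min k n, by omega⟩ with hg
  have hmono : Monotone g := by
    intro a b hab
    exact e.monotone (by rw [Fin.le_def]; simp only; omega)
  have hgle : ∀ i, g i ≤ T := fun i => hle _ (Finset.orderEmbOfFin_mem _ _ _)
  have hval : ∀ t ∈ F', ∃ k ≤ n, g k = t := by
    intro t ht
    obtain ⟨j, rfl⟩ := hmem t ht
    exact ⟨j, by omega, by simp only [hg]; congr 1; ext; simp; omega⟩
  refine ⟨g, n, hmono, ?_, hgle, ?_, ?_, ?_⟩
  · obtain ⟨k, _, hk⟩ := hval 0 (Finset.mem_insert_self _ _)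
    exact le_antisymm (hk ▸ hmono (Nat.zero_le k)) zero_le
  · obtain ⟨k, hk, hk'⟩ := hval T (by simp [hF'])
    exact le_antisymm (hgle n) (hk' ▸ hmono hk)
  · intro t ht htT
    exact hval t (by simp [hF', ht, htT])
  · rintro i t ht ⟨h1, h2⟩
    obtain ⟨k, hk, rfl⟩ := hval t (by simp [hF', ht, h2.le.trans (hgle _)])
    have h1' := hmono.reflect_lt h1
    have h2' := hmono.reflect_lt h2
    omega

namespace SimpleIntegrand

variable {𝓕 : Filtration ℝ≥0 mΩ}

/-- No jump time of `S` lies strictly between `a` and `b`. -/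
def Separated (S : SimpleIntegrand 𝓕 d) (a b : ℝ≥0) : Prop :=
  ∀ i ≤ S.n, ¬ (a < S.time i ∧ S.time i < b)

/-- The value of `S` on `(a, b]`, if it is constant there. -/
noncomputable def cell (S : SimpleIntegrand 𝓕 d) (a b : ℝ≥0) (ω : Ω) : EuclideanSpace ℝ (Fin d) :=
  ∑ i ∈ Finset.range S.n, if S.time i ≤ a ∧ b ≤ S.time (i + 1) then S.coef i ω else 0

lemma measurable_cell (S : SimpleIntegrand 𝓕 d) (a b : ℝ≥0) : Measurable[𝓕 a] (S.cell a b) := by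
  refine Finset.measurable_fun_sum _ fun i _ => ?_
  by_cases h : S.time i ≤ a ∧ b ≤ S.time (i + 1)
  · simp only [h]
    simpa using (S.measurable i).mono (𝓕.mono h.1) le_rfl
  · simp only [h]
    simp

lemma exists_norm_cell_le (S : SimpleIntegrand 𝓕 d) : ∃ C, ∀ a b ω, ‖S.cell a b ω‖ ≤ C := by
  obtain ⟨C, hC⟩ := S.bounded
  refine ⟨∑ i ∈ Finset.range S.n, C, fun a b ω => (norm_sum_le _ _).trans ?_⟩
  refine Finset.sum_le_sum fun i _ => ?_
  split_ifs
  · exact hC i ω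
  · simpa using (norm_nonneg _).trans (hC i ω)

lemma val_eq_cell (S : SimpleIntegrand 𝓕 d) {a b : ℝ≥0} (h : S.Separated a b) {s : ℝ}
    (hs : s ∈ Ioc (a : ℝ) b) (ω : Ω) : S.val s ω = S.cell a b ω := by
  refine Finset.sum_congr rfl fun i hi => ?_
  have h1 := h i (Finset.mem_range.1 hi).le
  have h2 := h (i + 1) (Finset.mem_range.1 hi)
  rw [Set.indicator_apply]
  congr 1
  rw [mem_Ioc, eq_iff_iff]
  rw [← NNReal.coe_lt_coe, ← NNReal.coe_lt_coe] at h1 h2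
  rw [← NNReal.coe_le_coe, ← NNReal.coe_le_coe]
  obtain ⟨hs1, hs2⟩ := hs
  constructor
  · rintro ⟨h3, h4⟩
    constructor <;> by_contra hc <;> push Not at hc
    · exact h1 ⟨hc, h3.trans_le hs2⟩
    · exact h2 ⟨hs1.trans_le h4, hc⟩
  · rintro ⟨h3, h4⟩
    exact ⟨h3.trans_lt hs1, hs2.trans h4⟩

lemma integral_sub_integral (S : SimpleIntegrand 𝓕 d)
    (B : ℝ≥0 → Ω → EuclideanSpace ℝ (Fin d)) {a b : ℝ≥0} (hab : a ≤ b) (h : S.Separated a b)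
    (ω : Ω) : S.integral B b ω - S.integral B a ω = ⟪S.cell a b ω, B b ω - B a ω⟫ := by
  rw [integral, integral, cell, ← Finset.sum_sub_distrib, sum_inner]
  refine Finset.sum_congr rfl fun i hi => ?_
  have hm := S.mono (Nat.le_succ i)
  rw [← inner_sub_right]
  rcases le_or_gt (S.time i) a with h1 | h1
  · rcases le_or_gt b (S.time (i + 1)) with h2 | h2
    · rw [if_pos ⟨h1, h2⟩, min_eq_right h2, min_eq_left (h1.trans hab), min_eq_left h1,
        min_eq_right (hab.trans h2)]
      congr 1; abel
    · have h3 : S.time (i + 1) ≤ a := by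
        by_contra hc; exact h (i + 1) (Finset.mem_range.1 hi) ⟨not_le.1 hc, h2⟩
      rw [if_neg (fun hh => absurd hh.2 (not_le.2 h2)), min_eq_left h2.le,
        min_eq_left (h1.trans hab), min_eq_left h3, min_eq_left h1]
      simp
  · have h3 : b ≤ S.time i := by
      by_contra hc; exact h i (Finset.mem_range.1 hi).le ⟨h1, not_le.1 hc⟩
    rw [if_neg (fun hh => absurd hh.1 (not_le.2 h1)), min_eq_right (h3.trans hm), min_eq_right h3,
      min_eq_right h1.le, min_eq_right (h1.le.trans hm)]
    simp

lemma integral_zero_right (S : SimpleIntegrand 𝓕 d) (B : ℝ≥0 → Ω → EuclideanSpace ℝ (Fin d))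
    (ω : Ω) : S.integral B 0 ω = 0 := by
  simp [integral]

lemma integral_eq_gridSum (S : SimpleIntegrand 𝓕 d) (B : ℝ≥0 → Ω → EuclideanSpace ℝ (Fin d))
    {g : ℕ → ℝ≥0} (hg : Monotone g) (hg0 : g 0 = 0) (h : ∀ i, S.Separated (g i) (g (i + 1)))
    (k : ℕ) (ω : Ω) :
    S.integral B (g k) ω = gridSum B g (fun i => S.cell (g i) (g (i + 1))) k ω := by
  induction k with
  | zero => simp [hg0, integral_zero_right, gridSum]
  | succ k ih =>
    rw [gridSum, Finset.sum_range_succ, ← S.integral_sub_integral B (hg (Nat.le_succ k)) (h k) ω]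
    rw [gridSum] at ih
    rw [← ih]; ring

lemma memLp_val (S : SimpleIntegrand 𝓕 d) (ω : Ω) (p : ℝ≥0∞) :
    MemLp (fun s => S.val s ω) p volume :=
  memLp_finsetSum _ fun _ _ => memLp_indicator_const p measurableSet_Ioc _ (Or.inr (by simp))

lemma measurable_val (S : SimpleIntegrand 𝓕 d) :
    Measurable (fun p : ℝ × Ω => S.val p.1 p.2) := by
  refine Finset.measurable_fun_sum _ fun i _ => ?_
  have h : Measurable fun p : ℝ × Ω => S.coef i p.2 :=
    ((S.measurable i).mono (𝓕.le _) le_rfl).comp measurable_snd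
  exact h.indicator (measurableSet_Ioc.preimage (measurable_fst (α := ℝ) (β := Ω)))

lemma measurable_integral (S : SimpleIntegrand 𝓕 d) {B : ℝ≥0 → Ω → EuclideanSpace ℝ (Fin d)}
    (hB : ∀ t, Measurable (B t)) (t : ℝ≥0) : Measurable (S.integral B t) := by
  refine Finset.measurable_fun_sum _ fun i _ => ?_
  have h := (S.measurable i).mono (𝓕.le _) le_rfl
  exact h.inner ((hB _).sub (hB _))

/-- The finite set of jump times. -/
noncomputable def times (S : SimpleIntegrand 𝓕 d) : Finset ℝ≥0 := (Finset.range (S.n + 1)).image S.time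

end SimpleIntegrand

omit mΩ in
/-- The energy of a step function. -/
lemma integral_norm_sq_eq_gridEnergy {g : ℕ → ℝ≥0} (hg : Monotone g) {ω : Ω}
    {ξ : ℕ → Ω → EuclideanSpace ℝ (Fin d)} {u : ℝ → EuclideanSpace ℝ (Fin d)} {n : ℕ}
    (h : ∀ i < n, ∀ s ∈ Ioc (g i : ℝ) (g (i + 1)), u s = ξ i ω) :
    ∫ s in (g 0 : ℝ)..g n, ‖u s‖ ^ 2 = gridEnergy g ξ n ω := by
  have hle : ∀ i, (g i : ℝ) ≤ g (i + 1) := fun i => by exact_mod_cast hg (Nat.le_succ i)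
  have hcongr : ∀ i < n, EqOn (fun s => ‖u s‖ ^ 2) (fun _ => ‖ξ i ω‖ ^ 2)
      (uIoc (g i : ℝ) (g (i + 1))) := by
    intro i hi s hs
    rw [uIoc_of_le (hle i)] at hs
    simp only [h i hi s hs]
  rw [← intervalIntegral.sum_integral_adjacent_intervals (a := fun i => (g i : ℝ))]
  · refine Finset.sum_congr rfl fun i hi => ?_
    rw [intervalIntegral.integral_congr_ae (g := fun _ => ‖ξ i ω‖ ^ 2)
      (ae_of_all _ fun s hs => hcongr i (Finset.mem_range.1 hi) hs)]
    simp [mul_comm]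
  · intro i hi
    exact (intervalIntegrable_const (c := ‖ξ i ω‖ ^ 2)).congr (hcongr i hi).symm

/-! ### Brownian motion is a Brownian motion relative to its augmented filtration -/

lemma IndepGaussian.of_indep {Ω : Type*} {m : MeasurableSpace Ω} [mΩ : MeasurableSpace Ω]
    {Q : Measure Ω} {V : Ω → ℝ} {v : ℝ≥0} (hV : Measurable V)
    (hl : Q.map V = gaussianReal 0 v)
    (h : Indep m (MeasurableSpace.comap V inferInstance) Q) : IndepGaussian m Q V v := by
  refine ⟨hV, fun A hA => ?_⟩
  ext C hC
  rw [Measure.map_apply hV hC, Measure.restrict_apply (hV hC), Measure.smul_apply, ← hl,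
    Measure.map_apply hV hC, smul_eq_mul, inter_comm]
  exact Indep_iff _ _ _ |>.1 h A _ hA ⟨C, hC, rfl⟩

/-- Every set of the augmented σ-algebra agrees up to a null set with one of m₁, and independence
does not see null sets. -/
lemma indep_sup_null {Ω : Type*} {m₁ m₂ : MeasurableSpace Ω} [mΩ : MeasurableSpace Ω]
    {P : Measure Ω} (h : Indep m₁ m₂ P) :
    Indep (m₁ ⊔ MeasurableSpace.generateFrom {N | MeasurableSet N ∧ P N = 0}) m₂ P := by
  have hle : m₁ ⊔ MeasurableSpace.generateFrom {N | MeasurableSet N ∧ P N = 0} ≤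
      eventuallyMeasurableSpace m₁ (ae P) := by
    refine sup_le le_eventuallyMeasurableSpace (MeasurableSpace.generateFrom_le ?_)
    rintro N ⟨_, hN⟩
    exact ⟨∅, @MeasurableSet.empty _ m₁, ae_eq_empty.2 hN⟩
  rw [Indep_iff]
  intro A B hA hB
  obtain ⟨A', hA', hAA'⟩ := hle A hA
  have h1 : P (A ∩ B) = P (A' ∩ B) := measure_congr (hAA'.inter (ae_eq_refl B))
  rw [h1, measure_congr hAA']
  exact Indep_iff _ _ _ |>.1 h A' B hA' hB

lemma measurable_of_components {Ω : Type*} {m : MeasurableSpace Ω}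
    {f : Ω → EuclideanSpace ℝ (Fin d)} (h : ∀ j, Measurable fun ω => f ω j) : Measurable f :=
  (WithLp.measurable_toLp 2 (Fin d → ℝ)).comp (measurable_pi_lambda _ h)

/-- Independence across the components j, together with independence of two σ-algebras inside each
component, makes the whole family independent. It is applied to the past and the increment of each
coordinate of the Brownian motion. -/
lemma iIndep_prod_bool {ι Ω : Type*} [Fintype ι] {m₁ m₂ M : ι → MeasurableSpace Ω}
    [mΩ : MeasurableSpace Ω]
    {P : Measure Ω} [IsProbabilityMeasure P] (hM : iIndep M P) (h1 : ∀ j, m₁ j ≤ M j)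
    (h2 : ∀ j, m₂ j ≤ M j) (h : ∀ j, Indep (m₁ j) (m₂ j) P) :
    iIndep (fun p : ι × Bool => if p.2 then m₂ p.1 else m₁ p.1) P := by
  classical
  rw [iIndep_iff]
  intro s f hf
  set f' : ι × Bool → Set Ω := fun p => if p ∈ s then f p else univ with hf'
  have hf1 : ∀ j, MeasurableSet[m₁ j] (f' (j, false)) := by
    intro j
    simp only [hf']
    split_ifs with hj
    · simpa using hf _ hj
    · exact @MeasurableSet.univ _ (m₁ j)
  have hf2 : ∀ j, MeasurableSet[m₂ j] (f' (j, true)) := by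
    intro j
    simp only [hf']
    split_ifs with hj
    · simpa using hf _ hj
    · exact @MeasurableSet.univ _ (m₂ j)
  have e1 : ⋂ i ∈ s, f i = ⋂ j, (f' (j, false) ∩ f' (j, true)) := by
    ext ω
    simp only [mem_iInter, mem_inter_iff, hf']
    constructor
    · intro hω j
      constructor <;> split_ifs with hj
      · exact hω _ hj
      · trivial
      · exact hω _ hj
      · trivial
    · rintro hω ⟨j, b⟩ hj
      have := hω j
      cases b
      · simpa [hj] using this.1
      · simpa [hj] using this.2
  have e2 : ∏ i ∈ s, P (f i) = ∏ i, P (f' i) := by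
    rw [← Finset.prod_subset (Finset.subset_univ s)]
    · exact Finset.prod_congr rfl fun i hi => by simp [hf', hi]
    · intro i _ hi; simp [hf', hi]
  rw [e1, e2, hM.meas_iInter fun j => @MeasurableSet.inter _ (M j) _ _ (h1 j _ (hf1 j))
    (h2 j _ (hf2 j)), Fintype.prod_prod_type]
  refine Finset.prod_congr rfl fun j _ => ?_
  rw [Fintype.prod_bool, Indep_iff _ _ _ |>.1 (h j) _ _ (hf1 j) (hf2 j), mul_comm]

namespace IsStandardBrownian

variable {P : Measure Ω} [IsProbabilityMeasure P] {W : ℝ≥0 → Ω → EuclideanSpace ℝ (Fin d)}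

lemma map_inner_increment (hW : IsStandardBrownian W P) {s t : ℝ≥0} (hst : s ≤ t)
    (u : EuclideanSpace ℝ (Fin d)) :
    P.map (fun ω => ⟪u, W t ω - W s ω⟫) = gaussianReal 0 (‖u‖₊ ^ 2 * (t - s)) := by
  have hm : ∀ j, Measurable fun ω => u j * (W t ω j - W s ω j) := fun j => by
    have h1 := hW.measurable t
    have h2 := hW.measurable s
    fun_prop
  have hl : ∀ j, P.map (fun ω => u j * (W t ω j - W s ω j)) =
      gaussianReal 0 (‖u j‖₊ ^ 2 * (t - s)) := by
    intro j
    have h1 := (hW.component j).hasLaw_sub t s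
    have h2 := (gaussianReal_const_mul h1 (u j)).map_eq
    simp only [Pi.sub_apply] at h2
    rw [h2]
    congr 1
    · simp
    · ext
      simp only [NNReal.coe_mul, NNReal.coe_mk, NNReal.coe_pow, coe_nnnorm, Real.norm_eq_abs,
        sq_abs, coe_nndist, NNReal.coe_sub hst]
      congr 1
      exact abs_of_nonneg (sub_nonneg.2 (NNReal.coe_le_coe.2 hst))
  have hind : iIndepFun (fun j ω => u j * (W t ω j - W s ω j)) P :=
    hW.indep.comp (fun j (p : ℝ≥0 → ℝ) => u j * (p t - p s)) fun j => by fun_prop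
  have e : (fun ω => ⟪u, W t ω - W s ω⟫) = fun ω => ∑ j, u j * (W t ω j - W s ω j) := by
    ext ω; simp [PiLp.inner_apply, mul_comm]
  have : IsProbabilityMeasure (P.map fun ω => ∑ j, u j * (W t ω j - W s ω j)) :=
    Measure.isProbabilityMeasure_map (Finset.measurable_fun_sum _ fun j _ => hm j).aemeasurable
  rw [e]
  refine Measure.ext_of_charFun ?_
  rw [hind.charFun_map_fun_sum_eq_prod fun j => (hm j).aemeasurable]
  funext x
  simp_rw [Finset.prod_apply, hl, charFun_gaussianReal, ← Complex.exp_sum]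
  congr 1
  have hu : (‖u‖ : ℂ) ^ 2 = ∑ j, (‖u j‖ : ℂ) ^ 2 := by
    exact_mod_cast EuclideanSpace.norm_sq_eq u
  simp only [Complex.ofReal_zero, mul_zero, zero_mul, zero_sub, NNReal.coe_mul, NNReal.coe_pow,
    coe_nnnorm, Complex.ofReal_mul, Complex.ofReal_pow, hu, Finset.sum_mul, Finset.sum_div,
    Finset.sum_neg_distrib]

lemma isFilteredBM (hW : IsStandardBrownian W P) (T : ℝ≥0) :
    IsFilteredBM (brownianFiltration W hW.measurable P) P T W where
  adapted t := by
    refine Measurable.mono (comap_measurable (W t)) ?_ le_rfl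
    exact le_sup_of_le_left (le_iSup (fun s : Iic t => MeasurableSpace.comap (W s) inferInstance)
      ⟨t, mem_Iic.2 le_rfl⟩)
  increment s t hst _ u := by
    have hV : Measurable fun ω => ⟪u, W t ω - W s ω⟫ :=
      measurable_const.inner ((hW.measurable t).sub (hW.measurable s))
    refine IndepGaussian.of_indep hV (hW.map_inner_increment hst u) ?_
    refine indep_sup_null ?_
    set m₁ : Fin d → MeasurableSpace Ω := fun j =>
      ⨆ r : Iic s, MeasurableSpace.comap (fun ω => W r ω j) inferInstance with hm1
    set m₂ : Fin d → MeasurableSpace Ω := fun j =>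
      MeasurableSpace.comap (fun ω => W t ω j - W s ω j) inferInstance with hm2
    set M : Fin d → MeasurableSpace Ω := fun j =>
      MeasurableSpace.comap (fun ω (t : ℝ≥0) => W t ω j) inferInstance with hM
    have hWM : ∀ j r, Measurable[M j] fun ω => W r ω j := fun j r =>
      (measurable_pi_apply r).comp (comap_measurable fun ω (t : ℝ≥0) => W t ω j)
    have h1 : ∀ j, m₁ j ≤ M j := fun j => iSup_le fun r => (hWM j r).comap_le
    have h2 : ∀ j, m₂ j ≤ M j := fun j => Measurable.comap_le
      (show Measurable[M j] fun ω => W t ω j - W s ω j from (hWM j t).sub (hWM j s))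
    have h12 : ∀ j, Indep (m₁ j) (m₂ j) P := by
      intro j
      have := ((hW.component j).indepFun_shift s).symm
      rw [IndepFun_iff_Indep] at this
      refine indep_of_indep_of_le this (iSup_le fun r => ?_) ?_
      · exact Measurable.comap_le ((measurable_pi_apply r).comp
          (comap_measurable fun ω (r : Iic s) => W r ω j))
      · refine Measurable.comap_le ?_
        have h3 := (measurable_pi_apply (t - s)).comp
          (comap_measurable (fun ω (r : ℝ≥0) => W (s + r) ω j - W s ω j))
        simpa [Function.comp_def, add_tsub_cancel_of_le hst] using h3
    have hle : ∀ p : Fin d × Bool, (if p.2 then m₂ p.1 else m₁ p.1) ≤ mΩ := by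
      have hMle : ∀ j, M j ≤ mΩ := fun j => Measurable.comap_le (measurable_pi_lambda _ fun r => by
        have := hW.measurable r
        fun_prop)
      rintro ⟨j, b⟩
      cases b
      · simpa using (h1 j).trans (hMle j)
      · simpa using (h2 j).trans (hMle j)
    -- The index `false` collects the pasts of all coordinates and `true` their increments; grouping
    -- the independent family along these disjoint index sets separates past from increment in
    -- dimension d.
    have hind := indep_iSup_of_disjoint hle (iIndep_prod_bool hW.indep.iIndep h1 h2 h12)
      (S := {p | p.2 = false}) (T := {p | p.2 = true})
      (Set.disjoint_left.2 fun p hp hp' => by simp_all)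
    refine indep_of_indep_of_le hind (iSup_le fun r => ?_) ?_
    · refine Measurable.comap_le ?_
      refine measurable_of_components fun j => ?_
      refine Measurable.mono (comap_measurable (fun ω => W r ω j)) ?_ le_rfl
      refine le_trans ?_ (le_iSup₂_of_le (j, false) rfl le_rfl)
      simpa using le_iSup (fun r : Iic s => MeasurableSpace.comap (fun ω => W r ω j)
        inferInstance) r
    · refine Measurable.comap_le ?_
      have e : (fun ω => ⟪u, W t ω - W s ω⟫) = fun ω => ∑ j, u j * (W t ω j - W s ω j) := by
        ext ω; simp [PiLp.inner_apply, mul_comm]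
      rw [e]
      refine Finset.measurable_fun_sum _ fun j _ => Measurable.const_mul ?_ _
      refine Measurable.mono (comap_measurable (fun ω => W t ω j - W s ω j)) ?_ le_rfl
      refine le_trans ?_ (le_iSup₂_of_le (j, true) rfl le_rfl)
      simp [hm2]

end IsStandardBrownian

end PortfolioES

namespace PortfolioES

variable {d : ℕ} {Ω : Type*} [mΩ : MeasurableSpace Ω]

/-! ### Square integrable functions on an interval -/

section SquareIntegrable

variable {T : ℝ} {E : Type*} [NormedAddCommGroup E] {u w b : ℝ → E}

omit mΩ in
lemma intervalIntegrable_norm_sq (h : MemLp u 2 (volume.restrict (Icc 0 T))) {s t : ℝ}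
    (hs : s ∈ Icc 0 T) (ht : t ∈ Icc 0 T) :
    IntervalIntegrable (fun r => ‖u r‖ ^ 2) volume s t := by
  have h1 : IntegrableOn (fun r => ‖u r‖ ^ 2) (Icc 0 T) := h.integrable_norm_pow (by norm_num)
  exact (h1.mono_set (uIcc_subset_Icc hs ht)).intervalIntegrable

omit mΩ in
lemma integral_norm_sub_sq_le (hT : 0 ≤ T) (hu : MemLp u 2 (volume.restrict (Icc 0 T)))
    (hw : MemLp w 2 (volume.restrict (Icc 0 T))) (hb : MemLp b 2 (volume.restrict (Icc 0 T))) :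
    ∫ s in (0 : ℝ)..T, ‖u s - w s‖ ^ 2 ≤
      2 * (∫ s in (0 : ℝ)..T, ‖u s - b s‖ ^ 2) + 2 * ∫ s in (0 : ℝ)..T, ‖w s - b s‖ ^ 2 := by
  have h0 : (0 : ℝ) ∈ Icc 0 T := ⟨le_rfl, hT⟩
  have hT' : T ∈ Icc 0 T := ⟨hT, le_rfl⟩
  have i1 := intervalIntegrable_norm_sq (hu.sub hb) h0 hT'
  have i2 := intervalIntegrable_norm_sq (hw.sub hb) h0 hT'
  have i3 := intervalIntegrable_norm_sq (hu.sub hw) h0 hT'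
  rw [← intervalIntegral.integral_const_mul, ← intervalIntegral.integral_const_mul,
    ← intervalIntegral.integral_add (by exact i1.const_mul 2) (by exact i2.const_mul 2)]
  refine intervalIntegral.integral_mono_on hT i3 ((i1.const_mul 2).add (i2.const_mul 2))
    fun s _ => ?_
  have h1 : ‖u s - w s‖ ≤ ‖u s - b s‖ + ‖w s - b s‖ := by
    calc ‖u s - w s‖ = ‖(u s - b s) - (w s - b s)‖ := by congr 1; abel
      _ ≤ _ := norm_sub_le _ _
  nlinarith [norm_nonneg (u s - w s), sq_nonneg (‖u s - b s‖ - ‖w s - b s‖)]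

end SquareIntegrable

/-! ### Uniform approximation of Itô integrals by elementary integrals -/

omit mΩ in
lemma gridSum_sub (B : ℝ≥0 → Ω → EuclideanSpace ℝ (Fin d)) (g : ℕ → ℝ≥0)
    (ξ ξ' : ℕ → Ω → EuclideanSpace ℝ (Fin d)) (k : ℕ) (ω : Ω) :
    gridSum B g ξ k ω - gridSum B g ξ' k ω = gridSum B g (fun i ω => ξ i ω - ξ' i ω) k ω := by
  simp_rw [gridSum, ← Finset.sum_sub_distrib, inner_sub_left]

section Approximation

variable {𝓕 : Filtration ℝ≥0 mΩ} {Q : Measure Ω} {T : ℝ≥0}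
  {B : ℝ≥0 → Ω → EuclideanSpace ℝ (Fin d)}

lemma SimpleIntegrand.isGridCoef (S : SimpleIntegrand 𝓕 d) {g : ℕ → ℝ≥0} (hg : Monotone g)
    (hgT : ∀ i, g i ≤ T) : IsGridCoef 𝓕 T g (fun i => S.cell (g i) (g (i + 1))) where
  mono := hg
  le := hgT
  measurable _ := S.measurable_cell _ _
  bounded _ := by
    obtain ⟨C, hC⟩ := S.exists_norm_cell_le
    exact ⟨C, hC _ _⟩

lemma IsGridCoef.sub {g : ℕ → ℝ≥0} {ξ ξ' : ℕ → Ω → EuclideanSpace ℝ (Fin d)}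
    (h : IsGridCoef 𝓕 T g ξ) (h' : IsGridCoef 𝓕 T g ξ') :
    IsGridCoef 𝓕 T g (fun i ω => ξ i ω - ξ' i ω) where
  mono := h.mono
  le := h.le
  measurable i := (h.measurable i).sub (h'.measurable i)
  bounded i := by
    obtain ⟨C, hC⟩ := h.bounded i
    obtain ⟨C', hC'⟩ := h'.bounded i
    exact ⟨C + C', fun ω => (norm_sub_le _ _).trans (add_le_add (hC ω) (hC' ω))⟩

lemma SimpleIntegrand.separated_of_times_subset (S : SimpleIntegrand 𝓕 d) {F : Finset ℝ≥0}
    (hF : S.times ⊆ F) {a b : ℝ≥0} (h : ∀ t ∈ F, ¬ (a < t ∧ t < b)) : S.Separated a b :=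
  fun i hi => h _ (hF (Finset.mem_image_of_mem _ (Finset.mem_range.2 (Nat.lt_succ_of_le hi))))

variable [IsProbabilityMeasure Q]

/-- On a grid containing F and all jump times, both elementary integrals are grid sums and the L²
distance of the integrands is the energy of the difference, so Lenglart's inequality applies. The
right side does not depend on F, which later gives uniformity over dense sets of times. -/
lemma measure_max_integral_sub_le (hB : IsFilteredBM 𝓕 Q T B) (S S' : SimpleIntegrand 𝓕 d)
    (F : Finset ℝ≥0) {ε K : ℝ} (hε : 0 < ε) (hK : 0 ≤ K) :
    Q {ω | ∃ t ∈ F, t ≤ T ∧ ε ≤ |S.integral B t ω - S'.integral B t ω|} ≤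
      Q {ω | K < ∫ s in (0 : ℝ)..T, ‖S.val s ω - S'.val s ω‖ ^ 2} + ENNReal.ofReal (K / ε ^ 2) := by
  classical
  obtain ⟨g, n, hg, hg0, hgT, hgn, hF, hsep⟩ := exists_grid (F ∪ (S.times ∪ S'.times)) T
  have hS : ∀ i, S.Separated (g i) (g (i + 1)) := fun i =>
    S.separated_of_times_subset (by intro t ht; simp [ht]) (hsep i)
  have hS' : ∀ i, S'.Separated (g i) (g (i + 1)) := fun i =>
    S'.separated_of_times_subset (by intro t ht; simp [ht]) (hsep i)
  have hc := (S.isGridCoef hg hgT).sub (S'.isGridCoef hg hgT)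
  have hE : ∀ ω, ∫ s in (0 : ℝ)..T, ‖S.val s ω - S'.val s ω‖ ^ 2 =
      gridEnergy g (fun i ω => S.cell (g i) (g (i + 1)) ω - S'.cell (g i) (g (i + 1)) ω) n ω := by
    intro ω
    have := integral_norm_sq_eq_gridEnergy hg (ω := ω) (n := n)
      (ξ := fun i ω => S.cell (g i) (g (i + 1)) ω - S'.cell (g i) (g (i + 1)) ω)
      (u := fun s => S.val s ω - S'.val s ω)
      (fun i _ s hs => by simp only [S.val_eq_cell (hS i) hs, S'.val_eq_cell (hS' i) hs])
    rw [hg0, hgn] at this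
    exact_mod_cast this
  simp_rw [hE]
  refine (measure_mono ?_).trans (hc.measure_max_le_add hB n hε hK)
  rintro ω ⟨t, ht, htT, hω⟩
  obtain ⟨k, hk, rfl⟩ := hF t (by simp [ht]) htT
  refine ⟨k, hk, ?_⟩
  rwa [← gridSum_sub, ← S.integral_eq_gridSum B hg hg0 hS, ← S'.integral_eq_gridSum B hg hg0 hS']

omit [IsProbabilityMeasure Q] in
lemma tendsto_measure_le_of_tendstoInMeasure {f : ℕ → Ω → ℝ} {h : Ω → ℝ}
    (hf : TendstoInMeasure Q f atTop h) {ε δ : ℝ} (hε : 0 < ε) (hδ : 0 < δ) :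
    ∀ᶠ n in atTop, Q {ω | ε ≤ |f n ω - h ω|} ≤ ENNReal.ofReal δ := by
  rw [tendstoInMeasure_iff_dist] at hf
  have := hf ε hε
  simp_rw [Real.dist_eq] at this
  exact this.eventually_le_const (by simpa using hδ)

/-- Elementary integrals approximating an Itô integral converge uniformly on finite sets of times,
in probability and at a rate that does not depend on the finite set. -/
lemma IsItoIntegral.eventually_measure_max_le (hB : IsFilteredBM 𝓕 Q T B)
    {b : ℝ → Ω → EuclideanSpace ℝ (Fin d)} {M : ℝ → Ω → ℝ}
    (h2 : ∀ᵐ ω ∂Q, MemLp (fun s => b s ω) 2 (volume.restrict (Icc 0 (T : ℝ))))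
    {S : ℕ → SimpleIntegrand 𝓕 d}
    (hS : TendstoInMeasure Q (fun n ω => ∫ s in (0 : ℝ)..T, ‖(S n).val s ω - b s ω‖ ^ 2) atTop
      (fun _ => (0 : ℝ)))
    (hM : ∀ t : ℝ≥0, t ≤ T → TendstoInMeasure Q (fun n => (S n).integral B t) atTop (M t))
    {ε : ℝ} (hε : 0 < ε) :
    ∀ᶠ n in atTop, ∀ F : Finset ℝ≥0, (∀ t ∈ F, t ≤ T) →
      Q {ω | ∃ t ∈ F, ε ≤ |(S n).integral B t ω - M t ω|} ≤ ENNReal.ofReal ε := by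
  -- With level ε/2, Lenglart's term δ/(ε/2)² is ε/4; the four error terms are then ε/8, ε/8, ε/4
  -- and ε/4.
  set δ : ℝ := ε ^ 3 / 16 with hδ
  have hδ0 : 0 < δ := by positivity
  have hA := tendsto_measure_le_of_tendstoInMeasure hS (show 0 < δ / 4 by positivity)
    (show 0 < ε / 8 by positivity)
  filter_upwards [hA] with n hn F hF
  -- The auxiliary index m may depend on F, because pointwise convergence at the finitely many times
  -- of F suffices for it; n is chosen before F, and the comparison of n with m is uniform in F.
  have hFm : ∀ᶠ m in atTop, ∀ t ∈ F, Q {ω | ε / 2 ≤ |(S m).integral B t ω - M t ω|} ≤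
      ENNReal.ofReal (ε / (4 * (F.card + 1))) := by
    rw [Filter.eventually_all_finset]
    exact fun t ht => tendsto_measure_le_of_tendstoInMeasure (hM t (hF t ht)) (by positivity)
      (by positivity)
  obtain ⟨m, hm, hmF⟩ := (hA.and hFm).exists
  have hsub : {ω | ∃ t ∈ F, ε ≤ |(S n).integral B t ω - M t ω|} ⊆
      {ω | ∃ t ∈ F, t ≤ T ∧ ε / 2 ≤ |(S n).integral B t ω - (S m).integral B t ω|} ∪
      ⋃ t ∈ F, {ω | ε / 2 ≤ |(S m).integral B t ω - M t ω|} := by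
    rintro ω ⟨t, ht, hω⟩
    by_cases hc : ε / 2 ≤ |(S m).integral B t ω - M t ω|
    · exact Or.inr (mem_biUnion ht hc)
    · refine Or.inl ⟨t, ht, hF t ht, ?_⟩
      have := abs_sub_le ((S n).integral B t ω) ((S m).integral B t ω) (M t ω)
      linarith
  have hE : Q {ω | δ < ∫ s in (0 : ℝ)..T, ‖(S n).val s ω - (S m).val s ω‖ ^ 2} ≤
      ENNReal.ofReal (ε / 8) + ENNReal.ofReal (ε / 8) := by
    refine le_trans (measure_mono_ae ?_) ((measure_union_le _ _).trans (add_le_add hn hm))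
    filter_upwards [h2] with ω hω hlt
    have hlt' : δ < ∫ s in (0 : ℝ)..T, ‖(S n).val s ω - (S m).val s ω‖ ^ 2 := hlt
    have := integral_norm_sub_sq_le T.coe_nonneg (((S n).memLp_val ω 2).restrict _)
      (((S m).memLp_val ω 2).restrict _) hω
    change _ ∨ _
    by_contra hc
    push Not at hc
    obtain ⟨h3, h4⟩ := hc
    simp only [Set.mem_ofPred_eq, not_le, sub_zero] at h3 h4
    have h5 := (le_abs_self _).trans_lt h3
    have h6 := (le_abs_self _).trans_lt h4
    linarith
  have hU : Q (⋃ t ∈ F, {ω | ε / 2 ≤ |(S m).integral B t ω - M t ω|}) ≤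
      ENNReal.ofReal (ε / 4) := by
    refine (measure_biUnion_finset_le _ _).trans ((Finset.sum_le_sum hmF).trans ?_)
    rw [Finset.sum_const, nsmul_eq_mul, ← ENNReal.ofReal_natCast, ← ENNReal.ofReal_mul (by positivity)]
    apply ENNReal.ofReal_le_ofReal
    rw [mul_div_assoc', div_le_div_iff₀ (by positivity) (by positivity)]
    nlinarith
  calc _ ≤ _ := measure_mono hsub
    _ ≤ _ := measure_union_le _ _
    _ ≤ ((ENNReal.ofReal (ε / 8) + ENNReal.ofReal (ε / 8)) + ENNReal.ofReal (δ / (ε / 2) ^ 2)) +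
        ENNReal.ofReal (ε / 4) := by
      gcongr
      refine (measure_max_integral_sub_le hB (S n) (S m) F (by positivity) hδ0.le).trans ?_
      gcongr
    _ = ENNReal.ofReal (ε / 8 + ε / 8 + δ / (ε / 2) ^ 2 + ε / 4) := by
      rw [ENNReal.ofReal_add, ENNReal.ofReal_add, ENNReal.ofReal_add] <;> positivity
    _ ≤ ENNReal.ofReal ε := by
      apply ENNReal.ofReal_le_ofReal
      rw [hδ]
      field_simp
      ring_nf
      linarith

/-- A nonnegative process that is uniformly close to elementary integrals started at `x`, whose
energies are tight, has expectation at most `x`. -/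
theorem lintegral_le_of_gridSum_approx (hB : IsFilteredBM 𝓕 Q T B) {x : ℝ}
    {L : ℝ≥0 → Ω → ℝ} (hL : ∀ᵐ ω ∂Q, ∀ t ≤ T, 0 ≤ L t ω) (hLT : AEMeasurable (L T) Q)
    (happ : ∀ ε > 0, ∃ K ≥ 0, ∀ δ > 0, ∃ (g : ℕ → ℝ≥0) (n : ℕ)
      (ξ : ℕ → Ω → EuclideanSpace ℝ (Fin d)), IsGridCoef 𝓕 T g ξ ∧ g n = T ∧
      Q {ω | ∃ k ≤ n, δ ≤ |x + gridSum B g ξ k ω - L (g k) ω|} ≤ ENNReal.ofReal δ ∧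
      Q {ω | K < gridEnergy g ξ n ω} ≤ ENNReal.ofReal ε) :
    ∫⁻ ω, ENNReal.ofReal (L T ω) ∂Q ≤ ENNReal.ofReal x := by
  have hLT0 : ∀ᵐ ω ∂Q, 0 ≤ L T ω := hL.mono fun ω h => h T le_rfl
  have hmin_int : ∀ c : ℝ, 0 ≤ c → Integrable (fun ω => min (L T ω) c) Q := by
    intro c hc
    refine Integrable.of_bound (C := c) (hLT.min aemeasurable_const).aestronglyMeasurable ?_
    filter_upwards [hLT0] with ω hω
    rw [Real.norm_eq_abs, abs_of_nonneg (le_min hω hc)]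
    exact min_le_right _ _
  -- Compare min(L_T, c) with Y, which is x plus the grid sum stopped before its energy exceeds K.
  -- Then E Y = x and E Y² ≤ x² + K. The loss is controlled on two small events: A, where the
  -- approximation fails, and E, where the stopping is active.
  have key : ∀ c : ℝ, 0 < c → ∫ ω, min (L T ω) c ∂Q ≤ x := by
    intro c hc
    refine le_of_forall_pos_le_add fun τ hτ => ?_
    obtain ⟨K, hK, hK'⟩ := happ (τ / (4 * c)) (by positivity)
    -- The parameter η makes η(x² + K) ≤ τ/4, and then δ is chosen so that δ + (1/(4η) + c)δ = τ/4;
    -- the event E costs another c · τ/(4c) = τ/4.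
    set η : ℝ := τ / (4 * (x ^ 2 + K + 1)) with hη
    have hK1 : 0 < x ^ 2 + K + 1 := by positivity
    have hη0 : 0 < η := by positivity
    set δ : ℝ := τ / (4 * (1 + 1 / (4 * η) + c)) with hδ
    have hδ0 : 0 < δ := by positivity
    obtain ⟨g, n, ξ, hξ, hgn, hA, hE⟩ := hK' δ hδ0
    have hξ' := hξ.trunc K
    set Y : Ω → ℝ := fun ω => x + gridSum B g (gridTrunc g K ξ) n ω with hY
    have hYm : MemLp Y 2 Q := (memLp_const x).add (hξ'.memLp_gridSum hB n)
    have hYi : Integrable Y Q := hYm.integrable (by norm_num)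
    have hSi : Integrable (gridSum B g (gridTrunc g K ξ) n) Q :=
      (hξ'.memLp_gridSum hB n).integrable (by norm_num)
    have hYint : ∫ ω, Y ω ∂Q = x := by
      rw [hY, integral_add (integrable_const x) hSi, hξ'.integral_gridSum hB]
      simp
    have hYsq : ∫ ω, Y ω ^ 2 ∂Q ≤ x ^ 2 + K := by
      have e : ∀ ω, Y ω ^ 2 = x ^ 2 + 2 * x * gridSum B g (gridTrunc g K ξ) n ω +
          gridSum B g (gridTrunc g K ξ) n ω ^ 2 := fun ω => by simp only [hY]; ring
      simp_rw [e]
      rw [integral_add (by exact (integrable_const _).add (hSi.const_mul _))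
        (hξ'.memLp_gridSum hB n).integrable_sq, integral_add (integrable_const _)
        (hSi.const_mul _), integral_const_mul, hξ'.integral_gridSum hB, hξ'.integral_gridSum_sq hB]
      have := hξ.integral_energy_trunc_le (Q := Q) hK n
      simpa using this
    set A := toMeasurable Q {ω | ∃ k ≤ n, δ ≤ |x + gridSum B g ξ k ω - L (g k) ω|} with hAdef
    have hAm : MeasurableSet A := measurableSet_toMeasurable _ _
    have hQA : Q.real A ≤ δ := by
      rw [Measure.real, hAdef, measure_toMeasurable]
      exact ENNReal.toReal_le_of_le_ofReal hδ0.le hA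
    set E := {ω | K < gridEnergy g ξ n ω} with hEdef
    have hEm : MeasurableSet E := measurableSet_lt measurable_const (hξ.measurable_energy' n)
    have hQE : Q.real E ≤ τ / (4 * c) := ENNReal.toReal_le_of_le_ofReal (by positivity) hE
    have hpt : ∀ᵐ ω ∂Q, min (L T ω) c ≤ Y ω + δ + A.indicator (fun ω => η * Y ω ^ 2) ω +
        A.indicator (fun _ => 1 / (4 * η) + c) ω + E.indicator (fun _ => c) ω := by
      filter_upwards [hL] with ω hω
      have hE0 : 0 ≤ E.indicator (fun _ => c) ω := Set.indicator_nonneg (fun _ _ => hc.le) ω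
      by_cases hωA : ω ∈ A
      · rw [Set.indicator_of_mem hωA, Set.indicator_of_mem hωA]
        -- On A nothing is known about Y pointwise, so its negative part is absorbed by the second
        -- moment through Young's inequality.
        have h1 : -Y ω ≤ η * Y ω ^ 2 + 1 / (4 * η) := by
          have : 0 ≤ η * (Y ω + 1 / (2 * η)) ^ 2 := by positivity
          have e : η * (Y ω + 1 / (2 * η)) ^ 2 = η * Y ω ^ 2 + Y ω + 1 / (4 * η) := by
            field_simp; ring
          linarith
        have := min_le_right (L T ω) c
        linarith
      · rw [Set.indicator_of_notMem hωA, Set.indicator_of_notMem hωA]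
        have hω' : ∀ k ≤ n, |x + gridSum B g ξ k ω - L (g k) ω| < δ := by
          intro k hk
          by_contra hcon
          exact hωA (subset_toMeasurable Q _ ⟨k, hk, not_lt.1 hcon⟩)
        -- Off A, the stopped sum equals x + gridSum at some k ≤ n, so Y > L(g k) - δ ≥ -δ. If the
        -- stopping is active this suffices, at the price of c on E; if not, k = n and Y > L_T - δ.
        by_cases hωE : ω ∈ E
        · rw [Set.indicator_of_mem hωE]
          obtain ⟨k, hk, ek⟩ := exists_gridSum_gridTrunc_eq B hξ.mono K n ω (ξ := ξ)
          have h1 := (abs_lt.1 (hω' k hk)).1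
          have h2 := hω (g k) (hξ.le k)
          have h3 : Y ω = x + gridSum B g ξ k ω := by simp only [hY, ek]
          have := min_le_right (L T ω) c
          linarith
        · have h3 : Y ω = x + gridSum B g ξ n ω := by
            simp only [hY, gridSum_gridTrunc_eq B hξ.mono (not_lt.1 hωE) le_rfl]
          have h1 := (abs_lt.1 (hω' n le_rfl)).1
          rw [hgn] at h1
          have := min_le_left (L T ω) c
          linarith
    have i1 : Integrable (fun ω => Y ω + δ) Q := hYi.add (integrable_const _)
    have i2 : Integrable (A.indicator fun ω => η * Y ω ^ 2) Q :=
      (hYm.integrable_sq.const_mul η).indicator hAm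
    have i3 : Integrable (A.indicator fun _ => 1 / (4 * η) + c) Q :=
      (integrable_const _).indicator hAm
    have i4 : Integrable (E.indicator fun _ => c) Q := (integrable_const _).indicator hEm
    have hle := integral_mono_ae (hmin_int c hc.le) (((i1.add i2).add i3).add i4) hpt
    have e1 : ∫ ω, (((fun ω => Y ω + δ) + A.indicator fun ω => η * Y ω ^ 2) +
        (A.indicator fun _ => 1 / (4 * η) + c) + E.indicator fun _ => c) ω ∂Q =
        x + δ + (∫ ω, A.indicator (fun ω => η * Y ω ^ 2) ω ∂Q) + (1 / (4 * η) + c) * Q.real A +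
          c * Q.real E := by
      rw [integral_add' ((i1.add i2).add i3) i4, integral_add' (i1.add i2) i3, integral_add' i1 i2,
        integral_add hYi (integrable_const _), hYint, integral_indicator_const _ hAm,
        integral_indicator_const _ hEm]
      simp [mul_comm]
    rw [e1] at hle
    have h5 : ∫ ω, A.indicator (fun ω => η * Y ω ^ 2) ω ∂Q ≤ η * (x ^ 2 + K) := by
      rw [integral_indicator hAm]
      refine (setIntegral_le_integral (hYm.integrable_sq.const_mul η)
        (ae_of_all _ fun ω => by positivity)).trans ?_
      rw [integral_const_mul]
      gcongr
    have h6 : (1 / (4 * η) + c) * Q.real A ≤ (1 / (4 * η) + c) * δ := by gcongr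
    have h7 : c * Q.real E ≤ τ / 4 := by
      calc c * Q.real E ≤ c * (τ / (4 * c)) := by gcongr
        _ = τ / 4 := by field_simp
    have h8 : η * (x ^ 2 + K) ≤ τ / 4 := by
      rw [hη, div_mul_eq_mul_div, div_le_div_iff₀ (by positivity) (by positivity)]
      nlinarith
    have h9 : δ + (1 / (4 * η) + c) * δ = τ / 4 := by
      rw [hδ]; field_simp; ring
    linarith
  have hmct : Tendsto (fun n : ℕ => ∫⁻ ω, ENNReal.ofReal (min (L T ω) (n + 1)) ∂Q) atTop
      (𝓝 (∫⁻ ω, ENNReal.ofReal (L T ω) ∂Q)) := by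
    refine lintegral_tendsto_of_tendsto_of_monotone
      (fun n => (hLT.min aemeasurable_const).ennreal_ofReal) (ae_of_all _ fun ω => ?_)
      (ae_of_all _ fun ω => ?_)
    · intro a b hab
      have : (a : ℝ) ≤ b := by exact_mod_cast hab
      simp only
      gcongr
    · refine tendsto_const_nhds.congr' ?_
      obtain ⟨N, hN⟩ := exists_nat_ge (L T ω)
      filter_upwards [eventually_ge_atTop N] with n hn
      have : (N : ℝ) ≤ n := by exact_mod_cast hn
      rw [min_eq_left (by linarith)]
  refine le_of_tendsto' hmct fun n => ?_
  rw [← ofReal_integral_eq_lintegral_ofReal (hmin_int _ (by positivity))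
    (hLT0.mono fun ω hω => le_min hω (by positivity))]
  exact ENNReal.ofReal_le_ofReal (key _ (by positivity))

end Approximation

end PortfolioES

namespace PortfolioES

variable {d : ℕ} {Ω : Type*} [mΩ : MeasurableSpace Ω]

/-! ### Sums and limits of independent Gaussian variables -/

namespace IndepGaussian

variable {Ω : Type*} {m m₂ : MeasurableSpace Ω} [mΩ : MeasurableSpace Ω] {Q : Measure Ω}
  [IsProbabilityMeasure Q] {V V₂ : Ω → ℝ} {v v₂ : ℝ≥0}

lemma integral_cexp (h : IndepGaussian m Q V v) (s : ℝ) :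
    ∫ ω, Complex.exp (s * V ω * Complex.I) ∂Q = Complex.exp (-(v * s ^ 2 / 2)) := by
  have := (iff_charFun h.measurable).1 h univ MeasurableSet.univ s
  simpa using this

/-- On an event of m the first exponential is m₂-measurable, hence independent of V₂, and
characteristic functions multiply. -/
lemma add (h : IndepGaussian m Q V v) (h₂ : IndepGaussian m₂ Q V₂ v₂) (hm : m ≤ m₂)
    (hm₂ : m₂ ≤ mΩ) (hV : Measurable[m₂] V) :
    IndepGaussian m Q (fun ω => V ω + V₂ ω) (v + v₂) := by
  rw [iff_charFun (show Measurable fun ω => V ω + V₂ ω from h.measurable.add h₂.measurable)]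
  intro A hA s
  have hA' : MeasurableSet A := hm₂ A (hm A hA)
  have hη : Measurable[m₂] (A.indicator fun ω => Complex.exp (s * V ω * Complex.I)) := by
    refine Measurable.indicator ?_ (hm A hA)
    fun_prop
  have hind : IndepFun (A.indicator fun ω => Complex.exp (s * V ω * Complex.I))
      (fun ω => Complex.exp (s * V₂ ω * Complex.I)) Q :=
    (h₂.indepFun hη).comp (φ := fun z : ℂ => z)
      (ψ := fun z : ℝ => Complex.exp (s * z * Complex.I)) measurable_id (by fun_prop)
  have e : (A.indicator fun ω => Complex.exp (s * ((V ω + V₂ ω : ℝ) : ℂ) * Complex.I)) = fun ω =>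
      A.indicator (fun ω => Complex.exp (s * V ω * Complex.I)) ω *
        Complex.exp (s * V₂ ω * Complex.I) := by
    ext ω
    by_cases hω : ω ∈ A
    · simp only [Set.indicator_of_mem hω, ← Complex.exp_add]
      congr 1; push_cast; ring
    · simp [Set.indicator_of_notMem hω]
  have hm2' := h₂.measurable
  rw [← integral_indicator hA', e, hind.integral_fun_mul_eq_mul_integral
    (hη.mono hm₂ le_rfl).aestronglyMeasurable (by fun_prop), integral_indicator hA',
    (iff_charFun h.measurable).1 h A hA, h₂.integral_cexp, mul_assoc, ← Complex.exp_add]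
  congr 2
  push_cast
  ring

/-- The characterization by characteristic functions restricted to events of m passes to almost sure
limits by dominated convergence. -/
lemma of_tendsto {V : ℕ → Ω → ℝ} {v : ℕ → ℝ≥0} {V' : Ω → ℝ} {v' : ℝ≥0}
    (h : ∀ k, IndepGaussian m Q (V k) (v k)) (hV' : Measurable V')
    (hlim : ∀ᵐ ω ∂Q, Tendsto (fun k => V k ω) atTop (𝓝 (V' ω)))
    (hv : Tendsto v atTop (𝓝 v')) : IndepGaussian m Q V' v' := by
  rw [iff_charFun hV']
  intro A hA s
  have h1 : Tendsto (fun k => ∫ ω in A, Complex.exp (s * V k ω * Complex.I) ∂Q) atTop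
      (𝓝 (∫ ω in A, Complex.exp (s * V' ω * Complex.I) ∂Q)) := by
    refine tendsto_integral_of_dominated_convergence (fun _ => 1) (fun k => ?_)
      (integrable_const _) (fun k => ae_of_all _ fun ω => ?_) ?_
    · have := (h k).measurable
      fun_prop
    · have : (s * V k ω * Complex.I : ℂ) = ((s * V k ω : ℝ) : ℂ) * Complex.I := by push_cast; ring
      rw [this, Complex.norm_exp_ofReal_mul_I]
    · filter_upwards [ae_restrict_of_ae hlim] with ω hω
      have hc : Continuous fun x : ℝ => Complex.exp (s * x * Complex.I) := by fun_prop
      exact (hc.tendsto _).comp hω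
  have h2 : Tendsto (fun k => (Q.real A : ℂ) * Complex.exp (-(v k * s ^ 2 / 2))) atTop
      (𝓝 ((Q.real A : ℂ) * Complex.exp (-(v' * s ^ 2 / 2)))) := by
    have hc : Continuous fun x : ℝ≥0 => (Q.real A : ℂ) * Complex.exp (-(x * s ^ 2 / 2)) := by
      fun_prop
    exact (hc.tendsto _).comp hv
  refine tendsto_nhds_unique h1 (h2.congr fun k => ?_)
  exact ((iff_charFun (h k).measurable).1 (h k) A hA s).symm

lemma congr_ae (h : IndepGaussian m Q V v) {V' : Ω → ℝ} (hV' : Measurable V')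
    (he : V =ᵐ[Q] V') : IndepGaussian m Q V' v :=
  of_tendsto (V := fun _ => V) (v := fun _ => v) (fun _ => h) hV'
    (he.mono fun ω hω => by rw [hω]; exact tendsto_const_nhds) tendsto_const_nhds

end IndepGaussian

/-- Elementary integrals of deterministic coefficients are Gaussian and independent of the past. -/
lemma IsFilteredBM.indepGaussian_gridSum {𝓕 : Filtration ℝ≥0 mΩ} {Q : Measure Ω}
    [IsProbabilityMeasure Q] {T : ℝ≥0} {B : ℝ≥0 → Ω → EuclideanSpace ℝ (Fin d)}
    (hB : IsFilteredBM 𝓕 Q T B) {g : ℕ → ℝ≥0} (hg : Monotone g) (hgT : ∀ i, g i ≤ T)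
    (η : ℕ → EuclideanSpace ℝ (Fin d)) (k : ℕ) :
    IndepGaussian (𝓕 (g 0)) Q (gridSum B g (fun i _ => η i) k)
      (∑ i ∈ Finset.range k, ‖η i‖₊ ^ 2 * (g (i + 1) - g i)) := by
  have hm : ∀ k, Measurable[𝓕 (g k)] (gridSum B g (fun i _ => η i) k) := fun k =>
    IsMartDiff.measurable_sum (IsGridCoef.isMartDiff (ξ := fun i _ => η i)
      ⟨hg, hgT, fun _ => measurable_const, fun i => ⟨‖η i‖, fun _ => le_rfl⟩⟩ hB) k
  induction k with
  | zero =>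
    rw [IndepGaussian.iff_charFun ((hm 0).mono (𝓕.le _) le_rfl)]
    intro A _ s
    simp [gridSum]
  | succ k ih =>
    have := ih.add (hB.increment _ _ (hg (Nat.le_succ k)) (hgT _) (η k)) (𝓕.mono (hg (Nat.zero_le k)))
      (𝓕.le _) (hm k)
    rw [Finset.sum_range_succ]
    convert this using 1
    ext ω
    rw [gridSum, Finset.sum_range_succ]
    rfl

/-! ### Step functions on uniform grids -/

/-- The points `i T / N`, `i ≤ N`, of the uniform grid. -/
noncomputable def uGrid (T : ℝ≥0) (N i : ℕ) : ℝ≥0 := (min i N : ℕ) * (T / N)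

lemma uGrid_mono (T : ℝ≥0) (N : ℕ) : Monotone (uGrid T N) := fun i j hij => by
  unfold uGrid; gcongr

lemma uGrid_zero (T : ℝ≥0) (N : ℕ) : uGrid T N 0 = 0 := by simp [uGrid]

lemma uGrid_self (T : ℝ≥0) {N : ℕ} (hN : 0 < N) : uGrid T N N = T := by
  have : (N : ℝ≥0) ≠ 0 := by positivity
  rw [uGrid, min_self]; field_simp

lemma uGrid_of_le (T : ℝ≥0) {N : ℕ} (hN : 0 < N) {i : ℕ} (h : N ≤ i) : uGrid T N i = T := by
  rw [uGrid, min_eq_right h]; field_simp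

lemma uGrid_le (T : ℝ≥0) {N : ℕ} (hN : 0 < N) (i : ℕ) : uGrid T N i ≤ T := by
  rcases le_total i N with h | h
  · exact (uGrid_mono T N h).trans_eq (uGrid_self T hN)
  · exact (uGrid_of_le T hN h).le

lemma uGrid_succ_sub_le (T : ℝ≥0) (N i : ℕ) :
    (uGrid T N (i + 1) : ℝ) - uGrid T N i ≤ T / N := by
  have h : ((min (i + 1) N : ℕ) : ℝ) - (min i N : ℕ) ≤ 1 := by
    have : min (i + 1) N ≤ min i N + 1 := by omega
    have : ((min (i + 1) N : ℕ) : ℝ) ≤ (min i N : ℕ) + 1 := by exact_mod_cast this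
    linarith
  have h0 : (0 : ℝ) ≤ T / N := by positivity
  simp only [uGrid, NNReal.coe_mul, NNReal.coe_natCast, NNReal.coe_div]
  rw [← sub_mul]
  nlinarith

/-- The step function with value `η i` on the `i`-th cell of the uniform grid. -/
noncomputable def stepFun {E : Type*} [AddCommMonoid E] (T : ℝ≥0) (N : ℕ) (η : ℕ → E) (s : ℝ) : E :=
  ∑ i ∈ Finset.range N, (Ioc (uGrid T N i : ℝ) (uGrid T N (i + 1))).indicator (fun _ => η i) s

lemma stepFun_eq {E : Type*} [AddCommMonoid E] {T : ℝ≥0} {N : ℕ} {η : ℕ → E} {i : ℕ} (hi : i < N)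
    {s : ℝ} (hs : s ∈ Ioc (uGrid T N i : ℝ) (uGrid T N (i + 1))) : stepFun T N η s = η i := by
  rw [stepFun, Finset.sum_eq_single i]
  · rw [Set.indicator_of_mem hs]
  · intro j _ hj
    rw [Set.indicator_of_notMem]
    rintro ⟨h1, h2⟩
    rcases lt_or_gt_of_ne hj with h | h
    · have : (uGrid T N (j + 1) : ℝ) ≤ uGrid T N i := by
        exact_mod_cast uGrid_mono T N (show j + 1 ≤ i from h)
      linarith [hs.1]
    · have : (uGrid T N (i + 1) : ℝ) ≤ uGrid T N j := by
        exact_mod_cast uGrid_mono T N (show i + 1 ≤ j from h)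
      linarith [hs.2]
  · intro h; exact absurd (Finset.mem_range.2 hi) h

lemma exists_mem_uGrid_cell {T : ℝ≥0} {N : ℕ} (hN : 0 < N) {s : ℝ} (hs : s ∈ Ioc (0 : ℝ) T) :
    ∃ i < N, s ∈ Ioc (uGrid T N i : ℝ) (uGrid T N (i + 1)) := by
  classical
  have hex : ∃ j, s ≤ uGrid T N j := ⟨N, by rw [uGrid_self T hN]; exact hs.2⟩
  set j := Nat.find hex with hj
  have hj1 : s ≤ uGrid T N j := Nat.find_spec hex
  have hj0 : j ≠ 0 := by
    intro h0
    rw [h0, uGrid_zero] at hj1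
    exact absurd hs.1 (not_lt.2 (by simpa using hj1))
  have hjN : j ≤ N := Nat.find_min' hex (by rw [uGrid_self T hN]; exact hs.2)
  refine ⟨j - 1, by omega, ?_, ?_⟩
  · exact not_le.1 (Nat.find_min hex (show j - 1 < j by omega))
  · rwa [Nat.sub_add_cancel (by omega)]

section StepFun

variable {E : Type*} [NormedAddCommGroup E]

lemma memLp_stepFun (T : ℝ≥0) (N : ℕ) (η : ℕ → E) (p : ℝ≥0∞) :
    MemLp (stepFun T N η) p volume :=
  memLp_finsetSum _ fun _ _ => memLp_indicator_const p measurableSet_Ioc _ (Or.inr (by simp))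

/-- Continuous functions of compact support are dense in L². Such a function is sampled at the left
endpoints of a uniform grid, and its boundedness controls the energy of a single cell. -/
lemma exists_stepFun_approx [NormedSpace ℝ E] {T : ℝ≥0} {y : ℝ → E}
    (hy : MemLp y 2 (volume.restrict (Icc 0 (T : ℝ)))) {ε : ℝ} (hε : 0 < ε) :
    ∃ (N : ℕ) (η : ℕ → E), 0 < N ∧ ∫ s in (0 : ℝ)..T, ‖stepFun T N η s - y s‖ ^ 2 ≤ ε ∧
      (∀ i, ‖η i‖ ^ 2 * (T / N) ≤ ε) ∧ (T : ℝ) / N ≤ ε := by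
  obtain ⟨f, hfc, hf, hfcont, hfL⟩ := MemLp.exists_hasCompactSupport_integral_rpow_sub_le
    (p := 2) (by norm_num) (by simpa using hy) (show 0 < ε / 4 by positivity)
  simp only [Real.rpow_two] at hf
  obtain ⟨C, hC⟩ := hfcont.bounded_above_of_compact_support hfc
  have hunif := hfc.uniformContinuous_of_continuous hfcont
  rw [Metric.uniformContinuous_iff] at hunif
  -- The square of ε' times T is at most ε/4; with the L² error ε/4 of f and the factors 2 of the
  -- triangle inequality for squares, the total is ε.
  set ε' : ℝ := Real.sqrt (ε / (4 * (T + 1))) with hε'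
  have hε'0 : 0 < ε' := Real.sqrt_pos.2 (by positivity)
  obtain ⟨δ, hδ, hfδ⟩ := hunif ε' hε'0
  have hlim : Tendsto (fun N : ℕ => (T : ℝ) / N) atTop (𝓝 0) :=
    tendsto_const_div_atTop_nhds_zero_nat (T : ℝ)
  have hsmall : ∀ᶠ N : ℕ in atTop, (T : ℝ) / N < min δ (min ε (ε / (C ^ 2 + 1))) :=
    hlim.eventually_lt_const (by positivity)
  obtain ⟨N, hN, hN0⟩ := (hsmall.and (eventually_gt_atTop 0)).exists
  rw [lt_min_iff, lt_min_iff] at hN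
  refine ⟨N, fun i => f (uGrid T N i), hN0, ?_, fun i => ?_, hN.2.1.le⟩
  · have hfL' : MemLp f 2 (volume.restrict (Icc 0 (T : ℝ))) := by simpa using hfL
    have hle := integral_norm_sub_sq_le T.coe_nonneg
      ((memLp_stepFun T N (fun i => f (uGrid T N i)) 2).restrict _) hy hfL'
    have h1 : ∫ s in (0 : ℝ)..T, ‖y s - f s‖ ^ 2 ≤ ε / 4 := by
      rwa [intervalIntegral.integral_of_le T.coe_nonneg, ← integral_Icc_eq_integral_Ioc]
    have h2 : ∫ s in (0 : ℝ)..T, ‖stepFun T N (fun i => f (uGrid T N i)) s - f s‖ ^ 2 ≤ ε / 4 := by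
      have hb : ∀ s ∈ Ioc (0 : ℝ) T, ‖stepFun T N (fun i => f (uGrid T N i)) s - f s‖ ^ 2 ≤
          ε / (4 * (T + 1)) := by
        intro s hs
        obtain ⟨i, hi, hsi⟩ := exists_mem_uGrid_cell hN0 hs
        rw [stepFun_eq hi hsi, ← dist_eq_norm]
        have hd : dist (uGrid T N i : ℝ) s < δ := by
          rw [Real.dist_eq, abs_sub_comm, abs_of_nonneg (sub_nonneg.2 hsi.1.le)]
          have := uGrid_succ_sub_le T N i
          linarith [hsi.2, hN.1]
        calc dist (f (uGrid T N i)) (f s) ^ 2 ≤ ε' ^ 2 := by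
              gcongr; exact (hfδ hd).le
          _ = ε / (4 * (T + 1)) := Real.sq_sqrt (by positivity)
      calc _ ≤ ∫ _ in (0 : ℝ)..T, ε / (4 * (T + 1)) := by
            refine intervalIntegral.integral_mono_on_of_le_Ioo T.coe_nonneg ?_
              intervalIntegrable_const fun s hs => hb s ⟨hs.1, hs.2.le⟩
            exact intervalIntegrable_norm_sq
              (((memLp_stepFun T N (fun i => f (uGrid T N i)) 2).restrict _).sub hfL')
              ⟨le_rfl, T.coe_nonneg⟩ ⟨T.coe_nonneg, le_rfl⟩
        _ ≤ ε / 4 := by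
            rw [intervalIntegral.integral_const, smul_eq_mul, sub_zero, mul_div_assoc',
              div_le_div_iff₀ (by positivity) (by positivity)]
            nlinarith [T.coe_nonneg]
    linarith
  · have h1 : ‖f (uGrid T N i)‖ ^ 2 ≤ C ^ 2 := pow_le_pow_left₀ (norm_nonneg _) (hC _) 2
    have h2 : (T : ℝ) / N * (C ^ 2 + 1) ≤ ε := by
      rw [← le_div_iff₀ (by positivity)]; exact hN.2.2.le
    have h3 : (0 : ℝ) ≤ T / N := by positivity
    nlinarith

end StepFun

/-- Deterministic step functions approximating `y` in `L²(0, T)` geometrically fast, on uniform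
grids whose mesh and largest cell energy vanish equally fast. -/
structure IsStepApprox (T : ℝ≥0) (y : ℝ → EuclideanSpace ℝ (Fin d)) (N : ℕ → ℕ)
    (η : ℕ → ℕ → EuclideanSpace ℝ (Fin d)) : Prop where
  pos : ∀ k, 0 < N k
  approx : ∀ k, ∫ s in (0 : ℝ)..T, ‖stepFun T (N k) (η k) s - y s‖ ^ 2 ≤ (1 / 16) ^ k
  cell : ∀ k i, ‖η k i‖ ^ 2 * (T / N k) ≤ (1 / 16) ^ k
  mesh : ∀ k, (T : ℝ) / N k ≤ (1 / 16) ^ k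

lemma exists_isStepApprox {T : ℝ≥0} {y : ℝ → EuclideanSpace ℝ (Fin d)}
    (hy : MemLp y 2 (volume.restrict (Icc 0 (T : ℝ)))) : ∃ N η, IsStepApprox T y N η := by
  have := fun k : ℕ => exists_stepFun_approx hy (show (0 : ℝ) < (1 / 16) ^ k by positivity)
  choose N η h using this
  exact ⟨N, η, fun k => (h k).1, fun k => (h k).2.1, fun k => (h k).2.2.1, fun k => (h k).2.2.2⟩

/-- A simple integrand on the uniform grid. -/
noncomputable def uSimple {𝓕 : Filtration ℝ≥0 mΩ} (T : ℝ≥0) (N : ℕ)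
    (ξ : ℕ → Ω → EuclideanSpace ℝ (Fin d)) (hξ : ∀ i, Measurable[𝓕 (uGrid T N i)] (ξ i))
    (hb : ∃ C : ℝ, ∀ i ω, ‖ξ i ω‖ ≤ C) : SimpleIntegrand 𝓕 d where
  n := N
  time := uGrid T N
  mono := uGrid_mono T N
  coef := ξ
  measurable := hξ
  bounded := hb

/-- The elementary integral of a deterministic step function. -/
noncomputable def stepInt (B : ℝ≥0 → Ω → EuclideanSpace ℝ (Fin d)) (T : ℝ≥0) (N : ℕ)
    (η : ℕ → EuclideanSpace ℝ (Fin d)) (t : ℝ≥0) (ω : Ω) : ℝ :=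
  ∑ i ∈ Finset.range N, ⟪η i, B (min (uGrid T N (i + 1)) t) ω - B (min (uGrid T N i) t) ω⟫

/-- A deterministic step function as a simple integrand. -/
noncomputable def detSimple (𝓕 : Filtration ℝ≥0 mΩ) (T : ℝ≥0) (N : ℕ)
    (η : ℕ → EuclideanSpace ℝ (Fin d)) : SimpleIntegrand 𝓕 d :=
  uSimple T N (fun i _ => if i < N then η i else 0) (fun _ => measurable_const) (by
    refine ⟨∑ i ∈ Finset.range N, ‖η i‖, fun i _ => ?_⟩
    split_ifs with h
    · exact Finset.single_le_sum (f := fun i => ‖η i‖) (fun _ _ => norm_nonneg _)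
        (Finset.mem_range.2 h)
    · simpa using Finset.sum_nonneg fun _ _ => norm_nonneg _)

lemma detSimple_integral (𝓕 : Filtration ℝ≥0 mΩ) (B : ℝ≥0 → Ω → EuclideanSpace ℝ (Fin d))
    (T : ℝ≥0) (N : ℕ) (η : ℕ → EuclideanSpace ℝ (Fin d)) (t : ℝ≥0) (ω : Ω) :
    (detSimple 𝓕 T N η).integral B t ω = stepInt B T N η t ω :=
  Finset.sum_congr rfl fun i hi => by
    simp only [detSimple, uSimple, if_pos (Finset.mem_range.1 hi)]

lemma detSimple_val (𝓕 : Filtration ℝ≥0 mΩ) (T : ℝ≥0) (N : ℕ)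
    (η : ℕ → EuclideanSpace ℝ (Fin d)) (s : ℝ) (ω : Ω) :
    (detSimple 𝓕 T N η).val s ω = stepFun T N η s :=
  Finset.sum_congr rfl fun i hi => by
    simp only [detSimple, uSimple, if_pos (Finset.mem_range.1 hi)]

omit mΩ in
-- Clamping the grid to [s, t] leaves the increments after s untouched and kills those before. The
-- increment of the step integral becomes a grid sum starting at time s, hence Gaussian and
-- independent of the past of s.
lemma stepInt_sub (B : ℝ≥0 → Ω → EuclideanSpace ℝ (Fin d)) (T : ℝ≥0) (N : ℕ)
    (η : ℕ → EuclideanSpace ℝ (Fin d)) {s t : ℝ≥0} (hst : s ≤ t) (ω : Ω) :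
    stepInt B T N η t ω - stepInt B T N η s ω =
      gridSum B (fun i => max s (min (uGrid T N i) t)) (fun i _ => η i) N ω := by
  rw [stepInt, stepInt, gridSum, ← Finset.sum_sub_distrib]
  refine Finset.sum_congr rfl fun i _ => ?_
  rw [← inner_sub_right]
  congr 1
  have key : ∀ a : ℝ≥0, B (min a t) ω - B (min a s) ω = B (max s (min a t)) ω - B s ω := by
    intro a
    rcases le_total a s with h | h
    · rw [min_eq_left (h.trans hst), min_eq_left h, max_eq_left h, sub_self, sub_self]
    · rw [min_eq_right h, max_eq_right (le_min h hst)]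
  have h1 := key (uGrid T N (i + 1))
  have h2 := key (uGrid T N i)
  calc _ = (B (min (uGrid T N (i + 1)) t) ω - B (min (uGrid T N (i + 1)) s) ω) -
        (B (min (uGrid T N i) t) ω - B (min (uGrid T N i) s) ω) := by abel
    _ = _ := by rw [h1, h2]; abel

end PortfolioES

namespace PortfolioES

variable {d : ℕ} {Ω : Type*} [mΩ : MeasurableSpace Ω]

/-! ### The Wiener integral with continuous paths -/

/-- `I` is a version with continuous paths of the integral `∫₀ᵗ y_s' dB_s` of a deterministic `y`. -/
structure IsWienerIntegral (𝓕 : Filtration ℝ≥0 mΩ) (P : Measure Ω)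
    (B : ℝ≥0 → Ω → EuclideanSpace ℝ (Fin d)) (T : ℝ≥0) (y : ℝ → EuclideanSpace ℝ (Fin d))
    (I : ℝ → Ω → ℝ) : Prop where
  continuous : ∀ ω, Continuous fun t => I t ω
  adapted : ∀ t : ℝ≥0, t ≤ T → Measurable[𝓕 t] (I t)
  approx : ∃ N η, IsStepApprox T y N η ∧ ∀ᵐ ω ∂P,
    TendstoUniformlyOn (fun k (t : ℝ≥0) => stepInt B T (N k) (η k) t ω) (fun t => I t ω) atTop
      (Iic T)

section Existence

omit mΩ in
lemma continuous_stepInt {B : ℝ≥0 → Ω → EuclideanSpace ℝ (Fin d)} {ω : Ω}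
    (h : Continuous fun t => B t ω) (T : ℝ≥0) (N : ℕ) (η : ℕ → EuclideanSpace ℝ (Fin d)) :
    Continuous fun t => stepInt B T N η t ω := by
  unfold stepInt
  have h1 : ∀ c : ℝ≥0, Continuous fun t => B (min c t) ω := fun c =>
    h.comp (continuous_const.min continuous_id)
  exact continuous_finsetSum _ fun i _ => continuous_const.inner ((h1 _).sub (h1 _))

lemma exists_tendstoUniformly_of_dist_le_geometric {α : Type*} {f : ℕ → α → ℝ} {k₀ : ℕ}
    (h : ∀ k ≥ k₀, ∀ t, dist (f k t) (f (k + 1) t) ≤ (1 / 2) ^ k) :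
    (∀ t, ∃ l, Tendsto (fun k => f k t) atTop (𝓝 l)) ∧
      ∀ F : α → ℝ, (∀ t, Tendsto (fun k => f k t) atTop (𝓝 (F t))) →
        TendstoUniformly f F atTop := by
  have hc : ∀ t n, dist (f (n + k₀) t) (f (n + 1 + k₀) t) ≤ 1 * (1 / 2) ^ n := by
    intro t n
    have := h (n + k₀) (by omega) t
    rw [show n + 1 + k₀ = n + k₀ + 1 by ring]
    refine this.trans ?_
    rw [one_mul, pow_add]
    exact mul_le_of_le_one_right (by positivity) (pow_le_one₀ (by norm_num) (by norm_num))
  constructor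
  · intro t
    obtain ⟨l, hl⟩ := cauchySeq_tendsto_of_complete
      (cauchySeq_of_le_geometric (1 / 2) 1 (by norm_num) (hc t))
    exact ⟨l, (tendsto_add_atTop_iff_nat k₀).1 hl⟩
  · intro F hF
    rw [Metric.tendstoUniformly_iff]
    intro ε hε
    have hlim : Tendsto (fun n : ℕ => 1 * (1 / 2 : ℝ) ^ n / (1 - 1 / 2)) atTop (𝓝 0) := by
      have := (tendsto_pow_atTop_nhds_zero_of_lt_one (r := (1 / 2 : ℝ)) (by norm_num)
        (by norm_num)).const_mul (1 : ℝ)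
      simpa using this.div_const (1 - 1 / 2)
    obtain ⟨n₀, hn₀⟩ := eventually_atTop.1 (hlim.eventually_lt_const hε)
    filter_upwards [eventually_ge_atTop (n₀ + k₀)] with k hk t
    obtain ⟨n, rfl⟩ : ∃ n, k = n + k₀ := ⟨k - k₀, by omega⟩
    rw [dist_comm]
    exact (dist_le_of_le_geometric_of_tendsto (1 / 2) 1 (by norm_num) (hc t)
      ((tendsto_add_atTop_iff_nat k₀).2 (hF t)) n).trans_lt (hn₀ n (by omega))

variable {𝓕 : Filtration ℝ≥0 mΩ} {P : Measure Ω} [IsProbabilityMeasure P] {T : ℝ≥0}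
  {B : ℝ≥0 → Ω → EuclideanSpace ℝ (Fin d)} {y : ℝ → EuclideanSpace ℝ (Fin d)}

/-- Lenglart's inequality bounds the probability of a large jump from one approximation to the next,
uniformly over finite sets of times. Increasing these sets to a countable dense set and applying
Borel–Cantelli gives the estimate at dense times; path continuity extends it to all times. -/
lemma ae_eventually_stepInt_dist_le (hB : IsFilteredBM 𝓕 P T B)
    (hcont : ∀ᵐ ω ∂P, Continuous fun t => B t ω)
    (hy : MemLp y 2 (volume.restrict (Icc 0 (T : ℝ)))) {N : ℕ → ℕ}
    {η : ℕ → ℕ → EuclideanSpace ℝ (Fin d)} (h : IsStepApprox T y N η) :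
    ∀ᵐ ω ∂P, ∃ k₀, ∀ k ≥ k₀, ∀ t : ℝ≥0, dist (stepInt B T (N k) (η k) (min t T) ω)
      (stepInt B T (N (k + 1)) (η (k + 1)) (min t T) ω) ≤ (1 / 2) ^ k := by
  classical
  set F : ℕ → Finset ℝ≥0 := fun m =>
    (Finset.range m).image fun i => min (TopologicalSpace.denseSeq ℝ≥0 i) T with hF
  set A : ℕ → ℕ → Set Ω := fun k m => {ω | ∃ t ∈ F m, t ≤ T ∧ (1 / 2) ^ k ≤
    |stepInt B T (N k) (η k) t ω - stepInt B T (N (k + 1)) (η (k + 1)) t ω|} with hA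
  have hAm : ∀ k, Monotone (A k) := by
    rintro k a b hab ω ⟨t, ht, h1, h2⟩
    exact ⟨t, Finset.image_subset_image (Finset.range_subset_range.2 hab) ht, h1, h2⟩
  have hbound : ∀ k, P (⋃ m, A k m) ≤ ENNReal.ofReal (4 * (1 / 4) ^ k) := by
    intro k
    rw [(hAm k).measure_iUnion]
    refine iSup_le fun m => ?_
    -- Consecutive step functions are at squared distance at most 4·16^{-k}; against the level
    -- 2^{-k} this gives probability at most 4·4^{-k}, which is summable. This is the reason for the
    -- rate 1/16 in `IsStepApprox`.
    have h1 := measure_max_integral_sub_le hB (detSimple 𝓕 T (N k) (η k))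
      (detSimple 𝓕 T (N (k + 1)) (η (k + 1))) (F m) (ε := (1 / 2) ^ k) (K := 4 * (1 / 16) ^ k)
      (by positivity) (by positivity)
    simp_rw [detSimple_integral, detSimple_val] at h1
    have h2 : ∫ s in (0 : ℝ)..T, ‖stepFun T (N k) (η k) s -
        stepFun T (N (k + 1)) (η (k + 1)) s‖ ^ 2 ≤ 4 * (1 / 16) ^ k := by
      have h3 := integral_norm_sub_sq_le T.coe_nonneg ((memLp_stepFun T (N k) (η k) 2).restrict _)
        ((memLp_stepFun T (N (k + 1)) (η (k + 1)) 2).restrict _) hy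
      have h4 := h.approx k
      have h5 := h.approx (k + 1)
      have h6 : (1 / 16 : ℝ) ^ (k + 1) ≤ (1 / 16) ^ k :=
        pow_le_pow_of_le_one (by norm_num) (by norm_num) (Nat.le_succ k)
      linarith
    refine h1.trans ?_
    have h7 : {ω : Ω | 4 * (1 / 16 : ℝ) ^ k < ∫ s in (0 : ℝ)..T, ‖stepFun T (N k) (η k) s -
        stepFun T (N (k + 1)) (η (k + 1)) s‖ ^ 2} = ∅ := by
      ext ω; simp only [Set.mem_ofPred_eq, mem_empty_iff_false, iff_false, not_lt]; exact h2
    rw [h7, measure_empty, zero_add]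
    apply ENNReal.ofReal_le_ofReal
    rw [← pow_mul, mul_comm k 2, pow_mul, mul_div_assoc, ← div_pow]
    norm_num
  have hsum : ∑' k, P (⋃ m, A k m) ≠ ∞ := by
    refine ne_top_of_le_ne_top ?_ (ENNReal.tsum_le_tsum hbound)
    exact ((summable_geometric_of_lt_one (by norm_num) (by norm_num)).mul_left 4).tsum_ofReal_ne_top
  filter_upwards [ae_eventually_notMem hsum, hcont] with ω hω hc
  obtain ⟨k₀, hk₀⟩ := eventually_atTop.1 hω
  refine ⟨k₀, fun k hk => ?_⟩
  have hcl : IsClosed {t : ℝ≥0 | dist (stepInt B T (N k) (η k) (min t T) ω)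
      (stepInt B T (N (k + 1)) (η (k + 1)) (min t T) ω) ≤ (1 / 2) ^ k} := by
    refine isClosed_le (Continuous.dist ?_ ?_) continuous_const
    · exact (continuous_stepInt hc T _ _).comp (continuous_id.min continuous_const)
    · exact (continuous_stepInt hc T _ _).comp (continuous_id.min continuous_const)
  have hsub : Set.range (TopologicalSpace.denseSeq ℝ≥0) ⊆
      {t : ℝ≥0 | dist (stepInt B T (N k) (η k) (min t T) ω)
      (stepInt B T (N (k + 1)) (η (k + 1)) (min t T) ω) ≤ (1 / 2) ^ k} := by
    rintro _ ⟨i, rfl⟩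
    by_contra hcon
    simp only [Set.mem_ofPred_eq, not_le] at hcon
    refine hk₀ k hk (mem_iUnion.2 ⟨i + 1, min (TopologicalSpace.denseSeq ℝ≥0 i) T, ?_,
      min_le_right _ _, ?_⟩)
    · exact Finset.mem_image_of_mem _ (Finset.mem_range.2 (Nat.lt_succ_self i))
    · rw [← Real.dist_eq]; exact hcon.le
  have := hcl.closure_subset_iff.2 hsub
  rw [(TopologicalSpace.denseRange_denseSeq ℝ≥0).closure_range] at this
  exact fun t => this (mem_univ t)

/-- The paths where uniform convergence or continuity of B fails lie in a null set, which belongs to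
𝓕 0 by augmentation. Setting the approximations to zero there keeps them adapted and makes every
path of the limit continuous. -/
theorem exists_isWienerIntegral (hB : IsFilteredBM 𝓕 P T B)
    (hcont : ∀ᵐ ω ∂P, Continuous fun t => B t ω)
    (hnull : ∀ N, MeasurableSet N → P N = 0 → MeasurableSet[𝓕 0] N)
    (hy : MemLp y 2 (volume.restrict (Icc 0 (T : ℝ)))) :
    ∃ I, IsWienerIntegral 𝓕 P B T y I := by
  obtain ⟨N, η, h⟩ := exists_isStepApprox hy
  have hgood := (ae_eventually_stepInt_dist_le hB hcont hy h).and hcont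
  set bad := toMeasurable P {ω | ¬ ((∃ k₀, ∀ k ≥ k₀, ∀ t : ℝ≥0,
    dist (stepInt B T (N k) (η k) (min t T) ω)
      (stepInt B T (N (k + 1)) (η (k + 1)) (min t T) ω) ≤ (1 / 2) ^ k) ∧
      Continuous fun t => B t ω)} with hbad
  have hbad0 : P bad = 0 := by rw [hbad, measure_toMeasurable]; exact hgood
  have hbadF : MeasurableSet[𝓕 0] bad := hnull bad (measurableSet_toMeasurable _ _) hbad0
  have hnb : ∀ ω, ω ∉ bad → (∃ k₀, ∀ k ≥ k₀, ∀ t : ℝ≥0,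
    dist (stepInt B T (N k) (η k) (min t T) ω)
      (stepInt B T (N (k + 1)) (η (k + 1)) (min t T) ω) ≤ (1 / 2) ^ k) ∧
      Continuous fun t => B t ω := by
    intro ω hω
    by_contra hcon
    exact hω (subset_toMeasurable P _ hcon)
  set f : ℕ → ℝ≥0 → Ω → ℝ := fun k t ω =>
    badᶜ.indicator (fun ω => stepInt B T (N k) (η k) (min t T) ω) ω with hf
  have hlim : ∀ ω t, ∃ l, Tendsto (fun k => f k t ω) atTop (𝓝 l) := by
    intro ω t
    by_cases hω : ω ∈ bad
    · exact ⟨0, by simp [hf, hω]⟩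
    · obtain ⟨⟨k₀, hk₀⟩, -⟩ := hnb ω hω
      obtain ⟨l, hl⟩ := (exists_tendstoUniformly_of_dist_le_geometric hk₀).1 t
      exact ⟨l, by simpa [hf, hω] using hl⟩
  choose I hI using hlim
  have hunif : ∀ ω, TendstoUniformly (fun k t => f k t ω) (I ω) atTop := by
    intro ω
    by_cases hω : ω ∈ bad
    · have : ∀ k t, f k t ω = 0 := fun k t => by simp [hf, hω]
      have h0 : I ω = fun _ => 0 := by
        funext t
        refine tendsto_nhds_unique (hI ω t) ?_
        simp [this]
      rw [h0, Metric.tendstoUniformly_iff]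
      intro ε hε
      simp [this, hε]
    · obtain ⟨⟨k₀, hk₀⟩, -⟩ := hnb ω hω
      have e : (fun k t => f k t ω) = fun k t => stepInt B T (N k) (η k) (min t T) ω := by
        funext k t; simp [hf, hω]
      rw [e]
      refine (exists_tendstoUniformly_of_dist_le_geometric hk₀).2 (I ω) fun t => ?_
      have := hI ω t
      rwa [show (fun k => f k t ω) = fun k => stepInt B T (N k) (η k) (min t T) ω from
        funext fun k => congrFun (congrFun e k) t] at this
  refine ⟨fun t ω => I ω t.toNNReal, fun ω => ?_, fun t ht => ?_, N, η, h, ?_⟩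
  · have hfc : ∀ k, Continuous fun t => f k t ω := by
      intro k
      by_cases hω : ω ∈ bad
      · simp only [hf, Set.indicator_of_notMem (show ω ∉ badᶜ from fun hh => hh hω)]
        exact continuous_const
      · simp only [hf, Set.indicator_of_mem (show ω ∈ badᶜ from hω)]
        exact (continuous_stepInt (hnb ω hω).2 T _ _).comp (continuous_id.min continuous_const)
    exact ((hunif ω).continuous (Frequently.of_forall hfc)).comp continuous_real_toNNReal
  · refine @measurable_of_tendsto_metrizable Ω ℝ (𝓕 t) _ _ _ _ (fun k ω => f k t ω) _ (fun k => ?_)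
      (tendsto_pi_nhds.2 fun ω => ?_)
    · refine Measurable.indicator ?_ (𝓕.mono zero_le _ hbadF.compl)
      refine Finset.measurable_fun_sum _ fun i _ => ?_
      have h1 : ∀ c : ℝ≥0, Measurable[𝓕 t] (B (min c (min t T))) := fun c =>
        (hB.adapted _).mono (𝓕.mono ((min_le_right _ _).trans (min_le_left _ _))) le_rfl
      exact Measurable.inner measurable_const ((h1 _).sub (h1 _))
    · simpa using hI ω t
  · have : ∀ᵐ ω ∂P, ω ∉ bad := measure_eq_zero_iff_ae_notMem.1 hbad0
    filter_upwards [this] with ω hω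
    rw [Metric.tendstoUniformlyOn_iff]
    intro ε hε
    filter_upwards [Metric.tendstoUniformly_iff.1 (hunif ω) ε hε] with k hk t ht
    have := hk t
    simpa [hf, hω, min_eq_left (show t ≤ T from ht)] using this

end Existence

/-! ### The law of the Wiener integral -/

lemma abs_integral_norm_sq_sub_le {E : Type*} [NormedAddCommGroup E] {T : ℝ} {f g : ℝ → E}
    (hT : 0 ≤ T)
    (hf : MemLp f 2 (volume.restrict (Icc 0 T))) (hg : MemLp g 2 (volume.restrict (Icc 0 T)))
    {s t : ℝ} (hs : 0 ≤ s) (hst : s ≤ t) (ht : t ≤ T) {ε : ℝ} (hε : 0 < ε) :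
    |(∫ r in s..t, ‖f r‖ ^ 2) - ∫ r in s..t, ‖g r‖ ^ 2| ≤
      (1 + 1 / ε) * (∫ r in (0 : ℝ)..T, ‖f r - g r‖ ^ 2) + ε * ∫ r in (0 : ℝ)..T, ‖g r‖ ^ 2 := by
  have h0 : (0 : ℝ) ∈ Icc 0 T := ⟨le_rfl, hT⟩
  have hT' : T ∈ Icc 0 T := ⟨hT, le_rfl⟩
  have hs' : s ∈ Icc 0 T := ⟨hs, hst.trans ht⟩
  have ht' : t ∈ Icc 0 T := ⟨hs.trans hst, ht⟩
  have i1 := intervalIntegrable_norm_sq hf hs' ht'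
  have i2 := intervalIntegrable_norm_sq hg hs' ht'
  have i3 : IntervalIntegrable (fun r => ‖f r - g r‖ ^ 2) volume 0 T :=
    intervalIntegrable_norm_sq (hf.sub hg) h0 hT'
  have i4 := intervalIntegrable_norm_sq hg h0 hT'
  have i5 : IntervalIntegrable (fun r => (1 + 1 / ε) * ‖f r - g r‖ ^ 2 + ε * ‖g r‖ ^ 2) volume 0 T :=
    (i3.const_mul _).add (i4.const_mul _)
  have i5' : IntervalIntegrable (fun r => (1 + 1 / ε) * ‖f r - g r‖ ^ 2 + ε * ‖g r‖ ^ 2) volume s t :=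
    i5.mono_set (by rw [uIcc_of_le hst, uIcc_of_le hT]; exact Icc_subset_Icc hs ht)
  rw [← intervalIntegral.integral_sub i1 i2]
  calc |∫ r in s..t, (‖f r‖ ^ 2 - ‖g r‖ ^ 2)|
      ≤ ∫ r in s..t, |‖f r‖ ^ 2 - ‖g r‖ ^ 2| :=
        intervalIntegral.abs_integral_le_integral_abs hst
    _ ≤ ∫ r in s..t, ((1 + 1 / ε) * ‖f r - g r‖ ^ 2 + ε * ‖g r‖ ^ 2) := by
        refine intervalIntegral.integral_mono_on hst (i1.sub i2).abs i5' fun r _ => ?_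
        have hd := abs_norm_sub_norm_le (f r) (g r)
        have h1 : |‖f r‖ ^ 2 - ‖g r‖ ^ 2| = |‖f r‖ - ‖g r‖| * (‖f r‖ + ‖g r‖) := by
          rw [sq_sub_sq, abs_mul, abs_of_nonneg (add_nonneg (norm_nonneg (f r)) (norm_nonneg (g r))),
            mul_comm]
        have h2 : ‖f r‖ ≤ ‖f r - g r‖ + ‖g r‖ := by
          have := norm_add_le (f r - g r) (g r); simpa using this
        have h3 : 2 * (‖f r - g r‖ * ‖g r‖) ≤ 1 / ε * ‖f r - g r‖ ^ 2 + ε * ‖g r‖ ^ 2 := by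
          have h : 0 ≤ (1 / ε) * (‖f r - g r‖ - ε * ‖g r‖) ^ 2 := by positivity
          have e : (1 / ε) * (‖f r - g r‖ - ε * ‖g r‖) ^ 2 = 1 / ε * ‖f r - g r‖ ^ 2 -
            2 * (‖f r - g r‖ * ‖g r‖) + ε * ‖g r‖ ^ 2 := by field_simp; ring
          linarith
        rw [h1]
        calc _ ≤ ‖f r - g r‖ * (‖f r - g r‖ + ‖g r‖ + ‖g r‖) := by gcongr
          _ ≤ _ := by nlinarith
    _ ≤ ∫ r in (0 : ℝ)..T, ((1 + 1 / ε) * ‖f r - g r‖ ^ 2 + ε * ‖g r‖ ^ 2) := by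
        refine intervalIntegral.integral_mono_interval hs hst ht (ae_of_all _ fun r => ?_) i5
        simp only [Pi.zero_apply]; positivity
    _ = _ := by
        rw [intervalIntegral.integral_add (i3.const_mul _) (i4.const_mul _),
          intervalIntegral.integral_const_mul, intervalIntegral.integral_const_mul]

lemma tendsto_integral_norm_sq {E : Type*} [NormedAddCommGroup E] {T : ℝ} {f : ℕ → ℝ → E}
    {g : ℝ → E} (hT : 0 ≤ T)
    (hf : ∀ k, MemLp (f k) 2 (volume.restrict (Icc 0 T)))
    (hg : MemLp g 2 (volume.restrict (Icc 0 T)))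
    (h : Tendsto (fun k => ∫ r in (0 : ℝ)..T, ‖f k r - g r‖ ^ 2) atTop (𝓝 0))
    {s t : ℝ} (hs : 0 ≤ s) (hst : s ≤ t) (ht : t ≤ T) :
    Tendsto (fun k => ∫ r in s..t, ‖f k r‖ ^ 2) atTop (𝓝 (∫ r in s..t, ‖g r‖ ^ 2)) := by
  rw [Metric.tendsto_atTop']
  intro δ hδ
  set G := ∫ r in (0 : ℝ)..T, ‖g r‖ ^ 2 with hG
  have hG0 : 0 ≤ G := intervalIntegral.integral_nonneg hT fun r _ => by positivity
  set ε := δ / (2 * (G + 1)) with hε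
  have hε0 : 0 < ε := by positivity
  have h1 := h.const_mul (1 + 1 / ε)
  rw [mul_zero] at h1
  obtain ⟨n, hn⟩ := eventually_atTop.1 (h1.eventually_lt_const (show 0 < δ / 2 by positivity))
  refine ⟨n, fun k hk => ?_⟩
  rw [Real.dist_eq]
  have h2 := abs_integral_norm_sq_sub_le hT (hf k) hg hs hst ht hε0
  have h3 : ε * G ≤ δ / 2 := by
    rw [hε, div_mul_eq_mul_div, div_le_div_iff₀ (by positivity) (by positivity)]
    nlinarith
  linarith [hn k hk.le]

lemma tendsto_toNNReal {f : ℕ → ℝ} {l : ℝ} (h : Tendsto f atTop (𝓝 l)) :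
    Tendsto (fun k => (f k).toNNReal) atTop (𝓝 l.toNNReal) :=
  (continuous_real_toNNReal.tendsto _).comp h

namespace IsWienerIntegral

variable {𝓕 : Filtration ℝ≥0 mΩ} {P : Measure Ω} [IsProbabilityMeasure P] {T : ℝ≥0}
  {B : ℝ≥0 → Ω → EuclideanSpace ℝ (Fin d)} {y : ℝ → EuclideanSpace ℝ (Fin d)} {I : ℝ → Ω → ℝ}

omit [IsProbabilityMeasure P] in
lemma measurable (h : IsWienerIntegral 𝓕 P B T y I) {t : ℝ≥0} (ht : t ≤ T) : Measurable (I t) :=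
  (h.adapted t ht).mono (𝓕.le t) le_rfl

/-- Increments of the Wiener integral and of the Brownian motion are jointly Gaussian and
independent of the past. -/
lemma indepGaussian_add (h : IsWienerIntegral 𝓕 P B T y I) (hB : IsFilteredBM 𝓕 P T B)
    (hy : MemLp y 2 (volume.restrict (Icc 0 (T : ℝ)))) {s t : ℝ≥0} (hst : s ≤ t) (ht : t ≤ T)
    (a : ℝ) (u : EuclideanSpace ℝ (Fin d)) :
    IndepGaussian (𝓕 s) P (fun ω => a * (I t ω - I s ω) + ⟪u, B t ω - B s ω⟫)
      (∫ r in (s : ℝ)..t, ‖a • y r + u‖ ^ 2).toNNReal := by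
  obtain ⟨N, η, hN, hlim⟩ := h.approx
  set g : ℕ → ℕ → ℝ≥0 := fun k i => max s (min (uGrid T (N k) i) t) with hg
  have hgm : ∀ k, Monotone (g k) := fun k i j hij =>
    max_le_max le_rfl (min_le_min (uGrid_mono T _ hij) le_rfl)
  have hgt : ∀ k i, g k i ≤ t := fun k i => max_le hst (min_le_right _ _)
  have hg0 : ∀ k, g k 0 = s := fun k => by simp [hg, uGrid_zero]
  have hgN : ∀ k, g k (N k) = t := fun k => by
    simp [hg, uGrid_self T (hN.pos k), min_eq_right ht, max_eq_right hst]
  have hG := fun k => hB.indepGaussian_gridSum (hgm k) (fun i => (hgt k i).trans ht)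
    (fun i => a • η k i + u) (N k)
  simp_rw [hg0] at hG
  -- The increment B_t - B_s telescopes along the same clamped grid, so the combination is a single
  -- grid sum with deterministic coefficients a η_i + u; this gives joint Gaussianity.
  have e1 : ∀ k, gridSum B (g k) (fun i _ => a • η k i + u) (N k) = fun ω =>
      a * (stepInt B T (N k) (η k) t ω - stepInt B T (N k) (η k) s ω) + ⟪u, B t ω - B s ω⟫ := by
    intro k
    ext ω
    have htel : B t ω - B s ω =
        ∑ i ∈ Finset.range (N k), (B (g k (i + 1)) ω - B (g k i) ω) := by
      rw [Finset.sum_range_sub (fun i => B (g k i) ω), hg0, hgN]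
    rw [stepInt_sub B T (N k) (η k) hst, htel, inner_sum, gridSum, gridSum, Finset.mul_sum,
      ← Finset.sum_add_distrib]
    refine Finset.sum_congr rfl fun i _ => ?_
    rw [inner_add_left, real_inner_smul_left]
  have e2 : ∀ k, (∑ i ∈ Finset.range (N k), ‖a • η k i + u‖₊ ^ 2 * (g k (i + 1) - g k i)) =
      (∫ r in (s : ℝ)..t, ‖a • stepFun T (N k) (η k) r + u‖ ^ 2).toNNReal := by
    intro k
    have h1 := integral_norm_sq_eq_gridEnergy (hgm k) (ω := ()) (n := N k)
      (ξ := fun i _ => a • η k i + u) (u := fun r => a • stepFun T (N k) (η k) r + u)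
      (fun i hi r hr => by
        have hr' : r ∈ Ioc (uGrid T (N k) i : ℝ) (uGrid T (N k) (i + 1)) := by
          obtain ⟨h1, h2⟩ := hr
          simp only [hg, NNReal.coe_max, NNReal.coe_min, max_lt_iff] at h1 h2
          have hsr : ¬ r ≤ s := not_le.2 h1.1
          have h3 := (le_max_iff.1 h2).resolve_left hsr
          have h4 := le_min_iff.1 h3
          refine ⟨?_, h4.1⟩
          by_contra hc
          rcases min_lt_iff.1 h1.2 with h5 | h5
          · exact hc h5
          · exact absurd h4.2 (not_le.2 h5)
        simp only [stepFun_eq hi hr'])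
    rw [hg0, hgN] at h1
    rw [h1, gridEnergy]
    have : ∀ i, ‖a • η k i + u‖ ^ 2 * ((g k (i + 1) : ℝ) - g k i) =
        ((‖a • η k i + u‖₊ ^ 2 * (g k (i + 1) - g k i) : ℝ≥0) : ℝ) := by
      intro i
      rw [NNReal.coe_mul, NNReal.coe_sub (hgm k (Nat.le_succ i))]
      simp
    simp_rw [this]
    rw [← NNReal.coe_sum, Real.toNNReal_coe]
  have hmem : ∀ f : ℝ → EuclideanSpace ℝ (Fin d), MemLp f 2 (volume.restrict (Icc 0 (T : ℝ))) →
      MemLp (fun r => a • f r + u) 2 (volume.restrict (Icc 0 (T : ℝ))) := fun f hf =>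
    (hf.const_smul a).add (memLp_const u)
  refine IndepGaussian.of_tendsto hG ?_ ?_ ?_
  · have h1 := h.measurable ht
    have h2 := h.measurable (hst.trans ht)
    have h3 := hB.measurable t
    have h4 := hB.measurable s
    fun_prop
  · filter_upwards [hlim] with ω hω
    have h1 := hω.tendsto_at (show t ∈ Iic T from ht)
    have h2 := hω.tendsto_at (show s ∈ Iic T from hst.trans ht)
    simp_rw [e1]
    exact ((h1.sub h2).const_mul a).add_const _
  · simp_rw [e2]
    refine tendsto_toNNReal (tendsto_integral_norm_sq T.coe_nonneg
      (fun k => hmem _ ((memLp_stepFun T (N k) (η k) 2).restrict _)) (hmem _ hy) ?_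
      s.coe_nonneg (by exact_mod_cast hst) (by exact_mod_cast ht))
    have h3 : ∀ k, ∫ r in (0 : ℝ)..T, ‖(a • stepFun T (N k) (η k) r + u) - (a • y r + u)‖ ^ 2 =
        a ^ 2 * ∫ r in (0 : ℝ)..T, ‖stepFun T (N k) (η k) r - y r‖ ^ 2 := by
      intro k
      rw [← intervalIntegral.integral_const_mul]
      refine intervalIntegral.integral_congr fun r _ => ?_
      simp only [add_sub_add_right_eq_sub, ← smul_sub, norm_smul, mul_pow, Real.norm_eq_abs, sq_abs]
    simp_rw [h3]
    have h4 : Tendsto (fun k => ∫ r in (0 : ℝ)..T, ‖stepFun T (N k) (η k) r - y r‖ ^ 2) atTop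
        (𝓝 0) := squeeze_zero (fun k => intervalIntegral.integral_nonneg T.coe_nonneg
          fun r _ => by positivity) hN.approx
        (tendsto_pow_atTop_nhds_zero_of_lt_one (by norm_num) (by norm_num))
    simpa using h4.const_mul (a ^ 2)

lemma indepGaussian (h : IsWienerIntegral 𝓕 P B T y I) (hB : IsFilteredBM 𝓕 P T B)
    (hy : MemLp y 2 (volume.restrict (Icc 0 (T : ℝ)))) {s t : ℝ≥0} (hst : s ≤ t) (ht : t ≤ T) :
    IndepGaussian (𝓕 s) P (fun ω => I t ω - I s ω) (∫ r in (s : ℝ)..t, ‖y r‖ ^ 2).toNNReal := by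
  simpa using h.indepGaussian_add hB hy hst ht 1 0

lemma eval_zero (h : IsWienerIntegral 𝓕 P B T y I) : ∀ᵐ ω ∂P, I 0 ω = 0 := by
  obtain ⟨N, η, -, hlim⟩ := h.approx
  filter_upwards [hlim] with ω hω
  have h1 := hω.tendsto_at (mem_Iic.2 zero_le)
  have h2 : ∀ k, stepInt B T (N k) (η k) 0 ω = 0 := fun k => by simp [stepInt]
  simp_rw [h2] at h1
  simpa using tendsto_nhds_unique h1 tendsto_const_nhds

end IsWienerIntegral

end PortfolioES

namespace PortfolioES

variable {d : ℕ} {Ω : Type*} [mΩ : MeasurableSpace Ω]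

/-! ### Primitives of integrable functions -/

section Primitive

omit mΩ

lemma _root_.LipschitzOnWith.comp_absolutelyContinuousOnInterval {f φ : ℝ → ℝ} {a b : ℝ} {K : ℝ≥0}
    {S : Set ℝ} (hφ : LipschitzOnWith K φ S) (hf : AbsolutelyContinuousOnInterval f a b)
    (hS : MapsTo f (uIcc a b) S) : AbsolutelyContinuousOnInterval (fun t => φ (f t)) a b := by
  rw [absolutelyContinuousOnInterval_iff] at hf ⊢
  intro ε hε
  obtain ⟨δ, hδ, h⟩ := hf (ε / (K + 1)) (by positivity)
  refine ⟨δ, hδ, fun E hE hEδ => ?_⟩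
  have h1 := h E hE hEδ
  calc ∑ i ∈ Finset.range E.1, dist (φ (f (E.2 i).1)) (φ (f (E.2 i).2))
      ≤ ∑ i ∈ Finset.range E.1, K * dist (f (E.2 i).1) (f (E.2 i).2) :=
        Finset.sum_le_sum fun i hi =>
          hφ.dist_le_mul _ (hS (hE.1 i hi).1) _ (hS (hE.1 i hi).2)
    _ = K * ∑ i ∈ Finset.range E.1, dist (f (E.2 i).1) (f (E.2 i).2) := by rw [Finset.mul_sum]
    _ ≤ K * (ε / (K + 1)) := by gcongr
    _ < (K + 1) * (ε / (K + 1)) := by gcongr; linarith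
    _ = ε := by field_simp

variable {a f g : ℝ → ℝ} {T : ℝ}

lemma ae_hasDerivAt_primitive (hT : 0 ≤ T) (hf : IntervalIntegrable f volume 0 T) :
    ∀ᵐ t, t ∈ Icc 0 T → HasDerivAt (fun t => ∫ u in (0 : ℝ)..t, f u) (f t) t := by
  filter_upwards [hf.ae_hasDerivAt_integral] with t ht h
  rw [uIcc_of_le hT] at ht
  exact ht h 0 ⟨le_rfl, hT⟩

lemma continuousOn_primitive (hT : 0 ≤ T) (hf : IntervalIntegrable f volume 0 T) :
    ContinuousOn (fun t => ∫ u in (0 : ℝ)..t, f u) (Icc 0 T) := by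
  have := (hf.absolutelyContinuousOnInterval_intervalIntegral left_mem_uIcc).continuousOn
  rwa [uIcc_of_le hT] at this

/-- The exponential of a primitive solves a linear equation. -/
lemma integral_mul_exp_primitive (hT : 0 ≤ T) (ha : IntervalIntegrable a volume 0 T) {s t : ℝ}
    (hs : s ∈ Icc 0 T) (ht : t ∈ Icc 0 T) :
    ∫ u in s..t, a u * Real.exp (∫ r in (0 : ℝ)..u, a r) =
      Real.exp (∫ r in (0 : ℝ)..t, a r) - Real.exp (∫ r in (0 : ℝ)..s, a r) := by
  have hac := ha.absolutelyContinuousOnInterval_intervalIntegral (c := 0) left_mem_uIcc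
  have hc := continuousOn_primitive hT ha
  obtain ⟨C, hC⟩ := isCompact_Icc.exists_bound_of_continuousOn hc
  -- The primitive is bounded on [0, T] and exp is Lipschitz on the range, so the composition is
  -- absolutely continuous and the fundamental theorem holds even though a is merely integrable.
  have hL : LipschitzOnWith (Real.exp C).toNNReal Real.exp (Iic C) := by
    refine Convex.lipschitzOnWith_of_nnnorm_deriv_le (fun _ _ => Real.differentiableAt_exp)
      (fun r hr => ?_) (convex_Iic C)
    rw [← NNReal.coe_le_coe, coe_nnnorm, Real.coe_toNNReal _ (Real.exp_pos C).le, Real.deriv_exp,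
      Real.norm_eq_abs, abs_of_pos (Real.exp_pos r)]
    exact Real.exp_le_exp.2 hr
  have hE := hL.comp_absolutelyContinuousOnInterval hac (fun u hu => by
    rw [uIcc_of_le hT] at hu
    exact (le_abs_self _).trans (hC u hu))
  have hsub : uIcc s t ⊆ uIcc 0 T := by rw [uIcc_of_le hT]; exact uIcc_subset_Icc hs ht
  rw [← (hE.mono hsub).integral_deriv_eq_sub]
  refine intervalIntegral.integral_congr_ae ?_
  filter_upwards [ae_hasDerivAt_primitive hT ha] with u hu hmem
  have hmem' := hsub (uIoc_subset_uIcc hmem)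
  rw [uIcc_of_le hT] at hmem'
  rw [(hu hmem').exp.deriv, mul_comm]

/-- Integration by parts for primitives. -/
lemma integral_mul_add_mul_primitive (hT : 0 ≤ T) (hf : IntervalIntegrable f volume 0 T)
    (hg : IntervalIntegrable g volume 0 T) (x y : ℝ) {t : ℝ} (ht : t ∈ Icc 0 T) :
    ∫ u in (0 : ℝ)..t, (f u * (y + ∫ r in (0 : ℝ)..u, g r) + (x + ∫ r in (0 : ℝ)..u, f r) * g u) =
      (x + ∫ r in (0 : ℝ)..t, f r) * (y + ∫ r in (0 : ℝ)..t, g r) - x * y := by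
  have hsub : uIcc 0 t ⊆ uIcc 0 T := by
    rw [uIcc_of_le hT]; exact uIcc_subset_Icc ⟨le_rfl, hT⟩ ht
  have hconst : ∀ c : ℝ, AbsolutelyContinuousOnInterval (fun _ => c) 0 t := fun c =>
    (LipschitzWith.const c).lipschitzOnWith.absolutelyContinuousOnInterval
  have hF : AbsolutelyContinuousOnInterval (fun u => x + ∫ r in (0 : ℝ)..u, f r) 0 t :=
    (hconst x).add ((hf.absolutelyContinuousOnInterval_intervalIntegral left_mem_uIcc).mono hsub)
  have hG : AbsolutelyContinuousOnInterval (fun u => y + ∫ r in (0 : ℝ)..u, g r) 0 t :=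
    (hconst y).add ((hg.absolutelyContinuousOnInterval_intervalIntegral left_mem_uIcc).mono hsub)
  have := hF.integral_deriv_mul_eq_sub hG
  simp only [intervalIntegral.integral_same, add_zero] at this
  rw [← this]
  refine intervalIntegral.integral_congr_ae ?_
  filter_upwards [ae_hasDerivAt_primitive hT hf, ae_hasDerivAt_primitive hT hg] with u h1 h2 hmem
  have hmem' := hsub (uIoc_subset_uIcc hmem)
  rw [uIcc_of_le hT] at hmem'
  rw [((h1 hmem').const_add x).deriv, ((h2 hmem').const_add y).deriv]

/-- **Gronwall's inequality** with an integrable kernel. -/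
lemma nonpos_of_le_integral_mul (hT : 0 ≤ T) {k φ : ℝ → ℝ} (hk : IntervalIntegrable k volume 0 T)
    (hk0 : ∀ t ∈ Icc 0 T, 0 ≤ k t) (hkφ : IntervalIntegrable (fun u => k u * φ u) volume 0 T)
    (h : ∀ t ∈ Icc 0 T, φ t ≤ ∫ u in (0 : ℝ)..t, k u * φ u) : ∀ t ∈ Icc 0 T, φ t ≤ 0 := by
  have hkn : IntervalIntegrable (fun u => -k u) volume 0 T := hk.neg
  -- Integrating factor: the derivative of E · ∫kφ is kE(φ - ∫kφ) ≤ 0, and the product starts at 0.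
  set E : ℝ → ℝ := fun t => Real.exp (∫ r in (0 : ℝ)..t, -k r) with hE
  have hEc : ContinuousOn E (Icc 0 T) := (continuousOn_primitive hT hkn).rexp
  have hEi : IntervalIntegrable (fun u => -k u * E u) volume 0 T := by
    refine hkn.mul_continuousOn ?_
    rwa [uIcc_of_le hT]
  have hEeq : ∀ t ∈ Icc 0 T, 1 + ∫ r in (0 : ℝ)..t, -k r * E r = E t := by
    intro t ht
    rw [integral_mul_exp_primitive hT hkn ⟨le_rfl, hT⟩ ht]
    simp [hE]
  intro t ht
  have hp := integral_mul_add_mul_primitive hT hEi hkφ 1 0 ht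
  have hle : ∫ u in (0 : ℝ)..t, ((-k u * E u) * (0 + ∫ r in (0 : ℝ)..u, k r * φ r) +
      (1 + ∫ r in (0 : ℝ)..u, -k r * E r) * (k u * φ u)) ≤ 0 := by
    rw [← neg_nonneg, ← intervalIntegral.integral_neg]
    refine intervalIntegral.integral_nonneg ht.1 fun u hu => ?_
    have hu' : u ∈ Icc 0 T := ⟨hu.1, hu.2.trans ht.2⟩
    rw [hEeq u hu', zero_add]
    have h1 := h u hu'
    have h2 : 0 ≤ k u * E u := mul_nonneg (hk0 u hu') (Real.exp_pos _).le
    nlinarith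
  rw [hp, hEeq t ht, zero_add, mul_zero, sub_zero] at hle
  have hEpos : 0 < E t := Real.exp_pos _
  exact (h t ht).trans (by nlinarith)

end Primitive

/-! ### Gaussian martingale differences -/

section GaussianDiff

lemma integrable_exp_mul_gaussianReal' (v : ℝ≥0) (s : ℝ) :
    Integrable (fun z => Real.exp (s * z)) (gaussianReal 0 v) :=
  integrable_exp_mul_gaussianReal s

lemma integral_exp_mul_gaussianReal (v : ℝ≥0) (s : ℝ) :
    ∫ z, Real.exp (s * z) ∂(gaussianReal 0 v) = Real.exp (v * s ^ 2 / 2) := by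
  have := congrFun (mgf_id_gaussianReal (μ := 0) (v := v)) s
  simpa [mgf] using this

/-- This is the derivative at 1 of the moment generating function e^{vs²/2}. -/
lemma integral_mul_exp_gaussianReal (v : ℝ≥0) :
    ∫ z, z * Real.exp z ∂(gaussianReal 0 v) = v * Real.exp (v / 2) := by
  have hset : (1 : ℝ) ∈ interior (integrableExpSet id (gaussianReal 0 v)) := by
    have : integrableExpSet id (gaussianReal 0 v) = univ := by
      ext s; simpa [integrableExpSet] using integrable_exp_mul_gaussianReal' v s
    rw [this]; simp
  have h1 := hasDerivAt_mgf hset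
  have h2 : HasDerivAt (mgf id (gaussianReal 0 v)) (v * Real.exp (v / 2)) 1 := by
    rw [mgf_id_gaussianReal]
    have : HasDerivAt (fun t : ℝ => Real.exp (0 * t + v * t ^ 2 / 2))
        (Real.exp (0 * 1 + v * 1 ^ 2 / 2) * (0 * 1 + v * (2 * 1) / 2)) 1 := by
      refine HasDerivAt.exp (HasDerivAt.add ((hasDerivAt_id (1 : ℝ)).const_mul 0) ?_)
      have := ((hasDerivAt_pow 2 (1 : ℝ)).const_mul (v : ℝ)).div_const 2
      simpa using this
    convert this using 1
    simp; ring
  have := h1.unique h2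
  simpa using this

/-- The remainder of the Wick exponential beyond its linear part. -/
noncomputable def wickRemainder (v : ℝ≥0) (z : ℝ) : ℝ := Real.exp (z - v / 2) - 1 - z

lemma measurable_wickRemainder (v : ℝ≥0) : Measurable (wickRemainder v) := by
  unfold wickRemainder; fun_prop

lemma memLp_wickRemainder (v : ℝ≥0) : MemLp (wickRemainder v) 2 (gaussianReal 0 v) := by
  have h1 : MemLp (fun z => Real.exp (z - v / 2)) 2 (gaussianReal 0 v) := by
    rw [memLp_two_iff_integrable_sq (by fun_prop)]
    have : (fun z : ℝ => Real.exp (z - v / 2) ^ 2) = fun z => Real.exp (2 * z) * Real.exp (-v) := by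
      ext z; rw [← Real.exp_nat_mul, ← Real.exp_add]; congr 1; push_cast; ring
    rw [this]
    exact (integrable_exp_mul_gaussianReal' v 2).mul_const _
  exact (h1.sub (memLp_const 1)).sub (memLp_id_gaussianReal' 2 (by simp))

lemma integral_wickRemainder (v : ℝ≥0) : ∫ z, wickRemainder v z ∂(gaussianReal 0 v) = 0 := by
  have e : ∀ z, wickRemainder v z = Real.exp (1 * z) * Real.exp (-(v / 2)) - 1 - z := by
    intro z; rw [wickRemainder, ← Real.exp_add]; ring_nf
  simp_rw [e]
  have i1 : Integrable (fun z => Real.exp (1 * z) * Real.exp (-((v : ℝ) / 2))) (gaussianReal 0 v) :=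
    (integrable_exp_mul_gaussianReal' v 1).mul_const _
  rw [integral_sub (by exact i1.sub (integrable_const _)) (integrable_id_gaussianReal v),
    integral_sub i1 (integrable_const _), integral_mul_const, integral_exp_mul_gaussianReal,
    integral_id_gaussianReal, ← Real.exp_add]
  simp

/-- The Wick exponential has second moment e^v; removing its constant and linear parts, of second
moments 1 and v, leaves a quantity of order v². Summed over cells of small variance this vanishes,
so a first order expansion replaces Itô's formula. -/
lemma integral_wickRemainder_sq (v : ℝ≥0) :
    ∫ z, wickRemainder v z ^ 2 ∂(gaussianReal 0 v) = Real.exp v - 1 - v := by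
  have e : ∀ z, wickRemainder v z ^ 2 = Real.exp (2 * z) * Real.exp (-v) -
      2 * Real.exp (-(v / 2)) * (Real.exp (1 * z) + z * Real.exp z) + 1 + 2 * z + z ^ 2 := by
    intro z
    have h1 : Real.exp (z - v / 2) = Real.exp (-(v / 2)) * Real.exp z := by
      rw [← Real.exp_add]; ring_nf
    have h2 : Real.exp (2 * z) = Real.exp z ^ 2 := by rw [← Real.exp_nat_mul]; norm_num
    have h3 : Real.exp (-(v : ℝ)) = Real.exp (-((v : ℝ) / 2)) ^ 2 := by
      rw [← Real.exp_nat_mul]; ring_nf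
    rw [wickRemainder, h1, h2, h3, one_mul]; ring
  simp_rw [e]
  have i1 : Integrable (fun z => Real.exp (2 * z) * Real.exp (-(v : ℝ))) (gaussianReal 0 v) :=
    (integrable_exp_mul_gaussianReal' v 2).mul_const _
  have i2 : Integrable (fun z => Real.exp (1 * z)) (gaussianReal 0 v) :=
    integrable_exp_mul_gaussianReal' v 1
  have i3 : Integrable (fun z => z * Real.exp z) (gaussianReal 0 v) := by
    have h := (memLp_id_gaussianReal' (μ := 0) (v := v) 2 (by simp)).integrable_mul
      (g := fun z => Real.exp z) (q := 2) (by
        rw [memLp_two_iff_integrable_sq (by fun_prop)]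
        have : (fun z : ℝ => Real.exp z ^ 2) = fun z => Real.exp (2 * z) := by
          ext z; rw [← Real.exp_nat_mul]; norm_num
        rw [this]; exact integrable_exp_mul_gaussianReal' v 2)
    exact h
  have i4 : Integrable (fun z => 2 * Real.exp (-((v : ℝ) / 2)) * (Real.exp (1 * z) + z * Real.exp z))
      (gaussianReal 0 v) := (i2.add i3).const_mul _
  have i5 : Integrable (fun z : ℝ => 2 * z) (gaussianReal 0 v) :=
    (integrable_id_gaussianReal v).const_mul 2
  rw [integral_add (by exact ((i1.sub i4).add (integrable_const _)).add i5)
      (integrable_sq_gaussianReal v),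
    integral_add (by exact (i1.sub i4).add (integrable_const _)) i5,
    integral_add (by exact i1.sub i4) (integrable_const _),
    integral_sub i1 i4, integral_mul_const, integral_const_mul, integral_add i2 i3,
    integral_const_mul, integral_exp_mul_gaussianReal, integral_exp_mul_gaussianReal,
    integral_mul_exp_gaussianReal, integral_id_gaussianReal, integral_sq_gaussianReal, ← Real.exp_add]
  have h4 : Real.exp (-((v : ℝ) / 2)) * Real.exp ((v : ℝ) / 2) = 1 := by
    rw [← Real.exp_add]; simp
  have h5 : (v : ℝ) * 1 ^ 2 / 2 = v / 2 := by ring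
  have h6 : (v : ℝ) * 2 ^ 2 / 2 + -v = v := by ring
  rw [h5, h6]
  have : 2 * Real.exp (-((v : ℝ) / 2)) * (Real.exp ((v : ℝ) / 2) + v * Real.exp ((v : ℝ) / 2)) =
      2 * (1 + v) := by
    calc _ = 2 * (1 + v) * (Real.exp (-((v : ℝ) / 2)) * Real.exp ((v : ℝ) / 2)) := by ring
      _ = _ := by rw [h4, mul_one]
  rw [this]
  simp; ring

/-- A centred function of a variable independent of the past, multiplied by an adapted weight, is
orthogonal to the past. It is used with weights given by the exponential at the left endpoint of a
cell. -/
lemma IndepGaussian.isMartDiff {𝓖 : Filtration ℕ mΩ} {Q : Measure Ω} [IsProbabilityMeasure Q]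
    {V : ℕ → Ω → ℝ} {v : ℕ → ℝ≥0} (hV : ∀ i, IndepGaussian (𝓖 i) Q (V i) (v i))
    (hVm : ∀ i, Measurable[𝓖 (i + 1)] (V i)) {Z : ℕ → Ω → ℝ} (hZ : ∀ i, Measurable[𝓖 i] (Z i))
    (hZ2 : ∀ i, MemLp (Z i) 2 Q) {φ : ℕ → ℝ → ℝ} (hφ : ∀ i, Measurable (φ i))
    (hφ2 : ∀ i, MemLp (φ i) 2 (gaussianReal 0 (v i)))
    (hφ0 : ∀ i, ∫ z, φ i z ∂(gaussianReal 0 (v i)) = 0) :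
    IsMartDiff 𝓖 Q (fun i ω => Z i ω * φ i (V i ω)) where
  measurable i := ((hZ i).mono (𝓖.mono (Nat.le_succ i)) le_rfl).mul ((hφ i).comp (hVm i))
  memLp i := (hV i).memLp_mul_comp (𝓖.le i) (hZ i) (hZ2 i) (hφ i) (hφ2 i)
  orth i ζ hζ _ := by
    simp_rw [← mul_assoc]
    have := (hV i).integral_mul_comp (𝓖.le i) (hζ.mul (hZ i)) (hφ i)
    rw [hφ0 i, mul_zero] at this
    exact this

end GaussianDiff

end PortfolioES

namespace PortfolioES

variable {d : ℕ} {Ω : Type*} [mΩ : MeasurableSpace Ω]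

/-! ### Measurability of processes with continuous paths -/

section Measurability

lemma measurable_uncurry_projIcc {E : Type*} [TopologicalSpace E] [TopologicalSpace.PseudoMetrizableSpace E] [MeasurableSpace E] [BorelSpace E] {X : ℝ → Ω → E} {T : ℝ} (hT : 0 ≤ T)
    (hc : ∀ ω, ContinuousOn (fun t => X t ω) (Icc 0 T)) (hm : ∀ t ∈ Icc 0 T, Measurable (X t)) :
    Measurable (fun p : Ω × ℝ => X (projIcc 0 T hT p.2) p.1) := by
  have h : Measurable (Function.uncurry fun (t : ℝ) (ω : Ω) => X (projIcc 0 T hT t) ω) := by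
    refine measurable_uncurry_of_continuous_of_measurable (fun ω => ?_) fun t => ?_
    · exact (hc ω).comp_continuous (continuous_subtype_val.comp continuous_projIcc)
        fun t => (projIcc 0 T hT t).2
    · exact hm _ (projIcc 0 T hT t).2
  exact h.comp measurable_swap

lemma aestronglyMeasurable_uncurry {E : Type*} [TopologicalSpace E] [TopologicalSpace.PseudoMetrizableSpace E] [SecondCountableTopology E] [MeasurableSpace E] [BorelSpace E] {P : Measure Ω} [SFinite P] {X : ℝ → Ω → E} {T : ℝ} (hT : 0 ≤ T)
    (hc : ∀ ω, ContinuousOn (fun t => X t ω) (Icc 0 T)) (hm : ∀ t ∈ Icc 0 T, Measurable (X t)) :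
    AEStronglyMeasurable (fun p : Ω × ℝ => X p.2 p.1)
      (P.prod (volume.restrict (Icc 0 T))) := by
  refine (measurable_uncurry_projIcc hT hc hm).aestronglyMeasurable.congr ?_
  have : ∀ᵐ p ∂(P.prod (volume.restrict (Icc 0 T))), p.2 ∈ Icc 0 T :=
    Measure.quasiMeasurePreserving_snd.ae (ae_restrict_mem measurableSet_Icc)
  filter_upwards [this] with p hp
  rw [projIcc_of_mem hT hp]

end Measurability

lemma tendstoInMeasure_zero_of_integral_sq {P : Measure Ω} [IsProbabilityMeasure P]
    {f : ℕ → Ω → ℝ} (hf : ∀ k, MemLp (f k) 2 P)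
    (h : Tendsto (fun k => ∫ ω, f k ω ^ 2 ∂P) atTop (𝓝 0)) :
    TendstoInMeasure P f atTop (fun _ => (0 : ℝ)) := by
  refine tendstoInMeasure_of_tendsto_eLpNorm (p := 2) (by norm_num)
    (fun k => (hf k).1) aestronglyMeasurable_const ?_
  have e : ∀ k, eLpNorm (f k - fun _ => (0 : ℝ)) 2 P =
      ENNReal.ofReal ((∫ ω, f k ω ^ 2 ∂P) ^ (1 / 2 : ℝ)) := by
    intro k
    have : (f k - fun _ => (0 : ℝ)) = f k := by ext; simp
    rw [this, (hf k).eLpNorm_eq_integral_rpow_norm (by norm_num) (by norm_num)]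
    simp
  simp_rw [e]
  have h1 := (Real.continuousAt_rpow_const (0 : ℝ) (1 / 2) (Or.inr (by norm_num))).tendsto.comp h
  rw [Real.zero_rpow (by norm_num)] at h1
  simpa using ENNReal.tendsto_ofReal h1

/-! ### The deterministic part of the product rule -/

omit mΩ in
-- Product rule for the smooth factor D = exp ∫a and a factor E that is only continuous. On each
-- cell the defect is exactly ∫ aD(E(g_{i+1}) - E(s)) ds, hence at most the oscillation w times
-- ∫|aD|. It serves both for the exponential equation and for discounting.
lemma abs_sub_sum_le_of_osc {T : ℝ≥0} {a : ℝ → ℝ} (ha : IntervalIntegrable a volume 0 T)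
    {E : ℝ → ℝ} (hE : ContinuousOn E (Icc 0 (T : ℝ))) {g : ℕ → ℝ≥0} (hg : Monotone g)
    (hg0 : g 0 = 0) (hgT : ∀ i, g i ≤ T) {w : ℝ}
    (hw : ∀ i, ∀ s ∈ Icc (g i : ℝ) (g (i + 1)), |E (g (i + 1)) - E s| ≤ w) (n : ℕ) :
    |Real.exp (∫ r in (0 : ℝ)..g n, a r) * E (g n) - E 0 -
      (∫ s in (0 : ℝ)..g n, a s * Real.exp (∫ r in (0 : ℝ)..s, a r) * E s) -
      ∑ i ∈ Finset.range n, Real.exp (∫ r in (0 : ℝ)..g i, a r) * (E (g (i + 1)) - E (g i))| ≤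
    w * ∫ s in (0 : ℝ)..g n, |a s * Real.exp (∫ r in (0 : ℝ)..s, a r)| := by
  have hmem : ∀ i, (g i : ℝ) ∈ Icc 0 (T : ℝ) := fun i =>
    ⟨(g i).coe_nonneg, by exact_mod_cast hgT i⟩
  have hD : ContinuousOn (fun s => Real.exp (∫ r in (0 : ℝ)..s, a r)) (Icc 0 (T : ℝ)) :=
    (continuousOn_primitive T.coe_nonneg ha).rexp
  have hu : uIcc (0 : ℝ) T = Icc 0 (T : ℝ) := uIcc_of_le T.coe_nonneg
  have i1 : IntervalIntegrable (fun s => a s * Real.exp (∫ r in (0 : ℝ)..s, a r)) volume 0 T :=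
    ha.mul_continuousOn (by rwa [hu])
  have i2 : IntervalIntegrable (fun s => a s * Real.exp (∫ r in (0 : ℝ)..s, a r) * E s)
    volume 0 T := i1.mul_continuousOn (by rwa [hu])
  have hsub : ∀ i j, uIcc (g i : ℝ) (g j) ⊆ uIcc 0 (T : ℝ) := fun i j => by
    rw [hu]; exact uIcc_subset_Icc (hmem i) (hmem j)
  induction n with
  | zero => simp [hg0]
  | succ n ih =>
    have hle : (g n : ℝ) ≤ g (n + 1) := by exact_mod_cast hg (Nat.le_succ n)
    have hsub0 : uIcc (0 : ℝ) (g n) ⊆ uIcc 0 (T : ℝ) := by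
      have := hsub 0 n; rwa [hg0, NNReal.coe_zero] at this
    have j1 := i1.mono_set (hsub n (n + 1))
    have j2 := i2.mono_set (hsub n (n + 1))
    rw [Finset.sum_range_succ,
      ← intervalIntegral.integral_add_adjacent_intervals (i2.mono_set hsub0) j2,
      ← intervalIntegral.integral_add_adjacent_intervals (i1.mono_set hsub0).abs j1.abs, mul_add]
    have hcell : Real.exp (∫ r in (0 : ℝ)..g (n + 1), a r) * E (g (n + 1)) -
        Real.exp (∫ r in (0 : ℝ)..g n, a r) * E (g n) -
        (∫ s in (g n : ℝ)..g (n + 1), a s * Real.exp (∫ r in (0 : ℝ)..s, a r) * E s) -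
        Real.exp (∫ r in (0 : ℝ)..g n, a r) * (E (g (n + 1)) - E (g n)) =
        ∫ s in (g n : ℝ)..g (n + 1),
          a s * Real.exp (∫ r in (0 : ℝ)..s, a r) * (E (g (n + 1)) - E s) := by
      simp_rw [mul_sub]
      rw [intervalIntegral.integral_sub (j1.mul_const _) j2, intervalIntegral.integral_mul_const,
        integral_mul_exp_primitive T.coe_nonneg ha (hmem n) (hmem (n + 1))]
      ring
    have hbd : |∫ s in (g n : ℝ)..g (n + 1),
          a s * Real.exp (∫ r in (0 : ℝ)..s, a r) * (E (g (n + 1)) - E s)| ≤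
        w * ∫ s in (g n : ℝ)..g (n + 1), |a s * Real.exp (∫ r in (0 : ℝ)..s, a r)| := by
      refine (intervalIntegral.abs_integral_le_integral_abs hle).trans ?_
      rw [← intervalIntegral.integral_const_mul]
      refine intervalIntegral.integral_mono_on hle ?_ (j1.abs.const_mul w) fun s hs => ?_
      · refine (j1.mul_continuousOn ?_).abs
        refine continuousOn_const.sub (hE.mono ?_)
        rw [← hu]; exact hsub _ _
      · rw [abs_mul, mul_comm]
        exact mul_le_mul_of_nonneg_right (hw n s hs) (abs_nonneg _)
    refine le_trans (le_of_eq_of_le ?_ (abs_add_le _ _)) (add_le_add ih hbd)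
    rw [← hcell]
    congr 1
    ring

end PortfolioES

namespace PortfolioES

variable {d : ℕ} {Ω : Type*} [mΩ : MeasurableSpace Ω]

/-! ### The stochastic exponential -/

/-- `x exp(∫₀ᵗ a) exp(I_t - ½ ∫₀ᵗ |y|²)`. -/
noncomputable def stochExp (x : ℝ) (a : ℝ → ℝ) (y : ℝ → EuclideanSpace ℝ (Fin d))
    (I : ℝ → Ω → ℝ) (t : ℝ) (ω : Ω) : ℝ :=
  x * Real.exp (∫ r in (0 : ℝ)..t, a r) * Real.exp (I t ω - (∫ r in (0 : ℝ)..t, ‖y r‖ ^ 2) / 2)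

omit mΩ in
lemma abs_integral_le_of_mem {a : ℝ → ℝ} {T : ℝ}
    (ha : IntervalIntegrable a volume 0 T) {t : ℝ} (ht : t ∈ Icc 0 T) :
    |∫ r in (0 : ℝ)..t, a r| ≤ ∫ r in (0 : ℝ)..T, |a r| :=
  (intervalIntegral.abs_integral_le_integral_abs ht.1).trans
    (intervalIntegral.integral_mono_interval le_rfl ht.1 ht.2
      (ae_of_all _ fun _ => abs_nonneg _) ha.abs)

omit mΩ in
lemma integral_norm_sq_le_of_mem {E : Type*} [NormedAddCommGroup E] {y : ℝ → E} {T : ℝ}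
    (hT : 0 ≤ T) (hy : MemLp y 2 (volume.restrict (Icc 0 T))) {t : ℝ} (ht : t ∈ Icc 0 T) :
    ∫ r in (0 : ℝ)..t, ‖y r‖ ^ 2 ≤ ∫ r in (0 : ℝ)..T, ‖y r‖ ^ 2 :=
  intervalIntegral.integral_mono_interval le_rfl ht.1 ht.2
    (ae_of_all _ fun _ => by positivity)
    (intervalIntegrable_norm_sq hy ⟨le_rfl, hT⟩ ⟨hT, le_rfl⟩)

omit mΩ in
lemma real_exp_sub_one_sub_le_sq {v : ℝ} (h0 : 0 ≤ v) (h1 : v ≤ 1) : Real.exp v - 1 - v ≤ v ^ 2 := by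
  have := Real.abs_exp_sub_one_sub_id_le (x := v) (by rwa [abs_of_nonneg h0])
  exact (le_abs_self _).trans this

lemma IndepGaussian.integral_sq_mul_comp {Ω : Type*} {m : MeasurableSpace Ω}
    [mΩ : MeasurableSpace Ω] {Q : Measure Ω}
    [IsProbabilityMeasure Q] {V Z : Ω → ℝ} {v : ℝ≥0} (h : IndepGaussian m Q V v) (hm : m ≤ mΩ)
    (hZ : Measurable[m] Z) {φ : ℝ → ℝ} (hφ : Measurable φ) :
    ∫ ω, (Z ω * φ (V ω)) ^ 2 ∂Q = (∫ ω, Z ω ^ 2 ∂Q) * ∫ z, φ z ^ 2 ∂(gaussianReal 0 v) := by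
  simp_rw [mul_pow]
  exact h.integral_mul_comp hm (hZ.pow_const 2) (φ := fun z => φ z ^ 2) (hφ.pow_const 2)

namespace IsWienerIntegral

variable {𝓕 : Filtration ℝ≥0 mΩ} {P : Measure Ω} [IsProbabilityMeasure P] {T : ℝ≥0}
  {B : ℝ≥0 → Ω → EuclideanSpace ℝ (Fin d)} {y : ℝ → EuclideanSpace ℝ (Fin d)} {I : ℝ → Ω → ℝ}
  {x : ℝ} {a : ℝ → ℝ}

/-- The law of the Wiener integral. -/
lemma indepGaussian_zero (h : IsWienerIntegral 𝓕 P B T y I) (hB : IsFilteredBM 𝓕 P T B)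
    (hy : MemLp y 2 (volume.restrict (Icc 0 (T : ℝ)))) {t : ℝ≥0} (ht : t ≤ T) :
    IndepGaussian (𝓕 0) P (I t) (∫ r in (0 : ℝ)..t, ‖y r‖ ^ 2).toNNReal := by
  have h1 := h.indepGaussian hB hy (zero_le : 0 ≤ t) ht
  rw [NNReal.coe_zero] at h1
  refine h1.congr_ae (h.measurable ht) ?_
  filter_upwards [h.eval_zero] with ω hω
  simp [hω]

omit [IsProbabilityMeasure P] in
lemma adapted_stochExp (h : IsWienerIntegral 𝓕 P B T y I) {t : ℝ≥0} (ht : t ≤ T) :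
    Measurable[𝓕 t] (stochExp x a y I t) := by
  have h1 := h.adapted t ht
  have h2 : Measurable[𝓕 t] fun ω => Real.exp (I t ω - (∫ r in (0 : ℝ)..t, ‖y r‖ ^ 2) / 2) :=
    Real.measurable_exp.comp (h1.sub_const _)
  exact h2.const_mul _

omit [IsProbabilityMeasure P] in
lemma measurable_stochExp (h : IsWienerIntegral 𝓕 P B T y I) {t : ℝ} (ht : t ∈ Icc 0 (T : ℝ)) :
    Measurable (stochExp x a y I t) := by
  lift t to ℝ≥0 using ht.1
  exact (h.adapted_stochExp (by exact_mod_cast ht.2)).mono (𝓕.le _) le_rfl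

omit [IsProbabilityMeasure P] in
lemma continuousOn_stochExp (h : IsWienerIntegral 𝓕 P B T y I)
    (hy : MemLp y 2 (volume.restrict (Icc 0 (T : ℝ)))) (ha : IntervalIntegrable a volume 0 T)
    (ω : Ω) : ContinuousOn (fun t => stochExp x a y I t ω) (Icc 0 (T : ℝ)) := by
  have h1 := continuousOn_primitive T.coe_nonneg ha
  have h2 := continuousOn_primitive T.coe_nonneg (intervalIntegrable_norm_sq hy
    ⟨le_rfl, T.coe_nonneg⟩ ⟨T.coe_nonneg, le_rfl⟩)
  have h3 := (h.continuous ω).continuousOn (s := Icc 0 (T : ℝ))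
  unfold stochExp
  exact (h1.rexp.const_mul x).mul ((h3.sub (h2.div_const 2)).rexp)

omit [IsProbabilityMeasure P] in
lemma integrable_sq_stochExp_aux (v : ℝ≥0) (c : ℝ) :
    Integrable (fun z : ℝ => (c * Real.exp (z - v / 2)) ^ 2) (gaussianReal 0 v) ∧
      ∫ z, (c * Real.exp (z - v / 2)) ^ 2 ∂(gaussianReal 0 v) = c ^ 2 * Real.exp v := by
  have e : (fun z : ℝ => (c * Real.exp (z - v / 2)) ^ 2) =
      fun z => c ^ 2 * Real.exp (-v) * Real.exp (2 * z) := by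
    ext z
    rw [mul_pow, ← Real.exp_nat_mul, mul_assoc, ← Real.exp_add]
    congr 2; push_cast; ring
  rw [e]
  refine ⟨(integrable_exp_mul_gaussianReal' v 2).const_mul _, ?_⟩
  rw [integral_const_mul, integral_exp_mul_gaussianReal, mul_assoc, ← Real.exp_add]
  congr 2; ring

lemma integral_stochExp_sq (h : IsWienerIntegral 𝓕 P B T y I) (hB : IsFilteredBM 𝓕 P T B)
    (hy : MemLp y 2 (volume.restrict (Icc 0 (T : ℝ)))) {t : ℝ≥0} (ht : t ≤ T) :
    MemLp (stochExp x a y I t) 2 P ∧ ∫ ω, stochExp x a y I t ω ^ 2 ∂P =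
      (x * Real.exp (∫ r in (0 : ℝ)..t, a r)) ^ 2 * Real.exp (∫ r in (0 : ℝ)..t, ‖y r‖ ^ 2) := by
  have hG := h.indepGaussian_zero hB hy ht
  have hV : 0 ≤ ∫ r in (0 : ℝ)..t, ‖y r‖ ^ 2 :=
    intervalIntegral.integral_nonneg t.coe_nonneg fun _ _ => by positivity
  set v := (∫ r in (0 : ℝ)..t, ‖y r‖ ^ 2).toNNReal with hv
  have hvV : (v : ℝ) = ∫ r in (0 : ℝ)..t, ‖y r‖ ^ 2 := Real.coe_toNNReal _ hV
  set c := x * Real.exp (∫ r in (0 : ℝ)..t, a r) with hc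
  obtain ⟨h1, h2⟩ := integrable_sq_stochExp_aux v c
  have hm : Measurable fun z : ℝ => (c * Real.exp (z - v / 2)) := by fun_prop
  have e : ∀ ω, stochExp x a y I t ω = c * Real.exp (I t ω - v / 2) := by
    intro ω; rw [stochExp, ← hc, hvV]
  constructor
  · rw [show stochExp x a y I t = fun ω => c * Real.exp (I t ω - v / 2) from funext e]
    exact hG.memLp_comp (φ := fun z => c * Real.exp (z - v / 2))
      ((memLp_two_iff_integrable_sq hm.aestronglyMeasurable).2 h1)
  · simp_rw [e]
    rw [hG.integral_comp (φ := fun z => (c * Real.exp (z - v / 2)) ^ 2) (hm.pow_const 2), h2, hvV]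

lemma integral_stochExp_sq_le (h : IsWienerIntegral 𝓕 P B T y I) (hB : IsFilteredBM 𝓕 P T B)
    (hy : MemLp y 2 (volume.restrict (Icc 0 (T : ℝ)))) (ha : IntervalIntegrable a volume 0 T)
    {t : ℝ≥0} (ht : t ≤ T) :
    ∫ ω, stochExp x a y I t ω ^ 2 ∂P ≤
      (x * Real.exp (∫ r in (0 : ℝ)..T, |a r|)) ^ 2 * Real.exp (∫ r in (0 : ℝ)..T, ‖y r‖ ^ 2) := by
  have ht' : (t : ℝ) ∈ Icc 0 (T : ℝ) := ⟨t.coe_nonneg, by exact_mod_cast ht⟩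
  rw [(h.integral_stochExp_sq hB hy ht).2, mul_pow, mul_pow]
  gcongr
  · exact (le_abs_self _).trans (abs_integral_le_of_mem ha ht')
  · exact integral_norm_sq_le_of_mem T.coe_nonneg hy ht'

/-- The martingale part of the error when the exponential is replaced by an elementary integral. -/
noncomputable def _root_.PortfolioES.expError (X : ℝ → Ω → ℝ) (y : ℝ → EuclideanSpace ℝ (Fin d))
    (I : ℝ → Ω → ℝ) (B : ℝ≥0 → Ω → EuclideanSpace ℝ (Fin d)) (g : ℕ → ℝ≥0)
    (η : ℕ → EuclideanSpace ℝ (Fin d)) (n : ℕ) (ω : Ω) : ℝ :=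
  ∑ i ∈ Finset.range n, X (g i) ω *
    wickRemainder (∫ r in (g i : ℝ)..g (i + 1), ‖y r‖ ^ 2).toNNReal (I (g (i + 1)) ω - I (g i) ω) +
  ∑ i ∈ Finset.range n, X (g i) ω *
    (1 * (I (g (i + 1)) ω - I (g i) ω) + ⟪-η i, B (g (i + 1)) ω - B (g i) ω⟫)

/-- Both sums consist of orthogonal differences, so second moments add. A cell of variance v_i
contributes at most v_i² ≤ τ v_i through the Wick remainder, and ∫|y - η_i|² through the replacement
of y by a constant; the weights have second moment at most C. -/
lemma memLp_expError (h : IsWienerIntegral 𝓕 P B T y I) (hB : IsFilteredBM 𝓕 P T B)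
    (hy : MemLp y 2 (volume.restrict (Icc 0 (T : ℝ)))) (ha : IntervalIntegrable a volume 0 T)
    {g : ℕ → ℝ≥0} (hg : Monotone g) (hg0 : g 0 = 0) (hgT : ∀ i, g i ≤ T)
    (η : ℕ → EuclideanSpace ℝ (Fin d))
    (n : ℕ) {τ : ℝ} (hτ : ∀ i, ∫ r in (g i : ℝ)..g (i + 1), ‖y r‖ ^ 2 ≤ τ) (hτ1 : τ ≤ 1) :
    MemLp (expError (stochExp x a y I) y I B g η n) 2 P ∧
      ∫ ω, expError (stochExp x a y I) y I B g η n ω ^ 2 ∂P ≤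
      2 * ((x * Real.exp (∫ r in (0 : ℝ)..T, |a r|)) ^ 2 *
        Real.exp (∫ r in (0 : ℝ)..T, ‖y r‖ ^ 2)) *
      (τ * (∫ r in (0 : ℝ)..T, ‖y r‖ ^ 2) +
        ∑ i ∈ Finset.range n, ∫ r in (g i : ℝ)..g (i + 1), ‖y r - η i‖ ^ 2) := by
  set C := (x * Real.exp (∫ r in (0 : ℝ)..T, |a r|)) ^ 2 *
    Real.exp (∫ r in (0 : ℝ)..T, ‖y r‖ ^ 2) with hC
  have hC0 : 0 ≤ C := by positivity
  have hle : ∀ i, g i ≤ g (i + 1) := fun i => hg (Nat.le_succ i)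
  have hle' : ∀ i, (g i : ℝ) ≤ g (i + 1) := fun i => by exact_mod_cast hle i
  set X := stochExp x a y I with hX
  set 𝓖 := gridFiltration 𝓕 hg
  have hXm : ∀ i, Measurable[𝓖 i] (X (g i)) := fun i => h.adapted_stochExp (hgT i)
  have hX2 : ∀ i, MemLp (X (g i)) 2 P := fun i => (h.integral_stochExp_sq hB hy (hgT i)).1
  have hIm : ∀ i, Measurable[𝓖 (i + 1)] fun ω => I (g (i + 1)) ω - I (g i) ω := fun i =>
    (h.adapted _ (hgT (i + 1))).sub ((h.adapted _ (hgT i)).mono (𝓕.mono (hle i)) le_rfl)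
  have hBm : ∀ i, Measurable[𝓖 (i + 1)] fun ω =>
      1 * (I (g (i + 1)) ω - I (g i) ω) + ⟪-η i, B (g (i + 1)) ω - B (g i) ω⟫ := fun i => by
    have h2 : Measurable[𝓖 (i + 1)] (B (g i)) := (hB.adapted _).mono (𝓕.mono (hle i)) le_rfl
    exact ((hIm i).const_mul 1).add (Measurable.inner measurable_const ((hB.adapted _).sub h2))
  have m1 := IndepGaussian.isMartDiff (𝓖 := 𝓖)
    (fun i => h.indepGaussian hB hy (hle i) (hgT (i + 1))) hIm hXm hX2
    (fun i => measurable_wickRemainder _) (fun i => memLp_wickRemainder _)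
    (fun i => integral_wickRemainder _)
  have m2 := IndepGaussian.isMartDiff (𝓖 := 𝓖)
    (fun i => h.indepGaussian_add hB hy (hle i) (hgT (i + 1)) 1 (-η i)) hBm hXm hX2
    (φ := fun _ z => z) (fun i => measurable_id) (fun i => memLp_id_gaussianReal' 2 (by simp))
    (fun i => integral_id_gaussianReal)
  refine ⟨(m1.memLp_sum n).add (m2.memLp_sum n), ?_⟩
  have hcell : ∀ i, 0 ≤ ∫ r in (g i : ℝ)..g (i + 1), ‖y r‖ ^ 2 := fun i =>
    intervalIntegral.integral_nonneg (hle' i) fun _ _ => by positivity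
  have hEX : ∀ i, ∫ ω, X (g i) ω ^ 2 ∂P ≤ C := fun i =>
    h.integral_stochExp_sq_le hB hy ha (hgT i)
  have hsum : ∑ i ∈ Finset.range n, ∫ r in (g i : ℝ)..g (i + 1), ‖y r‖ ^ 2 ≤
      ∫ r in (0 : ℝ)..T, ‖y r‖ ^ 2 := by
    have hmem : ∀ i, (g i : ℝ) ∈ Icc 0 (T : ℝ) := fun i =>
      ⟨(g i).coe_nonneg, by exact_mod_cast hgT i⟩
    rw [intervalIntegral.sum_integral_adjacent_intervals (a := fun i => (g i : ℝ))
      fun i _ => intervalIntegrable_norm_sq hy (hmem i) (hmem (i + 1)), hg0]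
    exact integral_norm_sq_le_of_mem T.coe_nonneg hy (hmem n)
  have b1 : ∫ ω, (∑ i ∈ Finset.range n, X (g i) ω * wickRemainder
      (∫ r in (g i : ℝ)..g (i + 1), ‖y r‖ ^ 2).toNNReal (I (g (i + 1)) ω - I (g i) ω)) ^ 2 ∂P ≤
      C * (τ * ∫ r in (0 : ℝ)..T, ‖y r‖ ^ 2) := by
    rw [m1.integral_sum_sq n]
    have hτ0 : 0 ≤ τ := (hcell 0).trans (hτ 0)
    calc _ ≤ ∑ i ∈ Finset.range n, C * (τ * ∫ r in (g i : ℝ)..g (i + 1), ‖y r‖ ^ 2) := by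
          refine Finset.sum_le_sum fun i _ => ?_
          rw [(h.indepGaussian hB hy (hle i) (hgT (i + 1))).integral_sq_mul_comp (𝓕.le _)
            (hXm i) (measurable_wickRemainder _)]
          rw [integral_wickRemainder_sq, Real.coe_toNNReal _ (hcell i)]
          have h1 := real_exp_sub_one_sub_le_sq (hcell i) ((hτ i).trans hτ1)
          have h2 : 0 ≤ ∫ ω, X (g i) ω ^ 2 ∂P := integral_nonneg fun _ => sq_nonneg _
          have h3 := hcell i
          have h4 := hτ i
          calc _ ≤ (∫ ω, X (g i) ω ^ 2 ∂P) * (τ * ∫ r in (g i : ℝ)..g (i + 1), ‖y r‖ ^ 2) := by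
                refine mul_le_mul_of_nonneg_left (h1.trans ?_) h2
                rw [sq]; exact mul_le_mul_of_nonneg_right h4 h3
            _ ≤ _ := mul_le_mul_of_nonneg_right (hEX i) (by positivity)
      _ ≤ _ := by rw [← Finset.mul_sum, ← Finset.mul_sum]; gcongr
  have b2 : ∫ ω, (∑ i ∈ Finset.range n, X (g i) ω *
      (1 * (I (g (i + 1)) ω - I (g i) ω) + ⟪-η i, B (g (i + 1)) ω - B (g i) ω⟫)) ^ 2 ∂P ≤
      C * ∑ i ∈ Finset.range n, ∫ r in (g i : ℝ)..g (i + 1), ‖y r - η i‖ ^ 2 := by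
    rw [m2.integral_sum_sq n, Finset.mul_sum]
    refine Finset.sum_le_sum fun i _ => ?_
    have e := (h.indepGaussian_add hB hy (hle i) (hgT (i + 1)) 1 (-η i)).integral_sq_mul_comp
      (𝓕.le _) (hXm i) measurable_id
    simp only [id] at e
    rw [e]
    have h0 : 0 ≤ ∫ r in (g i : ℝ)..g (i + 1), ‖y r - η i‖ ^ 2 :=
      intervalIntegral.integral_nonneg (hle' i) fun _ _ => by positivity
    simp only [one_smul, ← sub_eq_add_neg]
    rw [integral_sq_gaussianReal, Real.coe_toNNReal _ h0]
    exact mul_le_mul_of_nonneg_right (hEX i) h0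
  have i1 := (m1.memLp_sum n).integrable_sq
  have i2 := (m2.memLp_sum n).integrable_sq
  calc _ ≤ ∫ ω, (2 * (∑ i ∈ Finset.range n, X (g i) ω * wickRemainder
        (∫ r in (g i : ℝ)..g (i + 1), ‖y r‖ ^ 2).toNNReal (I (g (i + 1)) ω - I (g i) ω)) ^ 2 +
        2 * (∑ i ∈ Finset.range n, X (g i) ω *
        (1 * (I (g (i + 1)) ω - I (g i) ω) + ⟪-η i, B (g (i + 1)) ω - B (g i) ω⟫)) ^ 2) ∂P := by
        refine integral_mono_of_nonneg (ae_of_all _ fun _ => sq_nonneg _)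
          ((i1.const_mul 2).add (i2.const_mul 2)) (ae_of_all _ fun ω => ?_)
        simp only [expError]
        rw [← mul_add]; exact add_sq_le
    _ ≤ _ := by
        rw [integral_add (i1.const_mul 2) (i2.const_mul 2), integral_const_mul, integral_const_mul]
        linarith

end IsWienerIntegral

end PortfolioES

namespace PortfolioES

variable {d : ℕ} {Ω : Type*} [mΩ : MeasurableSpace Ω]

/-! ### The stochastic exponential solves its equation -/

lemma tendstoInMeasure_add {P : Measure Ω} {f f' : ℕ → Ω → ℝ} {h h' : Ω → ℝ}
    (hf : TendstoInMeasure P f atTop h) (hf' : TendstoInMeasure P f' atTop h') :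
    TendstoInMeasure P (fun k ω => f k ω + f' k ω) atTop (fun ω => h ω + h' ω) := by
  rw [tendstoInMeasure_iff_norm] at hf hf' ⊢
  intro ε hε
  have := (hf (ε / 2) (by positivity)).add (hf' (ε / 2) (by positivity))
  rw [add_zero] at this
  refine tendsto_of_tendsto_of_tendsto_of_le_of_le tendsto_const_nhds this (fun _ => zero_le)
    fun k => (measure_mono ?_).trans (measure_union_le _ _)
  intro ω hω
  simp only [Set.mem_ofPred_eq, mem_union, Real.norm_eq_abs] at hω ⊢
  by_contra hcon
  push Not at hcon
  have := abs_add_le (f k ω - h ω) (f' k ω - h' ω)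
  rw [show f k ω - h ω + (f' k ω - h' ω) = f k ω + f' k ω - (h ω + h' ω) by ring] at this
  linarith [hcon.1, hcon.2]

/-- Truncation of a real number to `[-k, k]`. -/
def clip (k z : ℝ) : ℝ := max (-k) (min k z)

lemma measurable_clip (k : ℝ) : Measurable (clip k) := by unfold clip; fun_prop

lemma abs_clip_le {k : ℝ} (hk : 0 ≤ k) (z : ℝ) : |clip k z| ≤ k :=
  abs_le.2 ⟨le_max_left _ _, max_le (by linarith) (min_le_left _ _)⟩

lemma clip_eq {k z : ℝ} (h : |z| ≤ k) : clip k z = z := by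
  rw [clip, min_eq_right (abs_le.1 h).2, max_eq_right (abs_le.1 h).1]

omit mΩ in
lemma exists_mesh_le {f : ℝ → ℝ} {T : ℝ} (hf : ContinuousOn f (Icc 0 T)) {ε : ℝ} (hε : 0 < ε) :
    ∃ δ > 0, ∀ s ∈ Icc 0 T, ∀ t ∈ Icc 0 T, |t - s| ≤ δ → |f t - f s| ≤ ε := by
  have h := isCompact_Icc.uniformContinuousOn_of_continuous hf
  rw [Metric.uniformContinuousOn_iff] at h
  obtain ⟨δ, hδ, h⟩ := h ε hε
  refine ⟨δ / 2, by positivity, fun s hs t ht hst => ?_⟩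
  have := h t ht s hs (by rw [Real.dist_eq]; linarith)
  rw [Real.dist_eq] at this
  exact this.le

omit mΩ in
lemma min_uGrid_sub_le (T : ℝ≥0) (N i : ℕ) (t : ℝ≥0) :
    ((min (uGrid T N (i + 1)) t : ℝ≥0) : ℝ) - (min (uGrid T N i) t : ℝ≥0) ≤ T / N := by
  refine le_trans ?_ (uGrid_succ_sub_le T N i)
  have h : (uGrid T N i : ℝ) ≤ uGrid T N (i + 1) := by
    exact_mod_cast uGrid_mono T N (Nat.le_succ i)
  rw [NNReal.coe_min, NNReal.coe_min]
  rcases le_total (uGrid T N (i + 1) : ℝ) t with h1 | h1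
  · rw [min_eq_left h1, min_eq_left (h.trans h1)]
  · rw [min_eq_right h1]
    rcases le_total (uGrid T N i : ℝ) t with h2 | h2
    · rw [min_eq_left h2]; linarith
    · rw [min_eq_right h2]; linarith

lemma IsStepApprox.tendsto_mesh {T : ℝ≥0} {y : ℝ → EuclideanSpace ℝ (Fin d)} {N : ℕ → ℕ}
    {η : ℕ → ℕ → EuclideanSpace ℝ (Fin d)} (h : IsStepApprox T y N η) {δ : ℝ} (hδ : 0 < δ) :
    ∀ᶠ k in atTop, (T : ℝ) / N k ≤ δ :=
  (((tendsto_pow_atTop_nhds_zero_of_lt_one (r := (1 / 16 : ℝ)) (by norm_num)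
    (by norm_num)).eventually_lt_const hδ).mono fun k hk => (h.mesh k).trans hk.le)

namespace IsWienerIntegral

variable {𝓕 : Filtration ℝ≥0 mΩ} {P : Measure Ω} [IsProbabilityMeasure P] {T : ℝ≥0}
  {B : ℝ≥0 → Ω → EuclideanSpace ℝ (Fin d)} {y : ℝ → EuclideanSpace ℝ (Fin d)} {I : ℝ → Ω → ℝ}
  {x : ℝ} {a : ℝ → ℝ}

omit [IsProbabilityMeasure P] mΩ in
-- Without drift, the exponential changes over a cell by its value at the left endpoint times ΔI
-- plus the Wick remainder of ΔI, exactly. The deterministic drift factor then costs only the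
-- oscillation error of the product rule. The statement is pathwise; the probabilistic part is
-- confined to `expError`.
lemma abs_stochExp_sub_sum_le (hI : Continuous fun t => I t ω) (hI0 : I 0 ω = 0)
    (hy : MemLp y 2 (volume.restrict (Icc 0 (T : ℝ)))) (ha : IntervalIntegrable a volume 0 T)
    {g : ℕ → ℝ≥0} (hg : Monotone g) (hg0 : g 0 = 0) (hgT : ∀ i, g i ≤ T)
    (η : ℕ → EuclideanSpace ℝ (Fin d)) {w : ℝ}
    (hw : ∀ i, ∀ s ∈ Icc (g i : ℝ) (g (i + 1)),
      |stochExp 1 (fun _ => 0) y I (g (i + 1)) ω - stochExp 1 (fun _ => 0) y I s ω| ≤ w) (n : ℕ) :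
    |(stochExp x a y I (g n) ω - x - ∫ s in (0 : ℝ)..g n, stochExp x a y I s ω * a s) -
      (expError (stochExp x a y I) y I B g η n ω +
      ∑ i ∈ Finset.range n, stochExp x a y I (g i) ω * ⟪η i, B (g (i + 1)) ω - B (g i) ω⟫)| ≤
    |x| * (w * ∫ s in (0 : ℝ)..g n, |a s * Real.exp (∫ r in (0 : ℝ)..s, a r)|) := by
  set E : ℝ → ℝ := fun t => stochExp 1 (fun _ => 0) y I t ω with hE
  have hEq : ∀ t, E t = Real.exp (I t ω - (∫ r in (0 : ℝ)..t, ‖y r‖ ^ 2) / 2) := fun t => by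
    simp [hE, stochExp]
  have hXE : ∀ t, stochExp x a y I t ω = x * Real.exp (∫ r in (0 : ℝ)..t, a r) * E t := fun t => by
    rw [hEq, stochExp]
  have hEc : ContinuousOn E (Icc 0 (T : ℝ)) := by
    have h2 := continuousOn_primitive T.coe_nonneg (intervalIntegrable_norm_sq hy
      ⟨le_rfl, T.coe_nonneg⟩ ⟨T.coe_nonneg, le_rfl⟩)
    rw [show E = fun t => _ from funext hEq]
    exact ((hI.continuousOn.sub (h2.div_const 2)).rexp)
  have key := abs_sub_sum_le_of_osc ha hEc hg hg0 hgT hw n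
  have hE0 : E 0 = 1 := by rw [hEq, hI0]; simp
  have hmem : ∀ i, (g i : ℝ) ∈ Icc 0 (T : ℝ) := fun i =>
    ⟨(g i).coe_nonneg, by exact_mod_cast hgT i⟩
  refine le_of_eq_of_le ?_ (mul_le_mul_of_nonneg_left key (abs_nonneg x))
  rw [← abs_mul]
  congr 1
  have hstep : ∀ i, E (g (i + 1)) - E (g i) = E (g i) *
      (wickRemainder (∫ r in (g i : ℝ)..g (i + 1), ‖y r‖ ^ 2).toNNReal
        (I (g (i + 1)) ω - I (g i) ω) + (I (g (i + 1)) ω - I (g i) ω)) := by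
    intro i
    have h0 : 0 ≤ ∫ r in (g i : ℝ)..g (i + 1), ‖y r‖ ^ 2 :=
      intervalIntegral.integral_nonneg (by exact_mod_cast hg (Nat.le_succ i))
        fun _ _ => by positivity
    have hadd : (∫ r in (0 : ℝ)..g (i + 1), ‖y r‖ ^ 2) = (∫ r in (0 : ℝ)..g i, ‖y r‖ ^ 2) +
        ∫ r in (g i : ℝ)..g (i + 1), ‖y r‖ ^ 2 :=
      (intervalIntegral.integral_add_adjacent_intervals
        (intervalIntegrable_norm_sq hy ⟨le_rfl, T.coe_nonneg⟩ (hmem i))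
        (intervalIntegrable_norm_sq hy (hmem i) (hmem (i + 1)))).symm
    rw [wickRemainder, Real.coe_toNNReal _ h0]
    have : E (g (i + 1)) = E (g i) * Real.exp (I (g (i + 1)) ω - I (g i) ω -
        (∫ r in (g i : ℝ)..g (i + 1), ‖y r‖ ^ 2) / 2) := by
      rw [hEq, hEq, hadd, ← Real.exp_add]; congr 1; ring
    rw [this]; ring
  simp only [hXE, hstep, expError, hE0]
  rw [← Finset.sum_add_distrib, ← Finset.sum_add_distrib]
  have hint : ∫ s in (0 : ℝ)..g n, x * Real.exp (∫ r in (0 : ℝ)..s, a r) * E s * a s =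
      x * ∫ s in (0 : ℝ)..g n, a s * Real.exp (∫ r in (0 : ℝ)..s, a r) * E s := by
    rw [← intervalIntegral.integral_const_mul]
    exact intervalIntegral.integral_congr fun s _ => by ring
  have hsum : ∀ i, x * Real.exp (∫ r in (0 : ℝ)..g i, a r) * E (g i) * wickRemainder
      (∫ r in (g i : ℝ)..g (i + 1), ‖y r‖ ^ 2).toNNReal (I (g (i + 1)) ω - I (g i) ω) +
      x * Real.exp (∫ r in (0 : ℝ)..g i, a r) * E (g i) *
      (1 * (I (g (i + 1)) ω - I (g i) ω) + ⟪-η i, B (g (i + 1)) ω - B (g i) ω⟫) +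
      x * Real.exp (∫ r in (0 : ℝ)..g i, a r) * E (g i) * ⟪η i, B (g (i + 1)) ω - B (g i) ω⟫ =
      x * (Real.exp (∫ r in (0 : ℝ)..g i, a r) * (E (g i) *
      (wickRemainder (∫ r in (g i : ℝ)..g (i + 1), ‖y r‖ ^ 2).toNNReal
        (I (g (i + 1)) ω - I (g i) ω) + (I (g (i + 1)) ω - I (g i) ω)))) := by
    intro i
    rw [inner_neg_left]; ring
  simp_rw [hsum]
  rw [← Finset.mul_sum, hint]
  ring

end IsWienerIntegral

end PortfolioES

/-! ### The Itô equation of the stochastic exponential -/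

namespace PortfolioES

variable {d : ℕ} {Ω : Type*} [mΩ : MeasurableSpace Ω]

namespace IsWienerIntegral

variable {𝓕 : Filtration ℝ≥0 mΩ} {P : Measure Ω} [IsProbabilityMeasure P] {T : ℝ≥0}
  {B : ℝ≥0 → Ω → EuclideanSpace ℝ (Fin d)} {y : ℝ → EuclideanSpace ℝ (Fin d)} {I : ℝ → Ω → ℝ}
  {x : ℝ} {a : ℝ → ℝ}

/-- Coefficients of the elementary integrals approximating the stochastic exponential. -/
noncomputable def _root_.PortfolioES.expCoef (X : ℝ → Ω → ℝ) (T : ℝ≥0) (N k : ℕ)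
    (η : ℕ → EuclideanSpace ℝ (Fin d)) (i : ℕ) (ω : Ω) : EuclideanSpace ℝ (Fin d) :=
  clip k (X (uGrid T N i) ω) • if i < N then η i else 0

omit [IsProbabilityMeasure P] in
lemma exists_expSimple (h : IsWienerIntegral 𝓕 P B T y I) {N : ℕ} (hN : 0 < N) (k : ℕ)
    (η : ℕ → EuclideanSpace ℝ (Fin d)) :
    ∃ S : SimpleIntegrand 𝓕 d, S.n = N ∧ S.time = uGrid T N ∧
      S.coef = expCoef (stochExp x a y I) T N k η :=
  ⟨uSimple T N (expCoef (stochExp x a y I) T N k η)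
    (fun i => ((measurable_clip _).comp (h.adapted_stochExp (uGrid_le T hN i))).smul_const _)
    ⟨k * ∑ i ∈ Finset.range N, ‖η i‖, fun i ω => by
      rw [expCoef, norm_smul]
      refine mul_le_mul (abs_clip_le (Nat.cast_nonneg k) _) ?_ (norm_nonneg _) (Nat.cast_nonneg k)
      split_ifs with hi
      · exact Finset.single_le_sum (f := fun i => ‖η i‖) (fun _ _ => norm_nonneg _)
          (Finset.mem_range.2 hi)
      · simpa using Finset.sum_nonneg fun _ _ => norm_nonneg _⟩, rfl, rfl, rfl⟩

/-- Clipping at k is there only to make the coefficients bounded. On a path bounded by k it is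
inactive, and every continuous path is bounded by all large k. -/
lemma expSimple_val {S : SimpleIntegrand 𝓕 d} {N k : ℕ} (hN : 0 < N) {X : ℝ → Ω → ℝ}
    {η : ℕ → EuclideanSpace ℝ (Fin d)}
    (h1 : S.n = N) (h2 : S.time = uGrid T N) (h3 : S.coef = expCoef X T N k η) {ω : Ω}
    (hX : ∀ t ∈ Icc 0 (T : ℝ), |X t ω| ≤ k) {s : ℝ} (hs : s ∈ Ioc 0 (T : ℝ)) :
    ∃ i < N, s ∈ Ioc (uGrid T N i : ℝ) (uGrid T N (i + 1)) ∧
      S.val s ω = X (uGrid T N i) ω • stepFun T N η s := by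
  obtain ⟨i, hi, hsi⟩ := exists_mem_uGrid_cell hN hs
  refine ⟨i, hi, hsi, ?_⟩
  have e : S.val s ω = stepFun T N (fun i => expCoef X T N k η i ω) s := by
    simp only [SimpleIntegrand.val, stepFun, h1, h2, h3]
  rw [e, stepFun_eq hi hsi, stepFun_eq hi hsi, expCoef, if_pos hi, clip_eq]
  exact hX _ ⟨NNReal.coe_nonneg _, by exact_mod_cast uGrid_le T hN i⟩

lemma expSimple_integral {S : SimpleIntegrand 𝓕 d} {N k : ℕ} (hN : 0 < N) {X : ℝ → Ω → ℝ}
    {η : ℕ → EuclideanSpace ℝ (Fin d)}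
    (h1 : S.n = N) (h2 : S.time = uGrid T N) (h3 : S.coef = expCoef X T N k η) {ω : Ω}
    (hX : ∀ t ∈ Icc 0 (T : ℝ), |X t ω| ≤ k) (t : ℝ≥0) :
    S.integral B t ω = ∑ i ∈ Finset.range N, X (min (uGrid T N i) t : ℝ≥0) ω *
      ⟪η i, B (min (uGrid T N (i + 1)) t) ω - B (min (uGrid T N i) t) ω⟫ := by
  simp only [SimpleIntegrand.integral, h1, h2, h3]
  refine Finset.sum_congr rfl fun i hi => ?_
  rw [expCoef, if_pos (Finset.mem_range.1 hi), clip_eq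
    (hX _ ⟨NNReal.coe_nonneg _, by exact_mod_cast uGrid_le T hN i⟩), real_inner_smul_left]
  -- Replacing the grid point by its minimum with t inside X is harmless: it matters only on cells
  -- after t, where the increment of B vanishes. The formula then lives on the grid stopped at t.
  rcases le_total (uGrid T N i) t with h | h
  · rw [min_eq_left h]
  · rw [min_eq_right h, min_eq_right (h.trans (uGrid_mono T N (Nat.le_succ i)))]
    simp

omit [IsProbabilityMeasure P] in
lemma _root_.PortfolioES.aestronglyMeasurable_norm_sq_integral {H H' : ℝ → Ω → EuclideanSpace ℝ (Fin d)}
    (h1 : AEStronglyMeasurable (fun p : Ω × ℝ => H p.2 p.1)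
      (P.prod (volume.restrict (Icc 0 (T : ℝ)))))
    (h2 : AEStronglyMeasurable (fun p : Ω × ℝ => H' p.2 p.1)
      (P.prod (volume.restrict (Icc 0 (T : ℝ))))) :
    AEStronglyMeasurable (fun ω => ∫ s in (0 : ℝ)..T, ‖H s ω - H' s ω‖ ^ 2) P := by
  have h3 := ((h1.sub h2).norm.pow 2).integral_prod_right'
  refine h3.congr (ae_of_all _ fun ω => ?_)
  simp only [Pi.pow_apply, Pi.sub_apply]
  rw [intervalIntegral.integral_of_le T.coe_nonneg, ← integral_Icc_eq_integral_Ioc]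

lemma aestronglyMeasurable_stochExp (h : IsWienerIntegral 𝓕 P B T y I)
    (hy : MemLp y 2 (volume.restrict (Icc 0 (T : ℝ)))) (ha : IntervalIntegrable a volume 0 T) :
    AEStronglyMeasurable (fun p : Ω × ℝ => stochExp x a y I p.2 p.1)
      (P.prod (volume.restrict (Icc 0 (T : ℝ)))) :=
  aestronglyMeasurable_uncurry T.coe_nonneg (fun ω => h.continuousOn_stochExp hy ha ω)
    fun _ ht => h.measurable_stochExp ht

omit [IsProbabilityMeasure P] in
lemma memLp_stochExp_smul (h : IsWienerIntegral 𝓕 P B T y I)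
    (hy : MemLp y 2 (volume.restrict (Icc 0 (T : ℝ)))) (ha : IntervalIntegrable a volume 0 T)
    (ω : Ω) : MemLp (fun s => stochExp x a y I s ω • y s) 2 (volume.restrict (Icc 0 (T : ℝ))) := by
  have hc := h.continuousOn_stochExp (x := x) hy ha ω
  obtain ⟨C, hC⟩ := isCompact_Icc.exists_bound_of_continuousOn hc
  refine MemLp.of_le_mul (c := C) hy
    ((hc.aestronglyMeasurable measurableSet_Icc).smul hy.1) ?_
  filter_upwards [ae_restrict_mem measurableSet_Icc] with s hs
  rw [norm_smul]
  exact mul_le_mul_of_nonneg_right (hC s hs) (norm_nonneg _)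

omit [IsProbabilityMeasure P] in
-- The error splits as X(u_i)(step - y) + (X(u_i) - X_s)y: the first part is small since the steps
-- approximate y and the path is bounded, the second by uniform continuity of the path.
lemma tendsto_expSimple_val (h : IsWienerIntegral 𝓕 P B T y I)
    (hy : MemLp y 2 (volume.restrict (Icc 0 (T : ℝ)))) (ha : IntervalIntegrable a volume 0 T)
    {N : ℕ → ℕ} {η : ℕ → ℕ → EuclideanSpace ℝ (Fin d)} (hN : IsStepApprox T y N η)
    {S : ℕ → SimpleIntegrand 𝓕 d} (h1 : ∀ k, (S k).n = N k) (h2 : ∀ k, (S k).time = uGrid T (N k))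
    (h3 : ∀ k, (S k).coef = expCoef (stochExp x a y I) T (N k) k (η k)) (ω : Ω) :
    Tendsto (fun k => ∫ s in (0 : ℝ)..T, ‖(S k).val s ω - stochExp x a y I s ω • y s‖ ^ 2) atTop
      (𝓝 0) := by
  set X := stochExp x a y I with hX
  have hc : ContinuousOn (fun t => X t ω) (Icc 0 (T : ℝ)) := h.continuousOn_stochExp hy ha ω
  obtain ⟨C, hC⟩ := isCompact_Icc.exists_bound_of_continuousOn hc
  have h0T : (0 : ℝ) ∈ Icc 0 (T : ℝ) := ⟨le_rfl, T.coe_nonneg⟩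
  have hTT : (T : ℝ) ∈ Icc 0 (T : ℝ) := ⟨T.coe_nonneg, le_rfl⟩
  set G := ∫ s in (0 : ℝ)..T, ‖y s‖ ^ 2 with hG
  have hG0 : 0 ≤ G := intervalIntegral.integral_nonneg T.coe_nonneg fun _ _ => by positivity
  have hC0 : 0 ≤ C := (norm_nonneg _).trans (hC 0 h0T)
  rw [Metric.tendsto_atTop']
  intro ε hε
  set w := Real.sqrt (ε / (8 * (G + 1))) with hw
  have hw0 : 0 < w := Real.sqrt_pos.2 (by positivity)
  obtain ⟨δ, hδ, hosc⟩ := exists_mesh_le hc hw0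
  have hpow := tendsto_pow_atTop_nhds_zero_of_lt_one (r := (1 / 16 : ℝ)) (by norm_num)
    (by norm_num)
  have hev : ∀ᶠ k : ℕ in atTop, (T : ℝ) / N k ≤ δ ∧ C ≤ k ∧ (1 / 16 : ℝ) ^ k < ε / (8 * (C ^ 2 + 1)) :=
    (hN.tendsto_mesh hδ).and ((tendsto_natCast_atTop_atTop.eventually_ge_atTop C).and
      (hpow.eventually_lt_const (by positivity)))
  obtain ⟨n, hn⟩ := eventually_atTop.1 hev
  refine ⟨n, fun k hk => ?_⟩
  obtain ⟨hk1, hk2, hk3⟩ := hn k hk.le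
  have hXk : ∀ t ∈ Icc 0 (T : ℝ), |X t ω| ≤ k := fun t ht => (hC t ht).trans hk2
  have i1 : IntervalIntegrable (fun s => ‖stepFun T (N k) (η k) s - y s‖ ^ 2) volume 0 T :=
    intervalIntegrable_norm_sq (((memLp_stepFun T (N k) (η k) 2).restrict _).sub hy) h0T hTT
  have i2 := intervalIntegrable_norm_sq hy h0T hTT
  have hb : ∀ s ∈ Ioo (0 : ℝ) T, ‖(S k).val s ω - X s ω • y s‖ ^ 2 ≤
      2 * C ^ 2 * ‖stepFun T (N k) (η k) s - y s‖ ^ 2 + 2 * w ^ 2 * ‖y s‖ ^ 2 := by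
    intro s hs
    obtain ⟨i, hi, hsi, e⟩ := expSimple_val (hN.pos k) (h1 k) (h2 k) (h3 k) hXk ⟨hs.1, hs.2.le⟩
    have hu : (uGrid T (N k) i : ℝ) ∈ Icc 0 (T : ℝ) :=
      ⟨NNReal.coe_nonneg _, by exact_mod_cast uGrid_le T (hN.pos k) i⟩
    have e2 : (S k).val s ω - X s ω • y s = X (uGrid T (N k) i) ω •
        (stepFun T (N k) (η k) s - y s) + (X (uGrid T (N k) i) ω - X s ω) • y s := by
      rw [e, smul_sub, sub_smul]; abel
    have hd : |X (uGrid T (N k) i) ω - X s ω| ≤ w := by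
      refine hosc s ⟨hs.1.le, hs.2.le⟩ _ hu ?_
      rw [abs_sub_comm, abs_of_nonneg (sub_nonneg.2 hsi.1.le)]
      have := uGrid_succ_sub_le T (N k) i
      linarith [hsi.2]
    have n1 : ‖X (uGrid T (N k) i) ω • (stepFun T (N k) (η k) s - y s)‖ ≤
        C * ‖stepFun T (N k) (η k) s - y s‖ := by
      rw [norm_smul]; exact mul_le_mul_of_nonneg_right (hC _ hu) (norm_nonneg _)
    have n2 : ‖(X (uGrid T (N k) i) ω - X s ω) • y s‖ ≤ w * ‖y s‖ := by
      rw [norm_smul]; exact mul_le_mul_of_nonneg_right hd (norm_nonneg _)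
    rw [e2]
    calc _ ≤ (C * ‖stepFun T (N k) (η k) s - y s‖ + w * ‖y s‖) ^ 2 :=
          pow_le_pow_left₀ (norm_nonneg _) ((norm_add_le _ _).trans (add_le_add n1 n2)) 2
      _ ≤ 2 * ((C * ‖stepFun T (N k) (η k) s - y s‖) ^ 2 + (w * ‖y s‖) ^ 2) := add_sq_le
      _ = _ := by ring
  have i0 : IntervalIntegrable (fun s => ‖(S k).val s ω - X s ω • y s‖ ^ 2) volume 0 T :=
    intervalIntegrable_norm_sq ((((S k).memLp_val ω 2).restrict _).sub
      (h.memLp_stochExp_smul hy ha ω)) h0T hTT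
  have hle := intervalIntegral.integral_mono_on_of_le_Ioo T.coe_nonneg i0
    ((i1.const_mul (2 * C ^ 2)).add (i2.const_mul (2 * w ^ 2))) hb
  rw [intervalIntegral.integral_add (i1.const_mul _) (i2.const_mul _),
    intervalIntegral.integral_const_mul, intervalIntegral.integral_const_mul] at hle
  have hw2 : w ^ 2 = ε / (8 * (G + 1)) := Real.sq_sqrt (by positivity)
  rw [Real.dist_eq, sub_zero, abs_of_nonneg (intervalIntegral.integral_nonneg T.coe_nonneg
    fun _ _ => by positivity)]
  have b1 : 2 * w ^ 2 * G ≤ ε / 4 := by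
    rw [hw2, mul_div_assoc', div_mul_eq_mul_div, div_le_div_iff₀ (by positivity) (by positivity)]
    nlinarith
  have b2 : 2 * C ^ 2 * ∫ s in (0 : ℝ)..T, ‖stepFun T (N k) (η k) s - y s‖ ^ 2 ≤ ε / 4 := by
    calc _ ≤ 2 * C ^ 2 * (ε / (8 * (C ^ 2 + 1))) := by
          gcongr; exact (hN.approx k).trans hk3.le
      _ ≤ ε / 4 := by
        rw [mul_div_assoc', div_le_div_iff₀ (by positivity) (by positivity)]
        nlinarith [sq_nonneg C]
  linarith

/-- The candidate integral M is defined as X - x - ∫Xa, so the equation holds by construction and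
only the convergence of the elementary integrals to M_t is at stake. Their difference is minus
`expError`, which tends to 0 in L², plus a term that tends to 0 on every good path. -/
theorem isIto_stochExp (h : IsWienerIntegral 𝓕 P B T y I) (hB : IsFilteredBM 𝓕 P T B)
    (hy : MemLp y 2 (volume.restrict (Icc 0 (T : ℝ)))) (ha : IntervalIntegrable a volume 0 T) :
    IsItoProcess 𝓕 P B T x (fun t ω => stochExp x a y I t ω * a t)
      (fun t ω => stochExp x a y I t ω • y t) (stochExp x a y I) := by
  obtain ⟨N, η, hN, -⟩ := id h.approx
  set X := stochExp x a y I with hX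
  have h0T : (0 : ℝ) ∈ Icc 0 (T : ℝ) := ⟨le_rfl, T.coe_nonneg⟩
  have hTT : (T : ℝ) ∈ Icc 0 (T : ℝ) := ⟨T.coe_nonneg, le_rfl⟩
  have hXc : ∀ ω, ContinuousOn (fun t => X t ω) (Icc 0 (T : ℝ)) := fun ω =>
    h.continuousOn_stochExp hy ha ω
  have hXa : ∀ ω, IntervalIntegrable (fun s => X s ω * a s) volume 0 T := fun ω => by
    refine ha.continuousOn_mul ?_
    rw [uIcc_of_le T.coe_nonneg]; exact hXc ω
  have hXm := h.aestronglyMeasurable_stochExp (x := x) hy ha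
  have hE1 : ∀ ω, ContinuousOn (fun t => stochExp 1 (fun _ => 0) y I t ω) (Icc 0 (T : ℝ)) :=
    fun ω => h.continuousOn_stochExp hy intervalIntegrable_const ω
  set M : ℝ → Ω → ℝ := fun t ω => X t ω - x - ∫ s in (0 : ℝ)..t, X s ω * a s with hM
  choose S hS1 hS2 hS3 using fun k => h.exists_expSimple (x := x) (a := a) (hN.pos k) k (η k)
  refine ⟨fun t ht => h.adapted_stochExp (by exact_mod_cast ht), ae_of_all _ hXc,
    ae_of_all _ fun ω => ?_, M, ⟨ae_of_all _ fun ω => h.memLp_stochExp_smul hy ha ω,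
    ae_of_all _ fun ω => ?_, S, ?_, ?_⟩, ae_of_all _ fun ω t _ => by simp only [hM]; ring⟩
  · exact (intervalIntegrable_iff_integrableOn_Icc_of_le T.coe_nonneg).1 (hXa ω)
  · exact ((hXc ω).sub continuousOn_const).sub (continuousOn_primitive T.coe_nonneg (hXa ω))
  · refine tendstoInMeasure_of_tendsto_ae (fun k => ?_)
      (ae_of_all _ (h.tendsto_expSimple_val hy ha hN hS1 hS2 hS3))
    refine aestronglyMeasurable_norm_sq_integral ?_ ?_
    · exact ((S k).measurable_val.comp measurable_swap).aestronglyMeasurable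
    · exact hXm.smul hy.1.comp_snd
  · intro t ht
    have htT : t ≤ T := by exact_mod_cast ht
    have ht' : (t : ℝ) ∈ Icc 0 (T : ℝ) := ⟨t.coe_nonneg, ht⟩
    set g : ℕ → ℕ → ℝ≥0 := fun k i => min (uGrid T (N k) i) t with hg
    have hgm : ∀ k, Monotone (g k) := fun k i j hij => min_le_min (uGrid_mono T _ hij) le_rfl
    have hg0 : ∀ k, g k 0 = 0 := fun k => by simp [hg, uGrid_zero]
    have hgT : ∀ k i, g k i ≤ T := fun k i => (min_le_right _ _).trans htT
    have hgN : ∀ k, g k (N k) = t := fun k => by simp [hg, uGrid_self T (hN.pos k), htT]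
    have hmem : ∀ k i, (g k i : ℝ) ∈ Icc 0 (T : ℝ) := fun k i =>
      ⟨NNReal.coe_nonneg _, by exact_mod_cast hgT k i⟩
    have hmesh : ∀ k i, (g k (i + 1) : ℝ) - g k i ≤ T / N k := fun k i => min_uGrid_sub_le T _ i t
    set R : ℕ → Ω → ℝ := fun k => expError X y I B (g k) (η k) (N k) with hR
    -- the martingale part of the error
    have hV := continuousOn_primitive T.coe_nonneg (intervalIntegrable_norm_sq hy h0T hTT)
    set G := ∫ s in (0 : ℝ)..T, ‖y s‖ ^ 2 with hG
    have hG0 : 0 ≤ G := intervalIntegral.integral_nonneg T.coe_nonneg fun _ _ => by positivity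
    set C := 2 * ((x * Real.exp (∫ r in (0 : ℝ)..T, |a r|)) ^ 2 * Real.exp G) with hC
    have hC0 : 0 ≤ C := by positivity
    have hcellτ : ∀ τ > 0, ∀ᶠ k in atTop, ∀ i,
        ∫ r in (g k i : ℝ)..g k (i + 1), ‖y r‖ ^ 2 ≤ τ := by
      intro τ hτ
      obtain ⟨δ, hδ, hosc⟩ := exists_mesh_le hV hτ
      filter_upwards [hN.tendsto_mesh hδ] with k hk i
      have hle : (g k i : ℝ) ≤ g k (i + 1) := by exact_mod_cast hgm k (Nat.le_succ i)
      have := hosc _ (hmem k i) _ (hmem k (i + 1)) (by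
        rw [abs_of_nonneg (sub_nonneg.2 hle)]; exact (hmesh k i).trans hk)
      rw [intervalIntegral.integral_interval_sub_left
        (intervalIntegrable_norm_sq hy h0T (hmem k _))
        (intervalIntegrable_norm_sq hy h0T (hmem k _))] at this
      exact (le_abs_self _).trans this
    have hηsum : ∀ k, ∑ i ∈ Finset.range (N k), ∫ r in (g k i : ℝ)..g k (i + 1),
        ‖y r - η k i‖ ^ 2 ≤ (1 / 16) ^ k := by
      intro k
      have hst : MemLp (fun r => y r - stepFun T (N k) (η k) r) 2
          (volume.restrict (Icc 0 (T : ℝ))) := hy.sub ((memLp_stepFun T (N k) (η k) 2).restrict _)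
      have e : ∀ i ∈ Finset.range (N k), ∫ r in (g k i : ℝ)..g k (i + 1), ‖y r - η k i‖ ^ 2 =
          ∫ r in (g k i : ℝ)..g k (i + 1), ‖y r - stepFun T (N k) (η k) r‖ ^ 2 := by
        intro i hi
        refine intervalIntegral.integral_congr_ae (ae_of_all _ fun r hr => ?_)
        rw [uIoc_of_le (by exact_mod_cast hgm k (Nat.le_succ i))] at hr
        have hr' : r ∈ Ioc (uGrid T (N k) i : ℝ) (uGrid T (N k) (i + 1)) := by
          obtain ⟨h1, h2⟩ := hr
          simp only [hg, NNReal.coe_min] at h1 h2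
          have h4 := le_min_iff.1 h2
          refine ⟨?_, h4.1⟩
          rcases min_lt_iff.1 h1 with h5 | h5
          · exact h5
          · exact absurd h4.2 (not_le.2 h5)
        rw [stepFun_eq (Finset.mem_range.1 hi) hr']
      rw [Finset.sum_congr rfl e, intervalIntegral.sum_integral_adjacent_intervals
        (a := fun i => (g k i : ℝ)) fun i _ => intervalIntegrable_norm_sq hst (hmem k i)
        (hmem k (i + 1)), hg0, hgN, NNReal.coe_zero]
      refine (integral_norm_sq_le_of_mem T.coe_nonneg hst ht').trans (le_trans (le_of_eq ?_)
        (hN.approx k))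
      exact intervalIntegral.integral_congr fun r _ => by simp only [norm_sub_rev]
    have hRmem : ∀ᶠ k in atTop, MemLp (R k) 2 P := by
      filter_upwards [hcellτ 1 one_pos] with k hk
      exact (h.memLp_expError hB hy ha (hgm k) (hg0 k) (hgT k) (η k) (N k) hk le_rfl).1
    have hRlim : Tendsto (fun k => ∫ ω, R k ω ^ 2 ∂P) atTop (𝓝 0) := by
      rw [Metric.tendsto_atTop']
      intro ε hε
      set τ := min 1 (ε / (4 * ((C + 1) * (G + 1)))) with hτ
      have hτ0 : 0 < τ := by positivity
      have hpow := tendsto_pow_atTop_nhds_zero_of_lt_one (r := (1 / 16 : ℝ)) (by norm_num)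
        (by norm_num)
      obtain ⟨n, hn⟩ := eventually_atTop.1 ((hcellτ τ hτ0).and
        (hpow.eventually_lt_const (show 0 < ε / (4 * (C + 1)) by positivity)))
      refine ⟨n, fun k hk => ?_⟩
      obtain ⟨hk1, hk2⟩ := hn k hk.le
      have := (h.memLp_expError (x := x) hB hy ha (hgm k) (hg0 k) (hgT k) (η k) (N k) hk1
        (min_le_left _ _)).2
      rw [Real.dist_eq, sub_zero, abs_of_nonneg (integral_nonneg fun _ => sq_nonneg _)]
      refine this.trans_lt ?_
      have h1 : τ * G ≤ ε / (4 * (C + 1)) := by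
        calc τ * G ≤ ε / (4 * ((C + 1) * (G + 1))) * (G + 1) := by
              gcongr
              · exact min_le_right _ _
              · linarith
          _ = ε / (4 * (C + 1)) := by field_simp
      calc _ ≤ C * (ε / (4 * (C + 1)) + ε / (4 * (C + 1))) := by
            gcongr; exact (hηsum k).trans hk2.le
        _ ≤ ε / 2 := by
            rw [← add_div, mul_div_assoc', div_le_div_iff₀ (by positivity) (by positivity)]
            nlinarith
        _ < ε := by linarith
    -- the remaining error vanishes path by path
    have hpath : ∀ᵐ ω ∂P, Tendsto (fun k => (S k).integral B t ω - M t ω + R k ω) atTop (𝓝 0) := by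
      filter_upwards [h.eval_zero] with ω hω
      obtain ⟨Cω, hCω⟩ := isCompact_Icc.exists_bound_of_continuousOn (hXc ω)
      rw [Metric.tendsto_atTop']
      intro ε hε
      set L := ∫ s in (0 : ℝ)..t, |a s * Real.exp (∫ r in (0 : ℝ)..s, a r)| with hL
      have hL0 : 0 ≤ L := intervalIntegral.integral_nonneg t.coe_nonneg fun _ _ => abs_nonneg _
      set w := ε / (2 * ((|x| + 1) * (L + 1))) with hw
      have hw0 : 0 < w := by positivity
      obtain ⟨δ, hδ, hosc⟩ := exists_mesh_le (hE1 ω) hw0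
      obtain ⟨n, hn⟩ := eventually_atTop.1 ((hN.tendsto_mesh hδ).and
        (tendsto_natCast_atTop_atTop.eventually_ge_atTop Cω))
      refine ⟨n, fun k hk => ?_⟩
      obtain ⟨hk1, hk2⟩ := hn k hk.le
      have key := abs_stochExp_sub_sum_le (B := B) (x := x) (h.continuous ω) hω hy ha
        (hgm k) (hg0 k) (hgT k) (η k) (w := w) (fun i s hs => by
          refine hosc s ⟨(NNReal.coe_nonneg _).trans hs.1, hs.2.trans (hmem k (i + 1)).2⟩ _
            (hmem k (i + 1)) ?_
          rw [abs_of_nonneg (sub_nonneg.2 hs.2)]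
          have := hmesh k i
          linarith [hs.1]) (N k)
      rw [hgN, ← expSimple_integral (B := B) (hN.pos k) (hS1 k) (hS2 k) (hS3 k)
        (fun t ht => (hCω t ht).trans hk2) t, abs_sub_comm] at key
      rw [Real.dist_eq, sub_zero]
      calc _ = |R k ω + (S k).integral B t ω - M t ω| := by congr 1; ring
        _ ≤ |x| * (w * L) := key
        _ ≤ (|x| + 1) * (w * (L + 1)) := by gcongr <;> linarith
        _ = ε / 2 := by rw [hw]; field_simp
        _ < ε := by linarith
    have hMm : AEStronglyMeasurable (M t) P := by
      refine ((h.measurable_stochExp ht').aestronglyMeasurable.sub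
        aestronglyMeasurable_const).sub ?_
      have h1 : AEStronglyMeasurable (fun p : Ω × ℝ => X p.2 p.1 * a p.2)
          (P.prod (volume.restrict (Icc 0 (T : ℝ)))) := by
        refine hXm.mul (AEStronglyMeasurable.comp_snd ?_)
        exact ((intervalIntegrable_iff_integrableOn_Icc_of_le T.coe_nonneg).1 ha).1
      have h2 := (h1.mono_measure (ν := P.prod (volume.restrict (Ioc 0 (t : ℝ))))
        (Measure.prod_mono le_rfl (Measure.restrict_mono_set _
          (Ioc_subset_Icc_self.trans (Icc_subset_Icc_right ht))))).integral_prod_right'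
      refine h2.congr (ae_of_all _ fun ω => ?_)
      simp only
      rw [intervalIntegral.integral_of_le t.coe_nonneg]
    -- The second moment bound for the error requires cells of energy at most 1, which holds only
    -- from some index on; hence the shift by k₀.
    obtain ⟨k₀, hk₀⟩ := eventually_atTop.1 hRmem
    have hRm : TendstoInMeasure P (fun k => R (k + k₀)) atTop (fun _ => (0 : ℝ)) :=
      tendstoInMeasure_zero_of_integral_sq (fun k => hk₀ _ (by omega))
        ((tendsto_add_atTop_iff_nat k₀).2 hRlim)
    have hQm : TendstoInMeasure P
        (fun k ω => (S (k + k₀)).integral B t ω - M t ω + R (k + k₀) ω) atTop (fun _ => (0 : ℝ)) := by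
      refine tendstoInMeasure_of_tendsto_ae (fun k => ?_) ?_
      · exact ((((S _).measurable_integral hB.measurable t).aestronglyMeasurable.sub hMm).add
          (hk₀ _ (by omega)).1)
      · filter_upwards [hpath] with ω hω
        exact (tendsto_add_atTop_iff_nat k₀).2 hω
    have hneg : TendstoInMeasure P (fun k ω => -R (k + k₀) ω) atTop (fun _ => (0 : ℝ)) := by
      rw [tendstoInMeasure_iff_norm] at hRm ⊢
      simpa using hRm
    have hsum := tendstoInMeasure_add hQm hneg
    rw [tendstoInMeasure_iff_norm] at hsum ⊢
    intro ε hε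
    have := hsum ε hε
    refine (tendsto_add_atTop_iff_nat k₀).1 (this.congr fun k => ?_)
    congr 1; ext ω
    simp only [Set.mem_ofPred_eq]
    rw [show (S (k + k₀)).integral B t ω - M t ω + R (k + k₀) ω + -R (k + k₀) ω - (0 + 0) =
      (S (k + k₀)).integral B t ω - M t ω by ring]

end IsWienerIntegral

end PortfolioES

namespace PortfolioES

variable {d : ℕ} {Ω : Type*} [mΩ : MeasurableSpace Ω]

/-! ### Approximation of Itô integrals along grids -/

/-- The process `M` is uniformly close to elementary integrals along arbitrarily fine grids, whose
integrands are close to `b` in `L²(0, T)`, in probability. -/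
def IsGridApprox (𝓕 : Filtration ℝ≥0 mΩ) (P : Measure Ω)
    (B : ℝ≥0 → Ω → EuclideanSpace ℝ (Fin d)) (T : ℝ≥0)
    (b : ℝ → Ω → EuclideanSpace ℝ (Fin d)) (M : ℝ → Ω → ℝ) : Prop :=
  ∀ ε > 0, ∀ F : Finset ℝ≥0, ∃ (g : ℕ → ℝ≥0) (n : ℕ) (ξ : ℕ → Ω → EuclideanSpace ℝ (Fin d))
    (u : ℝ → Ω → EuclideanSpace ℝ (Fin d)), IsGridCoef 𝓕 T g ξ ∧ g 0 = 0 ∧ g n = T ∧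
    (∀ t ∈ F, t ≤ T → ∃ k ≤ n, g k = t) ∧ (∀ i, (g (i + 1) : ℝ) - g i ≤ ε) ∧
    (∀ i, ∀ s ∈ Ioc (g i : ℝ) (g (i + 1)), ∀ ω, u s ω = ξ i ω) ∧
    Measurable (fun p : Ω × ℝ => u p.2 p.1) ∧ (∀ ω, MemLp (fun s => u s ω) 2 volume) ∧
    P {ω | ∃ k ≤ n, ε ≤ |gridSum B g ξ k ω - M (g k) ω|} ≤ ENNReal.ofReal ε ∧
    P {ω | ε ≤ ∫ s in (0 : ℝ)..T, ‖u s ω - b s ω‖ ^ 2} ≤ ENNReal.ofReal ε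

omit mΩ in
lemma exists_fine_grid (F : Finset ℝ≥0) (T : ℝ≥0) {ε : ℝ} (hε : 0 < ε) :
    ∃ (g : ℕ → ℝ≥0) (n : ℕ), Monotone g ∧ g 0 = 0 ∧ (∀ i, g i ≤ T) ∧ g n = T ∧
      (∀ t ∈ F, t ≤ T → ∃ k ≤ n, g k = t) ∧ (∀ i, ∀ t ∈ F, ¬ (g i < t ∧ t < g (i + 1))) ∧
      ∀ i, (g (i + 1) : ℝ) - g i ≤ ε := by
  classical
  obtain ⟨N, hN, hN0⟩ := (((tendsto_const_div_atTop_nhds_zero_nat (T : ℝ)).eventually_lt_const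
    hε).and (eventually_gt_atTop 0)).exists
  obtain ⟨g, n, hg, hg0, hgT, hgn, hF, hsep⟩ :=
    exists_grid (F ∪ (Finset.range (N + 1)).image (uGrid T N)) T
  refine ⟨g, n, hg, hg0, hgT, hgn, fun t ht => hF t (by simp [ht]),
    fun i t ht => hsep i t (by simp [ht]), fun i => ?_⟩
  rcases eq_or_lt_of_le (show (0 : ℝ) ≤ g (i + 1) from NNReal.coe_nonneg _) with h0 | h0
  · have := (g i).coe_nonneg; linarith
  · obtain ⟨j, hj, hij⟩ := exists_mem_uGrid_cell hN0 (s := (g (i + 1) : ℝ))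
      ⟨h0, by exact_mod_cast hgT (i + 1)⟩
    have h1 := hsep i (uGrid T N j) (by
      refine Finset.mem_union_right _ (Finset.mem_image_of_mem _ (Finset.mem_range.2 (by omega))))
    have h2 : uGrid T N j ≤ g i := by
      by_contra hcon
      exact h1 ⟨not_le.1 hcon, by exact_mod_cast hij.1⟩
    have h2' : (uGrid T N j : ℝ) ≤ g i := by exact_mod_cast h2
    have h3 := uGrid_succ_sub_le T N j
    linarith [hij.2]

section

variable {𝓕 : Filtration ℝ≥0 mΩ} {P : Measure Ω} [IsProbabilityMeasure P] {T : ℝ≥0}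
  {B : ℝ≥0 → Ω → EuclideanSpace ℝ (Fin d)} {b b' : ℝ → Ω → EuclideanSpace ℝ (Fin d)}
  {M M' : ℝ → Ω → ℝ}

omit [IsProbabilityMeasure P] in
lemma IsItoIntegral.eventually_measure_integral_le {S : ℕ → SimpleIntegrand 𝓕 d}
    (hS : TendstoInMeasure P (fun n ω => ∫ s in (0 : ℝ)..T, ‖(S n).val s ω - b s ω‖ ^ 2) atTop
      (fun _ => (0 : ℝ))) {ε δ : ℝ} (hε : 0 < ε) (hδ : 0 < δ) :
    ∀ᶠ n in atTop, P {ω | ε ≤ ∫ s in (0 : ℝ)..T, ‖(S n).val s ω - b s ω‖ ^ 2} ≤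
      ENNReal.ofReal δ := by
  filter_upwards [tendsto_measure_le_of_tendstoInMeasure hS hε hδ] with n hn
  refine (measure_mono fun ω hω => ?_).trans hn
  simp only [Set.mem_ofPred_eq, sub_zero] at hω ⊢
  exact hω.trans (le_abs_self _)

/-- One grid containing the jump times of both approximations, and finer than ε, represents both
elementary integrals; uniform closeness at its points comes from `eventually_measure_max_le`,
applied to the finite set of grid points. Differences are treated because uniqueness compares two
integrals. -/
theorem IsItoIntegral.isGridApprox_sub (hB : IsFilteredBM 𝓕 P T B)
    (h : IsItoIntegral 𝓕 P B T b M) (h' : IsItoIntegral 𝓕 P B T b' M') :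
    IsGridApprox 𝓕 P B T (fun s ω => b s ω - b' s ω) (fun t ω => M t ω - M' t ω) := by
  classical
  intro ε hε F
  obtain ⟨S, hS, hM⟩ := h.approx
  obtain ⟨S', hS', hM'⟩ := h'.approx
  have hε2 : 0 < ε / 2 := by positivity
  have hε4 : 0 < ε / 4 := by positivity
  have hM₁ : ∀ t : ℝ≥0, t ≤ T → TendstoInMeasure P (fun n => (S n).integral B t) atTop (M t) :=
    fun t ht => hM t (by exact_mod_cast ht)
  have hM₁' : ∀ t : ℝ≥0, t ≤ T → TendstoInMeasure P (fun n => (S' n).integral B t) atTop (M' t) :=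
    fun t ht => hM' t (by exact_mod_cast ht)
  obtain ⟨m, hm1, hm2, hm3, hm4⟩ :=
    ((IsItoIntegral.eventually_measure_max_le hB h.sq_integrable hS hM₁ hε2).and
    ((IsItoIntegral.eventually_measure_max_le hB h'.sq_integrable hS' hM₁' hε2).and
    ((IsItoIntegral.eventually_measure_integral_le hS hε4 hε2).and
    (IsItoIntegral.eventually_measure_integral_le hS' hε4 hε2)))).exists
  obtain ⟨g, n, hg, hg0, hgT, hgn, hF, hsep, hmesh⟩ :=
    exists_fine_grid (F ∪ ((S m).times ∪ (S' m).times)) T hε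
  have hs1 : ∀ i, (S m).Separated (g i) (g (i + 1)) := fun i =>
    (S m).separated_of_times_subset (by intro t ht; simp [ht]) (hsep i)
  have hs2 : ∀ i, (S' m).Separated (g i) (g (i + 1)) := fun i =>
    (S' m).separated_of_times_subset (by intro t ht; simp [ht]) (hsep i)
  refine ⟨g, n, fun i ω => (S m).cell (g i) (g (i + 1)) ω - (S' m).cell (g i) (g (i + 1)) ω,
    fun s ω => (S m).val s ω - (S' m).val s ω,
    ((S m).isGridCoef hg hgT).sub ((S' m).isGridCoef hg hgT), hg0, hgn,
    fun t ht => hF t (by simp [ht]), hmesh, fun i s hs ω => ?_, ?_, fun ω => ?_, ?_, ?_⟩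
  · beta_reduce
    rw [(S m).val_eq_cell (hs1 i) hs, (S' m).val_eq_cell (hs2 i) hs]
  · exact ((S m).measurable_val.comp measurable_swap).sub
      ((S' m).measurable_val.comp measurable_swap)
  · exact ((S m).memLp_val ω 2).sub ((S' m).memLp_val ω 2)
  · set F' := (Finset.range (n + 1)).image g with hF'
    have hF'T : ∀ t ∈ F', t ≤ T := by
      intro t ht
      obtain ⟨i, -, rfl⟩ := Finset.mem_image.1 ht
      exact hgT i
    have e : ENNReal.ofReal ε = ENNReal.ofReal (ε / 2) + ENNReal.ofReal (ε / 2) := by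
      rw [← ENNReal.ofReal_add hε2.le hε2.le]; congr 1; ring
    rw [e]
    refine le_trans (measure_mono ?_) ((measure_union_le _ _).trans
      (add_le_add (hm1 F' hF'T) (hm2 F' hF'T)))
    rintro ω ⟨k, hk, hω⟩
    have hkF : g k ∈ F' := Finset.mem_image_of_mem _ (Finset.mem_range.2 (by omega))
    rw [← gridSum_sub, ← (S m).integral_eq_gridSum B hg hg0 hs1,
      ← (S' m).integral_eq_gridSum B hg hg0 hs2] at hω
    by_contra hcon
    simp only [mem_union, Set.mem_ofPred_eq, not_or, not_exists, not_and, not_le] at hcon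
    have h1 := hcon.1 _ hkF
    have h2 := hcon.2 _ hkF
    have h3 := abs_sub ((S m).integral B (g k) ω - M (g k) ω)
      ((S' m).integral B (g k) ω - M' (g k) ω)
    rw [show (S m).integral B (g k) ω - M (g k) ω - ((S' m).integral B (g k) ω - M' (g k) ω) =
      (S m).integral B (g k) ω - (S' m).integral B (g k) ω - (M (g k) ω - M' (g k) ω) by ring] at h3
    linarith
  · have e : ENNReal.ofReal ε = ENNReal.ofReal (ε / 2) + ENNReal.ofReal (ε / 2) := by
      rw [← ENNReal.ofReal_add hε2.le hε2.le]; congr 1; ring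
    rw [e]
    refine le_trans (measure_mono_ae ?_) ((measure_union_le _ _).trans (add_le_add hm3 hm4))
    filter_upwards [h.sq_integrable, h'.sq_integrable] with ω h1 h2 hω
    have hω : ε ≤ ∫ s in (0 : ℝ)..T,
      ‖(S m).val s ω - (S' m).val s ω - (b s ω - b' s ω)‖ ^ 2 := hω
    change _ ∨ _
    by_contra hcon
    simp only [Set.mem_ofPred_eq, not_or, not_le] at hcon
    have h3 := (((S m).memLp_val ω 2).restrict (Icc 0 (T : ℝ))).sub h1
    have h4 := (((S' m).memLp_val ω 2).restrict (Icc 0 (T : ℝ))).sub h2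
    have h5 := integral_norm_sub_sq_le T.coe_nonneg h3 h4
      (b := fun _ => 0) (by exact MemLp.zero')
    simp only [Pi.sub_apply, sub_zero] at h5
    have h6 : ∀ s, (S m).val s ω - (S' m).val s ω - (b s ω - b' s ω) =
      (S m).val s ω - b s ω - ((S' m).val s ω - b' s ω) := fun s => by abel
    simp_rw [h6] at hω
    linarith [hcon.1, hcon.2]

lemma IsItoIntegral.zero (𝓕 : Filtration ℝ≥0 mΩ) (P : Measure Ω) [IsProbabilityMeasure P]
    (B : ℝ≥0 → Ω → EuclideanSpace ℝ (Fin d)) (T : ℝ) :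
    IsItoIntegral 𝓕 P B T (fun _ _ => 0) (fun _ _ => 0) := by
  refine ⟨ae_of_all _ fun _ => MemLp.zero', ae_of_all _ fun _ => continuousOn_const, fun _ =>
    ⟨0, fun _ => 0, monotone_const, fun _ _ => 0, fun _ => measurable_const,
      0, fun _ _ => by simp⟩, ?_, fun t _ => ?_⟩
  · have : (fun (n : ℕ) (ω : Ω) => ∫ s in (0 : ℝ)..T, ‖(SimpleIntegrand.val
      (⟨0, fun _ => 0, monotone_const, fun _ _ => 0, fun _ => measurable_const,
        0, fun _ _ => by simp⟩ : SimpleIntegrand 𝓕 d) s ω) - 0‖ ^ 2) = fun _ _ => 0 := by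
      funext n ω; simp [SimpleIntegrand.val]
    rw [this]
    exact tendstoInMeasure_of_tendsto_ae (fun _ => aestronglyMeasurable_const)
      (ae_of_all _ fun _ => tendsto_const_nhds)
  · exact tendstoInMeasure_of_tendsto_ae (fun _ => aestronglyMeasurable_const)
      (ae_of_all _ fun _ => tendsto_const_nhds)

theorem IsItoIntegral.isGridApprox (hB : IsFilteredBM 𝓕 P T B)
    (h : IsItoIntegral 𝓕 P B T b M) : IsGridApprox 𝓕 P B T b M := by
  simpa using h.isGridApprox_sub hB (IsItoIntegral.zero 𝓕 P B T)

end

end PortfolioES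

namespace PortfolioES

variable {d : ℕ} {Ω : Type*} [mΩ : MeasurableSpace Ω]

/-! ### The localized Itô isometry -/

section

variable {𝓕 : Filtration ℝ≥0 mΩ} {P : Measure Ω} [IsProbabilityMeasure P] {T : ℝ≥0}
  {B : ℝ≥0 → Ω → EuclideanSpace ℝ (Fin d)} {b : ℝ → Ω → EuclideanSpace ℝ (Fin d)}
  {M : ℝ → Ω → ℝ} {G : ℝ → Set Ω}

lemma measurableSet_section (hGj : MeasurableSet {p : Ω × ℝ | p.1 ∈ G p.2}) (ω : Ω) :
    MeasurableSet {s | ω ∈ G s} :=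
  hGj.preimage (measurable_const.prodMk measurable_id : Measurable fun s : ℝ => (ω, s))

lemma memLp_indicator_section (hGj : MeasurableSet {p : Ω × ℝ | p.1 ∈ G p.2}) {ω : Ω} (c : ℝ)
    {μ : Measure ℝ} (h : MemLp (fun s => b s ω) 2 μ) :
    MemLp (fun s => (G (s - c)).indicator (b s) ω) 2 μ := by
  have hm : MeasurableSet {s | ω ∈ G (s - c)} :=
    (measurableSet_section hGj ω).preimage (measurable_id.sub_const c)
  have e : (fun s => (G (s - c)).indicator (b s) ω) =
      {s | ω ∈ G (s - c)}.indicator fun s => b s ω := by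
    ext s : 1
    by_cases hs : ω ∈ G (s - c) <;> simp [Set.indicator, hs]
  rw [e]
  exact h.indicator hm

omit mΩ in
lemma norm_sq_indicator_sub_le (S S' : Set Ω) (hS : S ⊆ S') (f : Ω → EuclideanSpace ℝ (Fin d))
    (ω : Ω) : ‖S.indicator f ω - S'.indicator f ω‖ ^ 2 ≤ ‖f ω‖ ^ 2 := by
  by_cases h : ω ∈ S
  · simp [h, hS h]
  · by_cases h' : ω ∈ S' <;> simp [h, h']

/-- G s is to be read as "not yet stopped at time s". Closedness under limits from the left makes
the indicator of G (s - ε) converge to that of G s for each s > 0, and dominated convergence handles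
the lag; the remaining error is at most the distance of u to b. -/
lemma tendsto_integral_indicator_sub (hGanti : Antitone G)
    (hGl : ∀ ω s, 0 < s → (∀ r, r < s → ω ∈ G r) → ω ∈ G s)
    (hGj : MeasurableSet {p : Ω × ℝ | p.1 ∈ G p.2}) {ω : Ω}
    (hb : MemLp (fun s => b s ω) 2 (volume.restrict (Icc 0 (T : ℝ)))) {ε : ℕ → ℝ}
    (hε : ∀ k, 0 ≤ ε k) (hε0 : Tendsto ε atTop (𝓝 0)) {u : ℕ → ℝ → Ω → EuclideanSpace ℝ (Fin d)}
    (hu : ∀ k, MemLp (fun s => u k s ω) 2 volume)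
    (hub : Tendsto (fun k => ∫ s in (0 : ℝ)..T, ‖u k s ω - b s ω‖ ^ 2) atTop (𝓝 0)) :
    Tendsto (fun k => ∫ s in (0 : ℝ)..T,
      ‖(G (s - ε k)).indicator (u k s) ω - (G s).indicator (b s) ω‖ ^ 2) atTop (𝓝 0) := by
  have h0T : (0 : ℝ) ∈ Icc 0 (T : ℝ) := ⟨le_rfl, T.coe_nonneg⟩
  have hTT : (T : ℝ) ∈ Icc 0 (T : ℝ) := ⟨T.coe_nonneg, le_rfl⟩
  have hbG : MemLp (fun s => (G s).indicator (b s) ω) 2 (volume.restrict (Icc 0 (T : ℝ))) := by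
    simpa using memLp_indicator_section hGj 0 hb
  have hbε := fun k => memLp_indicator_section hGj (ε k) hb
  have hfε := fun k => memLp_indicator_section hGj (ε k) ((hu k).restrict (Icc 0 (T : ℝ)))
  have hDCT : Tendsto (fun k => ∫ s in (0 : ℝ)..T,
      ‖(G s).indicator (b s) ω - (G (s - ε k)).indicator (b s) ω‖ ^ 2) atTop (𝓝 0) := by
    have := intervalIntegral.tendsto_integral_filter_of_dominated_convergence (μ := volume)
      (a := (0 : ℝ)) (b := (T : ℝ)) (l := atTop) (f := fun _ => (0 : ℝ)) (F := fun k s =>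
      ‖(G s).indicator (b s) ω - (G (s - ε k)).indicator (b s) ω‖ ^ 2) (fun s => ‖b s ω‖ ^ 2)
      (Eventually.of_forall fun k => ?_) (Eventually.of_forall fun k => ae_of_all _ fun s _ => ?_)
      (intervalIntegrable_norm_sq hb h0T hTT) (ae_of_all _ fun s hs => ?_)
    · simpa using this
    · rw [uIoc_of_le T.coe_nonneg]
      exact ((hbG.sub (hbε k)).1.mono_measure
        (Measure.restrict_mono_set _ Ioc_subset_Icc_self)).norm.pow 2
    · rw [Real.norm_eq_abs, abs_of_nonneg (by positivity)]
      exact norm_sq_indicator_sub_le _ _ (hGanti (by linarith [hε k])) _ _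
    · rw [uIoc_of_le T.coe_nonneg] at hs
      by_cases hω : ω ∈ G s
      · refine tendsto_const_nhds.congr fun k => ?_
        have : ω ∈ G (s - ε k) := hGanti (by linarith [hε k]) hω
        simp [hω, this]
      · obtain ⟨r, hr, hωr⟩ : ∃ r < s, ω ∉ G r := by
          by_contra hcon
          push Not at hcon
          exact hω (hGl ω s hs.1 hcon)
        refine tendsto_const_nhds.congr' ?_
        filter_upwards [hε0.eventually_lt_const (sub_pos.2 hr)] with k hk
        have : ω ∉ G (s - ε k) := fun h => hωr (hGanti (by linarith) h)
        simp [hω, this]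
  have hle : ∀ k, ∫ s in (0 : ℝ)..T,
      ‖(G (s - ε k)).indicator (u k s) ω - (G s).indicator (b s) ω‖ ^ 2 ≤
      2 * (∫ s in (0 : ℝ)..T, ‖u k s ω - b s ω‖ ^ 2) + 2 * ∫ s in (0 : ℝ)..T,
      ‖(G s).indicator (b s) ω - (G (s - ε k)).indicator (b s) ω‖ ^ 2 := by
    intro k
    refine (integral_norm_sub_sq_le T.coe_nonneg (hfε k) hbG (hbε k)).trans ?_
    gcongr
    refine intervalIntegral.integral_mono_on T.coe_nonneg
      (intervalIntegrable_norm_sq ((hfε k).sub (hbε k)) h0T hTT)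
      (intervalIntegrable_norm_sq (((hu k).restrict _).sub hb) h0T hTT) fun s _ => ?_
    by_cases h : ω ∈ G (s - ε k) <;> simp [h]
  have h2 := (hub.const_mul 2).add (hDCT.const_mul 2)
  rw [mul_zero, add_zero] at h2
  exact squeeze_zero (fun k => intervalIntegral.integral_nonneg T.coe_nonneg
    fun _ _ => by positivity) hle h2

/-- Itô isometry up to a stopping time, described by its decreasing events G. Coefficients are
multiplied by the indicator of G at the left endpoint, which is adapted; on G t no coefficient
before t is changed. The isometry for elementary integrals passes to the limit by Fatou's lemma on
the left and dominated convergence on the right. -/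
theorem IsGridApprox.lintegral_indicator_sq_le (hB : IsFilteredBM 𝓕 P T B)
    (hM : IsGridApprox 𝓕 P B T b M) (hGanti : Antitone G)
    (hGm : ∀ t : ℝ≥0, t ≤ T → MeasurableSet[𝓕 t] (G t))
    (hGl : ∀ ω s, 0 < s → (∀ r, r < s → ω ∈ G r) → ω ∈ G s)
    (hGj : MeasurableSet {p : Ω × ℝ | p.1 ∈ G p.2})
    (hb : ∀ᵐ ω ∂P, MemLp (fun s => b s ω) 2 (volume.restrict (Icc 0 (T : ℝ))))
    {K : ℝ} (hK0 : 0 ≤ K) (hK : ∀ᵐ ω ∂P, ∫ s in (0 : ℝ)..T, ‖(G s).indicator (b s) ω‖ ^ 2 ≤ K)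
    {t : ℝ≥0} (ht : t ≤ T) :
    ∫⁻ ω, (G t).indicator (fun ω => ENNReal.ofReal (M t ω ^ 2)) ω ∂P ≤
      ENNReal.ofReal (∫ ω, (∫ s in (0 : ℝ)..t, ‖(G s).indicator (b s) ω‖ ^ 2) ∂P) := by
  have ht' : (t : ℝ) ∈ Icc 0 (T : ℝ) := ⟨t.coe_nonneg, by exact_mod_cast ht⟩
  -- The errors are summable, so by Borel–Cantelli the approximations converge along almost every
  -- path.
  set ε : ℕ → ℝ := fun m => (1 / 2) ^ m with hε
  have hε0 : ∀ m, 0 < ε m := fun m => by positivity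
  have hεlim : Tendsto ε atTop (𝓝 0) :=
    tendsto_pow_atTop_nhds_zero_of_lt_one (by norm_num) (by norm_num)
  have hεsum : ∑' m, ENNReal.ofReal (ε m) ≠ ∞ :=
    (summable_geometric_of_lt_one (by norm_num) (by norm_num)).tsum_ofReal_ne_top
  choose g n ξ u hξ hg0 hgn hF hmesh hcell hum hu2 hP1 hP2 using fun m => hM (ε m) (hε0 m) {t}
  choose k hkn hgk using fun m => hF m t (by simp) ht
  set ξ' : (m : ℕ) → ℕ → Ω → EuclideanSpace ℝ (Fin d) := fun m i => (G (g m i)).indicator (ξ m i)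
    with hξ'
  have hc : ∀ m, IsGridCoef 𝓕 T (g m) (ξ' m) := fun m =>
    ⟨(hξ m).mono, (hξ m).le, fun i => ((hξ m).measurable i).indicator (hGm _ ((hξ m).le i)),
      fun i => by
        obtain ⟨C, hC⟩ := (hξ m).bounded i
        exact ⟨C, fun ω => (norm_indicator_le_norm_self _ _).trans (hC ω)⟩⟩
  set f : ℕ → ℝ → Ω → EuclideanSpace ℝ (Fin d) := fun m s ω => (G (s - ε m)).indicator (u m s) ω
    with hf
  have hf2 : ∀ m ω, MemLp (fun s => f m s ω) 2 volume := fun m ω =>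
    memLp_indicator_section hGj _ (hu2 m ω)
  have hfint : ∀ m ω a c, IntervalIntegrable (fun s => ‖f m s ω‖ ^ 2) volume a c := fun m ω a c =>
    ((hf2 m ω).integrable_norm_pow (by norm_num)).intervalIntegrable
  set U : ℕ → Ω → ℝ := fun m ω => ∫ s in (0 : ℝ)..t, ‖f m s ω‖ ^ 2 with hU
  set e : Ω → ℝ := fun ω => ∫ s in (0 : ℝ)..t, ‖(G s).indicator (b s) ω‖ ^ 2 with he
  have hEU : ∀ m ω, gridEnergy (g m) (ξ' m) (k m) ω ≤ U m ω := by
    intro m ω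
    have hs := intervalIntegral.sum_integral_adjacent_intervals (a := fun i => (g m i : ℝ))
      (n := k m) fun i _ => hfint m ω (g m i) (g m (i + 1))
    rw [hg0, hgk, NNReal.coe_zero] at hs
    simp only [hU]
    rw [← hs]
    refine Finset.sum_le_sum fun i _ => ?_
    have hle : (g m i : ℝ) ≤ g m (i + 1) := by exact_mod_cast (hξ m).mono (Nat.le_succ i)
    calc _ = ∫ _ in (g m i : ℝ)..g m (i + 1), ‖ξ' m i ω‖ ^ 2 := by
          rw [intervalIntegral.integral_const, smul_eq_mul, mul_comm]
      _ ≤ _ := by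
          refine intervalIntegral.integral_mono_on_of_le_Ioo hle intervalIntegrable_const
            (hfint m ω _ _) fun s hs => ?_
          simp only [hξ', hf]
          -- For s in the cell the mesh bound gives s - ε_m ≤ g_i, so being in G at the left
          -- endpoint implies being in the lagged event G (s - ε_m); this is why the lag appears in
          -- f.
          by_cases hω : ω ∈ G (g m i)
          · have h2 : ω ∈ G (s - ε m) := hGanti (by linarith [hmesh m i, hs.2]) hω
            rw [Set.indicator_of_mem hω, Set.indicator_of_mem h2, hcell m i s ⟨hs.1, hs.2.le⟩]
          · rw [Set.indicator_of_notMem hω]; simp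
  have hU0 : ∀ m ω, 0 ≤ U m ω := fun m ω =>
    intervalIntegral.integral_nonneg t.coe_nonneg fun _ _ => by positivity
  have hUm : ∀ m, AEStronglyMeasurable (U m) P := by
    intro m
    have h1 : Measurable fun p : Ω × ℝ => f m p.2 p.1 := by
      have hset : MeasurableSet {p : Ω × ℝ | p.1 ∈ G (p.2 - ε m)} :=
        hGj.preimage (measurable_fst.prodMk (measurable_snd.sub_const (ε m)))
      have : (fun p : Ω × ℝ => f m p.2 p.1) =
          {p : Ω × ℝ | p.1 ∈ G (p.2 - ε m)}.indicator fun p => u m p.2 p.1 := by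
        ext p : 1
        by_cases hp : p.1 ∈ G (p.2 - ε m) <;> simp [hf, Set.indicator, hp]
      rw [this]
      exact (hum m).indicator hset
    have h2 := ((h1.norm.pow_const 2).aestronglyMeasurable
      (μ := P.prod (volume.restrict (Ioc 0 (t : ℝ))))).integral_prod_right'
    refine h2.congr (ae_of_all _ fun ω => ?_)
    simp only [hU]
    rw [intervalIntegral.integral_of_le t.coe_nonneg]
  have hbad1 := ae_eventually_notMem (μ := P)
    (s := fun m => {ω | ∃ j ≤ n m, ε m ≤ |gridSum B (g m) (ξ m) j ω - M (g m j) ω|})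
    (ne_top_of_le_ne_top hεsum (ENNReal.tsum_le_tsum hP1))
  have hbad2 := ae_eventually_notMem (μ := P)
    (s := fun m => {ω | ε m ≤ ∫ s in (0 : ℝ)..T, ‖u m s ω - b s ω‖ ^ 2})
    (ne_top_of_le_ne_top hεsum (ENNReal.tsum_le_tsum hP2))
  have hUlim : ∀ᵐ ω ∂P, Tendsto (fun m => U m ω) atTop (𝓝 (e ω)) := by
    filter_upwards [hbad2, hb] with ω hω hbω
    have hub : Tendsto (fun m => ∫ s in (0 : ℝ)..T, ‖u m s ω - b s ω‖ ^ 2) atTop (𝓝 0) := by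
      refine squeeze_zero' (Eventually.of_forall fun m => intervalIntegral.integral_nonneg
        T.coe_nonneg fun _ _ => by positivity) (hω.mono fun m hm => ?_) hεlim
      exact (not_le.1 hm).le
    have h1 := tendsto_integral_indicator_sub hGanti hGl hGj hbω (fun m => (hε0 m).le) hεlim
      (fun m => hu2 m ω) hub
    refine tendsto_integral_norm_sq T.coe_nonneg (fun m => (hf2 m ω).restrict _) ?_ h1 le_rfl
      ht'.1 ht'.2
    simpa using memLp_indicator_section hGj 0 hbω
  have heK : ∀ᵐ ω ∂P, e ω ≤ K := by
    filter_upwards [hK, hb] with ω hω hbω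
    have : MemLp (fun s => (G s).indicator (b s) ω) 2 (volume.restrict (Icc 0 (T : ℝ))) := by
      simpa using memLp_indicator_section hGj 0 hbω
    exact (integral_norm_sq_le_of_mem T.coe_nonneg this ht').trans hω
  -- The limiting energy is at most K, so truncation at K + 1 is eventually inactive on almost every
  -- path while giving a uniform bound for all m.
  set S : ℕ → Ω → ℝ := fun m => gridSum B (g m) (gridTrunc (g m) (K + 1) (ξ' m)) (k m) with hS
  have hK1 : 0 ≤ K + 1 := by linarith
  have hminint : ∀ m, Integrable (fun ω => min (K + 1) (U m ω)) P := fun m => by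
    refine Integrable.of_bound (C := K + 1) (aestronglyMeasurable_const.inf (hUm m))
      (ae_of_all _ fun ω => ?_)
    rw [Real.norm_eq_abs, abs_of_nonneg (le_min hK1 (hU0 m ω))]
    exact min_le_left _ _
  have hSE : ∀ m, ∫⁻ ω, ENNReal.ofReal (S m ω ^ 2) ∂P ≤
      ENNReal.ofReal (∫ ω, min (K + 1) (U m ω) ∂P) := by
    intro m
    rw [← ofReal_integral_eq_lintegral_ofReal (((hc m).trunc _).memLp_gridSum hB _).integrable_sq
      (ae_of_all _ fun _ => sq_nonneg _)]
    refine ENNReal.ofReal_le_ofReal ?_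
    rw [((hc m).trunc _).integral_gridSum_sq hB]
    refine integral_mono_of_nonneg (ae_of_all _ fun ω => gridEnergy_nonneg (hξ m).mono _ _)
      (hminint m) (ae_of_all _ fun ω => le_min (gridEnergy_gridTrunc_le (hξ m).mono hK1 _ _)
      (le_trans ?_ (hEU m ω)))
    refine Finset.sum_le_sum fun i _ => ?_
    have hle : (0 : ℝ) ≤ g m (i + 1) - g m i :=
      sub_nonneg.2 (by exact_mod_cast (hξ m).mono (Nat.le_succ i))
    refine mul_le_mul_of_nonneg_right ?_ hle
    rw [gridTrunc]
    split_ifs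
    · exact le_rfl
    · simp
  have hlim : Tendsto (fun m => ENNReal.ofReal (∫ ω, min (K + 1) (U m ω) ∂P)) atTop
      (𝓝 (ENNReal.ofReal (∫ ω, e ω ∂P))) := by
    refine ENNReal.tendsto_ofReal (tendsto_integral_of_dominated_convergence (fun _ => K + 1)
      (fun m => (hminint m).1) (integrable_const _) (fun m => ae_of_all _ fun ω => ?_) ?_)
    · rw [Real.norm_eq_abs, abs_of_nonneg (le_min hK1 (hU0 m ω))]
      exact min_le_left _ _
    · filter_upwards [hUlim, heK] with ω h1 h2
      have := (tendsto_const_nhds (x := K + 1)).min h1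
      rwa [min_eq_right (by linarith)] at this
  have hptw : ∀ᵐ ω ∂P, (G t).indicator (fun ω => ENNReal.ofReal (M t ω ^ 2)) ω ≤
      liminf (fun m => ENNReal.ofReal (S m ω ^ 2)) atTop := by
    filter_upwards [hbad1, hUlim, heK] with ω h1 h2 h3
    by_cases hω : ω ∈ G t
    · rw [Set.indicator_of_mem hω]
      have hSlim : Tendsto (fun m => S m ω) atTop (𝓝 (M t ω)) := by
        rw [tendsto_iff_dist_tendsto_zero]
        refine squeeze_zero' (Eventually.of_forall fun _ => dist_nonneg) ?_ hεlim
        filter_upwards [h1, h2.eventually_lt_const (show e ω < K + 1 by linarith)] with m hm1 hm2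
        have e1 : S m ω = gridSum B (g m) (ξ m) (k m) ω := by
          rw [hS]
          simp only
          rw [gridSum_gridTrunc_eq B (hξ m).mono ((hEU m ω).trans hm2.le) le_rfl]
          refine Finset.sum_congr rfl fun i hi => ?_
          simp only [hξ']
          rw [Set.indicator_of_mem]
          refine hGanti ?_ hω
          rw [← hgk m]
          exact_mod_cast (hξ m).mono (Finset.mem_range.1 hi).le
        rw [Real.dist_eq, e1]
        by_contra hcon
        refine hm1 ⟨k m, hkn m, ?_⟩
        rw [hgk]
        exact (not_le.1 hcon).le
      exact (ENNReal.tendsto_ofReal (hSlim.pow 2)).liminf_eq.ge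
    · rw [Set.indicator_of_notMem hω]; exact zero_le
  calc _ ≤ ∫⁻ ω, liminf (fun m => ENNReal.ofReal (S m ω ^ 2)) atTop ∂P := lintegral_mono_ae hptw
    _ ≤ liminf (fun m => ∫⁻ ω, ENNReal.ofReal (S m ω ^ 2) ∂P) atTop :=
        lintegral_liminf_le' fun m => ((((hc m).trunc _).memLp_gridSum hB _).1.aemeasurable.pow_const
          2).ennreal_ofReal
    _ ≤ liminf (fun m => ENNReal.ofReal (∫ ω, min (K + 1) (U m ω) ∂P)) atTop :=
        liminf_le_liminf (Eventually.of_forall hSE)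
    _ = _ := hlim.liminf_eq

end

end PortfolioES

namespace PortfolioES

variable {d : ℕ} {Ω : Type*} [mΩ : MeasurableSpace Ω]

/-! ### Uniqueness for linear stochastic differential equations -/

section

variable {𝓕 : Filtration ℝ≥0 mΩ} {P : Measure Ω} {T : ℝ≥0}

/-- `Y` is adapted on `[0, T]`, has continuous paths, and is constant outside of `[0, T]`. -/
structure IsContinuousAdapted (𝓕 : Filtration ℝ≥0 mΩ) (T : ℝ≥0) (Y : ℝ → Ω → ℝ) : Prop where
  continuous : ∀ ω, Continuous fun t => Y t ω
  adapted : ∀ t : ℝ≥0, t ≤ T → Measurable[𝓕 t] (Y t)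
  eq_proj : ∀ t, Y t = Y (projIcc 0 (T : ℝ) T.coe_nonneg t)

/-- Exceptional paths are set to zero, which respects adaptedness because null sets belong to 𝓕 0.
Stopping events for the modified process then have the required measurability. -/
lemma exists_isContinuousAdapted (hnull : ∀ N, MeasurableSet N → P N = 0 → MeasurableSet[𝓕 0] N)
    {X : ℝ → Ω → ℝ} (hX : ∀ t : ℝ≥0, t ≤ T → Measurable[𝓕 t] (X t))
    (hc : ∀ᵐ ω ∂P, ContinuousOn (fun t => X t ω) (Icc 0 (T : ℝ))) :
    ∃ Y, IsContinuousAdapted 𝓕 T Y ∧ ∀ᵐ ω ∂P, ∀ t ∈ Icc 0 (T : ℝ), Y t ω = X t ω := by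
  set bad := toMeasurable P {ω | ¬ ContinuousOn (fun t => X t ω) (Icc 0 (T : ℝ))} with hbad
  have hbad0 : P bad = 0 := by rw [hbad, measure_toMeasurable]; exact hc
  have hbadF : MeasurableSet[𝓕 0] bad := hnull bad (measurableSet_toMeasurable _ _) hbad0
  have hnb : ∀ ω, ω ∉ bad → ContinuousOn (fun t => X t ω) (Icc 0 (T : ℝ)) := by
    intro ω hω
    by_contra hcon
    exact hω (subset_toMeasurable P _ hcon)
  refine ⟨fun t => badᶜ.indicator (X (projIcc 0 (T : ℝ) T.coe_nonneg t)), ⟨fun ω => ?_,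
    fun t ht => ?_, fun t => ?_⟩, ?_⟩
  · by_cases hω : ω ∈ bad
    · simp only [Set.indicator_of_notMem (show ω ∉ badᶜ from fun h => h hω)]
      exact continuous_const
    · simp only [Set.indicator_of_mem (show ω ∈ badᶜ from hω)]
      exact (hnb ω hω).comp_continuous (continuous_subtype_val.comp continuous_projIcc)
        fun t => (projIcc 0 (T : ℝ) T.coe_nonneg t).2
  · refine Measurable.indicator ?_ (𝓕.mono zero_le _ hbadF.compl)
    rw [projIcc_of_mem T.coe_nonneg ⟨t.coe_nonneg, by exact_mod_cast ht⟩]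
    exact hX t ht
  · rw [projIcc_val]
  · have : ∀ᵐ ω ∂P, ω ∉ bad := measure_eq_zero_iff_ae_notMem.1 hbad0
    filter_upwards [this] with ω hω t ht
    rw [Set.indicator_of_mem (show ω ∈ badᶜ from hω), projIcc_of_mem T.coe_nonneg ht]

namespace IsContinuousAdapted

variable {Y : ℝ → Ω → ℝ}

lemma measurable (h : IsContinuousAdapted 𝓕 T Y) (t : ℝ) : Measurable (Y t) := by
  rw [h.eq_proj t]
  set s := projIcc 0 (T : ℝ) T.coe_nonneg t
  have := (h.adapted ⟨s, s.2.1⟩ (by exact_mod_cast s.2.2)).mono (𝓕.le _) le_rfl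
  exact this

lemma measurable_uncurry (h : IsContinuousAdapted 𝓕 T Y) :
    Measurable fun p : Ω × ℝ => Y p.2 p.1 :=
  (measurable_uncurry_of_continuous_of_measurable (u := Y) h.continuous h.measurable).comp
    measurable_swap

lemma eq_of_nonpos (h : IsContinuousAdapted 𝓕 T Y) {t : ℝ} (ht : t ≤ 0) : Y t = Y 0 := by
  rw [h.eq_proj t, h.eq_proj 0, projIcc_of_le_left _ ht, projIcc_left]

lemma exists_bound (h : IsContinuousAdapted 𝓕 T Y) (ω : Ω) : ∃ C, ∀ t, |Y t ω| ≤ C := by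
  obtain ⟨C, hC⟩ := isCompact_Icc.exists_bound_of_continuousOn (h.continuous ω).continuousOn
    (s := Icc 0 (T : ℝ))
  refine ⟨C, fun t => ?_⟩
  rw [h.eq_proj t]
  exact hC _ (projIcc 0 (T : ℝ) T.coe_nonneg t).2

/-- The event that `|Y|` has not exceeded `N` up to time `t`. -/
def _root_.PortfolioES.boundedUpTo (Y : ℝ → Ω → ℝ) (N t : ℝ) : Set Ω := {ω | ∀ r ≤ t, |Y r ω| ≤ N}

omit mΩ in
lemma _root_.PortfolioES.antitone_boundedUpTo (Y : ℝ → Ω → ℝ) (N : ℝ) :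
    Antitone (boundedUpTo Y N) :=
  fun _ _ hst _ hω r hr => hω r (hr.trans hst)

lemma mem_boundedUpTo_of_lt (h : IsContinuousAdapted 𝓕 T Y) {N s : ℝ} {ω : Ω}
    (hs : ∀ r, r < s → |Y r ω| ≤ N) : ω ∈ boundedUpTo Y N s := by
  have hcl : IsClosed {r | |Y r ω| ≤ N} := isClosed_le (h.continuous ω).abs continuous_const
  have : Iic s ⊆ {r | |Y r ω| ≤ N} := by
    rw [← closure_Iio]
    exact hcl.closure_subset_iff.2 fun r hr => hs r hr
  exact fun r hr => this hr

lemma mem_boundedUpTo_iff (h : IsContinuousAdapted 𝓕 T Y) {N s : ℝ} {ω : Ω} :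
    ω ∈ boundedUpTo Y N s ↔ ∀ q : ℚ, |Y (min q s) ω| ≤ N := by
  refine ⟨fun hω q => hω _ (min_le_right _ _), fun hω r hr => ?_⟩
  have hcl : IsClosed {r | |Y (min r s) ω| ≤ N} := isClosed_le
    ((h.continuous ω).comp (continuous_id.min continuous_const)).abs continuous_const
  have h1 : Set.range ((↑) : ℚ → ℝ) ⊆ {r | |Y (min r s) ω| ≤ N} := by
    rintro _ ⟨q, rfl⟩; exact hω q
  have h2 := hcl.closure_subset_iff.2 h1
  rw [Rat.denseRange_cast.closure_range] at h2
  have := h2 (mem_univ r)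
  rwa [Set.mem_ofPred_eq, min_eq_left hr] at this

lemma measurableSet_boundedUpTo (h : IsContinuousAdapted 𝓕 T Y) (N : ℝ) {t : ℝ≥0} (ht : t ≤ T) :
    MeasurableSet[𝓕 t] (boundedUpTo Y N t) := by
  have e : boundedUpTo Y N t = ⋂ q : ℚ, {ω | |Y (min q (t : ℝ)) ω| ≤ N} := by
    ext ω; rw [h.mem_boundedUpTo_iff, mem_iInter]; rfl
  rw [e]
  refine MeasurableSet.iInter fun q => ?_
  have hm : Measurable[𝓕 t] (Y (min q (t : ℝ))) := by
    rcases le_total (q : ℝ) 0 with hq | hq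
    · rw [h.eq_of_nonpos ((min_le_left _ _).trans hq)]
      exact (h.adapted 0 zero_le).mono (𝓕.mono zero_le) le_rfl
    · have := (h.adapted (min ⟨q, hq⟩ t) ((min_le_right _ _).trans ht)).mono
        (𝓕.mono (min_le_right _ _)) le_rfl
      exact this
  exact measurableSet_le (measurable_norm.comp hm) measurable_const

lemma measurableSet_boundedUpTo_uncurry (h : IsContinuousAdapted 𝓕 T Y) (N : ℝ) :
    MeasurableSet {p : Ω × ℝ | p.1 ∈ boundedUpTo Y N p.2} := by
  have e : {p : Ω × ℝ | p.1 ∈ boundedUpTo Y N p.2} =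
      ⋂ q : ℚ, {p : Ω × ℝ | |Y (min q p.2) p.1| ≤ N} := by
    ext p; rw [Set.mem_ofPred_eq, h.mem_boundedUpTo_iff, mem_iInter]; rfl
  rw [e]
  refine MeasurableSet.iInter fun q => ?_
  have : Measurable fun p : Ω × ℝ => Y (min q p.2) p.1 :=
    h.measurable_uncurry.comp (measurable_fst.prodMk (measurable_const.min measurable_snd))
  exact measurableSet_le this.norm measurable_const

end IsContinuousAdapted

omit mΩ in
-- Cauchy–Schwarz for the weight |k|, obtained by expanding ∫|k|(A|Y| - z)² ≥ 0 with z = ∫|k||Y|.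
-- The weight is only integrable, so Y rather than k must carry the square.
lemma sq_integral_mul_le {k Y : ℝ → ℝ} {t A : ℝ} (ht : 0 ≤ t)
    (hk : IntervalIntegrable k volume 0 t) (hY : Continuous Y) (hA0 : 0 < A)
    (hA : ∫ s in (0 : ℝ)..t, |k s| ≤ A) :
    (∫ s in (0 : ℝ)..t, Y s * k s) ^ 2 ≤ A * ∫ s in (0 : ℝ)..t, |k s| * Y s ^ 2 := by
  have i1 : IntervalIntegrable (fun s => |k s|) volume 0 t := hk.abs
  have i2 : IntervalIntegrable (fun s => |k s| * |Y s|) volume 0 t :=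
    i1.mul_continuousOn hY.abs.continuousOn
  have i3 : IntervalIntegrable (fun s => |k s| * Y s ^ 2) volume 0 t :=
    i1.mul_continuousOn (hY.pow 2).continuousOn
  set z := ∫ s in (0 : ℝ)..t, |k s| * |Y s| with hz
  have hz0 : 0 ≤ z := intervalIntegral.integral_nonneg ht fun _ _ => by positivity
  have hle : |∫ s in (0 : ℝ)..t, Y s * k s| ≤ z := by
    refine (intervalIntegral.abs_integral_le_integral_abs ht).trans_eq ?_
    refine intervalIntegral.integral_congr fun s _ => ?_
    simp only [abs_mul, mul_comm]
  have hpos : 0 ≤ ∫ s in (0 : ℝ)..t, |k s| * (A * |Y s| - z) ^ 2 :=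
    intervalIntegral.integral_nonneg ht fun _ _ => by positivity
  have e : ∀ c : ℝ, ∫ s in (0 : ℝ)..t, |k s| * (A * |Y s| - c) ^ 2 =
      A ^ 2 * (∫ s in (0 : ℝ)..t, |k s| * Y s ^ 2) - 2 * A * c *
        (∫ s in (0 : ℝ)..t, |k s| * |Y s|) + c ^ 2 * ∫ s in (0 : ℝ)..t, |k s| := by
    intro c
    rw [← intervalIntegral.integral_const_mul, ← intervalIntegral.integral_const_mul,
      ← intervalIntegral.integral_const_mul, ← intervalIntegral.integral_sub (i3.const_mul _)
      (i2.const_mul _), ← intervalIntegral.integral_add ((i3.const_mul _).sub (i2.const_mul _))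
      (i1.const_mul _)]
    refine intervalIntegral.integral_congr fun s _ => ?_
    have : Y s ^ 2 = |Y s| ^ 2 := (sq_abs _).symm
    simp only [this]; ring
  rw [e z, ← hz] at hpos
  have h1 : z ^ 2 * A ≤ A ^ 2 * ∫ s in (0 : ℝ)..t, |k s| * Y s ^ 2 := by
    nlinarith [mul_le_mul_of_nonneg_left hA (sq_nonneg z)]
  have h2 : z ^ 2 ≤ A * ∫ s in (0 : ℝ)..t, |k s| * Y s ^ 2 := by
    refine le_of_mul_le_mul_right (h1.trans_eq ?_) hA0
    ring
  refine le_trans ?_ h2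
  rw [← sq_abs]
  exact pow_le_pow_left₀ (abs_nonneg _) hle 2

variable [IsProbabilityMeasure P] {B : ℝ≥0 → Ω → EuclideanSpace ℝ (Fin d)}

/-- The second moment of `Y` at time `s`, as long as `|Y|` has not exceeded `N`. -/
noncomputable def truncMoment (P : Measure Ω) (Y : ℝ → Ω → ℝ) (N s : ℝ) : ℝ :=
  ∫ ω, (boundedUpTo Y N s).indicator (fun ω => Y s ω ^ 2) ω ∂P

omit mΩ in
lemma indicator_boundedUpTo_le (Y : ℝ → Ω → ℝ) (N s : ℝ) (ω : Ω) :
    (boundedUpTo Y N s).indicator (fun ω => Y s ω ^ 2) ω ≤ N ^ 2 := by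
  by_cases h : ω ∈ boundedUpTo Y N s
  · rw [Set.indicator_of_mem h, ← sq_abs]
    exact pow_le_pow_left₀ (abs_nonneg _) (h s le_rfl) 2
  · rw [Set.indicator_of_notMem h]; positivity

omit mΩ in
lemma indicator_boundedUpTo_nonneg (Y : ℝ → Ω → ℝ) (N s : ℝ) (ω : Ω) :
    0 ≤ (boundedUpTo Y N s).indicator (fun ω => Y s ω ^ 2) ω :=
  Set.indicator_nonneg (fun _ _ => sq_nonneg _) ω

namespace IsContinuousAdapted

variable {Y : ℝ → Ω → ℝ}

lemma measurable_indicator (h : IsContinuousAdapted 𝓕 T Y) (N : ℝ) :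
    Measurable fun p : Ω × ℝ => (boundedUpTo Y N p.2).indicator (fun ω => Y p.2 ω ^ 2) p.1 := by
  have e : (fun p : Ω × ℝ => (boundedUpTo Y N p.2).indicator (fun ω => Y p.2 ω ^ 2) p.1) =
      {p : Ω × ℝ | p.1 ∈ boundedUpTo Y N p.2}.indicator fun p => Y p.2 p.1 ^ 2 := by
    ext p
    by_cases hp : p.1 ∈ boundedUpTo Y N p.2 <;> simp [Set.indicator, hp]
  rw [e]
  exact (h.measurable_uncurry.pow_const 2).indicator (h.measurableSet_boundedUpTo_uncurry N)

lemma integrable_prod (h : IsContinuousAdapted 𝓕 T Y) (N : ℝ) {w : ℝ → ℝ} {t : ℝ}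
    (hw : IntegrableOn w (Ioc 0 t)) :
    Integrable (fun p : Ω × ℝ => w p.2 * (boundedUpTo Y N p.2).indicator (fun ω => Y p.2 ω ^ 2) p.1)
      (P.prod (volume.restrict (Ioc 0 t))) := by
  have h1 : Integrable (fun p : Ω × ℝ => w p.2) (P.prod (volume.restrict (Ioc 0 t))) :=
    hw.comp_snd P
  refine (h1.bdd_mul (h.measurable_indicator N).aestronglyMeasurable (c := N ^ 2)
    (ae_of_all _ fun p => ?_)).congr (ae_of_all _ fun p => by simp only [mul_comm])
  rw [Real.norm_eq_abs, abs_of_nonneg (indicator_boundedUpTo_nonneg _ _ _ _)]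
  exact indicator_boundedUpTo_le _ _ _ _

lemma integral_integral_eq (h : IsContinuousAdapted 𝓕 T Y) (N : ℝ) {w : ℝ → ℝ} {t : ℝ} (ht : 0 ≤ t)
    (hw : IntegrableOn w (Ioc 0 t)) :
    ∫ ω, (∫ s in (0 : ℝ)..t, w s * (boundedUpTo Y N s).indicator (fun ω => Y s ω ^ 2) ω) ∂P =
      ∫ s in (0 : ℝ)..t, w s * truncMoment P Y N s := by
  simp_rw [intervalIntegral.integral_of_le ht, truncMoment]
  rw [integral_integral_swap (f := fun ω s => w s *
    (boundedUpTo Y N s).indicator (fun ω => Y s ω ^ 2) ω) (h.integrable_prod N hw)]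
  simp_rw [integral_const_mul]

lemma intervalIntegrable_truncMoment (h : IsContinuousAdapted 𝓕 T Y) (N : ℝ) {w : ℝ → ℝ} {t : ℝ}
    (ht : 0 ≤ t) (hw : IntegrableOn w (Ioc 0 t)) :
    IntervalIntegrable (fun s => w s * truncMoment P Y N s) volume 0 t := by
  rw [intervalIntegrable_iff_integrableOn_Ioc_of_le ht]
  have := (h.integrable_prod (P := P) N hw).integral_prod_right
  simp only [integral_const_mul] at this
  exact this

end IsContinuousAdapted

end

end PortfolioES

/-! ### Gronwall estimate and pathwise uniqueness for linear equations -/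

namespace PortfolioES

variable {d : ℕ} {Ω : Type*} [mΩ : MeasurableSpace Ω]

section

variable {𝓕 : Filtration ℝ≥0 mΩ} {P : Measure Ω} [IsProbabilityMeasure P] {T : ℝ≥0}
  {B : ℝ≥0 → Ω → EuclideanSpace ℝ (Fin d)} {D M : ℝ → Ω → ℝ} {k : ℝ → ℝ}
  {y : ℝ → EuclideanSpace ℝ (Fin d)}

/-- As long as |Y| has not exceeded N, Y² ≤ 2(∫Yk)² + 2M². The first term is handled by the weighted
Cauchy–Schwarz inequality and the second by the localized isometry. The localization keeps all
moments finite and leads to a linear integral inequality for the truncated moment. -/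
lemma truncMoment_le (hB : IsFilteredBM 𝓕 P T B) {Y : ℝ → Ω → ℝ} (hY : IsContinuousAdapted 𝓕 T Y)
    (hk : IntervalIntegrable k volume 0 T) (hy : MemLp y 2 (volume.restrict (Icc 0 (T : ℝ))))
    (hM : IsGridApprox 𝓕 P B T (fun s ω => Y s ω • y s) M)
    (heq : ∀ᵐ ω ∂P, ∀ t ∈ Icc 0 (T : ℝ), Y t ω = (∫ s in (0 : ℝ)..t, Y s ω * k s) + M t ω)
    {N : ℝ} {t : ℝ} (ht : t ∈ Icc 0 (T : ℝ)) :
    truncMoment P Y N t ≤ ∫ s in (0 : ℝ)..t,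
      (2 * ((∫ s in (0 : ℝ)..T, |k s|) + 1) * |k s| + 2 * ‖y s‖ ^ 2) * truncMoment P Y N s := by
  have h0T : (0 : ℝ) ∈ Icc 0 (T : ℝ) := ⟨le_rfl, T.coe_nonneg⟩
  have hTT : (T : ℝ) ∈ Icc 0 (T : ℝ) := ⟨T.coe_nonneg, le_rfl⟩
  set G := boundedUpTo Y N with hG
  set χ : ℝ → Ω → ℝ := fun s ω => (G s).indicator (fun ω => Y s ω ^ 2) ω with hχ
  have hχ0 : ∀ s ω, 0 ≤ χ s ω := fun s ω => indicator_boundedUpTo_nonneg Y N s ω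
  have hχN : ∀ s ω, χ s ω ≤ N ^ 2 := fun s ω => indicator_boundedUpTo_le Y N s ω
  set A := (∫ s in (0 : ℝ)..T, |k s|) + 1 with hA
  have hA0 : 0 < A := by
    have : 0 ≤ ∫ s in (0 : ℝ)..T, |k s| :=
      intervalIntegral.integral_nonneg T.coe_nonneg fun _ _ => abs_nonneg _
    linarith
  have hkt : IntervalIntegrable k volume 0 t :=
    hk.mono_set (by rw [uIcc_of_le T.coe_nonneg]; exact uIcc_subset_Icc h0T ht)
  have hAt : ∫ s in (0 : ℝ)..t, |k s| ≤ A := by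
    have : ∫ s in (0 : ℝ)..t, |k s| ≤ ∫ s in (0 : ℝ)..T, |k s| :=
      intervalIntegral.integral_mono_interval le_rfl ht.1 ht.2
        (ae_of_all _ fun _ => abs_nonneg _) hk.abs
    linarith
  have hw1 : IntegrableOn (fun s => |k s|) (Ioc 0 t) :=
    (intervalIntegrable_iff_integrableOn_Ioc_of_le ht.1).1 hkt.abs
  have hy2 := intervalIntegrable_norm_sq hy h0T ht
  have hw2 : IntegrableOn (fun s => ‖y s‖ ^ 2) (Ioc 0 t) :=
    (intervalIntegrable_iff_integrableOn_Ioc_of_le ht.1).1 hy2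
  have hbG : ∀ s ω, ‖(G s).indicator (fun ω => Y s ω • y s) ω‖ ^ 2 = ‖y s‖ ^ 2 * χ s ω := by
    intro s ω
    by_cases h : ω ∈ G s
    · simp only [hχ, Set.indicator_of_mem h, norm_smul, mul_pow, Real.norm_eq_abs, sq_abs]; ring
    · simp only [hχ, Set.indicator_of_notMem h]; simp
  have hb2 : ∀ ω, MemLp (fun s => Y s ω • y s) 2 (volume.restrict (Icc 0 (T : ℝ))) := by
    intro ω
    obtain ⟨C, hC⟩ := hY.exists_bound ω
    refine MemLp.of_le_mul (c := C) hy ((hY.continuous ω).aestronglyMeasurable.smul hy.1)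
      (ae_of_all _ fun s => ?_)
    rw [norm_smul]
    exact mul_le_mul_of_nonneg_right (hC s) (norm_nonneg _)
  have hχmeas : ∀ ω, Measurable fun s => χ s ω := fun ω =>
    (hY.measurable_indicator N).comp (measurable_const.prodMk measurable_id)
  have hwχ : ∀ ω {w : ℝ → ℝ}, IntegrableOn w (Ioc 0 t) →
      IntervalIntegrable (fun s => w s * χ s ω) volume 0 t := by
    intro ω w hw
    rw [intervalIntegrable_iff_integrableOn_Ioc_of_le ht.1]
    refine (hw.bdd_mul (hχmeas ω).aestronglyMeasurable (c := N ^ 2)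
      (ae_of_all _ fun p => ?_)).congr (ae_of_all _ fun p => by simp only [mul_comm])
    rw [Real.norm_eq_abs, abs_of_nonneg (hχ0 _ _)]
    exact hχN _ _
  have hK : ∀ ω, ∫ s in (0 : ℝ)..T, ‖(G s).indicator (fun ω => Y s ω • y s) ω‖ ^ 2 ≤
      N ^ 2 * ∫ s in (0 : ℝ)..T, ‖y s‖ ^ 2 := by
    intro ω
    have i1 := intervalIntegrable_norm_sq hy h0T hTT
    have i0 : IntervalIntegrable
        (fun s => ‖(G s).indicator (fun ω => Y s ω • y s) ω‖ ^ 2) volume 0 T :=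
      intervalIntegrable_norm_sq (by
        have := memLp_indicator_section (b := fun s ω => Y s ω • y s)
          (hY.measurableSet_boundedUpTo_uncurry N) 0 (hb2 ω)
        simpa using this) h0T hTT
    rw [← intervalIntegral.integral_const_mul]
    refine intervalIntegral.integral_mono_on T.coe_nonneg i0 (i1.const_mul _) fun s _ => ?_
    rw [hbG, mul_comm]
    exact mul_le_mul_of_nonneg_right (hχN s ω) (by positivity)
  have hK0 : 0 ≤ N ^ 2 * ∫ s in (0 : ℝ)..T, ‖y s‖ ^ 2 :=
    mul_nonneg (sq_nonneg _) (intervalIntegral.integral_nonneg T.coe_nonneg fun _ _ => by positivity)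
  have hiso := hM.lintegral_indicator_sq_le (t := ⟨t, ht.1⟩) hB (antitone_boundedUpTo Y N)
    (fun t ht => hY.measurableSet_boundedUpTo N ht)
    (fun ω s _ h => hY.mem_boundedUpTo_of_lt fun r hr => h r hr r le_rfl)
    (hY.measurableSet_boundedUpTo_uncurry N) (ae_of_all _ hb2) hK0 (ae_of_all _ hK)
    (by exact_mod_cast ht.2)
  have hiso' : ∫⁻ ω, (G t).indicator (fun ω => ENNReal.ofReal (M t ω ^ 2)) ω ∂P ≤
      ENNReal.ofReal (∫ ω, (∫ s in (0 : ℝ)..t,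
        ‖(G s).indicator (fun ω => Y s ω • y s) ω‖ ^ 2) ∂P) := hiso
  simp_rw [hbG] at hiso'
  have F1 := hY.integral_integral_eq (P := P) N ht.1 hw1
  have F2 := hY.integral_integral_eq (P := P) N ht.1 hw2
  have I1 := hY.intervalIntegrable_truncMoment (P := P) N ht.1 hw1
  have I2 := hY.intervalIntegrable_truncMoment (P := P) N ht.1 hw2
  have hE1 : Integrable (fun ω => ∫ s in (0 : ℝ)..t, |k s| * χ s ω) P := by
    simp_rw [intervalIntegral.integral_of_le ht.1]
    exact (hY.integrable_prod (P := P) N hw1).integral_prod_left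
  have hrhs : ∫ s in (0 : ℝ)..t, (2 * A * |k s| + 2 * ‖y s‖ ^ 2) * truncMoment P Y N s =
      2 * A * (∫ ω, (∫ s in (0 : ℝ)..t, |k s| * χ s ω) ∂P) +
        2 * ∫ ω, (∫ s in (0 : ℝ)..t, ‖y s‖ ^ 2 * χ s ω) ∂P := by
    rw [F1, F2, ← intervalIntegral.integral_const_mul, ← intervalIntegral.integral_const_mul,
      ← intervalIntegral.integral_add (I1.const_mul _) (I2.const_mul _)]
    exact intervalIntegral.integral_congr fun s _ => by ring
  rw [hrhs]
  have hn1 : ∀ ω, 0 ≤ ∫ s in (0 : ℝ)..t, |k s| * χ s ω := fun ω =>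
    intervalIntegral.integral_nonneg ht.1 fun s _ => mul_nonneg (abs_nonneg _) (hχ0 s ω)
  have hn2 : 0 ≤ ∫ ω, (∫ s in (0 : ℝ)..t, ‖y s‖ ^ 2 * χ s ω) ∂P := integral_nonneg fun ω =>
    intervalIntegral.integral_nonneg ht.1 fun s _ => mul_nonneg (by positivity) (hχ0 s ω)
  have hχi : Integrable (χ t) P := by
    refine Integrable.of_bound (C := N ^ 2) ?_ (ae_of_all _ fun ω => ?_)
    · exact ((hY.measurable_indicator N).comp
        (measurable_id.prodMk measurable_const)).aestronglyMeasurable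
    · rw [Real.norm_eq_abs, abs_of_nonneg (hχ0 _ _)]; exact hχN _ _
  have hpt : ∀ᵐ ω ∂P, ENNReal.ofReal (χ t ω) ≤
      ENNReal.ofReal (2 * A * ∫ s in (0 : ℝ)..t, |k s| * χ s ω) +
        2 * (G t).indicator (fun ω => ENNReal.ofReal (M t ω ^ 2)) ω := by
    filter_upwards [heq] with ω hω
    by_cases h : ω ∈ G t
    · have hχt : χ t ω = Y t ω ^ 2 := by simp only [hχ, Set.indicator_of_mem h]
      have hint : ∫ s in (0 : ℝ)..t, |k s| * Y s ω ^ 2 = ∫ s in (0 : ℝ)..t, |k s| * χ s ω := by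
        refine intervalIntegral.integral_congr fun s hs => ?_
        rw [uIcc_of_le ht.1] at hs
        have : ω ∈ G s := antitone_boundedUpTo Y N hs.2 h
        simp only [hχ, Set.indicator_of_mem this]
      have hcs := sq_integral_mul_le ht.1 hkt (hY.continuous ω) hA0 hAt
      rw [hint] at hcs
      rw [Set.indicator_of_mem h, hχt, hω t ht, ← ENNReal.ofReal_ofNat (n := 2),
        ← ENNReal.ofReal_mul (by norm_num), ← ENNReal.ofReal_add
        (mul_nonneg (by positivity) (hn1 ω)) (by positivity)]
      refine ENNReal.ofReal_le_ofReal ?_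
      have := add_sq_le (a := ∫ s in (0 : ℝ)..t, Y s ω * k s) (b := M t ω)
      linarith
    · have : χ t ω = 0 := by simp only [hχ, Set.indicator_of_notMem h]
      rw [this]; simp
  have hle : ENNReal.ofReal (truncMoment P Y N t) ≤
      ENNReal.ofReal (2 * A * (∫ ω, (∫ s in (0 : ℝ)..t, |k s| * χ s ω) ∂P) +
        2 * ∫ ω, (∫ s in (0 : ℝ)..t, ‖y s‖ ^ 2 * χ s ω) ∂P) := by
    calc ENNReal.ofReal (truncMoment P Y N t) = ∫⁻ ω, ENNReal.ofReal (χ t ω) ∂P :=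
          ofReal_integral_eq_lintegral_ofReal hχi (ae_of_all _ fun ω => hχ0 t ω)
      _ ≤ ∫⁻ ω, (ENNReal.ofReal (2 * A * ∫ s in (0 : ℝ)..t, |k s| * χ s ω) +
        2 * (G t).indicator (fun ω => ENNReal.ofReal (M t ω ^ 2)) ω) ∂P := lintegral_mono_ae hpt
      _ = ENNReal.ofReal (2 * A * (∫ ω, (∫ s in (0 : ℝ)..t, |k s| * χ s ω) ∂P)) +
          2 * ∫⁻ ω, (G t).indicator (fun ω => ENNReal.ofReal (M t ω ^ 2)) ω ∂P := by
        rw [lintegral_add_left' ((hE1.const_mul _).1.aemeasurable.ennreal_ofReal),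
          lintegral_const_mul' _ _ (by norm_num), ← ofReal_integral_eq_lintegral_ofReal
          (hE1.const_mul _) (ae_of_all _ fun ω => mul_nonneg (by positivity) (hn1 ω)),
          integral_const_mul]
      _ ≤ _ := by
        rw [ENNReal.ofReal_add (mul_nonneg (by positivity) (integral_nonneg hn1))
          (by positivity), ENNReal.ofReal_mul (p := 2) (by norm_num), ENNReal.ofReal_ofNat]
        gcongr
  refine (ENNReal.ofReal_le_ofReal_iff ?_).1 hle
  exact add_nonneg (mul_nonneg (by positivity) (integral_nonneg hn1)) (by positivity)

/-- A process with `dD = D k dt + D y' dB` and `D_0 = 0` vanishes. -/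
theorem ae_eq_zero_of_linear (hB : IsFilteredBM 𝓕 P T B)
    (hnull : ∀ N, MeasurableSet N → P N = 0 → MeasurableSet[𝓕 0] N)
    (hD : ∀ t : ℝ≥0, t ≤ T → Measurable[𝓕 t] (D t))
    (hDc : ∀ᵐ ω ∂P, ContinuousOn (fun t => D t ω) (Icc 0 (T : ℝ)))
    (hk : IntervalIntegrable k volume 0 T) (hy : MemLp y 2 (volume.restrict (Icc 0 (T : ℝ))))
    (hM : IsGridApprox 𝓕 P B T (fun s ω => D s ω • y s) M)
    (heq : ∀ᵐ ω ∂P, ∀ t ∈ Icc 0 (T : ℝ), D t ω = (∫ s in (0 : ℝ)..t, D s ω * k s) + M t ω) :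
    ∀ᵐ ω ∂P, ∀ t ∈ Icc 0 (T : ℝ), D t ω = 0 := by
  obtain ⟨Y, hY, hYD⟩ := exists_isContinuousAdapted hnull hD hDc
  have hM' : IsGridApprox 𝓕 P B T (fun s ω => Y s ω • y s) M := by
    intro ε hε F
    obtain ⟨g, n, ξ, u, h1, h2, h3, h4, h5, h6, h7, h8, h9, h10⟩ := hM ε hε F
    refine ⟨g, n, ξ, u, h1, h2, h3, h4, h5, h6, h7, h8, h9, le_trans (measure_mono_ae ?_) h10⟩
    filter_upwards [hYD] with ω hω h
    have e : ∫ s in (0 : ℝ)..T, ‖u s ω - Y s ω • y s‖ ^ 2 =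
        ∫ s in (0 : ℝ)..T, ‖u s ω - D s ω • y s‖ ^ 2 := by
      refine intervalIntegral.integral_congr fun s hs => ?_
      rw [uIcc_of_le T.coe_nonneg] at hs
      simp only [hω s hs]
    have h' : ε ≤ ∫ s in (0 : ℝ)..T, ‖u s ω - Y s ω • y s‖ ^ 2 := h
    rw [e] at h'
    exact h'
  have heq' : ∀ᵐ ω ∂P, ∀ t ∈ Icc 0 (T : ℝ), Y t ω = (∫ s in (0 : ℝ)..t, Y s ω * k s) + M t ω := by
    filter_upwards [heq, hYD] with ω h1 h2 t ht
    rw [h2 t ht, h1 t ht]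
    congr 1
    refine intervalIntegral.integral_congr fun s hs => ?_
    rw [uIcc_of_le ht.1] at hs
    simp only [h2 s ⟨hs.1, hs.2.trans ht.2⟩]
  have h0T : (0 : ℝ) ∈ Icc 0 (T : ℝ) := ⟨le_rfl, T.coe_nonneg⟩
  have hTT : (T : ℝ) ∈ Icc 0 (T : ℝ) := ⟨T.coe_nonneg, le_rfl⟩
  set A := (∫ s in (0 : ℝ)..T, |k s|) + 1 with hA
  have hA0 : 0 ≤ A := by
    have : 0 ≤ ∫ s in (0 : ℝ)..T, |k s| :=
      intervalIntegral.integral_nonneg T.coe_nonneg fun _ _ => abs_nonneg _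
    linarith
  have hκ : IntervalIntegrable (fun s => 2 * A * |k s| + 2 * ‖y s‖ ^ 2) volume 0 T :=
    (hk.abs.const_mul _).add ((intervalIntegrable_norm_sq hy h0T hTT).const_mul 2)
  have hzero : ∀ N : ℕ, ∀ t ∈ Icc 0 (T : ℝ), truncMoment P Y N t ≤ 0 := by
    intro N
    refine nonpos_of_le_integral_mul T.coe_nonneg hκ (fun s _ => by positivity) ?_
      fun t ht => truncMoment_le hB hY hk hy hM' heq' ht
    exact hY.intervalIntegrable_truncMoment N T.coe_nonneg
      ((intervalIntegrable_iff_integrableOn_Ioc_of_le T.coe_nonneg).1 hκ)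
  have hae : ∀ᵐ ω ∂P, ∀ (N : ℕ) (q : ℚ),
      (boundedUpTo Y N (projIcc 0 (T : ℝ) T.coe_nonneg q)).indicator
        (fun ω => Y (projIcc 0 (T : ℝ) T.coe_nonneg q) ω ^ 2) ω = 0 := by
    rw [ae_all_iff]; intro N
    rw [ae_all_iff]; intro q
    set t := projIcc 0 (T : ℝ) T.coe_nonneg q
    have hi : Integrable (fun ω => (boundedUpTo Y N t).indicator (fun ω => Y t ω ^ 2) ω) P := by
      refine Integrable.of_bound (C := (N : ℝ) ^ 2) ?_ (ae_of_all _ fun ω => ?_)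
      · exact ((hY.measurable_indicator N).comp
          (measurable_id.prodMk measurable_const)).aestronglyMeasurable
      · rw [Real.norm_eq_abs, abs_of_nonneg (indicator_boundedUpTo_nonneg _ _ _ _)]
        exact indicator_boundedUpTo_le _ _ _ _
    have h0 : truncMoment P Y N t = 0 := le_antisymm (hzero N t t.2)
      (integral_nonneg fun ω => indicator_boundedUpTo_nonneg _ _ _ _)
    exact (integral_eq_zero_iff_of_nonneg (fun ω => indicator_boundedUpTo_nonneg _ _ _ _) hi).1 h0
  filter_upwards [hae, hYD] with ω h1 h2
  obtain ⟨C, hC⟩ := hY.exists_bound ω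
  -- Each path is bounded, so for some N its localization is never active; the vanishing of all
  -- truncated moments then makes Y zero at rational times, and continuity does the rest.
  obtain ⟨N, hN⟩ := exists_nat_ge C
  have hq : ∀ q : ℚ, Y q ω = 0 := by
    intro q
    have h := h1 N q
    rw [Set.indicator_of_mem (show ω ∈ boundedUpTo Y N _ from fun r _ => (hC r).trans hN)] at h
    rw [hY.eq_proj q]
    exact pow_eq_zero_iff (two_ne_zero) |>.1 h
  have hall : (fun t => Y t ω) = fun _ => 0 := by
    refine Continuous.ext_on Rat.denseRange_cast (hY.continuous ω) continuous_const ?_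
    rintro _ ⟨q, rfl⟩
    exact hq q
  intro t ht
  rw [← h2 t ht]
  exact congrFun hall t

/-- Pathwise uniqueness for linear equations. -/
theorem IsItoProcess.ae_eq_of_linear (hB : IsFilteredBM 𝓕 P T B)
    (hnull : ∀ N, MeasurableSet N → P N = 0 → MeasurableSet[𝓕 0] N) {x : ℝ} {X X' : ℝ → Ω → ℝ}
    {a a' : ℝ → Ω → ℝ}
    (hX : IsItoProcess 𝓕 P B T x a (fun t ω => X t ω • y t) X)
    (hX' : IsItoProcess 𝓕 P B T x a' (fun t ω => X' t ω • y t) X')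
    (hk : IntervalIntegrable k volume 0 T) (hy : MemLp y 2 (volume.restrict (Icc 0 (T : ℝ))))
    (haa : ∀ᵐ ω ∂P, ∀ t ∈ Icc 0 (T : ℝ), a' t ω - a t ω = (X' t ω - X t ω) * k t) :
    Indistinguishable P T X' X := by
  obtain ⟨M, hM, hMeq⟩ := hX.eq
  obtain ⟨M', hM', hMeq'⟩ := hX'.eq
  have hG := hM'.isGridApprox_sub hB hM
  simp_rw [← sub_smul] at hG
  have h0 := ae_eq_zero_of_linear (D := fun t ω => X' t ω - X t ω) hB hnull
    (fun t ht => (hX'.adapted t (by exact_mod_cast ht)).sub (hX.adapted t (by exact_mod_cast ht)))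
    (by filter_upwards [hX.continuous, hX'.continuous] with ω h1 h2 using h2.sub h1) hk hy hG (by
      filter_upwards [hMeq, hMeq', haa, hX.drift_integrable, hX'.drift_integrable]
        with ω h1 h2 h3 h4 h5 t ht
      have hsub : uIcc 0 t ⊆ Icc 0 (T : ℝ) := uIcc_subset_Icc ⟨le_rfl, T.coe_nonneg⟩ ht
      have e : ∫ s in (0 : ℝ)..t, (X' s ω - X s ω) * k s = ∫ s in (0 : ℝ)..t, (a' s ω - a s ω) :=
        intervalIntegral.integral_congr fun s hs => (h3 s (hsub hs)).symm
      rw [e, intervalIntegral.integral_sub ((h5.mono_set hsub).intervalIntegrable)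
        ((h4.mono_set hsub).intervalIntegrable), h1 t ht, h2 t ht]
      ring)
  filter_upwards [h0] with ω hω t ht
  linarith [hω t ht]

end

end PortfolioES

/-! ### Girsanov's theorem for a deterministic drift -/

namespace PortfolioES

variable {d : ℕ} {Ω : Type*} [mΩ : MeasurableSpace Ω]

lemma lintegral_exp_gaussianReal (v : ℝ≥0) (c : ℝ) :
    ∫⁻ z, ENNReal.ofReal (Real.exp (z - c)) ∂(gaussianReal 0 v) =
      ENNReal.ofReal (Real.exp (v / 2 - c)) := by
  have h := integral_exp_mul_gaussianReal v 1
  have hi := integrable_exp_mul_gaussianReal' v 1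
  simp only [one_mul, one_pow, mul_one] at h hi
  simp_rw [Real.exp_sub _ c]
  rw [← ofReal_integral_eq_lintegral_ofReal (hi.div_const _) (ae_of_all _ fun z => by positivity),
    integral_div, h]

namespace IndepGaussian

variable {Ω : Type*} {m : MeasurableSpace Ω} [mΩ : MeasurableSpace Ω] {Q : Measure Ω}
  [IsProbabilityMeasure Q] {V : Ω → ℝ} {v : ℝ≥0}

lemma lintegral_mul_comp (h : IndepGaussian m Q V v) (hm : m ≤ mΩ) {η : Ω → ℝ≥0∞}
    (hη : Measurable[m] η) {φ : ℝ → ℝ≥0∞} (hφ : Measurable φ) :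
    ∫⁻ ω, η ω * φ (V ω) ∂Q = (∫⁻ ω, η ω ∂Q) * ∫⁻ z, φ z ∂(gaussianReal 0 v) := by
  rw [← h.map_eq, lintegral_map hφ h.measurable]
  exact lintegral_mul_eq_lintegral_mul_lintegral_of_indepFun (hη.mono hm le_rfl)
    (hφ.comp h.measurable) ((h.indepFun hη).comp measurable_id hφ)

lemma lintegral_mul_exp (h : IndepGaussian m Q V v) (hm : m ≤ mΩ) {η : Ω → ℝ≥0∞}
    (hη : Measurable[m] η) (c : ℝ) :
    ∫⁻ ω, η ω * ENNReal.ofReal (Real.exp (V ω - c)) ∂Q =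
      (∫⁻ ω, η ω ∂Q) * ENNReal.ofReal (Real.exp (v / 2 - c)) := by
  rw [← lintegral_exp_gaussianReal]
  exact h.lintegral_mul_comp hm hη (φ := fun z => ENNReal.ofReal (Real.exp (z - c)))
    (by fun_prop)

/-- Working with [0, ∞]-valued integrals yields the integrability of the exponentials, required by
`of_mgf`, from the case of the whole space. -/
lemma of_lintegral_exp (hV : Measurable V)
    (h : ∀ A, MeasurableSet[m] A → ∀ s : ℝ,
      ∫⁻ ω in A, ENNReal.ofReal (Real.exp (s * V ω)) ∂Q =
        Q A * ENNReal.ofReal (Real.exp (v * s ^ 2 / 2))) : IndepGaussian m Q V v := by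
  refine of_mgf hV fun A hA s => ⟨?_, ?_⟩
  · refine (lintegral_ofReal_ne_top_iff_integrable (by fun_prop)
      (ae_of_all _ fun ω => (Real.exp_pos _).le)).1 ?_
    have := h univ MeasurableSet.univ s
    rw [Measure.restrict_univ] at this
    rw [this]
    exact ENNReal.mul_ne_top (measure_ne_top _ _) ENNReal.ofReal_ne_top
  · rw [integral_eq_lintegral_of_nonneg_ae (ae_of_all _ fun ω => (Real.exp_pos _).le)
      (by fun_prop), h A hA s, ENNReal.toReal_mul, ENNReal.toReal_ofReal (Real.exp_pos _).le]
    rfl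

end IndepGaussian

lemma lintegral_withDensity_ofReal {P : Measure Ω} {Z : Ω → ℝ} (hZ : Measurable Z)
    (f : Ω → ℝ≥0∞) (hf : Measurable f) :
    ∫⁻ ω, f ω ∂(P.withDensity fun ω => ENNReal.ofReal (Z ω)) =
      ∫⁻ ω, f ω * ENNReal.ofReal (Z ω) ∂P := by
  rw [lintegral_withDensity_eq_lintegral_mul _ hZ.ennreal_ofReal hf]
  simp only [Pi.mul_apply, mul_comm]

/-- The exponential martingale `exp (-∫₀ᵗ θ' dW - ½ ∫₀ᵗ |θ|²)`. -/
noncomputable def expDensity (θ : ℝ → EuclideanSpace ℝ (Fin d)) (I : ℝ → Ω → ℝ) (t : ℝ) (ω : Ω) :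
    ℝ :=
  Real.exp (-I t ω - (∫ r in (0 : ℝ)..t, ‖θ r‖ ^ 2) / 2)

/-- The Brownian motion shifted by `∫₀^{t ∧ T} θ`. -/
noncomputable def shiftedBM (B : ℝ≥0 → Ω → EuclideanSpace ℝ (Fin d)) (T : ℝ≥0)
    (θ : ℝ → EuclideanSpace ℝ (Fin d)) (t : ℝ≥0) (ω : Ω) : EuclideanSpace ℝ (Fin d) :=
  B t ω + ∫ r in (0 : ℝ)..(min t T : ℝ≥0), θ r

section

variable {𝓕 : Filtration ℝ≥0 mΩ} {P : Measure Ω} {T : ℝ≥0}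
  {B : ℝ≥0 → Ω → EuclideanSpace ℝ (Fin d)} {θ : ℝ → EuclideanSpace ℝ (Fin d)} {I : ℝ → Ω → ℝ}

/-- The measure with density `exp (-∫₀ᵀ θ' dW - ½ ∫₀ᵀ |θ|²)`. -/
noncomputable def girsanovMeasure (P : Measure Ω) (T : ℝ≥0) (θ : ℝ → EuclideanSpace ℝ (Fin d))
    (I : ℝ → Ω → ℝ) : Measure Ω :=
  P.withDensity fun ω => ENNReal.ofReal (expDensity θ I T ω)

lemma intervalIntegrable_of_memLp {E : Type*} [NormedAddCommGroup E] {T : ℝ} {θ : ℝ → E}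
    (hθ : MemLp θ 2 (volume.restrict (Icc 0 T))) {s t : ℝ} (hs : s ∈ Icc 0 T) (ht : t ∈ Icc 0 T) :
    IntervalIntegrable θ volume s t := by
  have h : IntegrableOn θ (Icc 0 T) := hθ.integrable (by norm_num)
  exact (h.mono_set (uIcc_subset_Icc hs ht)).intervalIntegrable

lemma IsWienerIntegral.measurable_expDensity (h : IsWienerIntegral 𝓕 P B T θ I) {t : ℝ≥0}
    (ht : t ≤ T) : Measurable[𝓕 t] (expDensity θ I t) := by
  unfold expDensity
  have := h.adapted t ht
  exact Real.measurable_exp.comp ((this.neg).sub_const _)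

variable [IsProbabilityMeasure P]

/-- The exponential martingale property. -/
lemma IsWienerIntegral.lintegral_mul_expDensity (h : IsWienerIntegral 𝓕 P B T θ I)
    (hB : IsFilteredBM 𝓕 P T B) (hθ : MemLp θ 2 (volume.restrict (Icc 0 (T : ℝ)))) {t : ℝ≥0}
    (ht : t ≤ T) {f : Ω → ℝ≥0∞} (hf : Measurable[𝓕 t] f) :
    ∫⁻ ω, f ω * ENNReal.ofReal (expDensity θ I T ω) ∂P =
      ∫⁻ ω, f ω * ENNReal.ofReal (expDensity θ I t ω) ∂P := by
  have ht' : (t : ℝ) ∈ Icc 0 (T : ℝ) := ⟨t.coe_nonneg, by exact_mod_cast ht⟩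
  have h0 : (0 : ℝ) ∈ Icc 0 (T : ℝ) := ⟨le_rfl, T.coe_nonneg⟩
  have hT : (T : ℝ) ∈ Icc 0 (T : ℝ) := ⟨T.coe_nonneg, le_rfl⟩
  have hg := h.indepGaussian_add hB hθ ht le_rfl (-1) 0
  have hv0 : 0 ≤ ∫ r in (t : ℝ)..T, ‖θ r‖ ^ 2 :=
    intervalIntegral.integral_nonneg ht'.2 fun _ _ => by positivity
  have hsplit : (∫ r in (0 : ℝ)..t, ‖θ r‖ ^ 2) + ∫ r in (t : ℝ)..T, ‖θ r‖ ^ 2 =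
      ∫ r in (0 : ℝ)..T, ‖θ r‖ ^ 2 :=
    intervalIntegral.integral_add_adjacent_intervals (intervalIntegrable_norm_sq hθ h0 ht')
      (intervalIntegrable_norm_sq hθ ht' hT)
  have key := hg.lintegral_mul_exp (𝓕.le t)
    (η := fun ω => f ω * ENNReal.ofReal (expDensity θ I t ω))
    (by exact hf.mul (h.measurable_expDensity ht).ennreal_ofReal)
    ((∫ r in (t : ℝ)..T, ‖θ r‖ ^ 2) / 2)
  have e : ((∫ r in (t : ℝ)..T, ‖(-1 : ℝ) • θ r + 0‖ ^ 2).toNNReal : ℝ) =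
      ∫ r in (t : ℝ)..T, ‖θ r‖ ^ 2 := by
    simp only [neg_smul, one_smul, add_zero, norm_neg]
    exact Real.coe_toNNReal _ hv0
  -- Half the variance of the increment is exactly the compensator between t and T, so the
  -- conditional factor is 1.
  rw [e, sub_self, Real.exp_zero, ENNReal.ofReal_one, mul_one] at key
  rw [← key]
  refine lintegral_congr fun ω => ?_
  rw [mul_assoc, expDensity, expDensity, ← ENNReal.ofReal_mul (Real.exp_pos _).le, ← Real.exp_add,
    ← hsplit]
  simp only [inner_zero_left]
  congr 3
  ring

lemma IsWienerIntegral.lintegral_expDensity (h : IsWienerIntegral 𝓕 P B T θ I)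
    (hB : IsFilteredBM 𝓕 P T B) (hθ : MemLp θ 2 (volume.restrict (Icc 0 (T : ℝ)))) :
    ∫⁻ ω, ENNReal.ofReal (expDensity θ I T ω) ∂P = 1 := by
  have h1 := h.lintegral_mul_expDensity hB hθ (t := 0) bot_le (f := fun _ => 1) measurable_const
  simp only [one_mul] at h1
  rw [h1]
  have : ∀ᵐ ω ∂P, ENNReal.ofReal (expDensity θ I ((0 : ℝ≥0) : ℝ) ω) = 1 := by
    filter_upwards [h.eval_zero] with ω hω
    simp [expDensity, hω]
  rw [lintegral_congr_ae this]
  simp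

lemma IsWienerIntegral.isProbabilityMeasure_girsanovMeasure (h : IsWienerIntegral 𝓕 P B T θ I)
    (hB : IsFilteredBM 𝓕 P T B) (hθ : MemLp θ 2 (volume.restrict (Icc 0 (T : ℝ)))) :
    IsProbabilityMeasure (girsanovMeasure P T θ I) :=
  ⟨by rw [girsanovMeasure, withDensity_apply _ MeasurableSet.univ, Measure.restrict_univ,
    h.lintegral_expDensity hB hθ]⟩

lemma IsWienerIntegral.lintegral_girsanovMeasure (h : IsWienerIntegral 𝓕 P B T θ I)
    (hB : IsFilteredBM 𝓕 P T B) (hθ : MemLp θ 2 (volume.restrict (Icc 0 (T : ℝ)))) {t : ℝ≥0}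
    (ht : t ≤ T) {f : Ω → ℝ≥0∞} (hf : Measurable[𝓕 t] f) :
    ∫⁻ ω, f ω ∂(girsanovMeasure P T θ I) = ∫⁻ ω, f ω * ENNReal.ofReal (expDensity θ I t ω) ∂P := by
  rw [girsanovMeasure, lintegral_withDensity_ofReal
    ((h.measurable_expDensity le_rfl).mono (𝓕.le T) le_rfl) _ (hf.mono (𝓕.le t) le_rfl)]
  exact h.lintegral_mul_expDensity hB hθ ht hf

lemma inner_integral {s t : ℝ} (u : EuclideanSpace ℝ (Fin d)) (hθ : IntervalIntegrable θ volume s t) :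
    ⟪u, ∫ r in s..t, θ r⟫ = ∫ r in s..t, ⟪u, θ r⟫ :=
  ((innerSL ℝ u).intervalIntegral_comp_comm hθ).symm

/-- Girsanov's theorem for a deterministic drift. -/
theorem IsWienerIntegral.isFilteredBM_shiftedBM (h : IsWienerIntegral 𝓕 P B T θ I)
    (hB : IsFilteredBM 𝓕 P T B) (hθ : MemLp θ 2 (volume.restrict (Icc 0 (T : ℝ)))) :
    IsFilteredBM 𝓕 (girsanovMeasure P T θ I) T (shiftedBM B T θ) where
  adapted t := (hB.adapted t).add_const _
  increment s t hst ht u := by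
    have := h.isProbabilityMeasure_girsanovMeasure hB hθ
    have hm : ∀ t, Measurable (shiftedBM B T θ t) := fun t => (hB.measurable t).add_const _
    have hs' : (s : ℝ) ∈ Icc 0 (T : ℝ) := ⟨s.coe_nonneg, by exact_mod_cast hst.trans ht⟩
    have ht' : (t : ℝ) ∈ Icc 0 (T : ℝ) := ⟨t.coe_nonneg, by exact_mod_cast ht⟩
    have hst' : (s : ℝ) ≤ t := by exact_mod_cast hst
    have h0 : (0 : ℝ) ∈ Icc 0 (T : ℝ) := ⟨le_rfl, T.coe_nonneg⟩
    have hdiff : ∀ ω, ⟪u, shiftedBM B T θ t ω - shiftedBM B T θ s ω⟫ =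
        ⟪u, B t ω - B s ω⟫ + ∫ r in (s : ℝ)..t, ⟪u, θ r⟫ := by
      intro ω
      rw [← inner_integral u (intervalIntegrable_of_memLp hθ hs' ht'),
        ← intervalIntegral.integral_interval_sub_left (intervalIntegrable_of_memLp hθ h0 ht')
          (intervalIntegrable_of_memLp hθ h0 hs'), ← inner_add_right, shiftedBM, shiftedBM,
        min_eq_left ht, min_eq_left (hst.trans ht)]
      congr 1
      abel
    refine IndepGaussian.of_lintegral_exp (by have := hm t; have := hm s; fun_prop) ?_
    intro A hA r
    have hi1 : IntervalIntegrable (fun w => ‖θ w‖ ^ 2) volume s t := intervalIntegrable_norm_sq hθ hs' ht'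
    have hi2 : IntervalIntegrable (fun w => ⟪u, θ w⟫) volume s t :=
      ⟨(innerSL ℝ u).integrable_comp (intervalIntegrable_of_memLp hθ hs' ht').1,
        (innerSL ℝ u).integrable_comp (intervalIntegrable_of_memLp hθ hs' ht').2⟩
    -- This is the variance of -ΔI + r⟪u, ΔB⟫. The cross term is what the drift of the shifted
    -- process compensates, and r²|u|²(t - s) is the variance that remains.
    have hv : ∫ w in (s : ℝ)..t, ‖(-1 : ℝ) • θ w + r • u‖ ^ 2 =
        (∫ w in (s : ℝ)..t, ‖θ w‖ ^ 2) - 2 * r * (∫ w in (s : ℝ)..t, ⟪u, θ w⟫) +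
          r ^ 2 * ‖u‖ ^ 2 * (t - s) := by
      rw [← intervalIntegral.integral_const_mul, ← intervalIntegral.integral_sub hi1
        (hi2.const_mul _)]
      have : r ^ 2 * ‖u‖ ^ 2 * ((t : ℝ) - s) = ∫ w in (s : ℝ)..t, r ^ 2 * ‖u‖ ^ 2 := by
        rw [intervalIntegral.integral_const, smul_eq_mul, mul_comm]
      rw [this, ← intervalIntegral.integral_add (hi1.sub (hi2.const_mul _))
        intervalIntegrable_const]
      refine intervalIntegral.integral_congr fun w _ => ?_
      simp only [neg_smul, one_smul]
      rw [neg_add_eq_sub, norm_sub_sq_real, real_inner_smul_left, norm_smul, mul_pow,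
        Real.norm_eq_abs, sq_abs]
      ring
    have hv0 : 0 ≤ ∫ w in (s : ℝ)..t, ‖(-1 : ℝ) • θ w + r • u‖ ^ 2 :=
      intervalIntegral.integral_nonneg hst' fun _ _ => by positivity
    have hsplit : (∫ r in (0 : ℝ)..s, ‖θ r‖ ^ 2) + ∫ r in (s : ℝ)..t, ‖θ r‖ ^ 2 =
        ∫ r in (0 : ℝ)..t, ‖θ r‖ ^ 2 :=
      intervalIntegral.integral_add_adjacent_intervals (intervalIntegrable_norm_sq hθ h0 hs') hi1
    have hA' : MeasurableSet A := 𝓕.le s A hA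
    have hAi : Measurable[𝓕 s] (A.indicator fun _ => (1 : ℝ≥0∞)) :=
      measurable_const.indicator hA
    have hQA : girsanovMeasure P T θ I A =
        ∫⁻ ω, A.indicator (fun _ => 1) ω * ENNReal.ofReal (expDensity θ I s ω) ∂P := by
      rw [← h.lintegral_girsanovMeasure hB hθ (hst.trans ht) hAi]
      exact (lintegral_indicator_one hA').symm
    -- Changing the measure multiplies exp(r⟪u, ΔB⟫) by exp(-ΔI) and a factor known at time s. The
    -- joint exponent is Gaussian and independent of 𝓕 s under the original measure, so its
    -- exponential moment on A is explicit.
    have hg := h.indepGaussian_add hB hθ hst ht (-1) (r • u)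
    have key := hg.lintegral_mul_exp (𝓕.le s)
      (η := fun ω => A.indicator (fun _ => 1) ω * ENNReal.ofReal (expDensity θ I s ω))
      (by exact hAi.mul (h.measurable_expDensity (hst.trans ht)).ennreal_ofReal)
      ((∫ r in (s : ℝ)..t, ‖θ r‖ ^ 2) / 2 - r * ∫ w in (s : ℝ)..t, ⟪u, θ w⟫)
    rw [← hQA, Real.coe_toNNReal _ hv0, hv] at key
    have hBt := hB.adapted t
    have hBs := (hB.adapted s).mono (𝓕.mono hst) le_rfl
    have hmeas : Measurable[𝓕 t] fun ω =>
        ENNReal.ofReal (Real.exp (r * ⟪u, shiftedBM B T θ t ω - shiftedBM B T θ s ω⟫)) := by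
      simp_rw [hdiff]
      have h1 : Measurable[𝓕 t] fun ω => ⟪u, B t ω - B s ω⟫ :=
        (innerSL ℝ u).continuous.measurable.comp (hBt.sub hBs)
      exact (Real.measurable_exp.comp ((h1.add_const _).const_mul r)).ennreal_ofReal
    rw [← lintegral_indicator hA', h.lintegral_girsanovMeasure hB hθ ht
      (hmeas.indicator (𝓕.mono hst A hA))]
    refine (Eq.trans ?_ key).trans ?_
    · refine lintegral_congr fun ω => ?_
      by_cases hω : ω ∈ A
      · simp only [Set.indicator_of_mem hω, one_mul]
        rw [expDensity, expDensity, ← ENNReal.ofReal_mul (Real.exp_pos _).le,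
          ← ENNReal.ofReal_mul (Real.exp_pos _).le, ← Real.exp_add, ← Real.exp_add, hdiff, ← hsplit,
          real_inner_smul_left]
        congr 2
        ring
      · simp [Set.indicator_of_notMem hω]
    · congr 3
      rw [NNReal.coe_mul, NNReal.coe_pow, coe_nnnorm, NNReal.coe_sub hst]
      ring

end

end PortfolioES

/-! ### Transfer of grid approximations to an absolutely continuous measure -/

namespace PortfolioES

variable {d : ℕ} {Ω : Type*} [mΩ : MeasurableSpace Ω]

section

variable {𝓕 : Filtration ℝ≥0 mΩ} {P : Measure Ω} {T : ℝ≥0}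
  {B : ℝ≥0 → Ω → EuclideanSpace ℝ (Fin d)} {θ : ℝ → EuclideanSpace ℝ (Fin d)}
  {b : ℝ → Ω → EuclideanSpace ℝ (Fin d)} {M : ℝ → Ω → ℝ}

/-- Absolute continuity in quantitative form; it carries smallness in probability from P to the
measure with density Z. -/
lemma withDensity_apply_le_of_measure_le {Z : Ω → ℝ≥0∞} [IsFiniteMeasure (P.withDensity Z)]
    {ε : ℝ≥0∞} (hε : ε ≠ 0) :
    ∃ δ > (0 : ℝ), ∀ s, P s ≤ ENNReal.ofReal δ → P.withDensity Z s ≤ ε := by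
  have hZ : ∫⁻ ω, Z ω ∂P ≠ ∞ := by
    have := measure_ne_top (P.withDensity Z) univ
    rwa [withDensity_apply _ MeasurableSet.univ, Measure.restrict_univ] at this
  obtain ⟨δ, hδ, h⟩ := exists_pos_setLIntegral_lt_of_measure_lt hZ hε
  obtain ⟨δ', h0, hlt⟩ : ∃ δ' > (0 : ℝ), ENNReal.ofReal δ' < δ := by
    obtain ⟨r, hr0, hr⟩ := ENNReal.lt_iff_exists_nnreal_btwn.1 hδ
    exact ⟨r, by exact_mod_cast hr0, by simpa using hr⟩
  refine ⟨δ', h0, fun s hs => ?_⟩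
  calc P.withDensity Z s ≤ P.withDensity Z (toMeasurable P s) := measure_mono (subset_toMeasurable _ _)
    _ = ∫⁻ ω in toMeasurable P s, Z ω ∂P := withDensity_apply _ (measurableSet_toMeasurable _ _)
    _ ≤ ε := (h _ (by rw [measure_toMeasurable]; exact hs.trans_lt hlt)).le

lemma gridSum_shiftedBM (hθ : MemLp θ 2 (volume.restrict (Icc 0 (T : ℝ)))) {g : ℕ → ℝ≥0}
    (hg : Monotone g) (hg0 : g 0 = 0) (hgT : ∀ i, g i ≤ T)
    {ξ : ℕ → Ω → EuclideanSpace ℝ (Fin d)} {u : ℝ → EuclideanSpace ℝ (Fin d)} {ω : Ω}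
    (hu : ∀ i, ∀ s ∈ Ioc (g i : ℝ) (g (i + 1)), u s = ξ i ω)
    (hi : IntervalIntegrable (fun s => ⟪u s, θ s⟫) volume 0 T) (k : ℕ) :
    gridSum (shiftedBM B T θ) g ξ k ω = gridSum B g ξ k ω + ∫ s in (0 : ℝ)..g k, ⟪u s, θ s⟫ := by
  have hmem : ∀ i, (g i : ℝ) ∈ Icc 0 (T : ℝ) := fun i =>
    ⟨(g i).coe_nonneg, by exact_mod_cast hgT i⟩
  have hsub : ∀ i j, uIcc (g i : ℝ) (g j) ⊆ uIcc 0 (T : ℝ) := fun i j => by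
    rw [uIcc_of_le T.coe_nonneg]; exact uIcc_subset_Icc (hmem i) (hmem j)
  induction k with
  | zero => simp [gridSum, hg0]
  | succ k ih =>
    have h0 : (0 : ℝ) ∈ Icc 0 (T : ℝ) := ⟨le_rfl, T.coe_nonneg⟩
    have hk : (g k : ℝ) ≤ g (k + 1) := by exact_mod_cast hg (Nat.le_succ k)
    have e1 : ∫ s in (g k : ℝ)..g (k + 1), ⟪u s, θ s⟫ = ⟪ξ k ω, ∫ s in (g k : ℝ)..g (k + 1), θ s⟫ := by
      rw [inner_integral _ (intervalIntegrable_of_memLp hθ (hmem _) (hmem _))]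
      refine intervalIntegral.integral_congr_ae (ae_of_all _ fun s hs => ?_)
      rw [uIoc_of_le hk] at hs
      rw [hu k s hs]
    have e2 : ∫ s in (0 : ℝ)..g (k + 1), ⟪u s, θ s⟫ =
        (∫ s in (0 : ℝ)..g k, ⟪u s, θ s⟫) + ∫ s in (g k : ℝ)..g (k + 1), ⟪u s, θ s⟫ := by
      refine (intervalIntegral.integral_add_adjacent_intervals (hi.mono_set ?_)
        (hi.mono_set (hsub _ _))).symm
      have := hsub 0 k
      rwa [hg0] at this
    have e3 : shiftedBM B T θ (g (k + 1)) ω - shiftedBM B T θ (g k) ω =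
        (B (g (k + 1)) ω - B (g k) ω) + ∫ s in (g k : ℝ)..g (k + 1), θ s := by
      rw [← intervalIntegral.integral_interval_sub_left (intervalIntegrable_of_memLp hθ h0 (hmem _))
          (intervalIntegrable_of_memLp hθ h0 (hmem _)), shiftedBM, shiftedBM,
        min_eq_left (hgT _), min_eq_left (hgT _)]
      abel
    have := ih
    simp only [gridSum] at this ⊢
    rw [Finset.sum_range_succ, Finset.sum_range_succ, this, e2, e3, inner_add_right, e1]
    ring

lemma intervalIntegrable_inner {T : ℝ} {u w : ℝ → EuclideanSpace ℝ (Fin d)} (hT : 0 ≤ T)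
    (hu : MemLp u 2 (volume.restrict (Icc 0 T))) (hw : MemLp w 2 (volume.restrict (Icc 0 T))) :
    IntervalIntegrable (fun s => ⟪u s, w s⟫) volume 0 T := by
  rw [intervalIntegrable_iff_integrableOn_Icc_of_le hT]
  have h := hu.norm.integrable_mul hw.norm
  exact h.mono (hu.1.inner hw.1) (ae_of_all _ fun s => by
    simpa using abs_real_inner_le_norm (u s) (w s))

lemma abs_integral_inner_sub_le {T : ℝ} {u b θ : ℝ → EuclideanSpace ℝ (Fin d)} (hT : 0 ≤ T)
    (hu : MemLp u 2 (volume.restrict (Icc 0 T))) (hb : MemLp b 2 (volume.restrict (Icc 0 T)))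
    (hθ : MemLp θ 2 (volume.restrict (Icc 0 T))) {t : ℝ} (ht : t ∈ Icc 0 T) {l : ℝ} (hl : 0 < l) :
    |(∫ s in (0 : ℝ)..t, ⟪u s, θ s⟫) - ∫ s in (0 : ℝ)..t, ⟪b s, θ s⟫| ≤
      l / 2 * (∫ s in (0 : ℝ)..T, ‖u s - b s‖ ^ 2) + (∫ s in (0 : ℝ)..T, ‖θ s‖ ^ 2) / (2 * l) := by
  have h0 : (0 : ℝ) ∈ Icc 0 T := ⟨le_rfl, hT⟩
  have hTT : T ∈ Icc 0 T := ⟨hT, le_rfl⟩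
  have hs : uIcc 0 t ⊆ uIcc 0 T := by rw [uIcc_of_le hT]; exact uIcc_subset_Icc h0 ht
  have i3 : IntervalIntegrable (fun s => ‖u s - b s‖ ^ 2) volume 0 T :=
    intervalIntegrable_norm_sq (hu.sub hb) h0 hTT
  have i4 := intervalIntegrable_norm_sq hθ h0 hTT
  have i5 : IntervalIntegrable (fun s => l / 2 * ‖u s - b s‖ ^ 2 + ‖θ s‖ ^ 2 / (2 * l)) volume 0 T :=
    (i3.const_mul _).add (i4.div_const _)
  rw [← intervalIntegral.integral_sub ((intervalIntegrable_inner hT hu hθ).mono_set hs)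
    ((intervalIntegrable_inner hT hb hθ).mono_set hs), ← intervalIntegral.integral_const_mul,
    ← intervalIntegral.integral_div, ← intervalIntegral.integral_add (i3.const_mul _)
    (i4.div_const _), ← Real.norm_eq_abs]
  refine (intervalIntegral.norm_integral_le_of_norm_le ht.1 (ae_of_all _ fun s _ => ?_)
    (i5.mono_set hs)).trans (intervalIntegral.integral_mono_interval le_rfl ht.1 ht.2
    (ae_of_all _ fun s => ?_) i5)
  · rw [← inner_sub_left, Real.norm_eq_abs]
    refine (abs_real_inner_le_norm _ _).trans ?_
    have h := sq_nonneg (l * ‖u s - b s‖ - ‖θ s‖)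
    have e : l / 2 * ‖u s - b s‖ ^ 2 + ‖θ s‖ ^ 2 / (2 * l) - ‖u s - b s‖ * ‖θ s‖ =
      (l * ‖u s - b s‖ - ‖θ s‖) ^ 2 / (2 * l) := by field_simp; ring
    have := div_nonneg h (by positivity : 0 ≤ 2 * l)
    linarith
  · simp only [Pi.zero_apply]
    positivity

/-- Grid approximations are stable under the Girsanov transformation. -/
theorem IsGridApprox.shiftedBM (hM : IsGridApprox 𝓕 P B T b M)
    (hθ : MemLp θ 2 (volume.restrict (Icc 0 (T : ℝ))))
    (hb : ∀ᵐ ω ∂P, MemLp (fun s => b s ω) 2 (volume.restrict (Icc 0 (T : ℝ)))) {Z : Ω → ℝ≥0∞}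
    [IsFiniteMeasure (P.withDensity Z)] :
    IsGridApprox 𝓕 (P.withDensity Z) (shiftedBM B T θ) T b
      (fun t ω => M t ω + ∫ s in (0 : ℝ)..t, ⟪b s ω, θ s⟫) := by
  intro ε hε F
  obtain ⟨δ, hδ, hQ⟩ := withDensity_apply_le_of_measure_le (P := P) (Z := Z)
    (ε := ENNReal.ofReal ε) (by simpa using hε)
  set c := ∫ s in (0 : ℝ)..T, ‖θ s‖ ^ 2 with hc
  have hc0 : 0 ≤ c := intervalIntegral.integral_nonneg T.coe_nonneg fun _ _ => by positivity
  set l := 2 * (c + 1) / ε with hl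
  have hl0 : 0 < l := by positivity
  -- The weight l makes the fixed term ‖θ‖²/(2l) at most ε/4, the entry ε/(2l) makes the L² error
  -- term at most ε/4, and δ/2 keeps the union of the two bad events below the threshold δ.
  set ε' := min (min (ε / 4) (ε / (2 * l))) (δ / 2) with hε'
  have h0 : 0 < ε' := by positivity
  have h1 : ε' ≤ ε / 4 := (min_le_left _ _).trans (min_le_left _ _)
  have h2 : ε' ≤ ε / (2 * l) := (min_le_left _ _).trans (min_le_right _ _)
  have h3 : ε' ≤ δ / 2 := min_le_right _ _
  obtain ⟨g, n, ξ, u, hξ, hg0, hgn, hgF, hmesh, hcell, hum, hu2, hp1, hp2⟩ := hM ε' h0 F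
  refine ⟨g, n, ξ, u, hξ, hg0, hgn, hgF, fun i => (hmesh i).trans (by linarith), hcell, hum, hu2,
    hQ _ ?_, hQ _ ?_⟩
  · calc P {ω | ∃ k ≤ n, ε ≤ |gridSum (PortfolioES.shiftedBM B T θ) g ξ k ω -
          (M (g k) ω + ∫ s in (0 : ℝ)..g k, ⟪b s ω, θ s⟫)|}
        ≤ P ({ω | ∃ k ≤ n, ε' ≤ |gridSum B g ξ k ω - M (g k) ω|} ∪
          {ω | ε' ≤ ∫ s in (0 : ℝ)..T, ‖u s ω - b s ω‖ ^ 2}) := by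
          refine measure_mono_ae ?_
          filter_upwards [hb] with ω hbω
          rintro ⟨k, hk, hω⟩
          by_contra hcon
          have hcon' : ¬((∃ k ≤ n, ε' ≤ |gridSum B g ξ k ω - M (g k) ω|) ∨
            ε' ≤ ∫ s in (0 : ℝ)..T, ‖u s ω - b s ω‖ ^ 2) := hcon
          push Not at hcon'
          obtain ⟨hA, hB⟩ := hcon'
          have huω : MemLp (fun s => u s ω) 2 (volume.restrict (Icc 0 (T : ℝ))) :=
            (hu2 ω).restrict _
          have e := gridSum_shiftedBM (B := B) (ξ := ξ) hθ hξ.mono hg0 hξ.le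
            (fun i s hs => hcell i s hs ω) (intervalIntegrable_inner T.coe_nonneg huω hθ) k
          have hle := abs_integral_inner_sub_le T.coe_nonneg huω hbω hθ
            (t := g k) ⟨(g k).coe_nonneg, by exact_mod_cast hξ.le k⟩ hl0
          rw [e] at hω
          have hA' := hA k hk
          have e1 : l / 2 * (∫ s in (0 : ℝ)..T, ‖u s ω - b s ω‖ ^ 2) ≤ ε / 4 := by
            calc l / 2 * (∫ s in (0 : ℝ)..T, ‖u s ω - b s ω‖ ^ 2) ≤ l / 2 * (ε / (2 * l)) := by
                  gcongr; linarith
              _ = ε / 4 := by field_simp; ring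
          have e2 : c / (2 * l) ≤ ε / 4 := by
            rw [hl, div_le_div_iff₀ (by positivity) (by norm_num)]
            have : ε * (2 * (2 * (c + 1) / ε)) = 4 * (c + 1) := by field_simp; ring
            linarith
          have h4 := abs_add_le (gridSum B g ξ k ω - M (g k) ω)
            ((∫ s in (0 : ℝ)..g k, ⟪u s ω, θ s⟫) - ∫ s in (0 : ℝ)..g k, ⟪b s ω, θ s⟫)
          have h5 : gridSum B g ξ k ω + (∫ s in (0 : ℝ)..g k, ⟪u s ω, θ s⟫) -
              (M (g k) ω + ∫ s in (0 : ℝ)..g k, ⟪b s ω, θ s⟫) =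
              (gridSum B g ξ k ω - M (g k) ω) +
            ((∫ s in (0 : ℝ)..g k, ⟪u s ω, θ s⟫) - ∫ s in (0 : ℝ)..g k, ⟪b s ω, θ s⟫) := by ring
          rw [h5] at hω
          linarith
      _ ≤ ENNReal.ofReal ε' + ENNReal.ofReal ε' := (measure_union_le _ _).trans (add_le_add hp1 hp2)
      _ ≤ ENNReal.ofReal δ := by
          rw [← ENNReal.ofReal_add h0.le h0.le]
          exact ENNReal.ofReal_le_ofReal (by linarith)
  · refine (measure_mono fun ω hω => ?_).trans (hp2.trans (ENNReal.ofReal_le_ofReal (by linarith)))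
    exact le_trans (by linarith : ε' ≤ ε) hω

variable [IsProbabilityMeasure P]

lemma IsGridApprox.aemeasurable (hM : IsGridApprox 𝓕 P B T b M) (hB : ∀ t, Measurable (B t))
    {t : ℝ≥0} (ht : t ≤ T) : AEMeasurable (M t) P := by
  have h : ∀ n : ℕ, ∃ f : Ω → ℝ, Measurable f ∧
      P {ω | 1 / ((n : ℝ) + 1) ≤ |f ω - M t ω|} ≤ ENNReal.ofReal (1 / ((n : ℝ) + 1)) := by
    intro n
    obtain ⟨g, m, ξ, u, hξ, hg0, hgn, hgF, -, -, -, -, hp, -⟩ :=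
      hM (1 / ((n : ℝ) + 1)) (by positivity) {t}
    obtain ⟨k, hk, hkt⟩ := hgF t (Finset.mem_singleton_self t) ht
    refine ⟨gridSum B g ξ k, ?_, (measure_mono fun ω hω => ?_).trans hp⟩
    · unfold gridSum
      refine Finset.measurable_fun_sum _ fun i _ => ?_
      exact ((hξ.measurable i).mono (𝓕.le _) le_rfl).inner ((hB _).sub (hB _))
    · exact ⟨k, hk, by rw [hkt]; exact hω⟩
  choose f hf hp using h
  have hlim := tendsto_one_div_add_atTop_nhds_zero_nat (𝕜 := ℝ)
  refine TendstoInMeasure.aemeasurable (u := atTop) (fun n => (hf n).aemeasurable) (g := M t) ?_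
  rw [tendstoInMeasure_iff_norm]
  intro ε hε
  have hlim' : Tendsto (fun n : ℕ => ENNReal.ofReal (1 / ((n : ℝ) + 1))) atTop (𝓝 0) := by
    simpa using ENNReal.tendsto_ofReal hlim
  refine tendsto_of_tendsto_of_tendsto_of_le_of_le' tendsto_const_nhds hlim'
    (Eventually.of_forall fun _ => bot_le) ?_
  filter_upwards [hlim.eventually (gt_mem_nhds hε)] with n hn
  refine (measure_mono fun ω hω => ?_).trans (hp n)
  exact hn.le.trans hω

/-- A modulus of continuity valid outside a set of small probability. The bad events, formed with
pairs of rational times to be measurable, decrease to a null set by uniform continuity; real times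
are recovered because the set of bad pairs is open. -/
lemma exists_measure_osc_le {N : ℝ → Ω → ℝ} (hm : ∀ t ∈ Icc 0 (T : ℝ), AEMeasurable (N t) P)
    (hc : ∀ᵐ ω ∂P, ContinuousOn (fun t => N t ω) (Icc 0 (T : ℝ))) {w ε : ℝ} (hw : 0 < w)
    (hε : 0 < ε) : ∃ δ > 0, ∃ E : Set Ω, P E ≤ ENNReal.ofReal ε ∧ ∀ᵐ ω ∂P, ω ∉ E →
      ∀ s ∈ Icc 0 (T : ℝ), ∀ t ∈ Icc 0 (T : ℝ), |s - t| < δ → |N s ω - N t ω| ≤ w := by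
  set π : ℝ → ℝ := fun t => projIcc 0 (T : ℝ) T.coe_nonneg t with hπ
  have hπm : ∀ t, π t ∈ Icc 0 (T : ℝ) := fun t => (projIcc 0 (T : ℝ) T.coe_nonneg t).2
  have hπc : Continuous π := continuous_subtype_val.comp continuous_projIcc
  set E : ℕ → Set Ω := fun m => ⋃ (p : ℚ) (q : ℚ) (_ : |π p - π q| < 1 / ((m : ℝ) + 1)),
    {ω | w < |N (π p) ω - N (π q) ω|} with hE
  have hEm : ∀ m, NullMeasurableSet (E m) P := fun m =>
    .iUnion fun p => .iUnion fun q => .iUnion fun _ =>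
      nullMeasurableSet_lt aemeasurable_const ((hm _ (hπm p)).sub (hm _ (hπm q))).norm
  have hanti : Antitone E := by
    intro m m' hmm
    refine iUnion_mono fun p => iUnion_mono fun q => iUnion_subset fun h => ?_
    refine subset_iUnion_of_subset (h.trans_le ?_) subset_rfl
    exact Nat.one_div_le_one_div hmm
  have hpath : ∀ ω, ContinuousOn (fun t => N t ω) (Icc 0 (T : ℝ)) →
      Continuous fun t => N (π t) ω := fun ω hω =>
    hω.comp_continuous hπc hπm
  have hnull : P (⋂ m, E m) = 0 := by
    rw [← compl_compl (⋂ m, E m)]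
    change ∀ᵐ ω ∂P, ω ∈ (⋂ m, E m)ᶜ
    filter_upwards [hc] with ω hω hmem
    have hu := isCompact_Icc.uniformContinuousOn_of_continuous hω
    rw [Metric.uniformContinuousOn_iff_le] at hu
    obtain ⟨δ, hδ, h⟩ := hu w hw
    obtain ⟨m, hmδ⟩ := exists_nat_one_div_lt hδ
    have := mem_iInter.1 hmem m
    simp only [hE, mem_iUnion] at this
    obtain ⟨p, q, hpq, hlt⟩ := this
    have h' := h _ (hπm p) _ (hπm q) (by rw [Real.dist_eq]; linarith)
    rw [Real.dist_eq] at h'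
    exact absurd hlt (not_lt.2 h')
  have hlim := tendsto_measure_iInter_atTop hEm hanti ⟨0, measure_ne_top P _⟩
  rw [hnull] at hlim
  obtain ⟨m, hmε⟩ := (hlim.eventually (gt_mem_nhds
    (show 0 < ENNReal.ofReal ε by simpa using hε))).exists
  refine ⟨1 / ((m : ℝ) + 1), by positivity, E m, hmε.le, ?_⟩
  filter_upwards [hc] with ω hω hnot s hs t ht hst
  by_contra hcon
  push Not at hcon
  have hcont := hpath ω hω
  have hopen : IsOpen {z : ℝ × ℝ | |π z.1 - π z.2| < 1 / ((m : ℝ) + 1) ∧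
      w < |N (π z.1) ω - N (π z.2) ω|} := by
    have h1 : Continuous fun z : ℝ × ℝ => |π z.1 - π z.2| :=
      ((hπc.comp continuous_fst).sub (hπc.comp continuous_snd)).abs
    have h2 : Continuous fun z : ℝ × ℝ => |N (π z.1) ω - N (π z.2) ω| :=
      ((hcont.comp continuous_fst).sub (hcont.comp continuous_snd)).abs
    exact (isOpen_lt h1 continuous_const).inter (isOpen_lt continuous_const h2)
  have hps : π s = s := by simp [hπ, projIcc_of_mem T.coe_nonneg hs]
  have hpt : π t = t := by simp [hπ, projIcc_of_mem T.coe_nonneg ht]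
  have hd : DenseRange (Prod.map ((↑) : ℚ → ℝ) ((↑) : ℚ → ℝ)) :=
    Rat.denseRange_cast.prodMap Rat.denseRange_cast
  obtain ⟨⟨p, q⟩, hpq⟩ := hd.exists_mem_open hopen ⟨(s, t), by
    refine ⟨?_, ?_⟩
    · simp only [hps, hpt]; exact hst
    · simp only [hps, hpt]; exact hcon⟩
  refine hnot ?_
  simp only [hE, mem_iUnion]
  exact ⟨p, q, hpq.1, hpq.2⟩

/-- Tightness of the energy ∫|b|²: it is compared with that of a single approximating elementary
integrand, whose coefficients are bounded by constants. -/
lemma IsGridApprox.exists_measure_lt_integral_le (hM : IsGridApprox 𝓕 P B T b M)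
    (hb : ∀ᵐ ω ∂P, MemLp (fun s => b s ω) 2 (volume.restrict (Icc 0 (T : ℝ)))) {ε : ℝ}
    (hε : 0 < ε) :
    ∃ K ≥ 0, P {ω | K < ∫ s in (0 : ℝ)..T, ‖b s ω‖ ^ 2} ≤ ENNReal.ofReal ε := by
  obtain ⟨g, n, ξ, u, hξ, hg0, hgn, -, -, hcell, -, hu2, -, hp⟩ := hM (ε / 2) (by positivity) ∅
  have hen : ∀ ω, ∫ s in (0 : ℝ)..T, ‖u s ω‖ ^ 2 = gridEnergy g ξ n ω := by
    intro ω
    have := integral_norm_sq_eq_gridEnergy hξ.mono (ω := ω) (ξ := ξ) (u := fun s => u s ω) (n := n)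
      fun i _ s hs => hcell i s hs ω
    rwa [hg0, hgn] at this
  obtain ⟨K, hK0, hK⟩ : ∃ K ≥ 0, P {ω | K < gridEnergy g ξ n ω} ≤ ENNReal.ofReal (ε / 2) := by
    choose C hC using hξ.bounded
    refine ⟨∑ i ∈ Finset.range n, |C i| ^ 2 * ((g (i + 1) : ℝ) - g i), ?_, ?_⟩
    · exact Finset.sum_nonneg fun i _ => mul_nonneg (by positivity)
        (sub_nonneg.2 (by exact_mod_cast hξ.mono (Nat.le_succ i)))
    · rw [show {ω | _ < gridEnergy g ξ n ω} = (∅ : Set Ω) from ?_, measure_empty]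
      · exact bot_le
      ext ω
      simp only [Set.mem_ofPred_eq, Set.mem_empty_iff_false, iff_false, not_lt]
      refine Finset.sum_le_sum fun i _ => ?_
      have : 0 ≤ (g (i + 1) : ℝ) - g i := sub_nonneg.2 (by exact_mod_cast hξ.mono (Nat.le_succ i))
      gcongr
      exact (hC i ω).trans (le_abs_self _)
  refine ⟨ε + 2 * K, by positivity, ?_⟩
  calc P {ω | ε + 2 * K < ∫ s in (0 : ℝ)..T, ‖b s ω‖ ^ 2}
      ≤ P ({ω | K < gridEnergy g ξ n ω} ∪ {ω | ε / 2 ≤ ∫ s in (0 : ℝ)..T, ‖u s ω - b s ω‖ ^ 2}) := by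
        refine measure_mono_ae ?_
        filter_upwards [hb] with ω hbω hω
        by_contra hcon
        have hcon' : ¬(K < gridEnergy g ξ n ω ∨
          ε / 2 ≤ ∫ s in (0 : ℝ)..T, ‖u s ω - b s ω‖ ^ 2) := hcon
        push Not at hcon'
        have huω : MemLp (fun s => u s ω) 2 (volume.restrict (Icc 0 (T : ℝ))) := (hu2 ω).restrict _
        have := integral_norm_sub_sq_le T.coe_nonneg hbω
          (w := fun _ => (0 : EuclideanSpace ℝ (Fin d))) MemLp.zero' huω
        simp only [sub_zero, zero_sub, norm_neg, hen] at this
        simp only [norm_sub_rev (b _ ω)] at this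
        have hω' : ε + 2 * K < ∫ s in (0 : ℝ)..T, ‖b s ω‖ ^ 2 := hω
        linarith [hcon'.1, hcon'.2]
    _ ≤ ENNReal.ofReal (ε / 2) + ENNReal.ofReal (ε / 2) :=
        (measure_union_le _ _).trans (add_le_add hK hp)
    _ = ENNReal.ofReal ε := by rw [← ENNReal.ofReal_add (by positivity) (by positivity)]; simp

end

end PortfolioES

/-! ### Discounting and the budget inequality under the martingale measure -/

namespace PortfolioES

variable {d : ℕ} {Ω : Type*} [mΩ : MeasurableSpace Ω]

/-- X - N is absolutely continuous and can be integrated by parts against the discount factor D.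
Since N is only continuous, the stochastic integral ∫D dN appears in the integrated form DN - ∫D'N.
-/
lemma discount_identity {r c N X : ℝ → ℝ} {T x : ℝ} (hT : 0 ≤ T)
    (hr : IntervalIntegrable r volume 0 T) (hX : ContinuousOn X (Icc 0 T))
    (hp : IntegrableOn (fun s => X s * r s - c s) (Icc 0 T))
    (heq : ∀ t ∈ Icc 0 T, X t = x + (∫ s in (0 : ℝ)..t, (X s * r s - c s)) + N t) {t : ℝ}
    (ht : t ∈ Icc 0 T) :
    Real.exp (∫ u in (0 : ℝ)..t, -r u) * X t +
        (∫ s in (0 : ℝ)..t, Real.exp (∫ u in (0 : ℝ)..s, -r u) * c s) =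
      x + Real.exp (∫ u in (0 : ℝ)..t, -r u) * N t -
        ∫ s in (0 : ℝ)..t, -r s * Real.exp (∫ u in (0 : ℝ)..s, -r u) * N s := by
  set D : ℝ → ℝ := fun s => Real.exp (∫ u in (0 : ℝ)..s, -r u) with hD
  have h0 : (0 : ℝ) ∈ Icc 0 T := ⟨le_rfl, hT⟩
  have hr' : IntervalIntegrable (fun s => -r s) volume 0 T := hr.neg
  have hpi : IntervalIntegrable (fun s => X s * r s - c s) volume 0 T :=
    (intervalIntegrable_iff_integrableOn_Icc_of_le hT).2 hp
  have hsub : uIcc 0 t ⊆ uIcc 0 T := by rw [uIcc_of_le hT]; exact uIcc_subset_Icc h0 ht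
  have hDc : ContinuousOn D (Icc 0 T) := (continuousOn_primitive hT hr').rexp
  have hDc' : ContinuousOn D (uIcc 0 T) := by rwa [uIcc_of_le hT]
  have hX' : ContinuousOn X (uIcc 0 T) := by rwa [uIcc_of_le hT]
  have hNc : ContinuousOn N (uIcc 0 T) := by
    rw [uIcc_of_le hT]
    refine ((hX.sub (continuousOn_const (c := x))).sub (continuousOn_primitive hT hpi)).congr fun s hs => ?_
    simp only [Pi.sub_apply]
    rw [heq s hs]
    ring
  have haD : IntervalIntegrable (fun s => -r s * D s) volume 0 T := hr'.mul_continuousOn hDc'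
  have hXr : IntervalIntegrable (fun s => X s * r s) volume 0 T := hr.continuousOn_mul hX'
  have hci : IntervalIntegrable c volume 0 T := by
    refine (hXr.sub hpi).congr fun s _ => ?_
    simp
  have hDci : IntervalIntegrable (fun s => D s * c s) volume 0 t :=
    (hci.continuousOn_mul hDc').mono_set hsub
  have haDN : IntervalIntegrable (fun s => -r s * D s * N s) volume 0 t :=
    (haD.mul_continuousOn hNc).mono_set hsub
  have hDt : ∀ s ∈ Icc 0 T, 1 + (∫ u in (0 : ℝ)..s, -r u * D u) = D s := by
    intro s hs
    have := integral_mul_exp_primitive hT hr' h0 hs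
    simp only [intervalIntegral.integral_same, Real.exp_zero] at this
    simp only [hD]
    rw [this]
    ring
  have hprod := integral_mul_add_mul_primitive hT haD hpi 1 x ht
  have e : ∫ u in (0 : ℝ)..t, (-r u * D u * (x + ∫ r_1 in (0 : ℝ)..u, (X r_1 * r r_1 - c r_1)) +
      (1 + ∫ r_1 in (0 : ℝ)..u, -r r_1 * D r_1) * (X u * r u - c u)) =
      ∫ u in (0 : ℝ)..t, (-(-r u * D u * N u) - D u * c u) := by
    refine intervalIntegral.integral_congr fun u hu => ?_
    rw [uIcc_of_le ht.1] at hu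
    have hu' : u ∈ Icc 0 T := ⟨hu.1, hu.2.trans ht.2⟩
    rw [hDt u hu']
    have := heq u hu'
    have e2 : x + ∫ s in (0 : ℝ)..u, (X s * r s - c s) = X u - N u := by linarith
    rw [e2]
    ring
  rw [e, hDt t ht, intervalIntegral.integral_sub (by exact haDN.neg) hDci, intervalIntegral.integral_neg] at hprod
  have := heq t ht
  have e2 : x + ∫ s in (0 : ℝ)..t, (X s * r s - c s) = X t - N t := by linarith
  rw [e2] at hprod
  linarith

/-- Abel summation: errors known to be small at grid points, but not in their increments, are paid
for by the variation of D. -/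
lemma abs_sum_mul_sub_le {D e : ℕ → ℝ} {ε : ℝ} {n : ℕ} (he : ∀ i ≤ n, |e i| ≤ ε) {k : ℕ}
    (hk : k ≤ n) :
    |(∑ i ∈ Finset.range k, D i * (e (i + 1) - e i)) - (D k * e k - D 0 * e 0)| ≤
      ε * ∑ i ∈ Finset.range k, |D (i + 1) - D i| := by
  induction k with
  | zero => simp
  | succ k ih =>
    rw [Finset.sum_range_succ, Finset.sum_range_succ, mul_add]
    have h1 := ih (by omega)
    have h2 : |(D (k + 1) - D k) * e (k + 1)| ≤ ε * |D (k + 1) - D k| := by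
      rw [abs_mul, mul_comm]
      exact mul_le_mul_of_nonneg_right (he _ hk) (abs_nonneg _)
    have h3 := abs_sub (∑ i ∈ Finset.range k, D i * (e (i + 1) - e i) - (D k * e k - D 0 * e 0))
      ((D (k + 1) - D k) * e (k + 1))
    have h4 : (∑ i ∈ Finset.range k, D i * (e (i + 1) - e i) + D k * (e (k + 1) - e k)) -
        (D (k + 1) * e (k + 1) - D 0 * e 0) =
      (∑ i ∈ Finset.range k, D i * (e (i + 1) - e i) - (D k * e k - D 0 * e 0)) -
      ((D (k + 1) - D k) * e (k + 1)) := by ring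
    rw [h4]
    linarith

section

variable {𝓕 : Filtration ℝ≥0 mΩ} {Q : Measure Ω} [IsProbabilityMeasure Q] {T : ℝ≥0}
  {B : ℝ≥0 → Ω → EuclideanSpace ℝ (Fin d)} {b : ℝ → Ω → EuclideanSpace ℝ (Fin d)}
  {N X c : ℝ → Ω → ℝ} {r : ℝ → ℝ} {x : ℝ}

lemma sum_abs_exp_sub_le (hr : IntervalIntegrable r volume 0 T) {g : ℕ → ℝ≥0} (hg : Monotone g)
    (hgT : ∀ i, g i ≤ T) (k : ℕ) :
    ∑ i ∈ Finset.range k, |Real.exp (∫ u in (0 : ℝ)..g (i + 1), r u) -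
      Real.exp (∫ u in (0 : ℝ)..g i, r u)| ≤
    ∫ s in (0 : ℝ)..T, |r s * Real.exp (∫ u in (0 : ℝ)..s, r u)| := by
  have hT := T.coe_nonneg
  have hmem : ∀ i, (g i : ℝ) ∈ Icc 0 (T : ℝ) := fun i =>
    ⟨(g i).coe_nonneg, by exact_mod_cast hgT i⟩
  have haD : IntervalIntegrable (fun s => r s * Real.exp (∫ u in (0 : ℝ)..s, r u)) volume 0 T :=
    hr.mul_continuousOn (by rw [uIcc_of_le hT]; exact (continuousOn_primitive hT hr).rexp)
  have hi : ∀ i j, IntervalIntegrable (fun s => |r s * Real.exp (∫ u in (0 : ℝ)..s, r u)|) volume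
      (g i) (g j) := fun i j => haD.abs.mono_set (by
    rw [uIcc_of_le hT]; exact uIcc_subset_Icc (hmem i) (hmem j))
  calc _ ≤ ∑ i ∈ Finset.range k, ∫ s in (g i : ℝ)..g (i + 1),
        |r s * Real.exp (∫ u in (0 : ℝ)..s, r u)| := by
        refine Finset.sum_le_sum fun i _ => ?_
        rw [← integral_mul_exp_primitive hT hr (hmem i) (hmem (i + 1))]
        exact intervalIntegral.abs_integral_le_integral_abs (by exact_mod_cast hg (Nat.le_succ i))
    _ = ∫ s in (g 0 : ℝ)..g k, |r s * Real.exp (∫ u in (0 : ℝ)..s, r u)| :=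
        intervalIntegral.sum_integral_adjacent_intervals fun i _ => hi i (i + 1)
    _ ≤ _ := intervalIntegral.integral_mono_interval (g 0).coe_nonneg
        (by exact_mod_cast hg (Nat.zero_le k)) (hmem k).2 (ae_of_all _ fun s => abs_nonneg _)
        haD.abs

/-- The budget inequality under the martingale measure. -/
theorem lintegral_discounted_le (hB : IsFilteredBM 𝓕 Q T B) (hN : IsGridApprox 𝓕 Q B T b N)
    (hb : ∀ᵐ ω ∂Q, MemLp (fun s => b s ω) 2 (volume.restrict (Icc 0 (T : ℝ))))
    (hr : IntervalIntegrable r volume 0 T)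
    (hX : ∀ᵐ ω ∂Q, ContinuousOn (fun t => X t ω) (Icc 0 (T : ℝ)))
    (hX0 : ∀ᵐ ω ∂Q, ∀ t ∈ Icc 0 (T : ℝ), 0 ≤ X t ω)
    (hc0 : ∀ᵐ ω ∂Q, ∀ t ∈ Icc 0 (T : ℝ), 0 ≤ c t ω)
    (hp : ∀ᵐ ω ∂Q, IntegrableOn (fun s => X s ω * r s - c s ω) (Icc 0 (T : ℝ)))
    (heq : ∀ᵐ ω ∂Q, ∀ t ∈ Icc 0 (T : ℝ),
      X t ω = x + (∫ s in (0 : ℝ)..t, (X s ω * r s - c s ω)) + N t ω)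
    (hLm : AEMeasurable (fun ω => Real.exp (∫ u in (0 : ℝ)..T, -r u) * X T ω +
      ∫ s in (0 : ℝ)..T, Real.exp (∫ u in (0 : ℝ)..s, -r u) * c s ω) Q) :
    ∫⁻ ω, ENNReal.ofReal (Real.exp (∫ u in (0 : ℝ)..T, -r u) * X T ω +
      ∫ s in (0 : ℝ)..T, Real.exp (∫ u in (0 : ℝ)..s, -r u) * c s ω) ∂Q ≤ ENNReal.ofReal x := by
  have hT := T.coe_nonneg
  set D : ℝ → ℝ := fun s => Real.exp (∫ u in (0 : ℝ)..s, -r u) with hD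
  have hD0 : ∀ s, 0 < D s := fun s => Real.exp_pos _
  have hr' : IntervalIntegrable (fun s => -r s) volume 0 T := hr.neg
  refine lintegral_le_of_gridSum_approx (L := fun t ω => D t * X t ω +
    ∫ s in (0 : ℝ)..t, D s * c s ω) hB ?_ hLm ?_
  · filter_upwards [hX0, hc0] with ω h1 h2 t ht
    have ht' : (t : ℝ) ≤ T := by exact_mod_cast ht
    exact add_nonneg (mul_nonneg (hD0 _).le (h1 t ⟨t.coe_nonneg, ht'⟩))
      (intervalIntegral.integral_nonneg t.coe_nonneg fun s hs =>
        mul_nonneg (hD0 _).le (h2 s ⟨hs.1, hs.2.trans ht'⟩))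
  intro ε hε
  set C := Real.exp (∫ s in (0 : ℝ)..T, |(-r s)|) with hC
  have hC0 : 0 < C := Real.exp_pos _
  have hDC : ∀ s ∈ Icc 0 (T : ℝ), D s ≤ C := fun s hs =>
    Real.exp_le_exp.2 ((le_abs_self _).trans (abs_integral_le_of_mem hr' hs))
  set V := ∫ s in (0 : ℝ)..T, |(-r s) * D s| with hV
  have hV0 : 0 ≤ V := intervalIntegral.integral_nonneg hT fun _ _ => abs_nonneg _
  obtain ⟨Kb, hKb0, hKb⟩ := hN.exists_measure_lt_integral_le hb (half_pos hε)
  -- Multiplication by D ≤ C costs C² in the energy, and the elementary energy is at most 2ε' + 2Kb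
  -- ≤ 2 + 2Kb off the bad events. This bound has to be fixed before δ.
  refine ⟨C ^ 2 * (2 + 2 * Kb), by positivity, fun δ hδ => ?_⟩
  have hNc : ∀ᵐ ω ∂Q, ContinuousOn (fun t => N t ω) (Icc 0 (T : ℝ)) := by
    filter_upwards [hX, hp, heq] with ω h1 h2 h3
    refine ((h1.sub (continuousOn_const (c := x))).sub (continuousOn_primitive hT
      ((intervalIntegrable_iff_integrableOn_Icc_of_le hT).2 h2))).congr fun s hs => ?_
    simp only [Pi.sub_apply]
    rw [h3 s hs]
    ring
  obtain ⟨δ₁, hδ₁, E, hE, hosc⟩ := exists_measure_osc_le (P := Q) (N := N)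
    (fun t ht => hN.aemeasurable hB.measurable (t := ⟨t, ht.1⟩) (by exact_mod_cast ht.2)) hNc
    (w := δ / (4 * (V + 1))) (ε := δ / 4) (by positivity) (by positivity)
  -- The last entry bounds the total approximation error ε'(1 + 2C + V): 1 for N at time 0, 2C for
  -- the boundary terms of the Abel summation and V for the variation of D. The entry δ₁/2 keeps the
  -- mesh below the modulus δ₁; the others limit energies and probabilities.
  set ε' := min (min (min 1 (ε / 2)) (min (δ / 4) (δ₁ / 2))) (δ / (2 * (1 + 2 * C + V))) with hε'
  have hε'0 : 0 < ε' := by positivity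
  have e1 : ε' ≤ 1 := (min_le_left _ _).trans ((min_le_left _ _).trans (min_le_left _ _))
  have e2 : ε' ≤ ε / 2 := (min_le_left _ _).trans ((min_le_left _ _).trans (min_le_right _ _))
  have e3 : ε' ≤ δ / 4 := (min_le_left _ _).trans ((min_le_right _ _).trans (min_le_left _ _))
  have e4 : ε' ≤ δ₁ / 2 := (min_le_left _ _).trans ((min_le_right _ _).trans (min_le_right _ _))
  have e5 : ε' * (1 + 2 * C + V) ≤ δ / 2 := by
    have : ε' ≤ δ / (2 * (1 + 2 * C + V)) := min_le_right _ _
    rw [le_div_iff₀ (by positivity)] at this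
    linarith
  have e6 : δ / (4 * (V + 1)) * V ≤ δ / 4 := by
    rw [div_mul_eq_mul_div, div_le_div_iff₀ (by positivity) (by norm_num)]
    nlinarith
  obtain ⟨g, n, ξ, u, hξ, hg0, hgn, -, hmesh, hcell, -, hu2, hp1, hp2⟩ := hN ε' hε'0 ∅
  have hmem : ∀ i, (g i : ℝ) ∈ Icc 0 (T : ℝ) := fun i =>
    ⟨(g i).coe_nonneg, by exact_mod_cast hξ.le i⟩
  have hgm : ∀ i, (g i : ℝ) ≤ g (i + 1) := fun i => by exact_mod_cast hξ.mono (Nat.le_succ i)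
  refine ⟨g, n, fun i ω => D (g i) • ξ i ω, ⟨hξ.mono, hξ.le, fun i => by
    have := hξ.measurable i
    exact this.const_smul (D (g i)),
    fun i => ?_⟩, hgn, ?_, ?_⟩
  · obtain ⟨K, hK⟩ := hξ.bounded i
    refine ⟨D (g i) * K, fun ω => ?_⟩
    rw [norm_smul, Real.norm_eq_abs, abs_of_pos (hD0 _)]
    exact mul_le_mul_of_nonneg_left (hK ω) (hD0 _).le
  · calc Q {ω | ∃ k ≤ n, δ ≤ |x + gridSum B g (fun i ω => D (g i) • ξ i ω) k ω -
          (D (g k) * X (g k) ω + ∫ s in (0 : ℝ)..g k, D s * c s ω)|}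
        ≤ Q ({ω | ∃ k ≤ n, ε' ≤ |gridSum B g ξ k ω - N (g k) ω|} ∪ E) := by
          refine measure_mono_ae ?_
          filter_upwards [hX, hp, heq, hosc, hNc] with ω h1 h2 h3 h4 h5
          rintro ⟨k, hk, hω⟩
          by_contra hcon
          have hcon' : ¬((∃ k ≤ n, ε' ≤ |gridSum B g ξ k ω - N (g k) ω|) ∨ ω ∈ E) := hcon
          push Not at hcon'
          obtain ⟨hA, hEω⟩ := hcon'
          have hid := discount_identity hT hr h1 h2 h3 (hmem k)
          have ho := abs_sub_sum_le_of_osc hr' h5 hξ.mono hg0 hξ.le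
            (w := δ / (4 * (V + 1))) (fun i s hs => by
              refine h4 hEω _ (hmem _) _ ⟨(g i).coe_nonneg.trans hs.1, hs.2.trans (hmem _).2⟩ ?_
              rw [abs_lt]
              constructor <;> linarith [hmesh i, hs.1, hs.2]) k
          have hint : ∫ s in (0 : ℝ)..g k, |(-r s) * D s| ≤ V := by
            refine intervalIntegral.integral_mono_interval le_rfl (hmem k).1 (hmem k).2
              (ae_of_all _ fun s => abs_nonneg _) ?_
            exact (hr'.mul_continuousOn (by
              rw [uIcc_of_le hT]; exact (continuousOn_primitive hT hr').rexp)).abs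
          have ho2 : δ / (4 * (V + 1)) * (∫ s in (0 : ℝ)..g k, |(-r s) * D s|) ≤ δ / 4 :=
            (mul_le_mul_of_nonneg_left hint (by positivity)).trans e6
          have hab := abs_sum_mul_sub_le (D := fun i => D (g i))
            (e := fun i => gridSum B g ξ i ω - N (g i) ω) (fun i hi => (hA i hi).le) hk
          have hvar := sum_abs_exp_sub_le hr' hξ.mono hξ.le k
          have hab2 := hab.trans (mul_le_mul_of_nonneg_left hvar hε'0.le)
          -- The first sum contains the errors of the elementary integrals and goes to Abel
          -- summation; the second is the Riemann sum of ∫D dN and goes to `abs_sub_sum_le_of_osc`.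
          have hgs : gridSum B g (fun i ω => D (g i) • ξ i ω) k ω =
              ∑ i ∈ Finset.range k, D (g i) * ((gridSum B g ξ (i + 1) ω - N (g (i + 1)) ω) -
                (gridSum B g ξ i ω - N (g i) ω)) +
              ∑ i ∈ Finset.range k, D (g i) * (N (g (i + 1)) ω - N (g i) ω) := by
            rw [← Finset.sum_add_distrib]
            refine Finset.sum_congr rfl fun i _ => ?_
            simp only [gridSum, Finset.sum_range_succ]
            rw [real_inner_smul_left]
            ring
          -- At index 0 the elementary integral is an empty sum, so the approximation itself forces
          -- N to be small at time 0.
          have hk0 : |N 0 ω| ≤ ε' := by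
            have := hA 0 (Nat.zero_le _)
            simp only [gridSum, Finset.sum_range_zero, hg0, NNReal.coe_zero, zero_sub, abs_neg]
              at this
            exact this.le
          have hDk : |D (g k) * (gridSum B g ξ k ω - N (g k) ω)| ≤ C * ε' := by
            rw [abs_mul, abs_of_pos (hD0 _)]
            exact mul_le_mul (hDC _ (hmem k)) (hA k hk).le (abs_nonneg _) hC0.le
          have hDk0 : |D (g 0) * (gridSum B g ξ 0 ω - N (g 0) ω)| ≤ C * ε' := by
            rw [abs_mul, abs_of_pos (hD0 _)]
            exact mul_le_mul (hDC _ (hmem 0)) (hA 0 (Nat.zero_le _)).le (abs_nonneg _) hC0.le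
          rw [hid, hgs] at hω
          simp only [abs_le] at hk0 hDk hDk0 hab2 ho
          have : |x + (∑ i ∈ Finset.range k, D (g i) * ((gridSum B g ξ (i + 1) ω -
              N (g (i + 1)) ω) - (gridSum B g ξ i ω - N (g i) ω)) +
              ∑ i ∈ Finset.range k, D (g i) * (N (g (i + 1)) ω - N (g i) ω)) -
              (x + Real.exp (∫ u in (0 : ℝ)..g k, -r u) * N (g k) ω -
                ∫ s in (0 : ℝ)..g k, -r s * Real.exp (∫ u in (0 : ℝ)..s, -r u) * N s ω)| ≤
              ε' * (1 + 2 * C + V) + δ / 4 := by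
            rw [abs_le]
            constructor <;> linarith [hk0.1, hk0.2, hDk.1, hDk.2, hDk0.1, hDk0.2, hab2.1, hab2.2,
              ho.1, ho.2]
          linarith
      _ ≤ ENNReal.ofReal ε' + ENNReal.ofReal (δ / 4) :=
          (measure_union_le _ _).trans (add_le_add hp1 hE)
      _ ≤ ENNReal.ofReal δ := by
          rw [← ENNReal.ofReal_add hε'0.le (by positivity)]
          exact ENNReal.ofReal_le_ofReal (by linarith)
  · calc Q {ω | C ^ 2 * (2 + 2 * Kb) < gridEnergy g (fun i ω => D (g i) • ξ i ω) n ω}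
        ≤ Q ({ω | ε' ≤ ∫ s in (0 : ℝ)..T, ‖u s ω - b s ω‖ ^ 2} ∪
          {ω | Kb < ∫ s in (0 : ℝ)..T, ‖b s ω‖ ^ 2}) := by
          refine measure_mono_ae ?_
          filter_upwards [hb] with ω hbω hω
          by_contra hcon
          have hcon' : ¬(ε' ≤ ∫ s in (0 : ℝ)..T, ‖u s ω - b s ω‖ ^ 2 ∨
            Kb < ∫ s in (0 : ℝ)..T, ‖b s ω‖ ^ 2) := hcon
          push Not at hcon'
          have huω : MemLp (fun s => u s ω) 2 (volume.restrict (Icc 0 (T : ℝ))) :=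
            (hu2 ω).restrict _
          have hen : ∫ s in (0 : ℝ)..T, ‖u s ω‖ ^ 2 = gridEnergy g ξ n ω := by
            have := integral_norm_sq_eq_gridEnergy hξ.mono (ω := ω) (ξ := ξ)
              (u := fun s => u s ω) (n := n) fun i _ s hs => hcell i s hs ω
            rwa [hg0, hgn] at this
          have h2 := integral_norm_sub_sq_le hT huω
            (w := fun _ => (0 : EuclideanSpace ℝ (Fin d))) MemLp.zero' hbω
          simp only [sub_zero, zero_sub, norm_neg, hen] at h2
          have h3 : gridEnergy g (fun i ω => D (g i) • ξ i ω) n ω ≤ C ^ 2 * gridEnergy g ξ n ω := by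
            rw [gridEnergy, gridEnergy, Finset.mul_sum]
            refine Finset.sum_le_sum fun i _ => ?_
            rw [norm_smul, mul_pow, Real.norm_eq_abs, sq_abs, mul_assoc]
            have := hDC _ (hmem i)
            have h4 := hD0 (g i)
            have h5 := sub_nonneg.2 (hgm i)
            gcongr
          have h4 : C ^ 2 * gridEnergy g ξ n ω ≤ C ^ 2 * (2 + 2 * Kb) := by
            gcongr
            linarith [hcon'.1, hcon'.2]
          exact absurd hω (not_lt.2 (h3.trans h4))
      _ ≤ ENNReal.ofReal ε' + ENNReal.ofReal (ε / 2) :=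
          (measure_union_le _ _).trans (add_le_add hp2 hKb)
      _ ≤ ENNReal.ofReal ε := by
          rw [← ENNReal.ofReal_add hε'0.le (by positivity)]
          exact ENNReal.ofReal_le_ofReal (by linarith)

end

end PortfolioES

/-! ### The state price density and the budget inequality -/

namespace PortfolioES

variable {d : ℕ} {Ω : Type*} [mΩ : MeasurableSpace Ω]

/-- Weighted AM–GM for a h and h^{-γ/(1-γ)} with weights γ and 1 - γ: the powers of h cancel in the
geometric mean. This is the conjugate inequality of the power utility, with equality at a =
h^{-1/(1-γ)}. -/
lemma rpow_le_mul_add_rpow {γ a h : ℝ} (hγ0 : 0 < γ) (hγ1 : γ < 1) (ha : 0 ≤ a) (hh : 0 < h) :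
    a ^ γ ≤ γ * (a * h) + (1 - γ) * h ^ (-(γ / (1 - γ))) := by
  have h1 : 0 < 1 - γ := by linarith
  have key := Real.geom_mean_le_arith_mean2_weighted hγ0.le h1.le (mul_nonneg ha hh.le)
    (Real.rpow_nonneg hh.le (-(γ / (1 - γ)))) (by ring)
  have e : (a * h) ^ γ * (h ^ (-(γ / (1 - γ)))) ^ (1 - γ) = a ^ γ := by
    rw [← Real.rpow_mul hh.le, Real.mul_rpow ha hh.le, mul_assoc, ← Real.rpow_add hh]
    have : γ + -(γ / (1 - γ)) * (1 - γ) = 0 := by field_simp; ring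
    rw [this, Real.rpow_zero, mul_one]
  rwa [e] at key

/-- The moment `E H_t^{-γ/(1-γ)}` of the state price density. -/
noncomputable def deflatorMoment (γ : ℝ) (r : ℝ → ℝ) (θ : ℝ → EuclideanSpace ℝ (Fin d)) (t : ℝ) :
    ℝ :=
  Real.exp (γ / (1 - γ) * (∫ u in (0 : ℝ)..t, r u) +
    γ / (1 - γ) ^ 2 / 2 * ∫ u in (0 : ℝ)..t, ‖θ u‖ ^ 2)

section

variable {𝓕 : Filtration ℝ≥0 mΩ} {P : Measure Ω} [IsProbabilityMeasure P] {T : ℝ≥0}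
  {B : ℝ≥0 → Ω → EuclideanSpace ℝ (Fin d)} {θ : ℝ → EuclideanSpace ℝ (Fin d)}
  {I : ℝ → Ω → ℝ} {r : ℝ → ℝ} {x γ : ℝ}

lemma IsWienerIntegral.lintegral_deflator_rpow (h : IsWienerIntegral 𝓕 P B T θ I)
    (hB : IsFilteredBM 𝓕 P T B) (hθ : MemLp θ 2 (volume.restrict (Icc 0 (T : ℝ))))
    (hγ1 : γ < 1) {t : ℝ} (ht : t ∈ Icc 0 (T : ℝ)) {l : ℝ} (hl : 0 < l) :
    ∫⁻ ω, ENNReal.ofReal ((l * (Real.exp (∫ u in (0 : ℝ)..t, -r u) * expDensity θ I t ω)) ^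
      (-(γ / (1 - γ)))) ∂P = ENNReal.ofReal (l ^ (-(γ / (1 - γ))) * deflatorMoment γ r θ t) := by
  have hg := h.indepGaussian_zero hB hθ (t := ⟨t, ht.1⟩) (by exact_mod_cast ht.2)
  have hS0 : 0 ≤ ∫ u in (0 : ℝ)..t, ‖θ u‖ ^ 2 :=
    intervalIntegral.integral_nonneg ht.1 fun _ _ => by positivity
  set S := ∫ u in (0 : ℝ)..t, ‖θ u‖ ^ 2 with hS
  set p := γ / (1 - γ) with hp
  have hg' : IndepGaussian (𝓕 0) P (I t) S.toNNReal := hg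
  set φ : ℝ → ℝ := fun z => l ^ (-p) * Real.exp (p * (∫ u in (0 : ℝ)..t, r u) + p * S / 2) *
    Real.exp (p * z) with hφ
  have e : ∀ ω, (l * (Real.exp (∫ u in (0 : ℝ)..t, -r u) * expDensity θ I t ω)) ^ (-p) =
      φ (I t ω) := by
    intro ω
    simp only [hφ]
    rw [Real.mul_rpow hl.le (by unfold expDensity; positivity), expDensity, ← Real.exp_add,
      ← Real.exp_mul, mul_assoc, ← Real.exp_add, intervalIntegral.integral_neg]
    congr 2
    ring
  simp_rw [e]
  have hφm : Measurable φ := by fun_prop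
  have hφ0 : ∀ z, 0 ≤ φ z := fun z => by positivity
  rw [← lintegral_map (f := fun z => ENNReal.ofReal (φ z)) hφm.ennreal_ofReal hg'.measurable,
    hg'.map_eq, ← ofReal_integral_eq_lintegral_ofReal
    ((integrable_exp_mul_gaussianReal' _ p).const_mul _) (ae_of_all _ hφ0),
    integral_const_mul, integral_exp_mul_gaussianReal, Real.coe_toNNReal _ hS0, mul_assoc,
    ← Real.exp_add, deflatorMoment]
  congr 3
  rw [← hS, ← hp]
  have h1 : (1 : ℝ) - γ ≠ 0 := by linarith
  -- The compensator contributes pS/2 to the exponent and the Gaussian moment p²S/2, in total p(p +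
  -- 1)S/2.
  have e2 : γ / (1 - γ) ^ 2 = p * (p + 1) := by rw [hp]; field_simp; ring
  rw [e2]
  ring

/-- The budget inequality under the original measure. -/
theorem lintegral_deflated_le (h : IsWienerIntegral 𝓕 P B T θ I) (hB : IsFilteredBM 𝓕 P T B)
    (hθ : MemLp θ 2 (volume.restrict (Icc 0 (T : ℝ)))) (hr : IntervalIntegrable r volume 0 T)
    {y : ℝ → Ω → EuclideanSpace ℝ (Fin d)} {c X : ℝ → Ω → ℝ}
    (hX : IsItoProcess 𝓕 P B T x (fun t ω => X t ω * (r t + ⟪y t ω, θ t⟫) - c t ω)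
      (fun t ω => X t ω • y t ω) X)
    (hX0 : ∀ᵐ ω ∂P, ∀ t ∈ Icc 0 (T : ℝ), 0 ≤ X t ω) {c' : ℝ → Ω → ℝ}
    (hcm : Measurable fun p : Ω × ℝ => c' p.2 p.1)
    (hca : ∀ t : ℝ≥0, t ≤ T → Measurable[𝓕 t] (c' t)) (hc0 : ∀ t ω, 0 ≤ c' t ω)
    (hcc : ∀ᵐ ω ∂P, ∀ᵐ t ∂(volume.restrict (Icc 0 (T : ℝ))), c' t ω = c t ω) :
    ∫⁻ ω, ENNReal.ofReal (Real.exp (∫ u in (0 : ℝ)..T, -r u) * X T ω * expDensity θ I T ω) ∂P +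
      ∫⁻ t in Icc 0 (T : ℝ), ∫⁻ ω, ENNReal.ofReal (Real.exp (∫ u in (0 : ℝ)..t, -r u) * c' t ω *
        expDensity θ I t ω) ∂P ≤ ENNReal.ofReal x := by
  have hT := T.coe_nonneg
  set Q := girsanovMeasure P T θ I with hQ
  have hQp := h.isProbabilityMeasure_girsanovMeasure hB hθ
  have hQP : Q ≪ P := withDensity_absolutelyContinuous _ _
  have hBQ := h.isFilteredBM_shiftedBM hB hθ
  obtain ⟨M, hM, hMeq⟩ := hX.eq
  have hfin : IsFiniteMeasure (P.withDensity fun ω => ENNReal.ofReal (expDensity θ I T ω)) := by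
    have : IsFiniteMeasure Q := inferInstance
    exact this
  have hN := (hM.isGridApprox hB).shiftedBM (θ := θ) hθ hM.sq_integrable
    (Z := fun ω => ENNReal.ofReal (expDensity θ I T ω))
  set D : ℝ → ℝ := fun s => Real.exp (∫ u in (0 : ℝ)..s, -r u) with hD
  have hr' : IntervalIntegrable (fun s => -r s) volume 0 T := hr.neg
  have hDc : ContinuousOn D (Icc 0 (T : ℝ)) := (continuousOn_primitive hT hr').rexp
  have hinner : ∀ᵐ ω ∂P, IntervalIntegrable (fun s => ⟪X s ω • y s ω, θ s⟫) volume 0 T := by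
    filter_upwards [hM.sq_integrable] with ω hω using intervalIntegrable_inner hT hω hθ
  have hpc : ∀ᵐ ω ∂P, IntegrableOn (fun s => X s ω * r s - c' s ω) (Icc 0 (T : ℝ)) := by
    filter_upwards [hX.drift_integrable, hinner, hcc] with ω h1 h2 h3
    rw [intervalIntegrable_iff_integrableOn_Icc_of_le hT] at h2
    refine (h1.sub h2).congr ?_
    filter_upwards [h3] with t ht
    simp only [Pi.sub_apply]
    rw [ht, real_inner_smul_left]
    ring
  have hcint : ∀ᵐ ω ∂P, IntegrableOn (fun s => D s * c' s ω) (Icc 0 (T : ℝ)) := by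
    filter_upwards [hpc, hX.continuous] with ω h1 h2
    have hXr : IntegrableOn (fun s => X s ω * r s) (Icc 0 (T : ℝ)) := by
      rw [← intervalIntegrable_iff_integrableOn_Icc_of_le hT]
      exact hr.continuousOn_mul (by rwa [uIcc_of_le hT])
    have hci : IntegrableOn (fun s => c' s ω) (Icc 0 (T : ℝ)) := by
      refine (hXr.sub h1).congr (ae_of_all _ fun s => ?_)
      simp
    rw [← intervalIntegrable_iff_integrableOn_Icc_of_le hT] at hci ⊢
    exact hci.continuousOn_mul (by rwa [uIcc_of_le hT])
  have heq : ∀ᵐ ω ∂P, ∀ t ∈ Icc 0 (T : ℝ), X t ω = x + (∫ s in (0 : ℝ)..t,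
      (X s ω * r s - c' s ω)) + (M t ω + ∫ s in (0 : ℝ)..t, ⟪X s ω • y s ω, θ s⟫) := by
    filter_upwards [hMeq, hpc, hinner, hcc] with ω h1 h2 h3 h4 t ht
    have hsub : uIcc 0 t ⊆ uIcc 0 (T : ℝ) := by
      rw [uIcc_of_le hT]; exact uIcc_subset_Icc ⟨le_rfl, hT⟩ ht
    rw [← intervalIntegrable_iff_integrableOn_Icc_of_le hT] at h2
    have hadd := intervalIntegral.integral_add (h2.mono_set hsub) (h3.mono_set hsub)
    suffices he : ∫ s in (0 : ℝ)..t, (X s ω * (r s + ⟪y s ω, θ s⟫) - c s ω) =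
        ∫ s in (0 : ℝ)..t, (X s ω * r s - c' s ω + ⟪X s ω • y s ω, θ s⟫) by
      rw [h1 t ht, he, hadd]
      ring
    refine intervalIntegral.integral_congr_ae ?_
    have h4' := (ae_restrict_iff' measurableSet_Icc).1 h4
    filter_upwards [h4'] with s hs hst
    rw [uIoc_of_le ht.1] at hst
    rw [hs ⟨hst.1.le, hst.2.trans ht.2⟩, real_inner_smul_left]
    ring
  have hXT : Measurable (X T) := (hX.adapted T le_rfl).mono (𝓕.le T) le_rfl
  have hDm : Measurable fun t => D (projIcc 0 (T : ℝ) hT t) := by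
    have : Continuous fun t => D (projIcc 0 (T : ℝ) hT t) :=
      hDc.comp_continuous (continuous_subtype_val.comp continuous_projIcc)
        fun t => (projIcc 0 (T : ℝ) hT t).2
    exact this.measurable
  have hDcm : Measurable fun p : Ω × ℝ => D (projIcc 0 (T : ℝ) hT p.2) * c' p.2 p.1 :=
    (hDm.comp measurable_snd).mul hcm
  have hcI : Measurable fun ω => ∫ s in (0 : ℝ)..T, D s * c' s ω := by
    have e : (fun ω => ∫ s in (0 : ℝ)..T, D s * c' s ω) = fun ω => ∫ s in Icc 0 (T : ℝ),
        D (projIcc 0 (T : ℝ) hT s) * c' s ω := by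
      funext ω
      rw [intervalIntegral.integral_of_le hT, ← integral_Icc_eq_integral_Ioc]
      refine setIntegral_congr_fun measurableSet_Icc fun s hs => ?_
      simp only [projIcc_of_mem hT hs]
    rw [e]
    exact (hDcm.stronglyMeasurable.integral_prod_right' (ν := volume.restrict (Icc 0 (T : ℝ)))).measurable
  have key := lintegral_discounted_le hBQ hN (hQP.ae_le hM.sq_integrable) hr
    (hQP.ae_le hX.continuous) (hQP.ae_le hX0) (c := c')
    (ae_of_all _ fun ω t _ => hc0 t ω) (hQP.ae_le hpc) (hQP.ae_le heq)
    ((hXT.const_mul _).add hcI).aemeasurable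
  have hsplit : ∀ᵐ ω ∂Q, ENNReal.ofReal (D T * X T ω + ∫ s in (0 : ℝ)..T, D s * c' s ω) =
      ENNReal.ofReal (D T * X T ω) + ∫⁻ s in Icc 0 (T : ℝ), ENNReal.ofReal (D s * c' s ω) := by
    filter_upwards [hQP.ae_le hX0, hQP.ae_le hcint] with ω h1 h2
    have e1 : ∫ s in (0 : ℝ)..T, D s * c' s ω = ∫ s in Icc 0 (T : ℝ), D s * c' s ω := by
      rw [intervalIntegral.integral_of_le hT, ← integral_Icc_eq_integral_Ioc]
    rw [ENNReal.ofReal_add (mul_nonneg (Real.exp_pos _).le (h1 T ⟨hT, le_rfl⟩))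
      (intervalIntegral.integral_nonneg hT fun s _ => mul_nonneg (Real.exp_pos _).le (hc0 s ω)),
      e1, ofReal_integral_eq_lintegral_ofReal h2
        (ae_of_all _ fun s => mul_nonneg (Real.exp_pos _).le (hc0 s ω))]
  have hkey2 : ∫⁻ ω, ENNReal.ofReal (D T * X T ω + ∫ s in (0 : ℝ)..T, D s * c' s ω) ∂Q ≤
    ENNReal.ofReal x := key
  -- For a variable known at time t the density at T may be replaced by the density at t, by the
  -- martingale property; this puts the deflator at the correct date for consumption.
  have hZ : ∀ t ∈ Icc 0 (T : ℝ), ∀ f : Ω → ℝ, Measurable[𝓕 t.toNNReal] f →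
      ∫⁻ ω, ENNReal.ofReal (f ω) ∂Q = ∫⁻ ω, ENNReal.ofReal (f ω * expDensity θ I t ω) ∂P := by
    intro t ht f hf
    have := h.lintegral_girsanovMeasure hB hθ (t := t.toNNReal)
      (by rw [← NNReal.coe_le_coe, Real.coe_toNNReal _ ht.1]; exact ht.2)
      (f := fun ω => ENNReal.ofReal (f ω)) hf.ennreal_ofReal
    rw [this, Real.coe_toNNReal _ ht.1]
    refine lintegral_congr fun ω => ?_
    rw [ENNReal.ofReal_mul' (by exact (Real.exp_pos _).le)]
  rw [lintegral_congr_ae hsplit, lintegral_add_left (hXT.const_mul _).ennreal_ofReal] at hkey2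
  refine le_trans (add_le_add (le_of_eq ?_) (le_of_eq ?_)) hkey2
  · refine (hZ T ⟨hT, le_rfl⟩ _ ?_).symm
    rw [Real.toNNReal_coe]
    exact (hX.adapted T le_rfl).const_mul _
  · have hsw : ∫⁻ ω, (∫⁻ s in Icc 0 (T : ℝ), ENNReal.ofReal (D s * c' s ω)) ∂Q =
        ∫⁻ s in Icc 0 (T : ℝ), (∫⁻ ω, ENNReal.ofReal (D s * c' s ω) ∂Q) := by
      have e : ∀ ω, ∫⁻ s in Icc 0 (T : ℝ), ENNReal.ofReal (D s * c' s ω) =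
          ∫⁻ s in Icc 0 (T : ℝ), ENNReal.ofReal (D (projIcc 0 (T : ℝ) hT s) * c' s ω) := fun ω =>
        setLIntegral_congr_fun measurableSet_Icc fun s hs => by simp only [projIcc_of_mem hT hs]
      simp_rw [e]
      rw [lintegral_lintegral_swap hDcm.ennreal_ofReal.aemeasurable]
      exact setLIntegral_congr_fun measurableSet_Icc fun s hs => by simp only [projIcc_of_mem hT hs]
    rw [hsw]
    refine setLIntegral_congr_fun measurableSet_Icc fun t ht => ?_
    refine (hZ t ht _ ?_).symm
    have := hca t.toNNReal (by rw [← NNReal.coe_le_coe, Real.coe_toNNReal _ ht.1]; exact ht.2)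
    rw [Real.coe_toNNReal _ ht.1] at this
    exact this.const_mul _

end

end PortfolioES

/-! ### Duality bound for the expected utility -/

namespace PortfolioES

variable {d : ℕ} {Ω : Type*} [mΩ : MeasurableSpace Ω]

lemma continuousOn_deflatorMoment {T : ℝ} (hT : 0 ≤ T) (γ : ℝ) {r : ℝ → ℝ}
    {θ : ℝ → EuclideanSpace ℝ (Fin d)} (hr : IntervalIntegrable r volume 0 T)
    (hθ : MemLp θ 2 (volume.restrict (Icc 0 T))) :
    ContinuousOn (deflatorMoment γ r θ) (Icc 0 T) := by
  have h2 := continuousOn_primitive hT (intervalIntegrable_norm_sq hθ (s := 0) (t := T)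
    ⟨le_rfl, hT⟩ ⟨hT, le_rfl⟩)
  exact (((continuousOn_primitive hT hr).const_mul _).add (h2.const_mul _)).rexp

section

variable {𝓕 : Filtration ℝ≥0 mΩ} {P : Measure Ω} [IsProbabilityMeasure P] {T : ℝ≥0}
  {B : ℝ≥0 → Ω → EuclideanSpace ℝ (Fin d)} {θ : ℝ → EuclideanSpace ℝ (Fin d)}
  {I : ℝ → Ω → ℝ} {r : ℝ → ℝ} {x γ : ℝ}

/-- The conjugate inequality with h = l H_t separates the cost of f at state prices from a moment of
the deflator that does not involve f. -/
lemma IsWienerIntegral.lintegral_rpow_le (h : IsWienerIntegral 𝓕 P B T θ I)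
    (hB : IsFilteredBM 𝓕 P T B) (hθ : MemLp θ 2 (volume.restrict (Icc 0 (T : ℝ))))
    (hγ0 : 0 < γ) (hγ1 : γ < 1) {t : ℝ} (ht : t ∈ Icc 0 (T : ℝ)) {l : ℝ} (hl : 0 < l) {f : Ω → ℝ}
    (hf : ∀ᵐ ω ∂P, 0 ≤ f ω) :
    ∫⁻ ω, ENNReal.ofReal (f ω ^ γ) ∂P ≤ ENNReal.ofReal (γ * l) *
      (∫⁻ ω, ENNReal.ofReal (Real.exp (∫ u in (0 : ℝ)..t, -r u) * f ω * expDensity θ I t ω) ∂P) +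
      ENNReal.ofReal ((1 - γ) * l ^ (-(γ / (1 - γ)))) *
        ENNReal.ofReal (deflatorMoment γ r θ t) := by
  have h1γ : 0 < 1 - γ := by linarith
  have hZm : Measurable (expDensity θ I t) :=
    (h.measurable_expDensity (t := ⟨t, ht.1⟩) (by exact_mod_cast ht.2)).mono (𝓕.le _) le_rfl
  set D := Real.exp (∫ u in (0 : ℝ)..t, -r u) with hD
  have hD0 : 0 < D := Real.exp_pos _
  have hZ0 : ∀ ω, 0 < expDensity θ I t ω := fun ω => Real.exp_pos _
  have hmom := h.lintegral_deflator_rpow (r := r) hB hθ hγ1 ht hl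
  calc ∫⁻ ω, ENNReal.ofReal (f ω ^ γ) ∂P
      ≤ ∫⁻ ω, (ENNReal.ofReal (γ * l) * ENNReal.ofReal (D * f ω * expDensity θ I t ω) +
          ENNReal.ofReal (1 - γ) * ENNReal.ofReal ((l * (D * expDensity θ I t ω)) ^
            (-(γ / (1 - γ))))) ∂P := by
        refine lintegral_mono_ae ?_
        filter_upwards [hf] with ω hω
        have hZω := hZ0 ω
        rw [← ENNReal.ofReal_mul (by positivity), ← ENNReal.ofReal_mul h1γ.le,
          ← ENNReal.ofReal_add (by positivity) (by positivity)]
        refine ENNReal.ofReal_le_ofReal ((rpow_le_mul_add_rpow hγ0 hγ1 hω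
          (h := l * (D * expDensity θ I t ω)) (by positivity)).trans (le_of_eq ?_))
        ring
    _ = _ := by
        rw [lintegral_add_right _ (by fun_prop), lintegral_const_mul' _ _ ENNReal.ofReal_ne_top,
          lintegral_const_mul' _ _ ENNReal.ofReal_ne_top, hmom,
          ENNReal.ofReal_mul (p := l ^ (-(γ / (1 - γ)))) (by positivity),
          ENNReal.ofReal_mul (p := 1 - γ) h1γ.le]
        ring

/-- Upper bound for the expected utility of consumption and terminal wealth. -/
theorem cost_le (h : IsWienerIntegral 𝓕 P B T θ I) (hB : IsFilteredBM 𝓕 P T B)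
    (hθ : MemLp θ 2 (volume.restrict (Icc 0 (T : ℝ)))) (hr : IntervalIntegrable r volume 0 T)
    (hγ0 : 0 < γ) (hγ1 : γ < 1) (hx : 0 < x)
    {y : ℝ → Ω → EuclideanSpace ℝ (Fin d)} {c X : ℝ → Ω → ℝ}
    (hX : IsItoProcess 𝓕 P B T x (fun t ω => X t ω * (r t + ⟪y t ω, θ t⟫) - c t ω)
      (fun t ω => X t ω • y t ω) X)
    (hX0 : ∀ᵐ ω ∂P, ∀ t ∈ Icc 0 (T : ℝ), 0 ≤ X t ω) {c' : ℝ → Ω → ℝ}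
    (hcm : Measurable fun p : Ω × ℝ => c' p.2 p.1)
    (hca : ∀ t : ℝ≥0, t ≤ T → Measurable[𝓕 t] (c' t)) (hc0 : ∀ t ω, 0 ≤ c' t ω)
    (hcc : ∀ᵐ ω ∂P, ∀ᵐ t ∂(volume.restrict (Icc 0 (T : ℝ))), c' t ω = c t ω) :
    cost P T γ γ c X ≤ ENNReal.ofReal (x ^ γ *
      ((∫ t in (0 : ℝ)..T, deflatorMoment γ r θ t) + deflatorMoment γ r θ T) ^ (1 - γ)) := by
  have hT := T.coe_nonneg
  have hTT : (T : ℝ) ∈ Icc 0 (T : ℝ) := ⟨hT, le_rfl⟩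
  have h1γ : 0 < 1 - γ := by linarith
  have hbud := lintegral_deflated_le h hB hθ hr hX hX0 hcm hca hc0 hcc
  set D : ℝ → ℝ := fun s => Real.exp (∫ u in (0 : ℝ)..s, -r u) with hD
  set G := deflatorMoment γ r θ with hG
  have hG0 : ∀ t, 0 < G t := fun t => Real.exp_pos _
  have hGc : ContinuousOn G (Icc 0 (T : ℝ)) := continuousOn_deflatorMoment hT γ hr hθ
  have hGi : IntegrableOn G (Icc 0 (T : ℝ)) := hGc.integrableOn_compact isCompact_Icc
  set Γ := (∫ t in (0 : ℝ)..T, G t) + G T with hΓ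
  have hI0 : 0 ≤ ∫ t in (0 : ℝ)..T, G t := intervalIntegral.integral_nonneg hT fun t _ => (hG0 t).le
  have hΓ0 : 0 < Γ := add_pos_of_nonneg_of_pos hI0 (hG0 T)
  -- The multiplier l minimizes γlx + (1 - γ)l^{-γ/(1-γ)}Γ: for it, both lx and l^{-γ/(1-γ)}Γ equal
  -- x^γ Γ^{1-γ}.
  set l := (Γ / x) ^ (1 - γ) with hl
  have hl0 : 0 < l := by positivity
  have hXT : Measurable (X T) := (hX.adapted T le_rfl).mono (𝓕.le T) le_rfl
  have e1 : cost P T γ γ c X = (∫⁻ t in Icc 0 (T : ℝ), (∫⁻ ω, ENNReal.ofReal (c' t ω ^ γ) ∂P)) +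
      ∫⁻ ω, ENNReal.ofReal (X T ω ^ γ) ∂P := by
    have hm : AEMeasurable (fun p : Ω × ℝ => ENNReal.ofReal (c' p.2 p.1 ^ γ))
        (P.prod (volume.restrict (Icc 0 (T : ℝ)))) := (hcm.pow_const γ).ennreal_ofReal.aemeasurable
    rw [← lintegral_lintegral_swap (f := fun ω t => ENNReal.ofReal (c' t ω ^ γ)) hm,
      ← lintegral_add_right _ (hXT.pow_const γ).ennreal_ofReal, cost]
    refine lintegral_congr_ae ?_
    filter_upwards [hcc] with ω hω
    congr 1
    refine lintegral_congr_ae ?_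
    filter_upwards [hω] with t ht
    rw [ht]
  set K := ENNReal.ofReal ((1 - γ) * l ^ (-(γ / (1 - γ)))) with hK
  have e2 : ∫⁻ t in Icc 0 (T : ℝ), (∫⁻ ω, ENNReal.ofReal (c' t ω ^ γ) ∂P) ≤
      ENNReal.ofReal (γ * l) * (∫⁻ t in Icc 0 (T : ℝ), ∫⁻ ω, ENNReal.ofReal (D t * c' t ω *
        expDensity θ I t ω) ∂P) + K * ENNReal.ofReal (∫ t in (0 : ℝ)..T, G t) := by
    rw [intervalIntegral.integral_of_le hT, ← integral_Icc_eq_integral_Ioc,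
      ofReal_integral_eq_lintegral_ofReal hGi (ae_of_all _ fun t => (hG0 t).le),
      ← lintegral_const_mul' _ _ ENNReal.ofReal_ne_top,
      ← lintegral_const_mul' _ _ ENNReal.ofReal_ne_top, ← lintegral_add_right']
    · exact setLIntegral_mono' measurableSet_Icc fun t ht =>
        h.lintegral_rpow_le hB hθ hγ0 hγ1 ht hl0 (ae_of_all _ fun ω => hc0 t ω)
    · exact hGi.1.aemeasurable.ennreal_ofReal.const_mul _
  have e3 : ∫⁻ ω, ENNReal.ofReal (X T ω ^ γ) ∂P ≤ ENNReal.ofReal (γ * l) *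
      (∫⁻ ω, ENNReal.ofReal (D T * X T ω * expDensity θ I T ω) ∂P) + K * ENNReal.ofReal (G T) :=
    h.lintegral_rpow_le (r := r) hB hθ hγ0 hγ1 hTT hl0 (f := X T)
    (by filter_upwards [hX0] with ω hω using hω T hTT)
  have hfin : γ * l * x + (1 - γ) * l ^ (-(γ / (1 - γ))) * Γ = x ^ γ * Γ ^ (1 - γ) := by
    have a1 : l * x = x ^ γ * Γ ^ (1 - γ) := by
      rw [hl, Real.div_rpow hΓ0.le hx.le, div_mul_eq_mul_div, div_eq_iff (by positivity)]
      have : x ^ γ * x ^ (1 - γ) = x := by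
        rw [← Real.rpow_add hx]; simp
      calc Γ ^ (1 - γ) * x = Γ ^ (1 - γ) * (x ^ γ * x ^ (1 - γ)) := by rw [this]
        _ = _ := by ring
    have a2 : l ^ (-(γ / (1 - γ))) * Γ = x ^ γ * Γ ^ (1 - γ) := by
      rw [hl, ← Real.rpow_mul (by positivity)]
      have : (1 - γ) * -(γ / (1 - γ)) = -γ := by field_simp
      have hΓγ : Γ ^ γ * Γ ^ (1 - γ) = Γ := by rw [← Real.rpow_add hΓ0]; simp
      rw [this, Real.rpow_neg (by positivity), Real.div_rpow hΓ0.le hx.le, inv_div,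
        div_mul_eq_mul_div, div_eq_iff (by positivity), mul_assoc, mul_comm (Γ ^ (1 - γ)), hΓγ]
    rw [mul_assoc, mul_assoc, a1, a2]
    ring
  calc cost P T γ γ c X ≤ _ := e1.le.trans (add_le_add e2 e3)
    _ = ENNReal.ofReal (γ * l) * ((∫⁻ ω, ENNReal.ofReal (D T * X T ω * expDensity θ I T ω) ∂P) +
        ∫⁻ t in Icc 0 (T : ℝ), ∫⁻ ω, ENNReal.ofReal (D t * c' t ω * expDensity θ I t ω) ∂P) +
        K * (ENNReal.ofReal (∫ t in (0 : ℝ)..T, G t) + ENNReal.ofReal (G T)) := by ring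
    _ ≤ ENNReal.ofReal (γ * l) * ENNReal.ofReal x + K * ENNReal.ofReal Γ := by
        rw [← ENNReal.ofReal_add hI0 (hG0 T).le]
        gcongr
    _ = _ := by
        rw [hK, ← ENNReal.ofReal_mul (by positivity), ← ENNReal.ofReal_mul (by positivity),
          ← ENNReal.ofReal_add (by positivity) (by positivity), hfin]

end

end PortfolioES

/-! ### The optimal control in closed form and its value -/

namespace PortfolioES

variable {d : ℕ} {Ω : Type*} [mΩ : MeasurableSpace Ω]

section

variable {T γ : ℝ} {r : ℝ → ℝ} {θ : ℝ → EuclideanSpace ℝ (Fin d)}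

/-- The integrand is the derivative of -log K_s for K_s = G T + ∫ₛᵀ G. In the optimal wealth,
consumption therefore contributes the fraction K_t/K_0 of initial wealth not yet spent. -/
lemma integral_div_tail {G : ℝ → ℝ} (hG : ContinuousOn G (Icc 0 T)) (hG0 : ∀ t, 0 < G t)
    {t : ℝ} (ht : t ∈ Icc 0 T) :
    Real.exp (-∫ s in (0 : ℝ)..t, G s / (G T + ∫ u in s..T, G u)) =
      (G T + ∫ u in t..T, G u) / (G T + ∫ u in (0 : ℝ)..T, G u) := by
  have hT : 0 ≤ T := ht.1.trans ht.2
  have hTT : T ∈ Icc 0 T := ⟨hT, le_rfl⟩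
  have h00 : (0 : ℝ) ∈ Icc 0 T := ⟨le_rfl, hT⟩
  have hGi : ∀ s ∈ Icc 0 T, ∀ u ∈ Icc 0 T, IntervalIntegrable G volume s u := fun s hs u hu =>
    (hG.mono (uIcc_subset_Icc hs hu)).intervalIntegrable
  set K : ℝ → ℝ := fun s => G T + ∫ u in s..T, G u with hK
  have hK0 : ∀ s ∈ Icc 0 T, 0 < K s := fun s hs =>
    add_pos_of_pos_of_nonneg (hG0 T) (intervalIntegral.integral_nonneg hs.2 fun u _ => (hG0 u).le)
  have hKe : ∀ s ∈ Icc 0 T, K s = K 0 - ∫ u in (0 : ℝ)..s, G u := by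
    intro s hs
    have := intervalIntegral.integral_add_adjacent_intervals (hGi 0 h00 s hs) (hGi s hs T hTT)
    simp only [hK]
    linarith
  have hKc : ContinuousOn K (Icc 0 T) :=
    (continuousOn_const.sub (continuousOn_primitive hT (hGi 0 h00 T hTT))).congr hKe
  have hsub : Icc 0 t ⊆ Icc 0 T := Icc_subset_Icc_right ht.2
  have hder : ∀ s ∈ Ioo 0 t, HasDerivAt (fun s => -Real.log (K s)) (G s / K s) s := by
    intro s hs
    have hs' : s ∈ Ioo 0 T := ⟨hs.1, hs.2.trans_le ht.2⟩
    have hsI : s ∈ Icc 0 T := ⟨hs'.1.le, hs'.2.le⟩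
    have h1 : HasDerivAt (fun s => ∫ u in (0 : ℝ)..s, G u) (G s) s :=
      intervalIntegral.integral_hasDerivAt_right (hGi 0 h00 s hsI)
        ((hG.mono Ioo_subset_Icc_self).stronglyMeasurableAtFilter isOpen_Ioo s hs')
        (hG.continuousAt (Icc_mem_nhds hs'.1 hs'.2))
    have h2 : HasDerivAt K (-G s) s := by
      refine (h1.const_sub (K 0)).congr_of_eventuallyEq ?_
      filter_upwards [Icc_mem_nhds hs'.1 hs'.2] with u hu using hKe u hu
    have h3 := (h2.log (hK0 s hsI).ne').neg
    rwa [neg_div, neg_neg] at h3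
  have hvc : ContinuousOn (fun s => G s / K s) (Icc 0 t) :=
    (hG.mono hsub).div (hKc.mono hsub) fun s hs => (hK0 s (hsub hs)).ne'
  have hFTC := intervalIntegral.integral_eq_sub_of_hasDerivAt_of_le ht.1
    (((hKc.mono hsub).log fun s hs => (hK0 s (hsub hs)).ne').neg) hder
    (by rw [← uIcc_of_le ht.1] at hvc; exact hvc.intervalIntegrable)
  have e : ∫ s in (0 : ℝ)..t, G s / (G T + ∫ u in s..T, G u) = -Real.log (K t) - -Real.log (K 0) :=
    hFTC
  rw [e]
  have : -(-Real.log (K t) - -Real.log (K 0)) = Real.log (K t) - Real.log (K 0) := by ring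
  rw [this, ← Real.log_div (hK0 t ht).ne' (hK0 0 h00).ne',
    Real.exp_log (div_pos (hK0 t ht) (hK0 0 h00))]

/-- The optimal consumption rate. -/
noncomputable def optRate (T γ : ℝ) (r : ℝ → ℝ) (θ : ℝ → EuclideanSpace ℝ (Fin d)) (t : ℝ) : ℝ :=
  deflatorMoment γ r θ t / (deflatorMoment γ r θ T + ∫ s in t..T, deflatorMoment γ r θ s)

lemma deflatorMoment_pos (t : ℝ) : 0 < deflatorMoment γ r θ t := Real.exp_pos _

lemma tail_pos {t : ℝ} (ht : t ≤ T) :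
    0 < deflatorMoment γ r θ T + ∫ s in t..T, deflatorMoment γ r θ s :=
  add_pos_of_pos_of_nonneg (deflatorMoment_pos T)
    (intervalIntegral.integral_nonneg ht fun u _ => (deflatorMoment_pos u).le)

lemma optRate_nonneg {t : ℝ} (ht : t ≤ T) : 0 ≤ optRate T γ r θ t :=
  div_nonneg (deflatorMoment_pos t).le (tail_pos ht).le

lemma continuousOn_optRate (hT : 0 ≤ T) (hr : IntervalIntegrable r volume 0 T)
    (hθ : MemLp θ 2 (volume.restrict (Icc 0 T))) :
    ContinuousOn (optRate T γ r θ) (Icc 0 T) := by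
  have hG := continuousOn_deflatorMoment hT γ hr hθ
  have hGi : IntervalIntegrable (deflatorMoment γ r θ) volume 0 T := by
    rw [← uIcc_of_le hT] at hG; exact hG.intervalIntegrable
  refine hG.div (continuousOn_const.add ?_) fun t ht => (tail_pos ht.2).ne'
  refine ((continuousOn_const (c := ∫ s in (0 : ℝ)..T, deflatorMoment γ r θ s)).sub
    (continuousOn_primitive hT hGi)).congr fun t ht => ?_
  have hsub : uIcc 0 t ⊆ uIcc 0 T := by
    rw [uIcc_of_le hT]; exact uIcc_subset_Icc ⟨le_rfl, hT⟩ ht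
  have := intervalIntegral.integral_interval_sub_left hGi (hGi.mono_set hsub)
  simp only [Pi.sub_apply]
  rw [this]

end

section

variable {𝓕 : Filtration ℝ≥0 mΩ} {P : Measure Ω} [IsProbabilityMeasure P] {T : ℝ≥0}
  {B : ℝ≥0 → Ω → EuclideanSpace ℝ (Fin d)} {θ : ℝ → EuclideanSpace ℝ (Fin d)}
  {J : ℝ → Ω → ℝ} {r : ℝ → ℝ} {x γ : ℝ}

/-- The optimal wealth process, as an explicit exponential. -/
noncomputable def optWealth (T x γ : ℝ) (r : ℝ → ℝ) (θ : ℝ → EuclideanSpace ℝ (Fin d))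
    (J : ℝ → Ω → ℝ) : ℝ → Ω → ℝ :=
  stochExp x (fun t => r t - optRate T γ r θ t + ‖θ t‖ ^ 2 / (1 - γ))
    (fun t => (1 / (1 - γ)) • θ t) J

lemma intervalIntegrable_optDrift {T : ℝ} (hT : 0 ≤ T) (hr : IntervalIntegrable r volume 0 T)
    (hθ : MemLp θ 2 (volume.restrict (Icc 0 T))) :
    IntervalIntegrable (fun t => r t - optRate T γ r θ t + ‖θ t‖ ^ 2 / (1 - γ)) volume 0 T := by
  have hv : IntervalIntegrable (optRate T γ r θ) volume 0 T := by
    have := continuousOn_optRate (γ := γ) hT hr hθ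
    rw [← uIcc_of_le hT] at this
    exact this.intervalIntegrable
  exact (hr.sub hv).add ((intervalIntegrable_norm_sq hθ ⟨le_rfl, hT⟩ ⟨hT, le_rfl⟩).div_const _)

omit mΩ in
lemma optWealth_eq {T : ℝ} (hT : 0 ≤ T) (hr : IntervalIntegrable r volume 0 T)
    (hθ : MemLp θ 2 (volume.restrict (Icc 0 T))) {t : ℝ} (ht : t ∈ Icc 0 T) (ω : Ω) :
    optWealth T x γ r θ J t ω =
      x * ((deflatorMoment γ r θ T + ∫ u in t..T, deflatorMoment γ r θ u) /
        (deflatorMoment γ r θ T + ∫ u in (0 : ℝ)..T, deflatorMoment γ r θ u)) *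
      Real.exp ((∫ u in (0 : ℝ)..t, r u) + (∫ u in (0 : ℝ)..t, ‖θ u‖ ^ 2) / (1 - γ)) *
      Real.exp (J t ω - (∫ u in (0 : ℝ)..t, ‖θ u‖ ^ 2) / (1 - γ) ^ 2 / 2) := by
  have h0 : (0 : ℝ) ∈ Icc 0 T := ⟨le_rfl, hT⟩
  have hsub : uIcc 0 t ⊆ uIcc 0 T := by rw [uIcc_of_le hT]; exact uIcc_subset_Icc h0 ht
  have hv : IntervalIntegrable (optRate T γ r θ) volume 0 T := by
    have := continuousOn_optRate (γ := γ) hT hr hθ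
    rw [← uIcc_of_le hT] at this
    exact this.intervalIntegrable
  have hS := intervalIntegrable_norm_sq hθ h0 ht
  have e1 : ∫ u in (0 : ℝ)..t, (r u - optRate T γ r θ u + ‖θ u‖ ^ 2 / (1 - γ)) =
      (∫ u in (0 : ℝ)..t, r u) + (∫ u in (0 : ℝ)..t, ‖θ u‖ ^ 2) / (1 - γ) +
        -∫ u in (0 : ℝ)..t, optRate T γ r θ u := by
    rw [intervalIntegral.integral_add ((hr.mono_set hsub).sub (hv.mono_set hsub)) (hS.div_const _),
      intervalIntegral.integral_sub (hr.mono_set hsub) (hv.mono_set hsub),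
      intervalIntegral.integral_div]
    ring
  have e2 : ∫ u in (0 : ℝ)..t, ‖(1 / (1 - γ)) • θ u‖ ^ 2 =
      (∫ u in (0 : ℝ)..t, ‖θ u‖ ^ 2) / (1 - γ) ^ 2 := by
    rw [← intervalIntegral.integral_div]
    refine intervalIntegral.integral_congr fun u _ => ?_
    simp only [norm_smul, mul_pow, Real.norm_eq_abs, sq_abs, div_pow, one_pow]
    ring
  rw [optWealth, stochExp, e1, e2, Real.exp_add]
  have := integral_div_tail (continuousOn_deflatorMoment hT γ hr hθ) deflatorMoment_pos ht
  simp only [optRate]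
  rw [this]
  ring

/-- The tail K_t cancels in the product of rate and wealth, so consumption is (x/Γ)G_t times an
exponential of the Gaussian J_t. Its γ-th moment reproduces G_t, up to the constant (x/Γ)^γ. -/
lemma IsWienerIntegral.lintegral_optConsumption (h : IsWienerIntegral 𝓕 P B T
    (fun t => (1 / (1 - γ)) • θ t) J) (hB : IsFilteredBM 𝓕 P T B)
    (hθ : MemLp θ 2 (volume.restrict (Icc 0 (T : ℝ)))) (hr : IntervalIntegrable r volume 0 T)
    (hγ1 : γ < 1) (hx : 0 < x) {t : ℝ} (ht : t ∈ Icc 0 (T : ℝ)) :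
    ∫⁻ ω, ENNReal.ofReal ((optRate T γ r θ t * optWealth T x γ r θ J t ω) ^ γ) ∂P =
      ENNReal.ofReal ((x / (deflatorMoment γ r θ T +
        ∫ u in (0 : ℝ)..T, deflatorMoment γ r θ u)) ^ γ * deflatorMoment γ r θ t) := by
  have hT := T.coe_nonneg
  have h1γ : 0 < 1 - γ := by linarith
  have hg := h.indepGaussian_zero hB (hθ.const_smul (1 / (1 - γ))) (t := ⟨t, ht.1⟩) (by exact_mod_cast ht.2)
  set S := ∫ u in (0 : ℝ)..t, ‖θ u‖ ^ 2 with hS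
  have hS0 : 0 ≤ S := intervalIntegral.integral_nonneg ht.1 fun _ _ => by positivity
  have e2 : ∫ u in (0 : ℝ)..t, ‖(1 / (1 - γ)) • θ u‖ ^ 2 = S / (1 - γ) ^ 2 := by
    rw [hS, ← intervalIntegral.integral_div]
    refine intervalIntegral.integral_congr fun u _ => ?_
    simp only [norm_smul, mul_pow, Real.norm_eq_abs, sq_abs, div_pow, one_pow]
    ring
  have hg' : IndepGaussian (𝓕 0) P (J t) (S / (1 - γ) ^ 2).toNNReal := by
    rw [← e2]; exact hg
  set Γ := deflatorMoment γ r θ T + ∫ u in (0 : ℝ)..T, deflatorMoment γ r θ u with hΓ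
  have hΓ0 : 0 < Γ := tail_pos hT
  have hK0 := tail_pos (γ := γ) (r := r) (θ := θ) ht.2
  have hG0 := deflatorMoment_pos (γ := γ) (r := r) (θ := θ) t
  set R := ∫ u in (0 : ℝ)..t, r u with hR
  set φ : ℝ → ℝ := fun z => (x / Γ * deflatorMoment γ r θ t) ^ γ *
    Real.exp (γ * (R + S / (1 - γ) - S / (1 - γ) ^ 2 / 2)) * Real.exp (γ * z) with hφ
  have e : ∀ ω, (optRate T γ r θ t * optWealth T x γ r θ J t ω) ^ γ = φ (J t ω) := by
    intro ω
    have : optRate T γ r θ t * optWealth T x γ r θ J t ω = (x / Γ * deflatorMoment γ r θ t) *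
        Real.exp (R + S / (1 - γ) - S / (1 - γ) ^ 2 / 2 + J t ω) := by
      have e3 : Real.exp (R + S / (1 - γ) - S / (1 - γ) ^ 2 / 2 + J t ω) =
        Real.exp (R + S / (1 - γ)) * Real.exp (J t ω - S / (1 - γ) ^ 2 / 2) := by
        rw [← Real.exp_add]; congr 1; ring
      rw [optWealth_eq hT hr hθ ht, e3, optRate, ← hR, ← hS, ← hΓ]
      generalize Real.exp (R + S / (1 - γ)) = E₁
      generalize Real.exp (J t ω - S / (1 - γ) ^ 2 / 2) = E₂
      field_simp
    simp only [hφ]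
    rw [this, Real.mul_rpow (by positivity) (by positivity), ← Real.exp_mul, mul_assoc _ _
      (Real.exp (γ * J t ω)), ← Real.exp_add]
    congr 2
    ring
  simp_rw [e]
  have hφm : Measurable φ := by fun_prop
  have hφ0 : ∀ z, 0 ≤ φ z := fun z => by positivity
  rw [← lintegral_map (f := fun z => ENNReal.ofReal (φ z)) hφm.ennreal_ofReal hg'.measurable,
    hg'.map_eq, ← ofReal_integral_eq_lintegral_ofReal
    ((integrable_exp_mul_gaussianReal' _ γ).const_mul _) (ae_of_all _ hφ0),
    integral_const_mul, integral_exp_mul_gaussianReal, Real.coe_toNNReal _ (by positivity),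
    Real.mul_rpow (by positivity) hG0.le, mul_assoc, mul_assoc, ← Real.exp_add]
  congr 2
  rw [deflatorMoment, ← Real.exp_mul, ← Real.exp_add, ← hR, ← hS]
  congr 1
  field_simp
  ring

/-- The expected utility of the optimal control. -/
theorem cost_optWealth (h : IsWienerIntegral 𝓕 P B T
    (fun t => (1 / (1 - γ)) • θ t) J) (hB : IsFilteredBM 𝓕 P T B)
    (hθ : MemLp θ 2 (volume.restrict (Icc 0 (T : ℝ)))) (hr : IntervalIntegrable r volume 0 T)
    (hγ1 : γ < 1) (hx : 0 < x) :
    cost P T γ γ (fun t ω => optRate T γ r θ t * optWealth T x γ r θ J t ω)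
      (optWealth T x γ r θ J) = ENNReal.ofReal (x ^ γ *
      ((∫ t in (0 : ℝ)..T, deflatorMoment γ r θ t) + deflatorMoment γ r θ T) ^ (1 - γ)) := by
  have hT := T.coe_nonneg
  have hTT : (T : ℝ) ∈ Icc 0 (T : ℝ) := ⟨hT, le_rfl⟩
  have hy : MemLp (fun t => (1 / (1 - γ)) • θ t) 2 (volume.restrict (Icc 0 (T : ℝ))) :=
    hθ.const_smul (1 / (1 - γ))
  set X := optWealth T x γ r θ J with hX
  set v := optRate T γ r θ with hv
  have hvc : ContinuousOn v (Icc 0 (T : ℝ)) := continuousOn_optRate hT hr hθ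
  have hXc : ∀ ω, ContinuousOn (fun t => X t ω) (Icc 0 (T : ℝ)) := fun ω =>
    h.continuousOn_stochExp hy (intervalIntegrable_optDrift hT hr hθ) ω
  have hXm : ∀ t ∈ Icc 0 (T : ℝ), Measurable (X t) := fun t ht => h.measurable_stochExp ht
  have hcm := measurable_uncurry_projIcc (X := fun t ω => v t * X t ω) hT
    (fun ω => hvc.mul (hXc ω)) fun t ht => (hXm t ht).const_mul _
  set Γ := deflatorMoment γ r θ T + ∫ u in (0 : ℝ)..T, deflatorMoment γ r θ u with hΓ
  have hΓ0 : 0 < Γ := tail_pos hT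
  -- Since the rate at T is 1, terminal wealth is covered by the formula for consumption at t = T.
  have hvT : v T = 1 := by
    rw [hv, optRate, intervalIntegral.integral_same, add_zero, div_self (deflatorMoment_pos T).ne']
  have hXT := h.lintegral_optConsumption (x := x) hB hθ hr hγ1 hx hTT
  rw [← hv, ← hX, hvT] at hXT
  simp only [one_mul] at hXT
  have hG := continuousOn_deflatorMoment hT γ hr hθ
  have hGi : IntegrableOn (deflatorMoment γ r θ) (Icc 0 (T : ℝ)) :=
    hG.integrableOn_compact isCompact_Icc
  have hproj : ∀ ω, ∫⁻ t in Icc 0 (T : ℝ), ENNReal.ofReal ((v t * X t ω) ^ γ) =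
      ∫⁻ t in Icc 0 (T : ℝ), ENNReal.ofReal ((v (projIcc 0 (T : ℝ) hT t) *
        X (projIcc 0 (T : ℝ) hT t) ω) ^ γ) := fun ω =>
    setLIntegral_congr_fun measurableSet_Icc fun t ht => by simp only [projIcc_of_mem hT ht]
  have hI : ∫⁻ ω, (∫⁻ t in Icc 0 (T : ℝ), ENNReal.ofReal ((v t * X t ω) ^ γ)) ∂P =
      ENNReal.ofReal ((x / Γ) ^ γ * ∫ u in (0 : ℝ)..T, deflatorMoment γ r θ u) := by
    simp_rw [hproj]
    rw [lintegral_lintegral_swap (hcm.pow_const γ).ennreal_ofReal.aemeasurable,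
      ← intervalIntegral.integral_const_mul, intervalIntegral.integral_of_le hT,
      ← integral_Icc_eq_integral_Ioc, ofReal_integral_eq_lintegral_ofReal (hGi.const_mul _)
        (ae_of_all _ fun t => mul_nonneg (by positivity) (deflatorMoment_pos t).le)]
    refine setLIntegral_congr_fun measurableSet_Icc fun t ht => ?_
    simp only [projIcc_of_mem hT ht]
    exact h.lintegral_optConsumption hB hθ hr hγ1 hx ht
  have hI0 : 0 ≤ ∫ u in (0 : ℝ)..T, deflatorMoment γ r θ u :=
    intervalIntegral.integral_nonneg hT fun u _ => (deflatorMoment_pos u).le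
  rw [cost, lintegral_add_right _ ((hXm T hTT).pow_const γ).ennreal_ofReal, hI, hXT,
    ← ENNReal.ofReal_add (by positivity) (mul_nonneg (by positivity) (deflatorMoment_pos _).le),
    ← mul_add, add_comm _ (deflatorMoment γ r θ T), ← hΓ, Real.div_rpow hx.le hΓ0.le,
    Real.rpow_sub hΓ0, Real.rpow_one]
  congr 1
  ring

end

end PortfolioES

/-! ### Gaussian tails, quantiles, and the tail mean of a lognormal variable -/

namespace PortfolioES

variable {d : ℕ} {Ω : Type*} [mΩ : MeasurableSpace Ω]

/-- The unnormalized Gaussian tail `∫_u^∞ exp (-t²/2) dt`. -/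
noncomputable def gaussTail (u : ℝ) : ℝ := ∫ t in Ioi u, Real.exp (-t ^ 2 / 2)

lemma integrable_exp_neg_sq_div_two : Integrable fun t : ℝ => Real.exp (-t ^ 2 / 2) := by
  have := integrable_exp_neg_mul_sq (b := 1 / 2) (by norm_num)
  refine this.congr (ae_of_all _ fun t => ?_)
  simp only
  congr 1
  ring

lemma gaussTail_pos (u : ℝ) : 0 < gaussTail u := by
  refine (setIntegral_pos_iff_support_of_nonneg_ae (ae_of_all _ fun t => (Real.exp_pos _).le)
    integrable_exp_neg_sq_div_two.integrableOn).2 ?_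
  have : Function.support (fun t : ℝ => Real.exp (-t ^ 2 / 2)) = univ := by
    ext t; simp [Real.exp_ne_zero]
  rw [this, univ_inter]
  simp

lemma hasDerivAt_gaussTail (u : ℝ) : HasDerivAt gaussTail (-Real.exp (-u ^ 2 / 2)) u := by
  have hc : Continuous fun t : ℝ => Real.exp (-t ^ 2 / 2) := by fun_prop
  have h1 : HasDerivAt (fun u => ∫ t in (0 : ℝ)..u, Real.exp (-t ^ 2 / 2)) (Real.exp (-u ^ 2 / 2)) u :=
    intervalIntegral.integral_hasDerivAt_right (hc.intervalIntegrable _ _)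
      hc.stronglyMeasurable.stronglyMeasurableAtFilter hc.continuousAt
  refine (h1.const_sub (gaussTail 0)).congr_of_eventuallyEq (Eventually.of_forall fun v => ?_)
  have := intervalIntegral.integral_Ioi_sub_Ioi' (a := (0 : ℝ)) (b := v) (μ := volume)
    integrable_exp_neg_sq_div_two.integrableOn integrable_exp_neg_sq_div_two.integrableOn
  simp only [gaussTail]
  linarith

/-- Mills' inequality. -/
lemma mul_gaussTail_le (u : ℝ) : u * gaussTail u ≤ Real.exp (-u ^ 2 / 2) := by
  have hd : ∀ t ∈ Ici u, HasDerivAt (fun t : ℝ => -Real.exp (-t ^ 2 / 2))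
      (t * Real.exp (-t ^ 2 / 2)) t := by
    intro t _
    have h1 : HasDerivAt (fun t : ℝ => -t ^ 2 / 2) (-t) t := by
      have := ((hasDerivAt_pow 2 t).neg).div_const 2
      refine this.congr_deriv ?_
      simp only [Nat.cast_ofNat, Nat.add_one_sub_one, pow_one]
      ring
    refine h1.exp.neg.congr_deriv ?_
    ring
  have hlim : Tendsto (fun t : ℝ => -Real.exp (-t ^ 2 / 2)) atTop (𝓝 0) := by
    have h1 : Tendsto (fun t : ℝ => -t ^ 2 / 2) atTop atBot := by
      have h2 : Tendsto (fun t : ℝ => t ^ 2) atTop atTop := tendsto_pow_atTop (by norm_num)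
      have h3 := h2.atTop_div_const (show (0 : ℝ) < 2 by norm_num)
      exact (tendsto_neg_atTop_atBot.comp h3).congr fun t => by simp [neg_div]
    simpa using (Real.tendsto_exp_atBot.comp h1).neg
  have hi : Integrable fun t : ℝ => t * Real.exp (-t ^ 2 / 2) := by
    refine (integrable_mul_exp_neg_mul_sq (b := 1 / 2) (by norm_num)).congr
      (ae_of_all _ fun t => ?_)
    simp only
    congr 2
    ring
  have hF := integral_Ioi_of_hasDerivAt_of_tendsto' hd hi.integrableOn hlim
  rw [zero_sub, neg_neg] at hF
  rw [← hF, gaussTail, ← integral_const_mul]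
  refine setIntegral_mono_on (integrable_exp_neg_sq_div_two.integrableOn.const_mul _)
    hi.integrableOn measurableSet_Ioi fun t ht => ?_
  exact mul_le_mul_of_nonneg_right (le_of_lt ht) (Real.exp_pos _).le

/-- The derivative has the sign of 2s·gaussTail(a + qs) - e^{-(a+qs)²/2}. From 2s ≤ 2S ≤ a ≤ a + qs
and Mills' inequality this is nonpositive. Here the condition |z_α| ≥ 2‖θ‖_T enters. -/
lemma antitoneOn_exp_mul_gaussTail {a q S : ℝ} (hq : 0 < q) (hS : 2 * S ≤ a) :
    AntitoneOn (fun s => Real.exp (q * s ^ 2) * gaussTail (a + q * s)) (Icc 0 S) := by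
  have hd : ∀ s, HasDerivAt (fun s => Real.exp (q * s ^ 2) * gaussTail (a + q * s))
      (Real.exp (q * s ^ 2) * (q * (2 * s)) * gaussTail (a + q * s) +
        Real.exp (q * s ^ 2) * (-Real.exp (-(a + q * s) ^ 2 / 2) * q)) s := by
    intro s
    have h1 : HasDerivAt (fun s => Real.exp (q * s ^ 2)) (Real.exp (q * s ^ 2) * (q * (2 * s))) s := by
      have := ((hasDerivAt_pow 2 s).const_mul q).exp
      refine this.congr_deriv ?_
      simp
    have h2 : HasDerivAt (fun s => a + q * s) q s := by
      simpa using ((hasDerivAt_id s).const_mul q).const_add a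
    have h3 : HasDerivAt (fun s => gaussTail (a + q * s)) (-Real.exp (-(a + q * s) ^ 2 / 2) * q) s :=
      HasDerivAt.comp (h₂ := gaussTail) (h := fun s => a + q * s) s
        (hasDerivAt_gaussTail (a + q * s)) h2
    exact h1.mul h3
  refine antitoneOn_of_deriv_nonpos (convex_Icc 0 S)
    (fun s _ => (hd s).continuousAt.continuousWithinAt)
    (fun s _ => (hd s).differentiableAt.differentiableWithinAt) fun s hs => ?_
  rw [interior_Icc] at hs
  rw [(hd s).deriv]
  have hm := mul_gaussTail_le (a + q * s)
  have h1 : 2 * s * gaussTail (a + q * s) ≤ (a + q * s) * gaussTail (a + q * s) :=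
    mul_le_mul_of_nonneg_right (by nlinarith [hs.1, hs.2, mul_pos hq hs.1]) (gaussTail_pos _).le
  have h2 : 0 < Real.exp (q * s ^ 2) * q := by positivity
  have : Real.exp (q * s ^ 2) * (q * (2 * s)) * gaussTail (a + q * s) +
        Real.exp (q * s ^ 2) * (-Real.exp (-(a + q * s) ^ 2 / 2) * q) =
      Real.exp (q * s ^ 2) * q * (2 * s * gaussTail (a + q * s) - Real.exp (-(a + q * s) ^ 2 / 2)) := by
    ring
  rw [this]
  exact mul_nonpos_of_nonneg_of_nonpos h2.le (by linarith)

/-- `∫_{z ≤ a} exp (s z - s²/2) dN(z)`. -/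
lemma setIntegral_Iic_exp_gaussianReal (s a : ℝ) :
    ∫ z in Iic a, Real.exp (s * z - s ^ 2 / 2) ∂(gaussianReal 0 1) =
      (√(2 * Real.pi))⁻¹ * gaussTail (s - a) := by
  rw [← integral_indicator measurableSet_Iic,
    integral_gaussianReal_eq_integral_smul one_ne_zero]
  have e1 : ∀ z, gaussianPDFReal 0 1 z •
      (Iic a).indicator (fun z => Real.exp (s * z - s ^ 2 / 2)) z =
      (√(2 * Real.pi))⁻¹ * (Iic (a - s)).indicator (fun z => Real.exp (-z ^ 2 / 2)) (z - s) := by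
    intro z
    by_cases hz : z ≤ a
    · rw [Set.indicator_of_mem (show z ∈ Iic a from hz), Set.indicator_of_mem (by simpa using hz),
        gaussianPDFReal]
      simp only [NNReal.coe_one, mul_one, sub_zero, smul_eq_mul]
      rw [mul_assoc, ← Real.exp_add]
      congr 2
      ring
    · rw [Set.indicator_of_notMem (show z ∉ Iic a from hz),
        Set.indicator_of_notMem (by simpa using hz)]
      simp
  simp_rw [e1]
  rw [integral_const_mul, integral_sub_right_eq_self
    (fun z => (Iic (a - s)).indicator (fun z => Real.exp (-z ^ 2 / 2)) z),
    integral_indicator measurableSet_Iic, gaussTail]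
  congr 1
  have := integral_comp_neg_Iic (a - s) (fun z => Real.exp (-z ^ 2 / 2))
  simp only [neg_sq, neg_sub] at this
  exact this

lemma cdf_gaussianReal_eq (a : ℝ) :
    cdf (gaussianReal 0 1) a = (√(2 * Real.pi))⁻¹ * gaussTail (-a) := by
  have := setIntegral_Iic_exp_gaussianReal 0 a
  simp only [zero_mul, ne_eq, OfNat.ofNat_ne_zero, not_false_eq_true, zero_pow, zero_div, sub_zero,
    Real.exp_zero, zero_sub, integral_const, smul_eq_mul, mul_one] at this
  rw [cdf_eq_real, ← this]
  simp

lemma gaussTail_zero : gaussTail 0 = √(2 * Real.pi) / 2 := by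
  have := integral_gaussian_Ioi (1 / 2)
  rw [gaussTail, ← show √(Real.pi / (1 / 2)) = √(2 * Real.pi) by congr 1; ring, ← this]
  congr 1
  funext t
  congr 1
  ring

section Quantile

variable {α : ℝ}

lemma isClosed_cdf_ge (α : ℝ) : IsClosed {z : ℝ | α ≤ cdf (gaussianReal 0 1) z} := by
  have hc : Continuous fun z => cdf (gaussianReal 0 1) z := by
    simp_rw [cdf_gaussianReal_eq]
    have : Continuous gaussTail :=
      continuous_iff_continuousAt.2 fun u => (hasDerivAt_gaussTail u).continuousAt
    fun_prop
  exact isClosed_le continuous_const hc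

lemma cdf_zero : cdf (gaussianReal 0 1) 0 = 1 / 2 := by
  have : 0 < √(2 * Real.pi) := by positivity
  rw [cdf_gaussianReal_eq, neg_zero, gaussTail_zero]
  field_simp

lemma bddBelow_cdf_ge (hα0 : 0 < α) : BddBelow {z : ℝ | α ≤ cdf (gaussianReal 0 1) z} := by
  obtain ⟨z₀, hz₀⟩ := ((tendsto_cdf_atBot (gaussianReal 0 1)).eventually (gt_mem_nhds hα0)).exists
  refine ⟨z₀, fun z hz => ?_⟩
  by_contra hcon
  exact absurd (hz.trans (monotone_cdf _ (not_le.1 hcon).le)) (not_le.2 hz₀)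

lemma zQuantile_le_iff (hα0 : 0 < α) (hα : α ≤ 1 / 2) (w : ℝ) :
    zQuantile α ≤ w ↔ α ≤ cdf (gaussianReal 0 1) w := by
  have hne : {z : ℝ | α ≤ cdf (gaussianReal 0 1) z}.Nonempty := ⟨0, by
    rw [Set.mem_ofPred_eq, cdf_zero]; exact hα⟩
  have hmem := (isClosed_cdf_ge α).csInf_mem hne (bddBelow_cdf_ge hα0)
  refine ⟨fun h => hmem.trans (monotone_cdf _ h), fun h => csInf_le (bddBelow_cdf_ge hα0) h⟩

lemma zQuantile_nonpos (hα0 : 0 < α) (hα : α ≤ 1 / 2) : zQuantile α ≤ 0 :=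
  (zQuantile_le_iff hα0 hα 0).2 (by rw [cdf_zero]; exact hα)

lemma cdf_zQuantile (hα0 : 0 < α) (hα : α ≤ 1 / 2) :
    cdf (gaussianReal 0 1) (zQuantile α) = α := by
  refine le_antisymm ?_ ((zQuantile_le_iff hα0 hα _).1 le_rfl)
  have hc : Continuous fun z => cdf (gaussianReal 0 1) z := by
    simp_rw [cdf_gaussianReal_eq]
    have : Continuous gaussTail :=
      continuous_iff_continuousAt.2 fun u => (hasDerivAt_gaussTail u).continuousAt
    fun_prop
  refine le_of_tendsto (hc.continuousAt.continuousWithinAt (s := Iio (zQuantile α))) ?_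
  filter_upwards [self_mem_nhdsWithin] with w hw
  by_contra hcon
  exact absurd ((zQuantile_le_iff hα0 hα w).2 (not_le.1 hcon).le) (not_le.2 hw)

lemma gaussTail_abs_zQuantile (hα0 : 0 < α) (hα : α ≤ 1 / 2) :
    (√(2 * Real.pi))⁻¹ * gaussTail |zQuantile α| = α := by
  rw [abs_of_nonpos (zQuantile_nonpos hα0 hα), ← cdf_gaussianReal_eq, cdf_zQuantile hα0 hα]

lemma Falpha_eq (z : ℝ) : Falpha α z = gaussTail z / gaussTail |zQuantile α| := rfl

variable {P : Measure Ω} [IsProbabilityMeasure P]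

/-- The degenerate case of the lognormal formula, which occurs at least at t = 0: the whole mass
lies at the quantile and the conditioning is trivial. -/
lemma tailMean_const (hα0 : 0 < α) (hα : α ≤ 1 / 2) {X : ℝ → Ω → ℝ} {t C : ℝ} (hC : 0 < C)
    (hX : ∀ᵐ ω ∂P, X t ω = C) : tailMean P α X t = C := by
  have hset : {l : ℝ | 0 ≤ l ∧ α ≤ P.real {ω | X t ω ≤ l}} = Ici C := by
    ext l
    simp only [Set.mem_ofPred_eq, Set.mem_Ici]
    by_cases hl : C ≤ l
    · have h1 : P.real {ω | X t ω ≤ l} = 1 := by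
        have hae : {ω | X t ω ≤ l} =ᵐ[P] (univ : Set Ω) := by
          filter_upwards [hX] with ω hω
          exact propext ⟨fun _ => trivial, fun _ => hω.le.trans hl⟩
        rw [measureReal_def, measure_congr hae, measure_univ, ENNReal.toReal_one]
      rw [h1]
      exact ⟨fun _ => hl, fun _ => ⟨hC.le.trans hl, by linarith⟩⟩
    · have h1 : P.real {ω | X t ω ≤ l} = 0 := by
        rw [measureReal_def]
        have : P {ω | X t ω ≤ l} = 0 := by
          refine measure_mono_null (fun ω hω => ?_) (ae_iff.1 hX)
          intro h
          exact hl (h ▸ hω)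
        simp [this]
      rw [h1]
      exact ⟨fun h => absurd h.2 (not_le.2 hα0), fun h => absurd h hl⟩
  have hq : quantile P α X t = C := by rw [quantile, hset, csInf_Ici]
  have hae : {ω | X t ω ≤ C} =ᵐ[P] (univ : Set Ω) := by
    filter_upwards [hX] with ω hω
    exact propext ⟨fun _ => trivial, fun _ => hω.le⟩
  rw [tailMean, hq, ProbabilityTheory.cond, measure_congr hae, Measure.restrict_congr_set hae,
    measure_univ, inv_one, one_smul, Measure.restrict_univ, integral_congr_ae hX]
  simp

/-- The tail mean of a lognormal random variable. -/
theorem tailMean_lognormal (hα0 : 0 < α) (hα : α ≤ 1 / 2) {X : ℝ → Ω → ℝ} {J : Ω → ℝ}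
    {t C s : ℝ} (hC : 0 < C) (hs : 0 ≤ s) (hJm : Measurable J)
    (hJ : P.map J = gaussianReal 0 (s ^ 2).toNNReal)
    (hX : ∀ ω, X t ω = C * Real.exp (J ω - s ^ 2 / 2)) :
    tailMean P α X t = C * Falpha α (|zQuantile α| + s) := by
  rcases hs.eq_or_lt with rfl | hs
  · have h1 : Falpha α (|zQuantile α| + 0) = 1 := by
      rw [Falpha_eq, add_zero, div_self (gaussTail_pos _).ne']
    rw [h1, mul_one]
    refine tailMean_const hα0 hα hC ?_
    have h0 : ∀ᵐ z ∂(P.map J), z = 0 := by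
      rw [hJ]
      simp only [ne_eq, OfNat.ofNat_ne_zero, not_false_eq_true, zero_pow, Real.toNNReal_zero,
        gaussianReal_zero_var]
      rw [ae_dirac_eq]
      rfl
    filter_upwards [ae_of_ae_map hJm.aemeasurable h0] with ω hω
    simp [hX, hω]
  -- For s > 0 the variable has the law of f at a standard normal, and f is an increasing bijection
  -- onto (0, ∞); the quantile of X is therefore f at z_α, and levels l ≤ 0 carry no mass.
  set f : ℝ → ℝ := fun z => C * Real.exp (s * z - s ^ 2 / 2) with hf
  have hfm : Measurable f := by fun_prop
  have hmap : P.map (X t) = (gaussianReal 0 1).map f := by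
    have e1 : X t = (fun z => C * Real.exp (z - s ^ 2 / 2)) ∘ J := funext hX
    have e2 : f = (fun z => C * Real.exp (z - s ^ 2 / 2)) ∘ fun z => s * z := rfl
    rw [e1, e2, ← Measure.map_map (by fun_prop) hJm, ← Measure.map_map (by fun_prop) (by fun_prop),
      hJ, gaussianReal_map_const_mul]
    congr 2
    · simp
    · ext
      simp [Real.coe_toNNReal _ (sq_nonneg s)]
  have hXm : Measurable (X t) := by
    rw [show X t = (fun z => C * Real.exp (z - s ^ 2 / 2)) ∘ J from funext hX]
    fun_prop
  have hfle : ∀ w z, f z ≤ f w ↔ z ≤ w := by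
    intro w z
    simp only [hf]
    rw [mul_le_mul_iff_right₀ hC, Real.exp_le_exp, sub_le_sub_iff_right, mul_le_mul_iff_right₀ hs]
  have hprob : ∀ l, P.real {ω | X t ω ≤ l} = (gaussianReal 0 1).real {z | f z ≤ l} := by
    intro l
    have h1 := congrArg (fun μ : Measure ℝ => μ.real (Iic l)) hmap
    simp only [measureReal_def] at h1 ⊢
    rw [Measure.map_apply hXm measurableSet_Iic, Measure.map_apply hfm measurableSet_Iic] at h1
    exact h1
  have hprobf : ∀ w, P.real {ω | X t ω ≤ f w} = cdf (gaussianReal 0 1) w := by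
    intro w
    rw [hprob, cdf_eq_real]
    congr 1
    ext z
    exact hfle w z
  have hf0 : ∀ z, 0 < f z := fun z => by positivity
  have hset : {l : ℝ | 0 ≤ l ∧ α ≤ P.real {ω | X t ω ≤ l}} = Ici (f (zQuantile α)) := by
    ext l
    simp only [Set.mem_ofPred_eq, Set.mem_Ici]
    rcases le_or_gt l 0 with hl | hl
    · have h1 : P.real {ω | X t ω ≤ l} = 0 := by
        rw [hprob, show {z | f z ≤ l} = (∅ : Set ℝ) from ?_]
        · simp
        · ext z
          simp only [Set.mem_ofPred_eq, Set.mem_empty_iff_false, iff_false, not_le]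
          exact hl.trans_lt (hf0 z)
      rw [h1]
      exact ⟨fun h => absurd h.2 (not_le.2 hα0), fun h => absurd (h.trans hl) (not_le.2 (hf0 _))⟩
    · obtain ⟨w, rfl⟩ : ∃ w, f w = l := by
        refine ⟨(Real.log (l / C) + s ^ 2 / 2) / s, ?_⟩
        simp only [hf]
        rw [mul_div_cancel₀ _ hs.ne', add_sub_cancel_right, Real.exp_log (by positivity)]
        field_simp
      rw [hprobf, hfle, zQuantile_le_iff hα0 hα]
      exact ⟨fun h => h.2, fun h => ⟨hl.le, h⟩⟩
  have hq : quantile P α X t = f (zQuantile α) := by rw [quantile, hset, csInf_Ici]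
  have hPA : P.real {ω | X t ω ≤ f (zQuantile α)} = α := by rw [hprobf, cdf_zQuantile hα0 hα]
  have hint : ∫ ω in {ω | X t ω ≤ f (zQuantile α)}, X t ω ∂P =
      C * ((√(2 * Real.pi))⁻¹ * gaussTail (|zQuantile α| + s)) := by
    have h1 : ∫ ω in {ω | X t ω ≤ f (zQuantile α)}, X t ω ∂P =
        ∫ l in Iic (f (zQuantile α)), l ∂(P.map (X t)) :=
      (setIntegral_map (f := fun l : ℝ => l) measurableSet_Iic (by fun_prop) hXm.aemeasurable).symm
    have h2 : f ⁻¹' Iic (f (zQuantile α)) = Iic (zQuantile α) := by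
      ext z; exact hfle _ z
    rw [h1, hmap, setIntegral_map measurableSet_Iic (by fun_prop) hfm.aemeasurable, h2]
    simp only [hf]
    rw [integral_const_mul, setIntegral_Iic_exp_gaussianReal,
      abs_of_nonpos (zQuantile_nonpos hα0 hα)]
    congr 3
    ring
  have hP : P {ω | X t ω ≤ f (zQuantile α)} = ENNReal.ofReal α := by
    rw [← ENNReal.ofReal_toReal (measure_ne_top P _)]
    exact congrArg ENNReal.ofReal hPA
  rw [tailMean, hq, ProbabilityTheory.cond, integral_smul_measure, hint, hP, smul_eq_mul,
    ENNReal.toReal_inv, ENNReal.toReal_ofReal hα0.le, Falpha_eq]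
  -- The conditioning divides by α, which is the normalized Gaussian tail at |z_α|, the denominator
  -- of F_α.
  have h3 := gaussTail_abs_zQuantile hα0 hα
  have h4 := gaussTail_pos |zQuantile α|
  have h5 : (0 : ℝ) < (√(2 * Real.pi))⁻¹ := by positivity
  set c := (√(2 * Real.pi))⁻¹
  generalize gaussTail (|zQuantile α| + s) = u
  generalize gaussTail |zQuantile α| = g at h3 h4 ⊢
  subst h3
  field_simp

end Quantile

end PortfolioES

/-! ### Càdlàg coefficients and the explicit market quantities -/

namespace PortfolioES

variable {d : ℕ} {Ω : Type*} [mΩ : MeasurableSpace Ω]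

section Cadlag

lemma IsCadlagOn.comp_continuous {E F : Type*} [TopologicalSpace E] [TopologicalSpace F] {T : ℝ}
    {f : ℝ → E} (h : IsCadlagOn T f) {φ : E → F} (hφ : Continuous φ) :
    IsCadlagOn T fun t => φ (f t) := by
  refine ⟨fun t h0 hT => hφ.continuousAt.comp_continuousWithinAt (h.1 t h0 hT), fun t h0 hT => ?_⟩
  obtain ⟨l, hl⟩ := h.2 t h0 hT
  exact ⟨φ l, (hφ.tendsto l).comp hl⟩

/-- A càdlàg function on `[0, T]`, stopped outside, is Borel measurable. -/
lemma IsCadlagOn.measurable_clamp {T : ℝ} (hT : 0 ≤ T) {f : ℝ → ℝ} (h : IsCadlagOn T f) :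
    Measurable fun t => f (min (max t 0) T) := by
  -- The next point of the grid of mesh 1/(n + 1) strictly above t: a countably valued approximation
  -- from the right, along which right continuity gives convergence.
  set s : ℕ → ℝ → ℝ := fun n t => (⌊((n : ℝ) + 1) * max t 0⌋₊ + 1 : ℝ) / ((n : ℝ) + 1) with hs
  have hlt : ∀ n t, max t 0 < s n t := by
    intro n t
    simp only [hs]
    rw [lt_div_iff₀ (by positivity), mul_comm]
    exact Nat.lt_floor_add_one _
  have hle : ∀ n t, s n t ≤ max t 0 + 1 / ((n : ℝ) + 1) := by
    intro n t
    simp only [hs]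
    rw [add_div]
    gcongr
    rw [div_le_iff₀ (by positivity), mul_comm]
    exact Nat.floor_le (by positivity)
  have hlim : ∀ t, Tendsto (fun n => s n t) atTop (𝓝 (max t 0)) := by
    intro t
    refine tendsto_of_tendsto_of_tendsto_of_le_of_le tendsto_const_nhds ?_
      (fun n => (hlt n t).le) (fun n => hle n t)
    simpa using tendsto_const_nhds (x := max t 0).add
      (tendsto_one_div_add_atTop_nhds_zero_nat (𝕜 := ℝ))
  refine measurable_of_tendsto_metrizable (f := fun n t => f (min (s n t) T)) (fun n => ?_) ?_
  · have : (fun t => f (min (s n t) T)) =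
        (fun k : ℕ => f (min (((k : ℝ) + 1) / ((n : ℝ) + 1)) T)) ∘
          fun t => ⌊((n : ℝ) + 1) * max t 0⌋₊ := rfl
    rw [this]
    exact (measurable_from_nat).comp (Nat.measurable_floor.comp (by fun_prop))
  · rw [tendsto_pi_nhds]
    intro t
    rcases lt_or_ge (max t 0) T with ht | ht
    · rw [min_eq_left ht.le]
      have hc := h.1 (max t 0) (le_max_right _ _) ht
      refine hc.tendsto.comp (tendsto_nhdsWithin_iff.2 ⟨?_, Eventually.of_forall fun n => ?_⟩)
      · have := (hlim t).min (tendsto_const_nhds (x := T))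
        rwa [min_eq_left ht.le] at this
      · exact le_min (hlt n t).le ht.le
    · rw [min_eq_right ht]
      refine tendsto_const_nhds.congr fun n => ?_
      rw [min_eq_right (ht.trans (hlt n t).le)]

/-- Right continuity and the left limit bound f near each point, one side at a time; compactness
makes the bound global. -/
lemma IsCadlagOn.exists_bound {T : ℝ} {f : ℝ → ℝ} (h : IsCadlagOn T f) :
    ∃ C, ∀ t ∈ Icc 0 T, |f t| ≤ C := by
  refine isCompact_Icc.induction_on (p := fun s => ∃ C, ∀ t ∈ s, |f t| ≤ C) ⟨0, by simp⟩
    (fun s t hst ⟨C, hC⟩ => ⟨C, fun u hu => hC u (hst hu)⟩)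
    (fun s t ⟨C, hC⟩ ⟨C', hC'⟩ => ⟨max C C', fun u hu => ?_⟩) fun t ht => ?_
  · rcases hu with hu | hu
    · exact (hC u hu).trans (le_max_left _ _)
    · exact (hC' u hu).trans (le_max_right _ _)
  · have hR : ∃ C, ∀ᶠ u in 𝓝[≥] t, u ∈ Icc 0 T → |f u| ≤ C := by
      rcases ht.2.eq_or_lt with rfl | hlt
      · refine ⟨|f t|, ?_⟩
        filter_upwards [self_mem_nhdsWithin] with u hu hu'
        rw [le_antisymm hu'.2 hu]
      · refine ⟨|f t| + 1, ?_⟩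
        filter_upwards [(h.1 t ht.1 hlt).abs.eventually (gt_mem_nhds (lt_add_one |f t|))]
          with u hu _ using hu.le
    have hL : ∃ C, ∀ᶠ u in 𝓝[<] t, u ∈ Icc 0 T → |f u| ≤ C := by
      rcases ht.1.eq_or_lt with rfl | hlt
      · refine ⟨0, ?_⟩
        filter_upwards [self_mem_nhdsWithin] with u hu hu'
        exact absurd hu (not_lt.2 hu'.1)
      · obtain ⟨l, hl⟩ := h.2 t hlt ht.2
        refine ⟨|l| + 1, ?_⟩
        filter_upwards [hl.abs.eventually (gt_mem_nhds (lt_add_one |l|))] with u hu _ using hu.le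
    obtain ⟨C, hC⟩ := hR
    obtain ⟨C', hC'⟩ := hL
    refine ⟨{u | u ∈ Icc 0 T ∧ |f u| ≤ max C C'}, ?_, max C C', fun u hu => hu.2⟩
    have : ∀ᶠ u in 𝓝 t, u ∈ Icc 0 T → |f u| ≤ max C C' := by
      rw [← nhdsLT_sup_nhdsGE, eventually_sup]
      exact ⟨hC'.mono fun u hu hu' => (hu hu').trans (le_max_right _ _),
        hC.mono fun u hu hu' => (hu hu').trans (le_max_left _ _)⟩
    filter_upwards [mem_nhdsWithin_of_mem_nhds this, self_mem_nhdsWithin] with u h1 h2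
    exact ⟨h2, h1 h2⟩

end Cadlag

namespace Market

variable {mk : Market d} {T γ : ℝ}

/-- The inverse matrix is written as det⁻¹ times the adjugate, which is measurable in the entries.
The formula also holds at singular times, where both sides take the default value 0. -/
lemma IsRegular.measurable_theta_clamp (h : mk.IsRegular T) (hT : 0 ≤ T) :
    Measurable fun t => mk.theta (min (max t 0) T) := by
  set c : ℝ → ℝ := fun t => min (max t 0) T with hc
  have hr : Measurable fun t => mk.r (c t) := h.cadlag_r.measurable_clamp hT
  have hmu : ∀ i, Measurable fun t => mk.mu (c t) i := fun i =>
    (h.cadlag_mu.comp_continuous (continuous_apply i)).measurable_clamp hT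
  have hs : ∀ i j, Measurable fun t => mk.sigma (c t) i j := fun i j =>
    (h.cadlag_sigma.comp_continuous
      (φ := fun A : Matrix (Fin d) (Fin d) ℝ => A i j) (by fun_prop)).measurable_clamp hT
  have hS : Measurable fun t (i j : Fin d) => mk.sigma (c t) i j :=
    measurable_pi_lambda _ fun i => measurable_pi_lambda _ fun j => hs i j
  have hdet : Measurable fun t => (mk.sigma (c t)).det := by
    have hcont : Continuous fun A : Fin d → Fin d → ℝ => (Matrix.of A).det :=
      Continuous.matrix_det (by fun_prop)
    exact hcont.measurable.comp hS
  have hadj : ∀ i j, Measurable fun t => (mk.sigma (c t)).adjugate i j := by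
    intro i j
    have hcont : Continuous fun A : Fin d → Fin d → ℝ => (Matrix.of A).adjugate i j :=
      (Continuous.matrix_adjugate (by fun_prop)).matrix_elem i j
    exact hcont.measurable.comp hS
  refine measurable_of_components fun i => ?_
  have e : (fun t => mk.theta (c t) i) = fun t => ∑ j, ((mk.sigma (c t)).det⁻¹ *
      (mk.sigma (c t)).adjugate i j) * (mk.mu (c t) j - mk.r (c t)) := by
    funext t
    simp only [theta, Matrix.mulVec, dotProduct, Matrix.inv_def, Ring.inverse_eq_inv',
      Matrix.smul_apply, smul_eq_mul]
  rw [e]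
  exact Finset.measurable_fun_sum _ fun j _ => (hdet.inv.mul (hadj i j)).mul ((hmu j).sub hr)

lemma clamp_of_mem {t : ℝ} (ht : t ∈ Icc 0 T) : min (max t 0) T = t := by
  rw [max_eq_left ht.1, min_eq_left ht.2]

lemma IsRegular.memLp_theta (h : mk.IsRegular T) (hT : 0 ≤ T) :
    MemLp mk.theta 2 (volume.restrict (Icc 0 T)) := by
  have hm : AEStronglyMeasurable mk.theta (volume.restrict (Icc 0 T)) := by
    refine (h.measurable_theta_clamp hT).stronglyMeasurable.aestronglyMeasurable.congr ?_
    filter_upwards [ae_restrict_mem measurableSet_Icc] with t ht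
    rw [clamp_of_mem ht]
  exact (memLp_two_iff_integrable_sq_norm hm).2 h.theta_sq

lemma IsRegular.intervalIntegrable_r (h : mk.IsRegular T) (hT : 0 ≤ T) :
    IntervalIntegrable mk.r volume 0 T := by
  rw [intervalIntegrable_iff_integrableOn_Icc_of_le hT]
  obtain ⟨C, hC⟩ := h.cadlag_r.exists_bound
  refine Integrable.of_bound (C := C) ?_ ?_
  · refine (h.cadlag_r.measurable_clamp hT).aestronglyMeasurable.congr ?_
    filter_upwards [ae_restrict_mem measurableSet_Icc] with t ht
    rw [clamp_of_mem ht]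
  · filter_upwards [ae_restrict_mem measurableSet_Icc] with t ht using hC t ht

lemma l2Norm_sq {y : ℝ → EuclideanSpace ℝ (Fin d)} {t : ℝ} (ht : 0 ≤ t) :
    l2Norm y t ^ 2 = ∫ u in (0 : ℝ)..t, ‖y u‖ ^ 2 :=
  Real.sq_sqrt (intervalIntegral.integral_nonneg ht fun _ _ => by positivity)

/-- This identifies the moments of the deflator with the functions of the theorem: qγ = γ/(1 - γ)
and q(q - 1)/2 = γ/(2(1 - γ)²). -/
lemma gTilde_rpow (hγ1 : γ < 1) {t : ℝ} (ht : 0 ≤ t) :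
    gTilde mk γ t ^ qExp γ = deflatorMoment γ mk.r mk.theta t := by
  have h1 : 1 - γ ≠ 0 := by linarith
  rw [gTilde, ← Real.exp_mul, deflatorMoment, l2Norm_sq ht, R, qExp]
  congr 1
  field_simp
  ring

lemma qNorm_rpow (hγ1 : γ < 1) (hT : 0 ≤ T) :
    qNorm (qExp γ) (gTilde mk γ) T ^ qExp γ =
      ∫ t in (0 : ℝ)..T, deflatorMoment γ mk.r mk.theta t := by
  have h1 : 0 < 1 - γ := by linarith
  have hq : 0 < qExp γ := by unfold qExp; positivity
  have e : ∫ u in (0 : ℝ)..T, |gTilde mk γ u| ^ qExp γ =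
      ∫ t in (0 : ℝ)..T, deflatorMoment γ mk.r mk.theta t := by
    refine intervalIntegral.integral_congr fun t ht => ?_
    rw [uIcc_of_le hT] at ht
    rw [abs_of_pos (by exact Real.exp_pos _), gTilde_rpow hγ1 ht.1]
  rw [qNorm, e, ← Real.rpow_mul (intervalIntegral.integral_nonneg hT fun t _ =>
    (deflatorMoment_pos t).le), one_div_mul_cancel hq.ne', Real.rpow_one]

lemma vStar_eq (hγ1 : γ < 1) {t : ℝ} (ht : t ∈ Icc 0 T) :
    vStar mk T γ t = optRate T γ mk.r mk.theta t := by
  rw [vStar, optRate, gTilde_rpow hγ1 ht.1, gTilde_rpow hγ1 (ht.1.trans ht.2)]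
  congr 2
  refine intervalIntegral.integral_congr fun s hs => ?_
  rw [uIcc_of_le ht.2] at hs
  exact gTilde_rpow hγ1 (ht.1.trans hs.1)

lemma one_sub_kappaTilde (hγ1 : γ < 1) (hT : 0 ≤ T) :
    1 - kappaTilde mk T γ = deflatorMoment γ mk.r mk.theta T / (deflatorMoment γ mk.r mk.theta T +
      ∫ t in (0 : ℝ)..T, deflatorMoment γ mk.r mk.theta t) := by
  have := tail_pos (γ := γ) (r := mk.r) (θ := mk.theta) hT
  rw [kappaTilde, qNorm_rpow hγ1 hT, gTilde_rpow hγ1 hT, add_comm (∫ t in (0 : ℝ)..T, _)]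
  rw [eq_div_iff this.ne', sub_mul, div_mul_cancel₀ _ this.ne']
  ring

lemma sigma_transpose_mulVec_piStar {t : ℝ} (h : IsUnit (mk.sigma t).det) :
    Matrix.mulVec (mk.sigma t).transpose (piStar mk γ t) = yStar mk γ t := by
  have hT : IsUnit (mk.sigma t).transpose.det := by rwa [Matrix.det_transpose]
  rw [piStar, Matrix.mul_inv_rev, Matrix.mulVec_smul, Matrix.mulVec_mulVec, ← Matrix.mul_assoc,
    Matrix.mul_nonsing_inv _ hT, Matrix.one_mul]
  rfl

end Market

end PortfolioES

/-! ### The Expected Shortfall of the optimal wealth -/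

namespace PortfolioES

variable {d : ℕ} {Ω : Type*} [mΩ : MeasurableSpace Ω]

section

variable {𝓕 : Filtration ℝ≥0 mΩ} {P : Measure Ω} [IsProbabilityMeasure P] {T : ℝ≥0}
  {B : ℝ≥0 → Ω → EuclideanSpace ℝ (Fin d)} {mk : Market d} {J : ℝ → Ω → ℝ} {x γ α ζ : ℝ}

lemma l2Norm_mono {T : ℝ} {y : ℝ → EuclideanSpace ℝ (Fin d)} (hT : 0 ≤ T)
    (hy : MemLp y 2 (volume.restrict (Icc 0 T))) {t : ℝ} (ht : t ∈ Icc 0 T) :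
    l2Norm y t ≤ l2Norm y T :=
  Real.sqrt_le_sqrt (integral_norm_sq_le_of_mem hT hy ht)

/-- The optimal wealth is a deterministic factor, its mean, times a normalized lognormal variable of
parameter q‖θ‖_t. The mean carries the unspent fraction of wealth and e^{R_t + q‖θ‖_t²}. -/
lemma tailMean_optWealth (h : IsWienerIntegral 𝓕 P B T (fun t => (1 / (1 - γ)) • mk.theta t) J)
    (hB : IsFilteredBM 𝓕 P T B) (hmk : mk.IsRegular T) (hγ1 : γ < 1) (hx : 0 < x) (hα0 : 0 < α)
    (hα : α ≤ 1 / 2) {t : ℝ} (ht : t ∈ Icc 0 (T : ℝ)) :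
    tailMean P α (optWealth T x γ mk.r mk.theta J) t =
      x * ((deflatorMoment γ mk.r mk.theta T + ∫ u in t..T, deflatorMoment γ mk.r mk.theta u) /
        (deflatorMoment γ mk.r mk.theta T + ∫ u in (0 : ℝ)..T, deflatorMoment γ mk.r mk.theta u)) *
      Real.exp (mk.R t) * (Real.exp (qExp γ * l2Norm mk.theta t ^ 2) *
        Falpha α (|zQuantile α| + qExp γ * l2Norm mk.theta t)) := by
  have hT := T.coe_nonneg
  have h1γ : 0 < 1 - γ := by linarith
  have hθ := hmk.memLp_theta hT
  have hg := h.indepGaussian_zero hB (hθ.const_smul (1 / (1 - γ))) (t := ⟨t, ht.1⟩)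
    (by exact_mod_cast ht.2)
  have hl := Market.l2Norm_sq (y := mk.theta) ht.1
  have e2 : ∫ u in (0 : ℝ)..t, ‖(1 / (1 - γ)) • mk.theta u‖ ^ 2 =
      (qExp γ * l2Norm mk.theta t) ^ 2 := by
    rw [mul_pow, hl, ← intervalIntegral.integral_const_mul]
    refine intervalIntegral.integral_congr fun u _ => ?_
    simp only [norm_smul, mul_pow, Real.norm_eq_abs, sq_abs, qExp]
  have hmap : P.map (J t) = gaussianReal 0 ((qExp γ * l2Norm mk.theta t) ^ 2).toNNReal := by
    rw [← e2]; exact hg.map_eq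
  have hq : 0 < qExp γ := by unfold qExp; positivity
  have hK := tail_pos (γ := γ) (r := mk.r) (θ := mk.theta) ht.2
  have hΓ := tail_pos (γ := γ) (r := mk.r) (θ := mk.theta) hT
  rw [tailMean_lognormal hα0 hα (J := J t) (s := qExp γ * l2Norm mk.theta t)
    (C := x * ((deflatorMoment γ mk.r mk.theta T + ∫ u in t..T, deflatorMoment γ mk.r mk.theta u) /
        (deflatorMoment γ mk.r mk.theta T + ∫ u in (0 : ℝ)..T, deflatorMoment γ mk.r mk.theta u)) *
      Real.exp (mk.R t + qExp γ * l2Norm mk.theta t ^ 2)) (by positivity)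
    (mul_nonneg hq.le (Real.sqrt_nonneg _)) hg.measurable hmap fun ω => ?_]
  · rw [Real.exp_add]
    simp only [mul_assoc]
  · rw [optWealth_eq hT (hmk.intervalIntegrable_r hT) hθ ht, ← hl, Market.R]
    have e3 : l2Norm mk.theta t ^ 2 / (1 - γ) = qExp γ * l2Norm mk.theta t ^ 2 := by
      rw [qExp, div_mul_eq_mul_div, one_mul]
    have e4 : l2Norm mk.theta t ^ 2 / (1 - γ) ^ 2 = (qExp γ * l2Norm mk.theta t) ^ 2 := by
      rw [qExp, mul_pow, div_pow, one_pow, div_mul_eq_mul_div, one_mul]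
    rw [e3, e4]

/-- The risk bound for the optimal wealth. -/
theorem esBound_optWealth
    (h : IsWienerIntegral 𝓕 P B T (fun t => (1 / (1 - γ)) • mk.theta t) J)
    (hB : IsFilteredBM 𝓕 P T B) (hmk : mk.IsRegular T) (hγ1 : γ < 1) (hx : 0 < x) (hα0 : 0 < α)
    (hα : α ≤ 1 / 2) (hζ0 : 0 < ζ) (hz : 2 * l2Norm mk.theta T ≤ |zQuantile α|)
    (hloose : 1 - (1 - kappaTilde mk T γ) * Real.exp (qExp γ * l2Norm mk.theta T ^ 2) *
        Falpha α (|zQuantile α| + qExp γ * l2Norm mk.theta T) ≤ ζ) :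
    ESBound mk P T x α ζ (optWealth T x γ mk.r mk.theta J) := by
  have hT := T.coe_nonneg
  have h1γ : 0 < 1 - γ := by linarith
  have hθ := hmk.memLp_theta hT
  have hq : 0 < qExp γ := by unfold qExp; positivity
  intro t ht
  have hR := Real.exp_pos (mk.R t)
  rw [expectedShortfall, levelRisk, div_le_one (by positivity),
    tailMean_optWealth h hB hmk hγ1 hx hα0 hα ht]
  -- Applied with a = |z_α| and S = ‖θ‖_T: the Gaussian factor of the tail mean is smallest at t =
  -- T.
  have hanti := antitoneOn_exp_mul_gaussTail hq hz
    ⟨Real.sqrt_nonneg _, l2Norm_mono hT hθ ht⟩ ⟨Real.sqrt_nonneg _, le_rfl⟩ (l2Norm_mono hT hθ ht)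
  have hz0 := gaussTail_pos |zQuantile α|
  have hF : Real.exp (qExp γ * l2Norm mk.theta T ^ 2) *
        Falpha α (|zQuantile α| + qExp γ * l2Norm mk.theta T) ≤
      Real.exp (qExp γ * l2Norm mk.theta t ^ 2) *
        Falpha α (|zQuantile α| + qExp γ * l2Norm mk.theta t) := by
    rw [Falpha_eq, Falpha_eq, ← mul_div_assoc, ← mul_div_assoc]
    exact div_le_div_of_nonneg_right hanti hz0.le
  have hF0 : 0 ≤ Real.exp (qExp γ * l2Norm mk.theta T ^ 2) *
        Falpha α (|zQuantile α| + qExp γ * l2Norm mk.theta T) := by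
    rw [Falpha_eq]
    have := gaussTail_pos (|zQuantile α| + qExp γ * l2Norm mk.theta T)
    positivity
  have hΓ := tail_pos (γ := γ) (r := mk.r) (θ := mk.theta) hT
  rw [Market.one_sub_kappaTilde hγ1 hT, mul_assoc] at hloose
  have hGT := deflatorMoment_pos (γ := γ) (r := mk.r) (θ := mk.theta) T
  -- The unspent fraction of wealth is also smallest at T, where it is 1 - κ̃(γ); the product of the
  -- two bounds is at least 1 - ζ.
  have hK : deflatorMoment γ mk.r mk.theta T ≤
      deflatorMoment γ mk.r mk.theta T + ∫ u in t..T, deflatorMoment γ mk.r mk.theta u :=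
    le_add_of_nonneg_right (intervalIntegral.integral_nonneg ht.2 fun u _ =>
      (deflatorMoment_pos u).le)
  have hprod := mul_le_mul (div_le_div_of_nonneg_right hK hΓ.le) hF hF0
    (div_nonneg (hGT.le.trans hK) hΓ.le)
  refine le_trans (b := x * Real.exp (mk.R t) - x * Real.exp (mk.R t) * (1 - ζ)) ?_ (by
    apply le_of_eq; ring)
  have h1 : 1 - ζ ≤ deflatorMoment γ mk.r mk.theta T / (deflatorMoment γ mk.r mk.theta T +
      ∫ u in (0 : ℝ)..T, deflatorMoment γ mk.r mk.theta u) *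
      (Real.exp (qExp γ * l2Norm mk.theta T ^ 2) *
        Falpha α (|zQuantile α| + qExp γ * l2Norm mk.theta T)) := by linarith [hloose]
  have h2 := mul_le_mul_of_nonneg_left (h1.trans hprod)
    (by positivity : 0 ≤ x * Real.exp (mk.R t))
  refine le_trans (le_of_eq ?_) (sub_le_sub_left h2 _)
  rw [← mul_assoc (x * Real.exp (mk.R t)), mul_right_comm x]

end

end PortfolioES

/-! ### Measurability of controls, admissibility, and assembly -/

namespace PortfolioES

variable {d : ℕ} {Ω : Type*} [mΩ : MeasurableSpace Ω]

section Filtration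

variable {P : Measure Ω} {W : ℝ≥0 → Ω → EuclideanSpace ℝ (Fin d)}

lemma measurableSet_brownianFiltration_of_null (hW : ∀ t, Measurable (W t)) (t : ℝ≥0) {N : Set Ω}
    (hN : MeasurableSet N) (h0 : P N = 0) : MeasurableSet[brownianFiltration W hW P t] N :=
  (le_sup_right : _ ≤ brownianFiltration W hW P t) N
    (MeasurableSpace.measurableSet_generateFrom ⟨hN, h0⟩)

lemma IsStandardBrownian.ae_continuous (hW : IsStandardBrownian W P) :
    ∀ᵐ ω ∂P, Continuous fun t => W t ω := by
  filter_upwards [ae_all_iff.2 fun j => (hW.component j).cont] with ω h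
  exact (PiLp.homeomorph 2 fun _ : Fin d => ℝ).isInducing.continuous_iff.2
    (continuous_pi fun j => h j)

end Filtration

section Progressive

variable {𝓕 : Filtration ℝ≥0 mΩ} {T : ℝ≥0} {E : Type*} [TopologicalSpace E]

lemma isProgressiveOn_of_deterministic [MeasurableSpace E] [BorelSpace E]
    [TopologicalSpace.PseudoMetrizableSpace E] [SecondCountableTopology E] {u : ℝ → E}
    (hu : Measurable fun t => u (min (max t 0) T)) :
    IsProgressiveOn 𝓕 T fun t (_ : Ω) => u t := by
  intro i
  have h1 : Measurable fun t : ℝ≥0 => u (min (t : ℝ) T) := by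
    simpa [Function.comp_def] using hu.comp measurable_coe_nnreal_real
  have h2 : Measurable[Subtype.instMeasurableSpace.prod (𝓕 i)]
      fun p : Iic i × Ω => u (min ((p.1 : ℝ≥0) : ℝ) T) :=
    h1.comp (measurable_subtype_coe.comp
      (@measurable_fst _ _ Subtype.instMeasurableSpace (𝓕 i)))
  exact h2.stronglyMeasurable

lemma isProgressiveOn_of_continuousOn {u : ℝ → Ω → ℝ}
    (hu : ∀ t : ℝ≥0, t ≤ T → Measurable[𝓕 t] (u t))
    (hc : ∀ ω, ContinuousOn (fun t => u t ω) (Icc 0 (T : ℝ))) : IsProgressiveOn 𝓕 T u := by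
  refine StronglyAdapted.isStronglyProgressive_of_continuous (fun t => ?_) fun ω => ?_
  · have h1 : Measurable[𝓕 t] (u ((min t T : ℝ≥0) : ℝ)) :=
      (hu (min t T) (min_le_right _ _)).mono (𝓕.mono (min_le_left _ _)) le_rfl
    rw [NNReal.coe_min] at h1
    exact h1.stronglyMeasurable
  · exact (hc ω).comp_continuous (by fun_prop) fun t =>
      ⟨le_min t.coe_nonneg T.coe_nonneg, min_le_right _ _⟩

lemma IsProgressiveOn.measurable_uncurry {u : ℝ → Ω → ℝ} (h : IsProgressiveOn 𝓕 T u) :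
    Measurable fun p : Ω × ℝ => u (min (max p.2 0) T) p.1 := by
  have h1 := (h T).measurable
  have h2 : Measurable[_, Subtype.instMeasurableSpace.prod (𝓕 T)]
      fun p : Ω × ℝ => ((⟨min p.2.toNNReal T, mem_Iic.2 (min_le_right _ _)⟩ : Iic T), p.1) := by
    refine Measurable.prodMk (Measurable.subtype_mk (by fun_prop)) ?_
    exact measurable_fst.mono le_rfl (𝓕.le T)
  convert h1.comp h2 using 2
  simp [Real.coe_toNNReal']

lemma IsProgressiveOn.measurable {u : ℝ → Ω → ℝ} (h : IsProgressiveOn 𝓕 T u) {t : ℝ≥0}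
    (ht : t ≤ T) : Measurable[𝓕 t] (u t) := by
  have h1 := (IsStronglyProgressive.stronglyAdapted h t).measurable
  rwa [min_eq_left (by exact_mod_cast ht)] at h1

end Progressive

section Wealth

variable {𝓕 : Filtration ℝ≥0 mΩ} {P : Measure Ω} [IsProbabilityMeasure P] {T : ℝ≥0}
  {B : ℝ≥0 → Ω → EuclideanSpace ℝ (Fin d)} {mk : Market d} {x γ : ℝ}

omit [IsProbabilityMeasure P] in
lemma IsItoProcess.congr_drift {a a' : ℝ → Ω → ℝ} {b : ℝ → Ω → EuclideanSpace ℝ (Fin d)}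
    {X : ℝ → Ω → ℝ} (h : IsItoProcess 𝓕 P B T x a b X)
    (haa : ∀ t ∈ Icc 0 (T : ℝ), ∀ ω, a t ω = a' t ω) : IsItoProcess 𝓕 P B T x a' b X where
  adapted := h.adapted
  continuous := h.continuous
  drift_integrable := h.drift_integrable.mono fun ω hω =>
    hω.congr_fun (fun t ht => haa t ht ω) measurableSet_Icc
  eq := by
    obtain ⟨M, hM, he⟩ := h.eq
    refine ⟨M, hM, he.mono fun ω hω t ht => ?_⟩
    rw [hω t ht]
    congr 2
    refine intervalIntegral.integral_congr fun s hs => haa s ?_ ω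
    rw [uIcc_of_le ht.1] at hs
    exact ⟨hs.1, hs.2.trans ht.2⟩

lemma intervalIntegrable_inner_theta (hmk : mk.IsRegular T) {y : ℝ → EuclideanSpace ℝ (Fin d)}
    (hy : MemLp y 2 (volume.restrict (Icc 0 (T : ℝ)))) :
    IntervalIntegrable (fun t => mk.r t + ⟪y t, mk.theta t⟫) volume 0 T := by
  refine (hmk.intervalIntegrable_r T.coe_nonneg).add ?_
  rw [intervalIntegrable_iff_integrableOn_Icc_of_le T.coe_nonneg]
  have hθ := hmk.memLp_theta T.coe_nonneg
  refine (L2.integrable_inner (𝕜 := ℝ) (hy.toLp y) (hθ.toLp _)).congr ?_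
  filter_upwards [hy.coeFn_toLp, hθ.coeFn_toLp] with t h1 h2
  rw [h1, h2]

/-- With the consumption process c held fixed, the drifts differ by (X' - X)(r + ⟪y, θ⟫), so the
difference solves a homogeneous linear equation. If consumption is proportional to wealth the kernel
changes to r + ⟪y, θ⟫ - v, as in `IsDetWealth.indistinguishable`. -/
lemma IsWealth.indistinguishable (hB : IsFilteredBM 𝓕 P T B)
    (hnull : ∀ N, MeasurableSet N → P N = 0 → MeasurableSet[𝓕 0] N) (hmk : mk.IsRegular T)
    {y : ℝ → EuclideanSpace ℝ (Fin d)} (hy : MemLp y 2 (volume.restrict (Icc 0 (T : ℝ))))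
    {c X X' : ℝ → Ω → ℝ} (hX : IsWealth mk 𝓕 P B T x (fun t _ => y t) c X)
    (hX' : IsWealth mk 𝓕 P B T x (fun t _ => y t) c X') : Indistinguishable P T X' X :=
  hX.ito.ae_eq_of_linear hB hnull hX'.ito (intervalIntegrable_inner_theta hmk hy) hy
    (ae_of_all _ fun ω t _ => by ring)

lemma IsDetWealth.indistinguishable (hB : IsFilteredBM 𝓕 P T B)
    (hnull : ∀ N, MeasurableSet N → P N = 0 → MeasurableSet[𝓕 0] N) (hmk : mk.IsRegular T)
    {y : ℝ → EuclideanSpace ℝ (Fin d)} {v : ℝ → ℝ} (hyv : IsDetControl T y v)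
    {X X' : ℝ → Ω → ℝ} (hX : IsDetWealth mk 𝓕 P B T x y v X)
    (hX' : IsDetWealth mk 𝓕 P B T x y v X') : Indistinguishable P T X' X := by
  have hv : IntervalIntegrable v volume 0 T :=
    (intervalIntegrable_iff_integrableOn_Icc_of_le T.coe_nonneg).2 hyv.integrable
  exact hX.ito.ae_eq_of_linear hB hnull hX'.ito
    ((intervalIntegrable_inner_theta hmk hyv.sq_integrable).sub hv) hyv.sq_integrable
    (ae_of_all _ fun ω t _ => by ring)

lemma IsWealth.cost_le {I : ℝ → Ω → ℝ} (h : IsWienerIntegral 𝓕 P B T mk.theta I)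
    (hB : IsFilteredBM 𝓕 P T B) (hmk : mk.IsRegular T) (hγ0 : 0 < γ) (hγ1 : γ < 1) (hx : 0 < x)
    {y : ℝ → Ω → EuclideanSpace ℝ (Fin d)} {c X : ℝ → Ω → ℝ}
    (hX : IsWealth mk 𝓕 P B T x y c X) (hc : IsProgressiveOn 𝓕 T c)
    (hc0 : ∀ t ∈ Icc 0 (T : ℝ), ∀ ω, 0 ≤ c t ω) :
    cost P T γ γ c X ≤ ENNReal.ofReal (x ^ γ *
      ((∫ t in (0 : ℝ)..T, deflatorMoment γ mk.r mk.theta t) +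
        deflatorMoment γ mk.r mk.theta T) ^ (1 - γ)) := by
  have hT := T.coe_nonneg
  refine PortfolioES.cost_le h hB (hmk.memLp_theta hT) (hmk.intervalIntegrable_r hT) hγ0 hγ1 hx
    hX.ito (hX.pos.mono fun ω hω t ht => (hω t ht).le)
    (c' := fun t => c (min (max t 0) T)) hc.measurable_uncurry (fun t ht => ?_)
    (fun t ω => hc0 _ ⟨le_min (le_max_right _ _) hT, min_le_right _ _⟩ ω)
    (ae_of_all _ fun ω => ?_)
  · rw [Market.clamp_of_mem ⟨t.coe_nonneg, by exact_mod_cast ht⟩]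
    exact hc.measurable ht
  · filter_upwards [ae_restrict_mem measurableSet_Icc] with t ht
    rw [Market.clamp_of_mem ht]

/-- The rate v is only almost everywhere equal to a Borel function and X is continuous only almost
surely, so vX need not be progressive. The duality bound is applied to the version |wY|, with w
Borel and Y continuous and adapted; it agrees with vX for almost every t on almost every path. -/
lemma IsDetWealth.cost_le {I : ℝ → Ω → ℝ} (h : IsWienerIntegral 𝓕 P B T mk.theta I)
    (hB : IsFilteredBM 𝓕 P T B)
    (hnull : ∀ N, MeasurableSet N → P N = 0 → MeasurableSet[𝓕 0] N) (hmk : mk.IsRegular T)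
    (hγ0 : 0 < γ) (hγ1 : γ < 1) (hx : 0 < x) {y : ℝ → EuclideanSpace ℝ (Fin d)} {v : ℝ → ℝ}
    {X : ℝ → Ω → ℝ} (hyv : IsDetControl T y v) (hX : IsDetWealth mk 𝓕 P B T x y v X) :
    cost P T γ γ (fun t ω => v t * X t ω) X ≤ ENNReal.ofReal (x ^ γ *
      ((∫ t in (0 : ℝ)..T, deflatorMoment γ mk.r mk.theta t) +
        deflatorMoment γ mk.r mk.theta T) ^ (1 - γ)) := by
  have hT := T.coe_nonneg
  obtain ⟨Y, hY, hYX⟩ := exists_isContinuousAdapted hnull hX.ito.adapted hX.ito.continuous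
  obtain ⟨w, hw, hvw⟩ := hyv.integrable.aestronglyMeasurable
  refine PortfolioES.cost_le h hB (hmk.memLp_theta hT) (hmk.intervalIntegrable_r hT) hγ0 hγ1 hx
    hX.ito (hX.pos.mono fun ω hω t ht => (hω t ht).le)
    (c' := fun t ω => |w t * Y t ω|) ?_ (fun t ht => ?_) (fun t ω => abs_nonneg _) ?_
  · exact ((hw.measurable.comp measurable_snd).mul hY.measurable_uncurry).abs
  · have h1 : Measurable[𝓕 t] fun ω => w t * Y t ω := (hY.adapted t ht).const_mul (w t)
    exact (_root_.continuous_abs.measurable).comp h1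
  · filter_upwards [hYX, hX.pos] with ω hω hpos
    filter_upwards [hvw, ae_restrict_mem measurableSet_Icc] with t hvt ht
    rw [hω t ht, ← hvt, abs_of_nonneg (mul_nonneg (hyv.nonneg t ht) (hpos t ht).le)]

end Wealth

section Optimal

variable {𝓕 : Filtration ℝ≥0 mΩ} {P : Measure Ω} [IsProbabilityMeasure P] {T : ℝ≥0}
  {B : ℝ≥0 → Ω → EuclideanSpace ℝ (Fin d)} {mk : Market d} {J : ℝ → Ω → ℝ} {x γ : ℝ}

lemma isDetControl_star (hmk : mk.IsRegular T) (hγ1 : γ < 1) :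
    IsDetControl T (yStar mk γ) (vStar mk T γ) where
  sq_integrable := (hmk.memLp_theta T.coe_nonneg).const_smul (1 / (1 - γ))
  nonneg t ht := by rw [Market.vStar_eq hγ1 ht]; exact optRate_nonneg ht.2
  integrable := (((continuousOn_optRate T.coe_nonneg (hmk.intervalIntegrable_r T.coe_nonneg)
    (hmk.memLp_theta T.coe_nonneg)).congr fun t ht => Market.vStar_eq hγ1 ht).integrableOn_Icc)

omit mΩ in
lemma optWealth_pos (hx : 0 < x) (t : ℝ) (ω : Ω) :
    0 < optWealth T x γ mk.r mk.theta J t ω := by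
  unfold optWealth stochExp
  positivity

lemma isIto_optWealth (h : IsWienerIntegral 𝓕 P B T (fun t => (1 / (1 - γ)) • mk.theta t) J)
    (hB : IsFilteredBM 𝓕 P T B) (hmk : mk.IsRegular T) (hγ1 : γ < 1) :
    IsItoProcess 𝓕 P B T x (fun t ω => optWealth T x γ mk.r mk.theta J t ω *
        (mk.r t - vStar mk T γ t + ‖mk.theta t‖ ^ 2 / (1 - γ)))
      (fun t ω => optWealth T x γ mk.r mk.theta J t ω • ((1 / (1 - γ)) • mk.theta t))
      (optWealth T x γ mk.r mk.theta J) := by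
  have hT := T.coe_nonneg
  refine (h.isIto_stochExp hB ((hmk.memLp_theta hT).const_smul (1 / (1 - γ)))
    (intervalIntegrable_optDrift hT (hmk.intervalIntegrable_r hT)
      (hmk.memLp_theta hT))).congr_drift fun t ht ω => ?_
  rw [Market.vStar_eq hγ1 ht]
  rfl

lemma isDetWealth_optWealth (h : IsWienerIntegral 𝓕 P B T (fun t => (1 / (1 - γ)) • mk.theta t) J)
    (hB : IsFilteredBM 𝓕 P T B) (hmk : mk.IsRegular T) (hγ1 : γ < 1) (hx : 0 < x) :
    IsDetWealth mk 𝓕 P B T x (yStar mk γ) (vStar mk T γ) (optWealth T x γ mk.r mk.theta J) where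
  ito := (isIto_optWealth h hB hmk hγ1).congr_drift fun t _ ω => by
    rw [yStar, real_inner_smul_left, real_inner_self_eq_norm_sq]
    ring
  pos := ae_of_all _ fun ω t _ => optWealth_pos hx t ω

lemma isAdmissible_star (h : IsWienerIntegral 𝓕 P B T (fun t => (1 / (1 - γ)) • mk.theta t) J)
    (hB : IsFilteredBM 𝓕 P T B)
    (hnull : ∀ N, MeasurableSet N → P N = 0 → MeasurableSet[𝓕 0] N) (hmk : mk.IsRegular T)
    (hγ1 : γ < 1) (hx : 0 < x) :
    IsAdmissible mk 𝓕 P B T x (fun t _ => yStar mk γ t)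
      (fun t ω => vStar mk T γ t * optWealth T x γ mk.r mk.theta J t ω) where
  progressive_y := isProgressiveOn_of_deterministic
    ((hmk.measurable_theta_clamp T.coe_nonneg).const_smul (1 / (1 - γ)))
  progressive_c := by
    have hT := T.coe_nonneg
    have hθ := hmk.memLp_theta hT
    have hr := hmk.intervalIntegrable_r hT
    refine isProgressiveOn_of_continuousOn
      (fun t ht => (h.adapted_stochExp ht).const_mul _) fun ω => ?_
    exact ((continuousOn_optRate hT hr hθ).congr fun t ht => Market.vStar_eq hγ1 ht).mul
      (h.continuousOn_stochExp (hθ.const_smul (1 / (1 - γ)))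
        (intervalIntegrable_optDrift hT hr hθ) ω)
  nonneg_c t ht ω := mul_nonneg ((isDetControl_star hmk hγ1).nonneg t ht) (optWealth_pos hx t ω).le
  exists_unique_wealth := ⟨_, isDetWealth_optWealth h hB hmk hγ1 hx, fun _ hX' =>
    IsWealth.indistinguishable hB hnull hmk (isDetControl_star hmk hγ1).sq_integrable
      (isDetWealth_optWealth h hB hmk hγ1 hx) hX'⟩

lemma cost_star (h : IsWienerIntegral 𝓕 P B T (fun t => (1 / (1 - γ)) • mk.theta t) J)
    (hB : IsFilteredBM 𝓕 P T B) (hmk : mk.IsRegular T) (hγ1 : γ < 1) (hx : 0 < x) :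
    cost P T γ γ (fun t ω => vStar mk T γ t * optWealth T x γ mk.r mk.theta J t ω)
      (optWealth T x γ mk.r mk.theta J) = ENNReal.ofReal (x ^ γ *
      ((∫ t in (0 : ℝ)..T, deflatorMoment γ mk.r mk.theta t) +
        deflatorMoment γ mk.r mk.theta T) ^ (1 - γ)) := by
  rw [← cost_optWealth h hB (hmk.memLp_theta T.coe_nonneg) (hmk.intervalIntegrable_r T.coe_nonneg)
    hγ1 hx]
  unfold cost
  refine lintegral_congr fun ω => ?_
  congr 1
  refine setLIntegral_congr_fun measurableSet_Icc fun t ht => ?_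
  simp only [Market.vStar_eq hγ1 ht]

end Optimal

end PortfolioES

theorem theorem3p18 {d : ℕ} {Ω : Type*} [MeasurableSpace Ω] (P : Measure Ω)
    [IsProbabilityMeasure P] (W : ℝ≥0 → Ω → EuclideanSpace ℝ (Fin d))
    (hW : IsStandardBrownian W P) (mk : Market d) (T x γ α ζ : ℝ)
    (hT : 0 < T) (hx : 0 < x) (hmk : mk.IsRegular T)
    (hγ0 : 0 < γ) (hγ1 : γ < 1) (hα0 : 0 < α) (hα : α ≤ 1 / 2) (hζ0 : 0 < ζ)
    (hr : ∀ t ∈ Icc 0 T, 0 ≤ mk.r t)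
    (hz : 2 * l2Norm mk.theta T ≤ |zQuantile α|)
    (hloose : 1 - (1 - kappaTilde mk T γ) *
        Real.exp (qExp γ * l2Norm mk.theta T ^ 2) *
        Falpha α (|zQuantile α| + qExp γ * l2Norm mk.theta T) ≤ ζ)
    (hζ1 : ζ < 1) :
    -- the portfolio process of the optimal control
    (∀ᵐ t ∂(volume.restrict (Icc 0 T)),
      Matrix.mulVec (mk.sigma t).transpose (piStar mk γ t) = yStar mk γ t) ∧
    ∃ X : ℝ → Ω → ℝ,
      -- the optimal wealth equation, with initial value `x`
      IsItoProcess (brownianFiltration W hW.measurable P) P W T x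
        (fun t ω => X t ω * (mk.r t - vStar mk T γ t + ‖mk.theta t‖ ^ 2 / (1 - γ)))
        (fun t ω => X t ω • ((1 / (1 - γ)) • mk.theta t)) X ∧
      -- `X` is the wealth process of the optimal control
      (∀ X' : ℝ → Ω → ℝ,
        IsDetWealth mk (brownianFiltration W hW.measurable P) P W T x
          (yStar mk γ) (vStar mk T γ) X' → Indistinguishable P T X' X) ∧
      -- it solves the constrained problem
      SolvesESProblem mk (brownianFiltration W hW.measurable P) P W T x γ γ α ζ
        (yStar mk γ) (vStar mk T γ) X ∧
      -- it solves the unconstrained problem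
      SolvesUnconstrainedProblem mk (brownianFiltration W hW.measurable P) P W T x γ γ
        (fun t _ => yStar mk γ t) (fun t ω => vStar mk T γ t * X t ω) X ∧
      -- the common optimal value
      cost P T γ γ (fun t ω => vStar mk T γ t * X t ω) X =
        ENNReal.ofReal (x ^ γ * (qNorm (qExp γ) (gTilde mk γ) T ^ qExp γ +
          gTilde mk γ T ^ qExp γ) ^ (1 / qExp γ)) := by
  lift T to ℝ≥0 using hT.le
  have hB := hW.isFilteredBM T
  have hcont := hW.ae_continuous
  have hnull : ∀ N, MeasurableSet N → P N = 0 →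
      MeasurableSet[brownianFiltration W hW.measurable P 0] N := fun N =>
    measurableSet_brownianFiltration_of_null hW.measurable 0
  have hθ := hmk.memLp_theta T.coe_nonneg
  -- Two Wiener integrals are needed: I, of θ, defines the state price density, and J, of θ/(1 - γ),
  -- drives the optimal wealth.
  obtain ⟨I, hI⟩ := exists_isWienerIntegral hB hcont hnull hθ
  obtain ⟨J, hJ⟩ := exists_isWienerIntegral hB hcont hnull (hθ.const_smul (1 / (1 - γ)))
  have hcost := cost_star hJ hB hmk hγ1 hx
  have hdet := isDetWealth_optWealth hJ hB hmk hγ1 hx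
  have hctl := isDetControl_star hmk hγ1
  refine ⟨hmk.nonsingular.mono fun t ht => Market.sigma_transpose_mulVec_piStar ht,
    optWealth T x γ mk.r mk.theta J, isIto_optWealth hJ hB hmk hγ1,
    fun X' hX' => hdet.indistinguishable hB hnull hmk hctl hX',
    ⟨hctl, hdet, esBound_optWealth hJ hB hmk hγ1 hx hα0 hα hζ0 hz hloose,
      fun y' v' X' hyv hX' _ => ?_⟩,
    ⟨isAdmissible_star hJ hB hnull hmk hγ1 hx, hdet, fun y' c' X' had hX' => ?_⟩, ?_⟩
  -- The value of the optimal control equals the duality bound, which holds for all deterministic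
  -- controls; the next case is the same comparison over all admissible controls.
  · rw [hcost]
    exact hX'.cost_le hI hB hnull hmk hγ0 hγ1 hx hyv
  · rw [hcost]
    exact hX'.cost_le hI hB hmk hγ0 hγ1 hx had.progressive_c had.nonneg_c
  · rw [hcost, Market.qNorm_rpow hγ1 T.coe_nonneg, Market.gTilde_rpow hγ1 T.coe_nonneg, qExp,
      one_div_one_div]
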